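/- **Theorem 1.4 (nonlinear Cartier descent).** Let $p$ be a prime, $k$ a commutative ring of characteristic $p$ (for instance a perfect field), and $S$ a smooth $k$-scheme. Let $S'=S\times_{k,\sigma}k$ be the base change of $S$ along the Frobenius $\sigma$ of $k$, and $F=F_{S/k}:S\to S'$ the relative Frobenius. Notation. For a $k$-morphism $f:X\to S$, with $S$ smooth over $k$, and $\lambda\in k$, a $\lambda$-connection on $f$ is an $\mathcal O_X$-linear map $\nabla:f^*T_{S/k}\to T_{X/k}$ whose composite with $T_{X/k}\to f^*T_{S/k}$ is $\lambda\cdot\mathrm{id}$. For $\lambda=1$ it is integrable (a transversal foliation) if $[\nabla D,\nabla E]=\nabla[D,E]$, and has vanishing $p$-curvature if $(\nabla D)^p=\nabla(D^p)$, for all local sections $D,E$ of $T_{S/k}$. A morphism $(X,\nabla_X)\to(Y,\nabla_Y)$ is an $S$-morphism $h$ with $\nabla_X(D)(h^*a)=h^*(\nabla_Y(D)(a))$ for all local sections $D$ of $T_{S/k}$ and $a$ of $\mathcal O_Y$. Let $\mathrm{NMIC}_0(S)$ be the category of pairs $(f:X\to S,\nabla)$ with $f$ quasi-compact and $\nabla$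 an integrable $1$-connection of vanishing $p$-curvature, and $\mathrm{NHIG}_0(S')$ the category of pairs $(g:Y\to S',\theta)$ with $g$ quasi-compact and $\theta$ the zero $0$-connection (zero Higgs field). Then there is an equivalence of categories $C:\mathrm{NMIC}_0(S)\to\mathrm{NHIG}_0(S')$, with quasi-inverse $C^{-1}$, such that: * $C^{-1}$ sends $Y$ to $Y\times_{S'}S\to S$ (naturally in $Y$) with the canonical connection, the one for which all functions pulled back from $Y$ are flat. * For $(X,\nabla)$ with $Y=C(X,\nabla)$, the induced morphism $q:X\cong Y\times_{S'}S\to Y$ is a homeomorphism, and $q$ identifies $\mathcal O_{Y}$ with the subsheaf $\mathcal O_X^{\nabla}\subset\mathcal O_X$ of functions killed by all $\nabla(D)$. * $C$ restricts to an equivalence between the objects $X$ that are separated and of finite type over $k$ and the objects $Y$ that are so, and to an equivalence between the $X$ that are $k$-varieties (integral, separated, of finite type over $k$) and the $k$-varieties $Y$ for which $Y\times_{S'}S$ is integral. Moreover: 1. (Linear objects.) Call an object of $\mathrm{NMIC}_0(S)$ or $\mathrm{NHIG}_0(S')$ linear if it is the linear scheme $\mathrm{Spec}\,\mathrm{Sym}(M)$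 of a quasi-coherent module $M$ of finite type (a coherent module, if $k$ is noetherian) with integrable connection, respectively integrable Higgs field, its $\lambda$-connection being the one that restricts to that of $M$ on linear functions. Then $C$ restricts to an equivalence between the full subcategories of linear objects. It is the classical Cartier correspondence there: the functor $(M,\nabla)\mapsto M^{\nabla=0}\subset F_*M$ is an equivalence $c$ from quasi-coherent $\mathcal O_S$-modules of finite type with integrable connection of vanishing $p$-curvature to quasi-coherent $\mathcal O_{S'}$-modules of finite type with zero Higgs field, and whenever $X$ is the linear scheme of $(M,\nabla)$, $C(X)$ is the linear scheme of $c(M,\nabla)=M^{\nabla=0}$, the inclusions of the modules as linear functions being compatible with $q$. 2. (Smooth objects.) $C$ restricts to an equivalence between the full subcategories of objects with $f:X\to S$ smooth, respectively $g:Y\to S'$ smooth; and, if $k$ is a field, between the objects which are in addition $k$-varieties. -/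

import Mathlib

open CategoryTheory AlgebraicGeometry Limits Opposite

universe u

namespace NonlinearCartier

noncomputable section

/-! ### Constants, sections in characteristic `p` -/

section Constants

variable {k : Type u} [CommRing k] {X : Scheme.{u}}

/-- The structure map `k → 𝒪_X(W)` of a `k`-scheme. -/
def const (x : X ⟶ Spec (.of k)) (W : X.Opens) : k →+* Γ(X, W) :=
  ((Scheme.ΓSpecIso (.of k)).inv ≫ x.appLE ⊤ W le_top).hom

lemma natCast_eq_zero (x : X ⟶ Spec (.of k)) (p : ℕ) [CharP k p] (W : X.Opens) : (p : Γ(X, W)) = 0 := by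
  rw [← map_natCast (const x W), CharP.cast_eq_zero, map_zero]

lemma res_const (x : X ⟶ Spec (.of k)) {W W' : X.Opens} (i : W' ≤ W) (c : k) :
    X.presheaf.map (homOfLE i).op (const x W c) = const x W' c := by
  have h := x.appLE_map (U := ⊤) (V := W) le_top (homOfLE i).op
  change ((Scheme.ΓSpecIso (.of k)).inv ≫ x.appLE ⊤ W le_top ≫
    X.presheaf.map (homOfLE i).op).hom c = _
  rw [h]
  rfl

end Constants

/-! ### The `p`-th power of a derivation -/

section Derivations

variable {A : Type u} [CommRing A]

lemma iterate_leibniz (D : Derivation ℤ A A) (n : ℕ) (a b : A) :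
    (D^[n]) (a * b) =
      ∑ ij ∈ Finset.HasAntidiagonal.antidiagonal n, (n.choose ij.1 : A) * ((D^[ij.1]) a * (D^[ij.2]) b) := by
  induction n with
  | zero => simp
  | succ n ih =>
    rw [Function.iterate_succ_apply', ih, Finset.sum_antidiagonal_choose_succ_mul
      (fun i j => (D^[i]) a * (D^[j]) b), map_sum, ← Finset.sum_add_distrib]
    refine Finset.sum_congr rfl fun ij hij => ?_
    have hc : n.choose ij.2 = n.choose ij.1 :=
      (Nat.choose_symm_of_eq_add (Finset.HasAntidiagonal.mem_antidiagonal.mp hij).symm).symm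
    simp only [hc]
    simp only [Derivation.leibniz, smul_eq_mul, Derivation.map_natCast, mul_zero, add_zero,
      Function.iterate_succ_apply']
    ring

lemma iterate_add (D : Derivation ℤ A A) (n : ℕ) (a b : A) :
    (D^[n]) (a + b) = (D^[n]) a + (D^[n]) b :=
  Function.Semiconj₂.iterate (fun a b => map_add D a b) n a b

/-- If `p = 0` in `A`, the `p`-fold composite `D ∘ ⋯ ∘ D` of a derivation is a derivation. -/
def derivPow (p : ℕ) [Fact p.Prime] (h0 : (p : A) = 0) (D : Derivation ℤ A A) :
    Derivation ℤ A A :=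
  Derivation.mk' (AddMonoidHom.mk' (D^[p]) (iterate_add D p)).toIntLinearMap (by
    intro a b
    have hp : p.Prime := Fact.out
    change (D^[p]) (a * b) = a * (D^[p]) b + b * (D^[p]) a
    have hne : ((0, p) : ℕ × ℕ) ≠ (p, 0) := by simp [hp.ne_zero]
    rw [iterate_leibniz, Finset.sum_eq_add_of_mem (0, p) (p, 0) (by simp) (by simp) hne]
    · simp [mul_comm]
    · rintro ⟨i, j⟩ hij ⟨h1, h2⟩
      rw [Finset.HasAntidiagonal.mem_antidiagonal] at hij
      simp only at hij
      have hi0 : i ≠ 0 := by rintro rfl; apply h1; simp at hij; simp [hij]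
      have hip : i < p := by
        rcases Nat.lt_or_ge i p with h | h
        · exact h
        · exact absurd (by ext <;> simp <;> omega) h2
      obtain ⟨m, hm⟩ := hp.dvd_choose_self hi0 hip
      simp [hm, h0])

@[simp]
lemma derivPow_apply (p : ℕ) [Fact p.Prime] (h0 : (p : A) = 0) (D : Derivation ℤ A A) (a : A) :
    derivPow p h0 D a = (D^[p]) a := rfl

end Derivations

/-! ### The tangent sheaf `T_{X/k} = Der_k(𝒪_X, 𝒪_X)` -/

section Tangent

variable {k : Type u} [CommRing k] {X : Scheme.{u}}

/-- A section over `U` of the tangent sheaf `T_{X/k} = Der_k(𝒪_X) = Hom(Ω_{X/k}, 𝒪_X)`: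
a `k`-derivation of the sheaf of rings `𝒪_X|_U`. -/
@[ext]
structure VectorField (x : X ⟶ Spec (.of k)) (U : X.Opens) where
  /-- the derivation on the sections over `W ≤ U` -/
  act : ∀ W : X.Opens, W ≤ U → Derivation ℤ Γ(X, W) Γ(X, W)
  act_const : ∀ (W : X.Opens) (h : W ≤ U) (c : k), act W h (const x W c) = 0
  act_res : ∀ (W W' : X.Opens) (h : W ≤ U) (i : W' ≤ W) (a : Γ(X, W)),
    act W' (i.trans h) (X.presheaf.map (homOfLE i).op a) =
      X.presheaf.map (homOfLE i).op (act W h a)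

namespace VectorField

variable {x : X ⟶ Spec (.of k)} {U : X.Opens}

instance : Zero (VectorField x U) where
  zero :=
    { act := fun _ _ => 0
      act_const := by simp
      act_res := by simp }

instance : Add (VectorField x U) where
  add D E :=
    { act := fun W h => D.act W h + E.act W h
      act_const := by simp [D.act_const, E.act_const]
      act_res := fun W W' h i a => by
        simp [D.act_res W W' h i, E.act_res W W' h i] }

instance : SMul Γ(X, U) (VectorField x U) where
  smul a D :=
    { act := fun W h => (X.presheaf.map (homOfLE h).op a : Γ(X, W)) • D.act W h
      act_const := by simp [D.act_const]
      act_res := fun W W' h i b => by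
        have : X.presheaf.map (homOfLE (i.trans h)).op a =
            X.presheaf.map (homOfLE i).op (X.presheaf.map (homOfLE h).op a) := by
          rw [← CommRingCat.comp_apply, ← Functor.map_comp]; rfl
        simp only [Derivation.smul_apply, D.act_res _ _ h i, smul_eq_mul, map_mul, this] }

/-- The Lie bracket of two local vector fields. -/
instance : Bracket (VectorField x U) (VectorField x U) where
  bracket D E :=
    { act := fun W h => ⁅D.act W h, E.act W h⁆
      act_const := by simp [Derivation.commutator_apply, D.act_const, E.act_const]
      act_res := by
        intro W W' h i a
        simp [Derivation.commutator_apply, D.act_res _ _ h i, E.act_res _ _ h i] }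

/-- The `p`-th power `D ↦ D^p = D ∘ ⋯ ∘ D` on vector fields in characteristic `p`. -/
def pPow (p : ℕ) [Fact p.Prime] [CharP k p] (D : VectorField x U) : VectorField x U where
  act W h := derivPow p (natCast_eq_zero x p W) (D.act W h)
  act_const W h c := by
    obtain ⟨n, hn⟩ := Nat.exists_eq_succ_of_ne_zero (Fact.out : p.Prime).ne_zero
    rw [derivPow_apply, hn, Function.iterate_succ_apply, D.act_const]
    exact Function.iterate_fixed (map_zero _) n
  act_res W W' h i a := by
    rw [derivPow_apply, derivPow_apply]
    exact ((Function.Semiconj.iterate_right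
      (f := fun b : Γ(X, W) => (X.presheaf.map (homOfLE i).op b : Γ(X, W')))
      (fun b => (D.act_res W W' h i b).symm) p).eq a).symm

/-- Restriction of a vector field to a smaller open set. -/
def res {V : X.Opens} (i : V ≤ U) (D : VectorField x U) : VectorField x V where
  act W h := D.act W (h.trans i)
  act_const W h c := D.act_const W (h.trans i) c
  act_res W W' h j a := D.act_res W W' (h.trans i) j a

end VectorField

end Tangent

/-! ### `λ`-connections on a morphism `f : X ⟶ S`, and the category of such pairs -/

section Connections

variable {k : Type u} [CommRing k] {S : Scheme.{u}}

/-- A `λ`-connection on `f : X ⟶ S`, for `S` smooth over `k` and `λ ∈ k`.  This is an `𝒪_X`-linear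
map `∇ : f^* T_{S/k} ⟶ T_{X/k}`, written through the adjunction of `f^*` and `f_*` as an
`𝒪_S`-linear map of sheaves `T_{S/k} ⟶ f_* T_{X/k}`, whose composite with
`T_{X/k} ⟶ f^* T_{S/k} = Der_k(f⁻¹ 𝒪_S, 𝒪_X)` (restriction of derivations to `f⁻¹ 𝒪_S`)
is `λ · id`. -/
structure LambdaConnection (s : S ⟶ Spec (.of k)) (lam : k) {X : Scheme.{u}} (f : X ⟶ S) where
  /-- the value `∇(D)` on a local vector field `D` of the base -/
  nabla : ∀ V : S.Opens, VectorField s V → VectorField (f ≫ s) (f ⁻¹ᵁ V)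
  nabla_add : ∀ (V : S.Opens) (D E : VectorField s V), nabla V (D + E) = nabla V D + nabla V E
  nabla_smul : ∀ (V : S.Opens) (a : Γ(S, V)) (D : VectorField s V),
    nabla V (a • D) = (f.app V a : Γ(X, f ⁻¹ᵁ V)) • nabla V D
  nabla_res : ∀ (V V' : S.Opens) (i : V' ≤ V) (D : VectorField s V),
    nabla V' (D.res i) = (nabla V D).res (f.preimage_mono i)
  /-- the composite with `T_{X/k} ⟶ f^* T_{S/k}` is `λ · id` -/
  symbol : ∀ (V W : S.Opens) (h : W ≤ V) (D : VectorField s V) (a : Γ(S, W)),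
    (nabla V D).act (f ⁻¹ᵁ W) (f.preimage_mono h) (f.app W a) =
      const (f ≫ s) (f ⁻¹ᵁ W) lam * f.app W (D.act W h a)

namespace LambdaConnection

variable {s : S ⟶ Spec (.of k)} {lam : k} {X : Scheme.{u}} {f : X ⟶ S}

/-- The curvature `(D, E) ↦ [∇ D, ∇ E] - λ ∇ [D, E]` vanishes.  For `λ = 1`, the decomposition
`T_{X/k} = T_{X/S} ⊕ im ∇` identifies it with the class of `[∇ D, ∇ E]` modulo `im ∇`, so that
the condition says that `im ∇` is a (transversal) foliation; for `λ = 0` it says that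
`[∇ D, ∇ E] = 0`. -/
def Integrable (c : LambdaConnection s lam f) : Prop :=
  ∀ (V : S.Opens) (D E : VectorField s V),
    ⁅c.nabla V D, c.nabla V E⁆ = (const (f ≫ s) (f ⁻¹ᵁ V) lam) • c.nabla V ⁅D, E⁆

/-- Vanishing of the `p`-curvature of a (`1`-)connection.  Under
`T_{X/k} / im ∇ = T_{X/S}` the `p`-curvature is `D ↦ (∇ D)^p - ∇ (D^p)`. -/
def PCurvatureZero (p : ℕ) [Fact p.Prime] [CharP k p] (c : LambdaConnection s lam f) : Prop :=
  ∀ (V : S.Opens) (D : VectorField s V), (c.nabla V D).pPow p = c.nabla V (D.pPow p)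

/-- The map `∇ : f^* T_{S/k} ⟶ T_{X/k}` is zero. -/
def IsZero (c : LambdaConnection s lam f) : Prop :=
  ∀ (V : S.Opens) (D : VectorField s V), c.nabla V D = 0

/-- The local section `a` of `𝒪_X` over `U` is flat, `∇(a) = 0`: it is killed by all derivations
`∇(D)`. -/
def IsFlat (c : LambdaConnection s lam f) (U : X.Opens) (a : Γ(X, U)) : Prop :=
  ∀ (V : S.Opens) (D : VectorField s V) (W : X.Opens) (hV : W ≤ f ⁻¹ᵁ V) (hU : W ≤ U),
    (c.nabla V D).act W hV (X.presheaf.map (homOfLE hU).op a) = 0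

end LambdaConnection

/-- An `S`-scheme together with a `λ`-connection on its structure morphism. -/
structure LambdaScheme (s : S ⟶ Spec (.of k)) (lam : k) where
  /-- the `S`-scheme -/
  X : Over S
  /-- the `λ`-connection -/
  conn : LambdaConnection s lam X.hom

namespace LambdaScheme

variable {s : S ⟶ Spec (.of k)} {lam : k}

/-- A morphism of pairs: an `S`-morphism `h : X ⟶ Y` with `h_* ∘ ∇_X = h^* ∇_Y`, an equality of
maps from `T_{S/k}` to derivations of `h⁻¹ 𝒪_Y` with values in `𝒪_X`. -/
@[ext]
structure Hom (P Q : LambdaScheme s lam) where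
  /-- the underlying `S`-morphism -/
  hom : P.X ⟶ Q.X
  comm : ∀ (V : S.Opens) (D : VectorField s V) (W : Q.X.left.Opens) (hW : W ≤ Q.X.hom ⁻¹ᵁ V)
    (hW' : hom.left ⁻¹ᵁ W ≤ P.X.hom ⁻¹ᵁ V) (a : Γ(Q.X.left, W)),
    (P.conn.nabla V D).act (hom.left ⁻¹ᵁ W) hW' (hom.left.app W a) =
      hom.left.app W ((Q.conn.nabla V D).act W hW a)

lemma Hom.preimage_le {P Q : LambdaScheme s lam} (h : P.X ⟶ Q.X) {V : S.Opens}
    {W : Q.X.left.Opens} (hW : W ≤ Q.X.hom ⁻¹ᵁ V) : h.left ⁻¹ᵁ W ≤ P.X.hom ⁻¹ᵁ V := by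
  rw [← Over.w h]
  exact h.left.preimage_mono hW

instance : Category (LambdaScheme s lam) where
  Hom := Hom
  id P := ⟨𝟙 P.X, fun _ _ _ _ _ _ => rfl⟩
  comp {P Q R} g h := ⟨g.hom ≫ h.hom, fun V D W hW hW' a => by
    have h1 := h.comm V D W hW (Hom.preimage_le h.hom hW) a
    have h2 := g.comm V D (h.hom.left ⁻¹ᵁ W) (Hom.preimage_le h.hom hW) hW' (h.hom.left.app W a)
    exact h2.trans (congrArg (g.hom.left.app (h.hom.left ⁻¹ᵁ W)) h1)⟩

variable (s lam) in
/-- Forgetting the `λ`-connection. -/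
@[simps]
def forget : LambdaScheme s lam ⥤ Over S where
  obj P := P.X
  map h := h.hom

end LambdaScheme

end Connections

/-! ### Frobenius -/

section Frobenius

variable {k : Type u} [CommRing k] (p : ℕ) [Fact p.Prime]

/-- The `p`-th power endomorphism of a ring in which `p = 0`. -/
def powHom {A : Type u} [CommRing A] (h0 : (p : A) = 0) : A →+* A where
  toFun a := a ^ p
  map_one' := one_pow p
  map_mul' a b := mul_pow a b p
  map_zero' := zero_pow (Fact.out : p.Prime).ne_zero
  map_add' a b := by
    obtain ⟨r, hr⟩ := exists_add_pow_prime_eq (Fact.out : p.Prime) a b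
    rw [hr, h0]
    ring

variable [CharP k p]

/-- The absolute Frobenius as a map of ringed spaces: the identity on points, `a ↦ a ^ p` on
functions. -/
def absFrobPre {X : Scheme.{u}} (x : X ⟶ Spec (.of k)) :
    X.toPresheafedSpace.Hom X.toPresheafedSpace where
  base := 𝟙 _
  c :=
    { app := fun U => CommRingCat.ofHom (powHom p (natCast_eq_zero x p U.unop))
      naturality := fun U V i => by
        ext a
        exact (map_pow (X.presheaf.map i).hom a p).symm }

lemma absFrobPre_stalkMap {X : Scheme.{u}} (x : X ⟶ Spec (.of k)) (y : X)
    (a : X.presheaf.stalk y) : (absFrobPre p x).stalkMap y a = a ^ p := by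
  obtain ⟨U, hU, b, rfl⟩ := X.presheaf.exists_germ_eq a
  have h := PresheafedSpace.stalkMap_germ_apply (absFrobPre p x) U y hU b
  refine h.trans ?_
  exact map_pow (X.presheaf.germ U y hU).hom b p

/-- The absolute Frobenius endomorphism of a scheme over a ring of characteristic `p`. -/
def absFrob {X : Scheme.{u}} (x : X ⟶ Spec (.of k)) : X ⟶ X where
  toHom := absFrobPre p x
  prop y := ⟨fun a ha => by
    have h : IsUnit ((a : X.presheaf.stalk y) ^ p) := absFrobPre_stalkMap p x y a ▸ ha
    exact (isUnit_pow_iff (Fact.out : p.Prime).ne_zero).mp h⟩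

lemma absFrob_app {X : Scheme.{u}} (x : X ⟶ Spec (.of k)) (U : X.Opens) (a : Γ(X, U)) :
    (absFrob p x).app U a = a ^ p := rfl

variable {S : Scheme.{u}} (s : S ⟶ Spec (.of k))

/-- `S' = S ×_{k,σ} k`, the base change of `S` along the Frobenius `σ : k → k`. -/
def frobTwist : Scheme.{u} :=
  pullback s (Spec.map (CommRingCat.ofHom (frobenius k p)))

/-- The structure morphism `S' ⟶ Spec k`. -/
def frobTwistStr : frobTwist p s ⟶ Spec (.of k) :=
  pullback.snd s (Spec.map (CommRingCat.ofHom (frobenius k p)))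

lemma absFrob_comp : absFrob p s ≫ s = s ≫ Spec.map (CommRingCat.ofHom (frobenius k p)) := by
  apply ext_of_isAffine
  ext b
  obtain ⟨c, rfl⟩ : ∃ c : k, (Scheme.ΓSpecIso (.of k)).inv c = b :=
    ⟨(Scheme.ΓSpecIso (.of k)).hom b, by simp⟩
  have h1 : (absFrob p s ≫ s).appTop ((Scheme.ΓSpecIso (.of k)).inv c) =
      s.appTop ((Scheme.ΓSpecIso (.of k)).inv c) ^ p := rfl
  have h2 : (s ≫ Spec.map (CommRingCat.ofHom (frobenius k p))).appTop
      ((Scheme.ΓSpecIso (.of k)).inv c) =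
      s.appTop ((Spec.map (CommRingCat.ofHom (frobenius k p))).appTop
        ((Scheme.ΓSpecIso (.of k)).inv c)) := rfl
  have h3 : (Spec.map (CommRingCat.ofHom (frobenius k p))).appTop
      ((Scheme.ΓSpecIso (.of k)).inv c) = (Scheme.ΓSpecIso (.of k)).inv (frobenius k p c) :=
    (congrArg (fun φ => φ.hom c)
      (Scheme.ΓSpecIso_inv_naturality (CommRingCat.ofHom (frobenius k p)))).symm
  change (absFrob p s ≫ s).appTop _ = (s ≫ Spec.map _).appTop _
  rw [h1, h2, h3, frobenius_def, map_pow, map_pow]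

/-- The relative Frobenius `F_{S/k} : S ⟶ S'`. -/
def relFrob : S ⟶ frobTwist p s :=
  pullback.lift (absFrob p s) s (absFrob_comp p s)

end Frobenius

/-! ### Modules with `λ`-connection -/

section Modules

variable {k : Type u} [CommRing k] {S : Scheme.{u}}

/-- An `𝒪_S`-module `M` with a `λ`-connection.  As `S` is smooth over `k`, a `k`-linear map
`M ⟶ M ⊗ Ω_{S/k}` with the `λ`-Leibniz rule is the same as an `𝒪_S`-linear rule `D ↦ ∇_D` from
local vector fields to local endomorphisms with
`∇_D (a v) = λ D(a) v + a ∇_D v`. -/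
structure LambdaModule (s : S ⟶ Spec (.of k)) (lam : k) where
  /-- the module -/
  M : S.Modules
  /-- the covariant derivative along a local vector field -/
  nabla : ∀ U : S.Opens, VectorField s U → (Γ(M, U) →+ Γ(M, U))
  nabla_add : ∀ (U : S.Opens) (D E : VectorField s U) (v : Γ(M, U)),
    nabla U (D + E) v = nabla U D v + nabla U E v
  nabla_smul : ∀ (U : S.Opens) (a : Γ(S, U)) (D : VectorField s U) (v : Γ(M, U)),
    nabla U (a • D) v = a • nabla U D v
  leibniz : ∀ (U : S.Opens) (D : VectorField s U) (a : Γ(S, U)) (v : Γ(M, U)),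
    nabla U D (a • v) = (const s U lam * D.act U le_rfl a) • v + a • nabla U D v
  nabla_res : ∀ (U U' : S.Opens) (i : U' ≤ U) (D : VectorField s U) (v : Γ(M, U)),
    nabla U' (D.res i) (M.presheaf.map (homOfLE i).op v) =
      M.presheaf.map (homOfLE i).op (nabla U D v)

namespace LambdaModule

variable {s : S ⟶ Spec (.of k)} {lam : k}

/-- The curvature `(D, E) ↦ [∇_D, ∇_E] - λ ∇_{[D, E]}` vanishes. -/
def Integrable (N : LambdaModule s lam) : Prop :=
  ∀ (U : S.Opens) (D E : VectorField s U) (v : Γ(N.M, U)),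
    N.nabla U D (N.nabla U E v) - N.nabla U E (N.nabla U D v) =
      const s U lam • N.nabla U ⁅D, E⁆ v

/-- The `p`-curvature `D ↦ (∇_D)^p - ∇_{D^p}` vanishes. -/
def PCurvatureZero (p : ℕ) [Fact p.Prime] [CharP k p] (N : LambdaModule s lam) : Prop :=
  ∀ (U : S.Opens) (D : VectorField s U) (v : Γ(N.M, U)),
    ((N.nabla U D)^[p]) v = N.nabla U (D.pPow p) v

/-- The `λ`-connection is the zero map. -/
def IsZero (N : LambdaModule s lam) : Prop :=
  ∀ (U : S.Opens) (D : VectorField s U) (v : Γ(N.M, U)), N.nabla U D v = 0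

/-- Quasi-coherent of finite type; on a locally noetherian scheme this means coherent. -/
def Coherent (N : LambdaModule s lam) : Prop :=
  SheafOfModules.IsQuasicoherent (R := S.ringCatSheaf) N.M ∧
    SheafOfModules.IsFiniteType.{u} (R := S.ringCatSheaf) N.M

/-- The section `v` of `M` over `U` is flat. -/
def IsFlat (N : LambdaModule s lam) (U : S.Opens) (v : Γ(N.M, U)) : Prop :=
  ∀ (W : S.Opens) (h : W ≤ U) (D : VectorField s W),
    N.nabla W D (N.M.presheaf.map (homOfLE h).op v) = 0

/-- Morphisms are the horizontal `𝒪_S`-linear maps. -/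
@[ext]
structure Hom (N N' : LambdaModule s lam) where
  /-- the underlying map of modules -/
  hom : N.M ⟶ N'.M
  comm : ∀ (U : S.Opens) (D : VectorField s U) (v : Γ(N.M, U)),
    hom.app U (N.nabla U D v) = N'.nabla U D (hom.app U v)

instance : Category (LambdaModule s lam) where
  Hom := Hom
  id N := ⟨𝟙 N.M, fun _ _ _ => rfl⟩
  comp g h := ⟨g.hom ≫ h.hom, fun U D v =>
    (congrArg (h.hom.app U) (g.comm U D v)).trans (h.comm U D (g.hom.app U v))⟩

variable (s lam) in
/-- Forgetting the `λ`-connection. -/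
@[simps]
def forget : LambdaModule s lam ⥤ S.Modules where
  obj N := N.M
  map h := h.hom

end LambdaModule

/-- The data exhibiting the `S`-scheme with `λ`-connection `P` as the linear scheme
`Spec Sym(M) ⟶ S` of the module with `λ`-connection `N = (M, ∇)`: the structure morphism is affine,
the functions over an affine open `U` are the symmetric algebra of `M(U)` by means of `ι`, and
the `λ`-connection of `P` restricts to that of `N` on linear functions. -/
structure LinearModel {s : S ⟶ Spec (.of k)} {lam : k} (N : LambdaModule s lam)
    (P : LambdaScheme s lam) where
  affine : IsAffineHom P.X.hom
  /-- the inclusion of `M` as the linear functions, `M ⟶ f_* 𝒪_X` -/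
  ι : ∀ U : S.Opens, Γ(N.M, U) →+ Γ(P.X.left, P.X.hom ⁻¹ᵁ U)
  ι_smul : ∀ (U : S.Opens) (a : Γ(S, U)) (v : Γ(N.M, U)),
    ι U (a • v) = P.X.hom.app U a * ι U v
  ι_res : ∀ (U U' : S.Opens) (i : U' ≤ U) (v : Γ(N.M, U)),
    ι U' (N.M.presheaf.map (homOfLE i).op v) =
      P.X.left.presheaf.map (homOfLE (P.X.hom.preimage_mono i)).op (ι U v)
  isSymmetricAlgebra : ∀ U : S.Opens, IsAffineOpen U →
    letI : Algebra Γ(S, U) Γ(P.X.left, P.X.hom ⁻¹ᵁ U) := (P.X.hom.app U).hom.toAlgebra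
    IsSymmetricAlgebra
      ({ toFun := ι U
         map_add' := map_add (ι U)
         map_smul' := ι_smul U } : Γ(N.M, U) →ₗ[Γ(S, U)] Γ(P.X.left, P.X.hom ⁻¹ᵁ U))
  horizontal : ∀ (U : S.Opens) (D : VectorField s U) (v : Γ(N.M, U)),
    (P.conn.nabla U D).act (P.X.hom ⁻¹ᵁ U) le_rfl (ι U v) = ι U (N.nabla U D v)

/-- Linear objects: linear schemes of coherent modules with integrable `λ`-connection. -/
def LambdaScheme.IsLinear {s : S ⟶ Spec (.of k)} {lam : k} (P : LambdaScheme s lam) : Prop :=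
  ∃ N : LambdaModule s lam, N.Coherent ∧ N.Integrable ∧ Nonempty (LinearModel N P)

/-- A `k`-variety: an integral separated scheme of finite type over `k`. -/
def IsVariety {X : Scheme.{u}} (x : X ⟶ Spec (.of k)) : Prop :=
  IsIntegral X ∧ IsSeparated x ∧ LocallyOfFiniteType x ∧ QuasiCompact x

end Modules

/-! ### The categories -/

section Categories

variable {k : Type u} [CommRing k] (p : ℕ) [Fact p.Prime] [CharP k p] {S : Scheme.{u}}

/-- `NMIC_0(S)`: quasi-compact `S`-schemes with an integrable connection (transversal foliation) of
vanishing `p`-curvature. -/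
abbrev NMIC₀ (s : S ⟶ Spec (.of k)) :=
  ObjectProperty.FullSubcategory fun P : LambdaScheme s 1 =>
    QuasiCompact P.X.hom ∧ P.conn.Integrable ∧ P.conn.PCurvatureZero p

/-- `NHIG_0(S)`: quasi-compact `S`-schemes with an integrable `0`-connection (Higgs field) which
is zero. -/
abbrev NHIG₀ (s : S ⟶ Spec (.of k)) :=
  ObjectProperty.FullSubcategory fun P : LambdaScheme s 0 =>
    QuasiCompact P.X.hom ∧ P.conn.Integrable ∧ P.conn.IsZero

/-- `MIC_0(S)`: coherent modules with integrable connection of vanishing `p`-curvature. -/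
abbrev MIC₀ (s : S ⟶ Spec (.of k)) :=
  ObjectProperty.FullSubcategory fun N : LambdaModule s 1 =>
    N.Coherent ∧ N.Integrable ∧ N.PCurvatureZero p

/-- `HIG_0(S)`: coherent modules with zero Higgs field. -/
abbrev HIG₀ (s : S ⟶ Spec (.of k)) :=
  ObjectProperty.FullSubcategory fun N : LambdaModule s 0 =>
    N.Coherent ∧ N.Integrable ∧ N.IsZero

/-- The underlying `S`-scheme. -/
abbrev NMIC₀.toOver (s : S ⟶ Spec (.of k)) : NMIC₀ p s ⥤ Over S :=
  ObjectProperty.ι _ ⋙ LambdaScheme.forget s 1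

/-- The underlying `S`-scheme. -/
abbrev NHIG₀.toOver (s : S ⟶ Spec (.of k)) : NHIG₀ s ⥤ Over S :=
  ObjectProperty.ι _ ⋙ LambdaScheme.forget s 0

/-- The underlying module. -/
abbrev MIC₀.toModules (s : S ⟶ Spec (.of k)) : MIC₀ p s ⥤ S.Modules :=
  ObjectProperty.ι _ ⋙ LambdaModule.forget s 1

/-- The underlying module. -/
abbrev HIG₀.toModules (s : S ⟶ Spec (.of k)) : HIG₀ s ⥤ S.Modules :=
  ObjectProperty.ι _ ⋙ LambdaModule.forget s 0

/-- The equivalence `e` restricts to an equivalence between the full subcategories of the objects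
satisfying `P` and `Q` respectively. -/
def RestrictsTo {C D : Type*} [Category C] [Category D] (e : C ≌ D) (P : C → Prop)
    (Q : D → Prop) : Prop :=
  ∃ e' : ObjectProperty.FullSubcategory P ≌ ObjectProperty.FullSubcategory Q,
    Nonempty (e'.functor ⋙ ObjectProperty.ι Q ≅ ObjectProperty.ι P ⋙ e.functor)

variable {p} {s : S ⟶ Spec (.of k)}

section Descent

variable {e : NMIC₀ p s ≌ NHIG₀ (frobTwistStr p s)}
  (α : e.inverse ⋙ NMIC₀.toOver p s ≅
    NHIG₀.toOver (frobTwistStr p s) ⋙ Over.pullback (relFrob p s))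

/-- For an `S'`-scheme `Y`, the projection `X ≅ Y ×_{S'} S ⟶ Y`, where `X` corresponds to `Y`. -/
def proj (Y : NHIG₀ (frobTwistStr p s)) : (e.inverse.obj Y).obj.X.left ⟶ Y.obj.X.left :=
  (α.hom.app Y).left ≫ pullback.fst Y.obj.X.hom (relFrob p s)

/-- For `P = (X, ∇)` with corresponding `S'`-scheme `X'`, the projection
`X ≅ X' ×_{S'} S ⟶ X'`. -/
def descentMap (P : NMIC₀ p s) : P.obj.X.left ⟶ (e.functor.obj P).obj.X.left :=
  ((NMIC₀.toOver p s).map (e.unit.app P)).left ≫ proj α (e.functor.obj P)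

lemma comp_aux {A B C Y T T' : Scheme.{u}} (a : A ⟶ B) (b : B ⟶ C) (c : C ⟶ Y) (g : Y ⟶ T')
    (f : A ⟶ T) (f₁ : B ⟶ T) (f₂ : C ⟶ T) (F : T ⟶ T') (h1 : a ≫ f₁ = f) (h2 : b ≫ f₂ = f₁)
    (h3 : c ≫ g = f₂ ≫ F) : (a ≫ b ≫ c) ≫ g = f ≫ F := by
  subst h1 h2
  simp [h3]

lemma descentMap_comp (P : NMIC₀ p s) :
    descentMap α P ≫ (e.functor.obj P).obj.X.hom = P.obj.X.hom ≫ relFrob p s := by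
  exact comp_aux _ _ _ _ _ _ _ _ (Over.w ((NMIC₀.toOver p s).map (e.unit.app P)))
    (Over.w (α.hom.app (e.functor.obj P))) pullback.condition

lemma descentMap_le (P : NMIC₀ p s) (U : (frobTwist p s).Opens) :
    P.obj.X.hom ⁻¹ᵁ relFrob p s ⁻¹ᵁ U ≤
      descentMap α P ⁻¹ᵁ (e.functor.obj P).obj.X.hom ⁻¹ᵁ U := by
  rw [← Scheme.Hom.comp_preimage, ← Scheme.Hom.comp_preimage, descentMap_comp]

end Descent

end Categories

end

end NonlinearCartier

open NonlinearCartier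

namespace NonlinearCartier

/-! ### Decomposition of modules over the Weyl algebra in characteristic `p` -/

section Weyl

/-! Locally `S` has coordinates `x_i`, that is, an étale map to affine space. The relative Frobenius
of an étale map is an isomorphism, so `𝒪_S` is generated over `𝒪_{S'}` by the monomials `x^I` with
all exponents `< p`. The dual derivations `∂_i` commute, satisfy `∂_i^p = 0`, kill `𝒪_{S'}` and form
a basis of the tangent sheaf. In particular `F` is affine, flat and a homeomorphism.

The heart is an argument on the Weyl algebra. Suppose that operators `X_i`, `D_i` with `[D_i, X_j] =
δ_ij`, commuting `D_i` and `D_i^p = 0` act on a group `M` killed by `p`. Then Taylor expansion,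
which only divides by factorials `r!` with `r < p`, writes every element uniquely as `∑ X^I n_I`
with all `n_I` killed by the `D_i` (`WeylOperators.exists_sum`,
`WeylOperators.eq_zero_of_sum_eq_zero`). An integrable connection of vanishing `p`-curvature makes
`∇(∂_i)` such operators, on functions of `X` and on sections of a module alike. So `𝒪_X` is free
over `𝒪_X^∇` on the monomials.

A `p`-th power is always flat. Hence `𝒪_X^∇` is an `𝒪_X`-algebra through Frobenius and is compatible
with localization, and its relative spectrum is a scheme `Y` homeomorphic to `X`
(`isFlatQuotient_quotientMk`). It has the universal property of a quotient
(`IsFlatQuotient.exists_desc`), which gives the map `Y ⟶ S'`. Comparing monomial bases gives `X ≅ Y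
×_{S'} S` (`IsFlatQuotient.isPullback`).

Conversely, on `T = Y ×_{S'} S` the monomials are again a basis over `𝒪_Y`. So a vector field on `S`
has exactly one lift to `T` that kills `𝒪_Y` (`IsLift.unique`, `IsLift.exists_lift`). Uniqueness
yields linearity of the canonical connection, its integrability, vanishing `p`-curvature and
functoriality, and the flat functions are those of `Y`. Frobenius pullback is therefore fully
faithful and essentially surjective. Geometric properties go up and down because `F` is flat,
surjective, affine and universally closed.

For modules the same decomposition applies. The pullback `F^* N'` is realized as the sheaf of maps
from the dual of `F_* 𝒪_S` to `N'`, and finiteness and quasi-coherence are read off on coefficients.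
Linear objects match because symmetric algebras commute with base change: over a free extension,
being the symmetric algebra can be tested on coefficients (`isSymmetricAlgebra_iff_of_basis`). -/

lemma end_mul_apply {M : Type*} [AddCommGroup M] (f g : AddMonoid.End M) (m : M) :
    (f * g) m = f (g m) := rfl

section OneVariable

variable {M : Type*} [AddCommGroup M] {p : ℕ} [Fact p.Prime] {X D : AddMonoid.End M}

lemma apply_pow_succ (h : ∀ m, D (X m) = X (D m) + m) (j : ℕ) {m : M}
    (hm : D m = 0) : D ((X ^ (j + 1)) m) = (j + 1) • (X ^ j) m := by
  induction j with
  | zero => simp [h, hm]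
  | succ j ih =>
    rw [pow_succ', end_mul_apply, h, ih, map_nsmul, pow_succ' X j, end_mul_apply,
      succ_nsmul _ (j + 1)]

lemma pow_apply_pow_of_lt (h : ∀ m, D (X m) = X (D m) + m) {m : M}
    (hm : D m = 0) {j r : ℕ} (hj : j < r) : (D ^ r) ((X ^ j) m) = 0 := by
  induction r generalizing j with
  | zero => omega
  | succ r ih =>
    rw [pow_succ, end_mul_apply]
    cases j with
    | zero => simp [hm]
    | succ j => rw [apply_pow_succ h j hm, map_nsmul, ih (by omega), smul_zero]

lemma pow_apply_pow_self (h : ∀ m, D (X m) = X (D m) + m) {m : M}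
    (hm : D m = 0) (r : ℕ) : (D ^ r) ((X ^ r) m) = r.factorial • m := by
  induction r with
  | zero => simp
  | succ r ih =>
    rw [pow_succ, end_mul_apply, apply_pow_succ h r hm, map_nsmul, ih, Nat.factorial_succ,
      mul_smul]

/-- A prime `p` does not divide `r!` for `r < p`. The inverse is taken as a natural number, since
`M` is only an abelian group. -/
lemma exists_nsmul_factorial (hp : ∀ m : M, p • m = 0) {r : ℕ} (hr : r < p) :
    ∃ c : ℕ, ∀ m : M, c • r.factorial • m = m := by
  have hpp : p.Prime := Fact.out
  obtain ⟨c, -, hc⟩ := Nat.exists_mul_mod_eq_one_of_coprime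
    (hpp.coprime_factorial_of_lt hr).symm hpp.one_lt
  refine ⟨c, fun m => ?_⟩
  rw [← mul_smul, mul_comm, ← Nat.div_add_mod (r.factorial * c) p, hc, add_smul, mul_smul, hp,
    zero_add, one_smul]

/-- Taylor expansion. If `D^(r+1) m = 0`, then `D^r m` is killed by `D`, and subtracting `X^r (D^r
m) / r!` from `m` lowers the order of nilpotence by one. -/
lemma exists_sum_pow (hp : ∀ m : M, p • m = 0) (h : ∀ m, D (X m) = X (D m) + m) {r : ℕ}
    (hr : r ≤ p) (m : M) (hm : (D ^ r) m = 0) :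
    ∃ n : ℕ → M, (∀ j, D (n j) = 0) ∧ m = ∑ j ∈ Finset.range r, (X ^ j) (n j) := by
  induction r generalizing m with
  | zero => exact ⟨0, by simp, by simpa using hm⟩
  | succ r ih =>
    obtain ⟨c, hc⟩ := exists_nsmul_factorial hp (Nat.lt_of_succ_le hr)
    have h0 : D (c • (D ^ r) m) = 0 := by
      rw [map_nsmul, ← end_mul_apply, ← pow_succ', hm, smul_zero]
    obtain ⟨n, hn, hs⟩ := ih (by omega) (m - (X ^ r) (c • (D ^ r) m)) (by
      rw [map_sub, pow_apply_pow_self h h0, ← mul_smul, mul_comm, mul_smul, hc, sub_self])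
    refine ⟨Function.update n r (c • (D ^ r) m), fun j => ?_, ?_⟩
    · by_cases hj : j = r
      · subst hj; simpa using h0
      · simpa [hj] using hn j
    · rw [Finset.sum_range_succ, Function.update_self, ← sub_eq_iff_eq_add, hs]
      refine Finset.sum_congr rfl fun j hj => ?_
      rw [Function.update_of_ne (Finset.mem_range.mp hj).ne]

/-- Applying `D^r` kills all terms of lower degree and turns the top one into `r!` times its
coefficient, so coefficients vanish from the top down. -/
lemma eq_zero_of_sum_pow_eq_zero (hp : ∀ m : M, p • m = 0) (h : ∀ m, D (X m) = X (D m) + m)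
    {r : ℕ} (hr : r ≤ p) (n : ℕ → M) (hn : ∀ j, D (n j) = 0)
    (hs : ∑ j ∈ Finset.range r, (X ^ j) (n j) = 0) : ∀ j < r, n j = 0 := by
  induction r with
  | zero => simp
  | succ r ih =>
    have h1 : n r = 0 := by
      obtain ⟨c, hc⟩ := exists_nsmul_factorial hp (Nat.lt_of_succ_le hr)
      have h2 := congrArg (D ^ r) hs
      rw [Finset.sum_range_succ, map_add, map_sum, Finset.sum_eq_zero fun j hj =>
        pow_apply_pow_of_lt h (hn j) (Finset.mem_range.mp hj), zero_add,
        pow_apply_pow_self h (hn r), map_zero] at h2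
      rw [← hc (n r), h2, smul_zero]
    rw [Finset.sum_range_succ, h1, map_zero, add_zero] at hs
    intro j hj
    rcases Nat.lt_succ_iff_lt_or_eq.mp hj with h3 | rfl
    · exact ih (by omega) hs j h3
    · exact h1

end OneVariable

/-- The monomial operator `X_0 ^ I_0 ∘ ⋯ ∘ X_{d-1} ^ I_{d-1}`. -/
def monomialOp {M : Type*} [AddCommGroup M] {d p : ℕ} (X : Fin d → AddMonoid.End M)
    (I : Fin d → Fin p) : AddMonoid.End M :=
  (List.ofFn fun i => X i ^ (I i : ℕ)).prod

/-- Operators `X_i`, `D_i` satisfying the relations of the Weyl algebra and `D_i ^ p = 0` in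
characteristic `p`. -/
structure WeylOperators (p : ℕ) {M : Type*} [AddCommGroup M] {d : ℕ}
    (X D : Fin d → AddMonoid.End M) : Prop where
  smul_eq_zero : ∀ m : M, p • m = 0
  comm : ∀ i j m, D i (D j m) = D j (D i m)
  leibniz : ∀ i j m, D i (X j m) = X j (D i m) + if i = j then m else 0
  pow_eq_zero : ∀ i m, (D i ^ p) m = 0

/-- The restriction of an additive endomorphism to a stable subgroup. -/
def restrictEnd {M : Type*} [AddCommGroup M] (K : AddSubgroup M) (f : AddMonoid.End M)
    (h : ∀ m ∈ K, f m ∈ K) : AddMonoid.End K :=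
  AddMonoidHom.mk' (fun m => ⟨f m, h m m.2⟩) fun _ _ => Subtype.ext (map_add f _ _)

lemma restrictEnd_pow {M : Type*} [AddCommGroup M] (K : AddSubgroup M) (f : AddMonoid.End M)
    (h : ∀ m ∈ K, f m ∈ K) (n : ℕ) (m : K) :
    (((restrictEnd K f h) ^ n) m : M) = (f ^ n) m := by
  induction n with
  | zero => rfl
  | succ n ih =>
    rw [pow_succ', pow_succ', end_mul_apply, end_mul_apply, ← ih]
    rfl

lemma restrictEnd_monomialOp {M : Type*} [AddCommGroup M] {d p : ℕ} (K : AddSubgroup M)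
    (f : Fin d → AddMonoid.End M) (h : ∀ i, ∀ m ∈ K, f i m ∈ K) (I : Fin d → Fin p) (m : K) :
    ((monomialOp (fun i => restrictEnd K (f i) (h i)) I) m : M) = (monomialOp f I) m := by
  induction d with
  | zero => simp [monomialOp]
  | succ d ih =>
    have := ih (fun i => f i.succ) (fun i => h i.succ) (fun i => I i.succ)
    simp only [monomialOp, List.ofFn_succ, List.prod_cons, end_mul_apply, restrictEnd_pow] at *
    rw [this]

namespace WeylOperators

variable {p : ℕ}

/-- Since `D_0` commutes with the remaining operators, its kernel is a module over the Weyl algebra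
in one variable fewer. This is the induction step of the two theorems below. -/
lemma tail {M : Type*} [AddCommGroup M] {d : ℕ} {X D : Fin (d + 1) → AddMonoid.End M}
    (h : WeylOperators p X D) :
    ∃ (hX : ∀ i : Fin d, ∀ m ∈ (D 0).ker, X i.succ m ∈ (D 0).ker)
      (hD : ∀ i : Fin d, ∀ m ∈ (D 0).ker, D i.succ m ∈ (D 0).ker),
      WeylOperators p (fun i => restrictEnd (D 0).ker (X i.succ) (hX i))
        (fun i => restrictEnd (D 0).ker (D i.succ) (hD i)) := by
  refine ⟨fun i m hm => ?_, fun i m hm => ?_, ⟨fun m => Subtype.ext (h.smul_eq_zero m),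
    fun i j m => Subtype.ext (h.comm _ _ m), fun i j m => Subtype.ext ?_,
    fun i m => Subtype.ext ?_⟩⟩
  · change D 0 _ = 0 at hm ⊢
    rw [h.leibniz, hm, if_neg (Fin.succ_ne_zero i).symm, map_zero, add_zero]
  · change D 0 _ = 0 at hm ⊢
    rw [h.comm, hm, map_zero]
  · refine (h.leibniz i.succ j.succ m).trans ?_
    by_cases hij : i = j
    · subst hij; simp; rfl
    · simp [hij]; rfl
  · rw [restrictEnd_pow]
    exact h.pow_eq_zero _ _

lemma sum_cons {M : Type*} [AddCommMonoid M] {d : ℕ} (f : (Fin (d + 1) → Fin p) → M) :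
    ∑ I, f I = ∑ j : Fin p, ∑ I : Fin d → Fin p, f (Fin.cons j I) := by
  rw [← Fintype.sum_prod_type', ← (Fin.consEquiv fun _ => Fin p).sum_comp]
  rfl

lemma monomialOp_cons {M : Type*} [AddCommGroup M] {d : ℕ} (X : Fin (d + 1) → AddMonoid.End M)
    (j : Fin p) (I : Fin d → Fin p) (m : M) :
    monomialOp X (Fin.cons j I : Fin (d + 1) → Fin p) m =
      (X 0 ^ (j : ℕ)) (monomialOp (fun i => X i.succ) I m) := by
  simp [monomialOp, List.ofFn_succ, List.prod_cons, end_mul_apply]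

variable [Fact p.Prime]

/-- Every element is a combination of the monomials `X ^ I`, `I_i < p`, with coefficients killed by
all `D_i`. -/
theorem exists_sum {M : Type*} [AddCommGroup M] {d : ℕ} {X D : Fin d → AddMonoid.End M}
    (h : WeylOperators p X D) (m : M) :
    ∃ n : (Fin d → Fin p) → M, (∀ I i, D i (n I) = 0) ∧ m = ∑ I, monomialOp X I (n I) := by
  induction d generalizing M with
  | zero => exact ⟨fun _ => m, fun _ i => i.elim0, by simp [monomialOp]⟩
  | succ d ih =>
    have h0 : ∀ m, D 0 (X 0 m) = X 0 (D 0 m) + m := fun m => by simpa using h.leibniz 0 0 m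
    obtain ⟨n, hn, hs⟩ := exists_sum_pow h.smul_eq_zero h0 le_rfl m (h.pow_eq_zero 0 m)
    obtain ⟨hX, hD, hw⟩ := h.tail
    choose n' hn' hs' using fun j => ih hw ⟨n j, hn j⟩
    refine ⟨fun I => n' (I 0) (Fin.tail I), fun I i => ?_, ?_⟩
    · refine Fin.cases ?_ (fun i => ?_) i
      · exact (n' (I 0) (Fin.tail I)).2
      · exact congrArg Subtype.val (hn' (I 0) (Fin.tail I) i)
    · rw [sum_cons, hs, Finset.sum_range]
      refine Finset.sum_congr rfl fun j _ => ?_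
      have := congrArg Subtype.val (hs' j)
      rw [AddSubgroup.val_finsetSum] at this
      simp only [restrictEnd_monomialOp] at this
      change n j = _ at this
      conv_lhs => rw [this, map_sum]
      exact Finset.sum_congr rfl fun I _ => by rw [monomialOp_cons]; rfl

/-- The coefficients of the monomials `X ^ I`, `I_i < p`, are unique. -/
theorem eq_zero_of_sum_eq_zero {M : Type*} [AddCommGroup M] {d : ℕ} {X D : Fin d → AddMonoid.End M}
    (h : WeylOperators p X D) (n : (Fin d → Fin p) → M) (hn : ∀ I i, D i (n I) = 0)
    (hs : ∑ I, monomialOp X I (n I) = 0) (I : Fin d → Fin p) : n I = 0 := by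
  induction d generalizing M with
  | zero =>
    obtain rfl := Subsingleton.elim I default
    have h1 (I : Fin 0 → Fin p) : monomialOp X I = 1 := by simp [monomialOp]
    rw [Fintype.sum_unique, h1] at hs
    exact (congrArg n (Subsingleton.elim _ _)).trans hs
  | succ d ih =>
    have h0 : ∀ m, D 0 (X 0 m) = X 0 (D 0 m) + m := fun m => by simpa using h.leibniz 0 0 m
    obtain ⟨hX, hD, hw⟩ := h.tail
    let n' : Fin p → (Fin d → Fin p) → (D 0).ker := fun j I =>
      ⟨n (Fin.cons j I), hn _ 0⟩
    -- The one-variable lemma takes coefficients indexed by `ℕ`; only the indices below `p` matter,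
    -- and the value `0` beyond them is a filler.
    let N : ℕ → (D 0).ker := fun j => if hj : j < p then
      ∑ I, monomialOp (fun i => restrictEnd (D 0).ker (X i.succ) (hX i)) I (n' ⟨j, hj⟩ I) else 0
    have h1 := eq_zero_of_sum_pow_eq_zero h.smul_eq_zero h0 le_rfl (fun j => (N j : M))
      (fun j => (N j).2) (by
        rw [sum_cons] at hs
        rw [Finset.sum_range, ← hs]
        refine Finset.sum_congr rfl fun j _ => ?_
        simp only [N, j.2, dif_pos, AddSubgroup.val_finsetSum, restrictEnd_monomialOp, map_sum]
        exact Finset.sum_congr rfl fun I _ => by rw [monomialOp_cons])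
    have h3 := ih hw (n' (I 0)) (fun J i => Subtype.ext (hn _ i.succ)) (by
      have := h1 (I 0) (I 0).2
      simp only [N, (I 0).2, dif_pos] at this
      exact Subtype.ext this) (Fin.tail I)
    have h4 := congrArg Subtype.val h3
    simpa [n'] using h4

end WeylOperators

/-- The monomial `x_0 ^ I_0 ⋯ x_{d-1} ^ I_{d-1}`. -/
def monom {A : Type*} [CommRing A] {d p : ℕ} (x : Fin d → A) (I : Fin d → Fin p) : A :=
  ∏ i, x i ^ (I i : ℕ)

lemma map_monom {A B : Type*} [CommRing A] [CommRing B] {d p : ℕ} (f : A →+* B) (x : Fin d → A)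
    (I : Fin d → Fin p) : f (monom x I) = monom (fun i => f (x i)) I := by
  simp [monom]

/-- Derivations `D_i` on a module which are dual to elements `x_i` of the ring, commute, and
satisfy `D_i ^ p = 0`, in characteristic `p`. -/
structure WeylModule (p : ℕ) {A M : Type*} [CommRing A] [AddCommGroup M] [Module A M] {d : ℕ}
    (x : Fin d → A) (D : Fin d → M →+ M) : Prop where
  char : (p : A) = 0
  comm : ∀ i j m, D i (D j m) = D j (D i m)
  leibniz : ∀ i j m, D i (x j • m) = x j • D i m + if i = j then m else 0
  iterate_eq_zero : ∀ i m, (D i)^[p] m = 0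

namespace WeylModule

variable {p : ℕ} {A M : Type*} [CommRing A] [AddCommGroup M] [Module A M] {d : ℕ}
  {x : Fin d → A} {D : Fin d → M →+ M}

/-- Scalar multiplication as an additive endomorphism. -/
def smulEnd (M : Type*) [AddCommGroup M] [Module A M] (a : A) : AddMonoid.End M :=
  AddMonoidHom.mk' (fun m : M => a • m) (smul_add _)

lemma monomialOp_smul (x : Fin d → A) (I : Fin d → Fin p) (m : M) :
    monomialOp (fun i => smulEnd M (x i)) I m = monom x I • m := by
  have hpow (a : A) (n : ℕ) (m : M) : (smulEnd M a ^ n) m = a ^ n • m := by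
    induction n with
    | zero => simp
    | succ n ih => rw [pow_succ', end_mul_apply, ih, pow_succ', mul_smul]; rfl
  induction d with
  | zero => simp [monomialOp, monom]
  | succ d ih =>
    have := ih (fun i => x i.succ) (fun i => I i.succ)
    rw [monomialOp] at this
    rw [monomialOp, List.ofFn_succ, List.prod_cons, end_mul_apply, this, hpow, monom, monom,
      Fin.prod_univ_succ, mul_smul]

lemma end_pow_apply (f : AddMonoid.End M) (n : ℕ) (m : M) : (f ^ n) m = f^[n] m := by
  induction n with
  | zero => rfl
  | succ n ih => rw [pow_succ', end_mul_apply, ih, Function.iterate_succ_apply']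

lemma operators (h : WeylModule p x D) :
    WeylOperators p (fun i => smulEnd M (x i)) D where
  smul_eq_zero m := by rw [← Nat.cast_smul_eq_nsmul A, h.char, zero_smul]
  comm := h.comm
  leibniz := h.leibniz
  pow_eq_zero i m := (end_pow_apply _ _ _).trans (h.iterate_eq_zero i m)

variable [Fact p.Prime]

theorem exists_sum (h : WeylModule p x D) (m : M) :
    ∃ n : (Fin d → Fin p) → M, (∀ I i, D i (n I) = 0) ∧ m = ∑ I, monom x I • n I := by
  obtain ⟨n, hn, hs⟩ := h.operators.exists_sum m
  exact ⟨n, hn, hs.trans (Finset.sum_congr rfl fun I _ => monomialOp_smul x I _)⟩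

theorem eq_zero_of_sum_eq_zero (h : WeylModule p x D) (n : (Fin d → Fin p) → M)
    (hn : ∀ I i, D i (n I) = 0) (hs : ∑ I, monom x I • n I = 0) (I : Fin d → Fin p) :
    n I = 0 :=
  h.operators.eq_zero_of_sum_eq_zero n hn
    ((Finset.sum_congr rfl fun I _ => monomialOp_smul x I _).trans hs) I

lemma eq_of_sum_eq_sum (h : WeylModule p x D) {n n' : (Fin d → Fin p) → M}
    (hn : ∀ I i, D i (n I) = 0) (hn' : ∀ I i, D i (n' I) = 0)
    (hs : ∑ I, monom x I • n I = ∑ I, monom x I • n' I) : n = n' := by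
  funext I
  refine sub_eq_zero.mp (h.eq_zero_of_sum_eq_zero (n - n')
    (fun I i => by simp [hn, hn']) ?_ I)
  simp [smul_sub, hs]

/-- The exponent `0`. -/
def zeroIndex (p d : ℕ) [Fact p.Prime] : Fin d → Fin p := fun _ => ⟨0, (Fact.out : p.Prime).pos⟩

lemma monom_zeroIndex (x : Fin d → A) : monom x (zeroIndex p d) = 1 := by
  simp [monom, zeroIndex]

/-- If a combination of monomials is killed by all `D_i`, it equals its constant coefficient. -/
lemma sum_eq_of_flat (h : WeylModule p x D) {n : (Fin d → Fin p) → M}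
    (hn : ∀ I i, D i (n I) = 0) (hs : ∀ i, D i (∑ I, monom x I • n I) = 0) :
    ∑ I, monom x I • n I = n (zeroIndex p d) ∧ ∀ I, I ≠ zeroIndex p d → n I = 0 := by
  classical
  -- An element killed by all `D_i` is its own expansion, with the single monomial `1`; uniqueness
  -- of coefficients then compares the two expansions.
  have h1 := h.eq_of_sum_eq_sum hn
    (n' := Pi.single (zeroIndex p d) (∑ I, monom x I • n I)) (fun I i => by
      by_cases hI : I = zeroIndex p d
      · subst hI; rw [Pi.single_eq_same]; exact hs i
      · rw [Pi.single_eq_of_ne hI, map_zero]) (by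
      symm
      rw [Finset.sum_eq_single (zeroIndex p d)]
      · rw [monom_zeroIndex, one_smul, Pi.single_eq_same]
      · intro I _ hI; rw [Pi.single_eq_of_ne hI, smul_zero]
      · simp)
  refine ⟨((congrFun h1 (zeroIndex p d)).trans (by rw [Pi.single_eq_same])).symm,
    fun I hI => (congrFun h1 I).trans (by rw [Pi.single_eq_of_ne hI])⟩

end WeylModule

end Weyl


/-! ### The relative Frobenius of étale and of standard smooth algebras -/

section RelativeFrobenius

-- The ideal of the diagonal is generated by the elements `1 ⊗ q - q ⊗ 1`, whose `p`-th powers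
-- vanish because `q^p` comes from `C`. Being finitely generated it is nilpotent, and being
-- idempotent (no differentials) it is zero.
open TensorProduct in
lemma isEpi_of_unramified {p : ℕ} [Fact p.Prime] {C Q : Type u} [CommRing C] [CommRing Q]
    [Algebra C Q] [Algebra.FormallyUnramified C Q] [Algebra.FiniteType C Q] (h0 : (p : C) = 0)
    (h : ∀ q : Q, q ^ p ∈ (algebraMap C Q).range) : Algebra.IsEpi C Q := by
  have hT : (p : Q ⊗[C] Q) = 0 := by
    rw [← map_natCast (algebraMap C (Q ⊗[C] Q)), h0, map_zero]
  have hnil : KaehlerDifferential.ideal C Q ≤ nilradical (Q ⊗[C] Q) := by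
    rw [← KaehlerDifferential.span_range_eq_ideal, Ideal.span_le]
    rintro _ ⟨q, rfl⟩
    refine ⟨p, ?_⟩
    obtain ⟨c, hc⟩ := h q
    have := map_sub (powHom p hT) ((1 : Q) ⊗ₜ[C] q) (q ⊗ₜ[C] (1 : Q))
    refine this.trans ?_
    change ((1 : Q) ⊗ₜ[C] q) ^ p - (q ⊗ₜ[C] (1 : Q)) ^ p = 0
    rw [Algebra.TensorProduct.tmul_pow, Algebra.TensorProduct.tmul_pow, one_pow, ← hc,
      Algebra.algebraMap_eq_smul_one, TensorProduct.tmul_smul, TensorProduct.smul_tmul', sub_self]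
  obtain ⟨n, hn⟩ := (KaehlerDifferential.ideal_fg C Q).isNilpotent_iff_le_nilradical.mpr hnil
  have hid : IsIdempotentElem (KaehlerDifferential.ideal C Q) := by
    have := (Ideal.cotangent_subsingleton_iff (KaehlerDifferential.ideal C Q)).mp
      (inferInstanceAs (Subsingleton (Ω[Q⁄C])))
    exact this
  have hbot : KaehlerDifferential.ideal C Q = ⊥ := by
    cases n with
    | zero => rw [pow_zero] at hn; rw [← mul_one (KaehlerDifferential.ideal C Q), hn, mul_zero]; rfl
    | succ n => rw [hid.pow_succ_eq] at hn; exact hn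
  rw [Algebra.isEpi_iff_forall_one_tmul_eq]
  intro q
  refine sub_eq_zero.mp ((Submodule.mem_bot _).mp (hbot ▸ ?_ :
    (1 : Q) ⊗ₜ[C] q - q ⊗ₜ[C] (1 : Q) ∈ (⊥ : Ideal (Q ⊗[C] Q))))
  exact KaehlerDifferential.one_smul_sub_smul_one_mem_ideal C q

/-- Both composites are Frobenius maps, so `f` is a homeomorphism on spectra and an epimorphism of
rings. A flat surjective monomorphism of affine schemes is an isomorphism. -/
lemma bijective_of_etale {p : ℕ} [Fact p.Prime] {C Q : Type u} [CommRing C] [CommRing Q]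
    (f : C →+* Q) (g : Q →+* C) (hf : f.Etale) (h0 : (p : C) = 0)
    (hgf : ∀ c, g (f c) = c ^ p) (hfg : ∀ q, f (g q) = q ^ p) : Function.Bijective f := by
  have hp : p.Prime := Fact.out
  algebraize [f]
  have hepi : Algebra.IsEpi C Q := isEpi_of_unramified h0 fun q => ⟨g q, hfg q⟩
  have : Epi (CommRingCat.ofHom f) := CommRingCat.epi_iff_epi.mpr hepi
  have : Mono (Spec.map (CommRingCat.ofHom f)) :=
    inferInstanceAs (Mono (Scheme.Spec.map (CommRingCat.ofHom f).op))
  have : Flat (Spec.map (CommRingCat.ofHom f)) := Flat.SpecMap_iff.mpr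
    (inferInstanceAs (Module.Flat C Q))
  have hh : IsHomeomorph (PrimeSpectrum.comap f) := PrimeSpectrum.isHomeomorph_comap f
    (fun q => ⟨p, hp.pos, g q, hfg q⟩) (fun c hc => ⟨p, by
      change c ^ p = 0
      rw [← hgf, (RingHom.mem_ker).mp hc, map_zero]⟩)
  have : Surjective (Spec.map (CommRingCat.ofHom f)) := ⟨hh.surjective⟩
  have := Flat.isIso_of_surjective_of_mono (Spec.map (CommRingCat.ofHom f))
  have : IsIso (CommRingCat.ofHom f) := by
    have : IsIso (Scheme.Spec.map (CommRingCat.ofHom f).op) :=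
      inferInstanceAs (IsIso (Spec.map (CommRingCat.ofHom f)))
    have := isIso_of_reflects_iso (CommRingCat.ofHom f).op Scheme.Spec
    exact isIso_of_op _
  exact ConcreteCategory.bijective_of_isIso (CommRingCat.ofHom f)

variable (p : ℕ) [Fact p.Prime]

/-- The Frobenius endomorphism in `CommRingCat`. -/
def frobHom (A : CommRingCat.{u}) (h0 : (p : A) = 0) : A ⟶ A := CommRingCat.ofHom (powHom p h0)

lemma frobHom_comp {A B : CommRingCat.{u}} (hA : (p : A) = 0) (hB : (p : B) = 0) (f : A ⟶ B) :
    frobHom p A hA ≫ f = f ≫ frobHom p B hB := by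
  ext a
  exact map_pow f.hom a p

/-- The relative Frobenius of an étale algebra is an isomorphism. -/
theorem isPushout_frobHom_of_etale {P A : CommRingCat.{u}} (f : P ⟶ A) (hf : f.hom.Etale)
    (hP : (p : P) = 0) (hA : (p : A) = 0) :
    IsPushout (frobHom p P hP) f f (frobHom p A hA) := by
  have w := frobHom_comp p hP hA f
  -- `C` is the Frobenius twist of `A` over `P` and `c` is the relative Frobenius; `g`, the base
  -- change map `A ⟶ C`, inverts it up to absolute Frobenius on both sides.
  let C := pushout (frobHom p P hP) f
  let c : C ⟶ A := pushout.desc f (frobHom p A hA) w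
  let g : A ⟶ C := pushout.inr _ _
  have hpo := IsPushout.of_hasPushout (frobHom p P hP) f
  have hC : (p : C) = 0 := by rw [← map_natCast g.hom, hA, map_zero]
  have hgc : c ≫ g = frobHom p C hC := by
    apply pushout.hom_ext
    · rw [pushout.inl_desc_assoc, ← pushout.condition]
      exact frobHom_comp p hP hC _
    · rw [pushout.inr_desc_assoc]
      exact frobHom_comp p hA hC _
  have hcg : g ≫ c = frobHom p A hA := pushout.inr_desc _ _ _
  have hinl : (pushout.inl (frobHom p P hP) f).hom.Etale :=
    RingHom.Etale.isStableUnderBaseChange.pushout_inl RingHom.Etale.respectsIso _ _ hf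
  -- A map between étale `P`-algebras is étale, and `C` is étale over `P` by base change.
  have hc : c.hom.Etale := by
    have hcomp : f.hom = c.hom.comp (pushout.inl (frobHom p P hP) f).hom :=
      congrArg (fun φ => φ.hom) (pushout.inl_desc f (frobHom p A hA) w).symm
    algebraize [f.hom, c.hom, (pushout.inl (frobHom p P hP) f).hom]
    have : IsScalarTower P C A := .of_algebraMap_eq' hcomp
    exact Algebra.Etale.of_restrictScalars P C A
  have hb := bijective_of_etale c.hom g.hom hc hC
    (fun x => congrArg (fun φ => φ.hom x) hgc) (fun x => congrArg (fun φ => φ.hom x) hcg)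
  have : IsIso c := (ConcreteCategory.isIso_iff_bijective c).mpr hb
  refine IsPushout.of_iso_pushout ⟨w⟩ (asIso c).symm ?_ ?_
  · rw [Iso.symm_hom, asIso_inv, IsIso.comp_inv_eq]
    exact (pushout.inl_desc _ _ _).symm
  · rw [Iso.symm_hom, asIso_inv, IsIso.comp_inv_eq]
    exact (pushout.inr_desc _ _ _).symm

end RelativeFrobenius


/-! ### Pushouts of rings -/

section Pushouts

variable {R A B X : CommRingCat.{u}} {f : R ⟶ A} {g : R ⟶ B} {a : A ⟶ X} {b : B ⟶ X}

lemma injective_of_isPushout (H : IsPushout f g a b) (hg : g.hom.Flat)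
    (hf : Function.Injective f) : Function.Injective b := by
  algebraize [f.hom, g.hom, a.hom, b.hom, (a.hom.comp f.hom)]
  have : IsScalarTower R B X := .of_algebraMap_eq' (congrArg (fun φ => φ.hom) H.w)
  have hp : Algebra.IsPushout R A B X := CommRingCat.isPushout_iff_isPushout.mp H
  have hb : IsBaseChange B (IsScalarTower.toAlgHom R A X).toLinearMap := hp.symm.out
  have h1 : Function.Injective ((Algebra.linearMap R A).lTensor B) :=
    Module.Flat.lTensor_preserves_injective_linearMap _ hf
  intro y z h
  have h2 : ∀ y : B, b y = hb.equiv ((Algebra.linearMap R A).lTensor B (y ⊗ₜ[R] (1 : R))) := by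
    intro y
    rw [LinearMap.lTensor_tmul, IsBaseChange.equiv_tmul]
    simp [Algebra.smul_def]
    rfl
  have h3 := h1 (hb.equiv.injective ((h2 y).symm.trans (h.trans (h2 z))))
  simpa using congrArg (TensorProduct.rid R B) h3

/-- The hypothesis `he` makes `e` a basis of `A` over `R`, and a basis remains one after base
change. -/
lemma existsUnique_sum_of_isPushout (H : IsPushout f g a b) {ι : Type*} [Fintype ι]
    (e : ι → A) (he : ∀ y, ∃! c : ι → R, y = ∑ i, e i * f (c i)) (x : X) :
    ∃! c : ι → B, x = ∑ i, a (e i) * b (c i) := by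
  classical
  algebraize [f.hom, g.hom, a.hom, b.hom, (a.hom.comp f.hom)]
  have : IsScalarTower R B X := .of_algebraMap_eq' (congrArg (fun φ => φ.hom) H.w)
  have hp : Algebra.IsPushout R A B X := CommRingCat.isPushout_iff_isPushout.mp H
  have hb : IsBaseChange B (IsScalarTower.toAlgHom R A X).toLinearMap := hp.symm.out
  have hs : ∀ c : ι → R, ∑ i, c i • e i = ∑ i, e i * f (c i) := fun c =>
    Finset.sum_congr rfl fun i _ => by rw [Algebra.smul_def, mul_comm]; rfl
  let v : Module.Basis ι R A := Module.Basis.mk (v := e)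
    (Fintype.linearIndependent_iff.mpr fun c hc => by
      have := (he 0).unique (y₁ := c) (y₂ := 0) (by simpa [hs] using hc.symm) (by simp)
      exact fun i => congrFun this i)
    (fun y _ => by
      obtain ⟨c, hc, -⟩ := he y
      rw [hc, ← hs]
      exact Submodule.sum_mem _ fun i _ => Submodule.smul_mem _ _ (Submodule.subset_span ⟨i, rfl⟩))
  let w := hb.basis v
  have hw : ∀ i, w i = a (e i) := fun i => by
    rw [IsBaseChange.basis_apply, Module.Basis.mk_apply]; rfl
  have hs' : ∀ c : ι → B, ∑ i, c i • w i = ∑ i, a (e i) * b (c i) := fun c =>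
    Finset.sum_congr rfl fun i _ => by rw [Algebra.smul_def, mul_comm, hw]; rfl
  refine ⟨w.repr x, ((hs' _).symm.trans (w.sum_repr x)).symm, fun c hc => ?_⟩
  rw [hc.trans (hs' c).symm]
  exact (w.repr_sum_self c).symm

/-- Generation alone suffices for the construction of coordinates: uniqueness of the coefficients is
obtained later from the derivations. -/
lemma exists_sum_of_isPushout (H : IsPushout f g a b) {ι : Type*} [Fintype ι]
    (e : ι → A) (he : ∀ y, ∃ c : ι → R, y = ∑ i, e i * f (c i)) (x : X) :
    ∃ c : ι → B, x = ∑ i, a (e i) * b (c i) := by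
  algebraize [f.hom, g.hom, a.hom, b.hom, (a.hom.comp f.hom)]
  have : IsScalarTower R B X := .of_algebraMap_eq' (congrArg (fun φ => φ.hom) H.w)
  have hp : Algebra.IsPushout R A B X := CommRingCat.isPushout_iff_isPushout.mp H
  have hb : IsBaseChange B (IsScalarTower.toAlgHom R A X).toLinearMap := hp.symm.out
  induction x using hb.inductionOn with
  | zero => exact ⟨0, by simp⟩
  | tmul y =>
    obtain ⟨c, rfl⟩ := he y
    refine ⟨fun i => g (c i), ?_⟩
    change a (∑ i, e i * f (c i)) = _
    rw [map_sum]
    refine Finset.sum_congr rfl fun i _ => ?_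
    rw [map_mul]
    exact congrArg (a (e i) * ·) (congrArg (fun φ => φ.hom (c i)) H.w)
  | smul s n hn =>
    obtain ⟨c, rfl⟩ := hn
    refine ⟨fun i => s * c i, ?_⟩
    rw [Algebra.smul_def, Finset.mul_sum]
    refine Finset.sum_congr rfl fun i _ => ?_
    rw [map_mul]
    change b s * _ = _
    ring
  | add y z hy hz =>
    obtain ⟨c, rfl⟩ := hy
    obtain ⟨c', rfl⟩ := hz
    exact ⟨c + c', by simp [mul_add, Finset.sum_add_distrib]⟩

lemma flat_of_isPushout (H : IsPushout f g a b) (hg : g.hom.Flat) : a.hom.Flat := by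
  algebraize [f.hom, g.hom, a.hom, b.hom, (a.hom.comp f.hom)]
  have : IsScalarTower R B X := .of_algebraMap_eq' (congrArg (fun φ => φ.hom) H.w)
  have hp : Algebra.IsPushout R A B X := CommRingCat.isPushout_iff_isPushout.mp H
  exact Module.Flat.isBaseChange R A B X hp.out

end Pushouts

/-! ### Coordinates on standard smooth algebras -/

section Coordinates

/-- The differentials `dx_i` form a basis, so `A ⊗ Ω` of the polynomial ring maps isomorphically to
`Ω[A⁄R]`. The Jacobi–Zariski sequence then kills both the differentials and the first cotangent
homology of `A` over the polynomial ring. -/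
lemma etale_of_basis_kaehlerDifferential {R A : Type u} [CommRing R] [CommRing A]
    [Algebra R A] [Algebra.FinitePresentation R A] [Subsingleton (Algebra.H1Cotangent R A)]
    {ι : Type} [Finite ι] (b : Module.Basis ι A (Ω[A⁄R])) (x : ι → A)
    (hb : ∀ i, b i = KaehlerDifferential.D R A (x i)) :
    (MvPolynomial.eval₂Hom (algebraMap R A) x).Etale := by
  algebraize [MvPolynomial.eval₂Hom (algebraMap R A) x]
  have : IsScalarTower R (MvPolynomial ι R) A := .of_algebraMap_eq fun r =>
    (MvPolynomial.eval₂Hom_C _ _ r).symm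
  have hX : ∀ i, algebraMap (MvPolynomial ι R) A (MvPolynomial.X i) = x i := fun i =>
    MvPolynomial.eval₂Hom_X' _ _ i
  let v := (KaehlerDifferential.mvPolynomialBasis R ι).baseChange A
  have hv : ∀ i, KaehlerDifferential.mapBaseChange R (MvPolynomial ι R) A (v i) = b i := by
    intro i
    simp [v, hX, hb, KaehlerDifferential.mvPolynomialBasis_apply]
  let e := v.equiv b (Equiv.refl ι)
  have he : (e : _ →ₗ[A] _) = KaehlerDifferential.mapBaseChange R (MvPolynomial ι R) A :=
    v.ext fun i => by simp [e, hv]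
  have hbij : Function.Bijective (KaehlerDifferential.mapBaseChange R (MvPolynomial ι R) A) := by
    rw [← he]; exact e.bijective
  have h1 : Subsingleton (Ω[A⁄MvPolynomial ι R]) := by
    refine ⟨fun y z => ?_⟩
    have key : ∀ y : Ω[A⁄MvPolynomial ι R], y = 0 := by
      intro y
      obtain ⟨y, rfl⟩ := KaehlerDifferential.map_surjective R (MvPolynomial ι R) A y
      exact (KaehlerDifferential.exact_mapBaseChange_map R (MvPolynomial ι R) A y).mpr
        (hbij.2 y)
    rw [key y, key z]
  have h2 : Subsingleton (Algebra.H1Cotangent (MvPolynomial ι R) A) := by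
    refine ⟨fun y z => ?_⟩
    have key : ∀ y : Algebra.H1Cotangent (MvPolynomial ι R) A, y = 0 := by
      intro y
      have h0 : Algebra.H1Cotangent.δ R (MvPolynomial ι R) A y = 0 := hbij.1 (by
        rw [map_zero]
        exact (Algebra.H1Cotangent.exact_δ_mapBaseChange R (MvPolynomial ι R) A _).mpr ⟨y, rfl⟩)
      obtain ⟨z, rfl⟩ := (Algebra.H1Cotangent.exact_map_δ R (MvPolynomial ι R) A y).mp h0
      rw [Subsingleton.elim z 0, map_zero]
    rw [key y, key z]
  have : Algebra.FormallyEtale (MvPolynomial ι R) A := ⟨h1, h2⟩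
  have : Algebra.FinitePresentation (MvPolynomial ι R) A :=
    Algebra.FinitePresentation.of_restrict_scalars_finitePresentation R _ _
  exact ⟨inferInstance, inferInstance⟩

theorem exists_coordinates (R A : Type u) [CommRing R] [CommRing A] [Algebra R A]
    [Algebra.IsStandardSmooth R A] :
    ∃ (n : ℕ) (x : Fin n → A) (D : Fin n → Derivation R A A),
      (∀ i j, D i (x j) = if i = j then 1 else 0) ∧
      (MvPolynomial.eval₂Hom (algebraMap R A) x).Etale := by
  classical
  obtain ⟨h1, ι, b, hb⟩ :=
    Algebra.IsStandardSmooth.iff_exists_basis_kaehlerDifferential.mp ‹Algebra.IsStandardSmooth R A›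
  -- The index set of a basis is forced to be finite only over a nontrivial ring; over the zero ring
  -- the empty basis serves.
  obtain ⟨n, b, hb⟩ : ∃ (n : ℕ) (b : Module.Basis (Fin n) A (Ω[A⁄R])),
      Set.range b ⊆ Set.range (KaehlerDifferential.D R A) := by
    rcases subsingleton_or_nontrivial A with hA | hA
    · have : Subsingleton (Ω[A⁄R]) := Module.subsingleton A _
      exact ⟨0, Module.Basis.empty _, by rintro _ ⟨i, -⟩; exact i.elim0⟩
    · have : Finite ι := Module.Finite.finite_basis b
      let e := Finite.equivFin ι
      exact ⟨Nat.card ι, b.reindex e, by rwa [Module.Basis.range_reindex]⟩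
  choose x hx using fun i => hb ⟨i, rfl⟩
  -- The derivations are the coordinate functions of the basis `dx_i` composed with the universal
  -- derivation.
  refine ⟨n, x, fun i => (b.coord i).compDer (KaehlerDifferential.D R A), fun i j => ?_,
    etale_of_basis_kaehlerDifferential b x fun i => (hx i).symm⟩
  simp [hx, Finsupp.single_apply, eq_comm]

lemma mvPolynomial_exists_sum_expand (p : ℕ) [Fact p.Prime] (R : Type*) [CommRing R] (n : ℕ)
    (q : MvPolynomial (Fin n) R) : ∃ c : (Fin n → Fin p) → MvPolynomial (Fin n) R,
      q = ∑ I, monom (MvPolynomial.X (R := R)) I * MvPolynomial.expand p (c I) := by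
  classical
  have hp : 0 < p := (Fact.out : p.Prime).pos
  induction q using MvPolynomial.induction_on' with
  | monomial d r =>
    -- Division of the exponents by `p`: the remainder goes into the monomial, the quotient into the
    -- argument of `expand`.
    let J : Fin n → Fin p := fun i => ⟨d i % p, Nat.mod_lt _ hp⟩
    let e : Fin n →₀ ℕ := Finsupp.equivFunOnFinite.symm fun i => d i / p
    refine ⟨Pi.single J (MvPolynomial.monomial e r), ?_⟩
    rw [Finset.sum_eq_single J (fun I _ h => by simp [h]) (by simp), Pi.single_eq_same,
      MvPolynomial.expand_monomial, monom]
    have : ∏ i, (MvPolynomial.X (R := R) i : MvPolynomial (Fin n) R) ^ (J i : ℕ) =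
        MvPolynomial.monomial (Finsupp.equivFunOnFinite.symm fun i => d i % p) 1 := by
      rw [MvPolynomial.monomial_eq, map_one, one_mul, Finsupp.prod_fintype _ _ (by simp)]
      rfl
    rw [this, MvPolynomial.monomial_mul, one_mul]
    refine congrArg (fun e => MvPolynomial.monomial e r) (Finsupp.ext fun i => ?_)
    simpa [e, mul_comm] using (Nat.mod_add_div (d i) p).symm
  | add q q' hq hq' =>
    obtain ⟨c, rfl⟩ := hq
    obtain ⟨c', rfl⟩ := hq'
    exact ⟨c + c', by simp [mul_add, Finset.sum_add_distrib]⟩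

lemma isPushout_mvPolynomial_map {R R' : CommRingCat.{u}} (f : R ⟶ R') (σ : Type) :
    IsPushout f (CommRingCat.ofHom MvPolynomial.C) (CommRingCat.ofHom MvPolynomial.C)
      (CommRingCat.ofHom (MvPolynomial.map (σ := σ) f.hom)) := by
  let _ : Algebra R R' := f.hom.toAlgebra
  let _ := MvPolynomial.algebraMvPolynomial (R := R) (S := R') (σ := σ)
  exact CommRingCat.isPushout_iff_isPushout (R := R) (R' := R') (S := MvPolynomial σ R)
    (S' := MvPolynomial σ R').mpr inferInstance

variable (p : ℕ) [Fact p.Prime]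

open MvPolynomial in
/-- The relative Frobenius of an algebra étale over a polynomial ring. -/
theorem relativeFrobenius_of_etale {k A A' : CommRingCat.{u}} (hk : (p : k) = 0)
    (hA : (p : A) = 0) {j : k ⟶ A} {t : k ⟶ A'} {r : A ⟶ A'}
    (H : IsPushout (frobHom p k hk) j t r) {φ : A' ⟶ A} (hr : r ≫ φ = frobHom p A hA)
    (ht : t ≫ φ = j) {n : ℕ} (x : Fin n → A) (hx : (eval₂Hom j.hom x).Etale) :
    Function.Injective φ ∧
      ∀ a, ∃ c : (Fin n → Fin p) → A', a = ∑ I, monom x I * φ (c I) := by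
  let P : CommRingCat.{u} := .of (MvPolynomial (Fin n) k)
  let c₀ : k ⟶ P := CommRingCat.ofHom C
  let f : P ⟶ A := CommRingCat.ofHom (eval₂Hom j.hom x)
  -- The Frobenius of the polynomial ring factors as `m`, Frobenius on coefficients, followed by
  -- `ex`, the relative Frobenius `X_i ↦ X_i^p`.
  let m : P ⟶ P := CommRingCat.ofHom (MvPolynomial.map (powHom p hk))
  let ex : P ⟶ P := CommRingCat.ofHom (expand p).toRingHom
  have hP : (p : P) = 0 := by rw [← map_natCast c₀.hom, hk, map_zero]
  have hcf : c₀ ≫ f = j := by ext a; exact eval₂Hom_C _ _ a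
  have hce : c₀ ≫ ex = c₀ := by exact CommRingCat.hom_ext (RingHom.ext fun a => expand_C _ a)
  have hme : m ≫ ex = frobHom p P hP := by
    refine CommRingCat.hom_ext (MvPolynomial.ringHom_ext (fun a => ?_) fun i => ?_)
    · change expand p (MvPolynomial.map (powHom p hk) (C a)) = (C a) ^ p
      rw [map_C, expand_C, ← map_pow]; rfl
    · change expand p (MvPolynomial.map (powHom p hk) (X i)) = (X i) ^ p
      rw [map_X, expand_X]
  have h1 : IsPushout (frobHom p k hk) c₀ c₀ m := by
    exact isPushout_mvPolynomial_map (frobHom p k hk) (Fin n)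
  rw [← hcf] at H
  let f' : P ⟶ A' := h1.desc t (f ≫ r) (by rw [H.w, Category.assoc])
  have hf'1 : c₀ ≫ f' = t := h1.inl_desc _ _ _
  have hf'2 : m ≫ f' = f ≫ r := h1.inr_desc _ _ _
  have h2 : IsPushout m f f' r := by
    rw [← hf'1] at H
    exact H.of_top hf'2 h1
  have hfφ : ex ≫ f = f' ≫ φ := by
    apply h1.hom_ext
    · rw [reassoc_of% hf'1, ht, reassoc_of% hce, hcf]
    · rw [reassoc_of% hf'2, hr, reassoc_of% hme, frobHom_comp]
  -- Cancellation of pushout squares: the outer square is the Frobenius square of the étale map `f`,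
  -- the left one is `h2`. It exhibits `φ` as a base change of the relative Frobenius of affine
  -- space, for which injectivity and generation are explicit.
  have h3 : IsPushout ex f' f φ := by
    refine IsPushout.of_left (h₁₁ := m) (v₁₁ := f) (h₂₁ := r) ?_ hfφ h2
    have := isPushout_frobHom_of_etale p f hx hP hA
    rw [← hme, ← hr] at this
    exact this
  refine ⟨injective_of_isPushout h3 (flat_of_isPushout h2 ?_) ?_, fun a => ?_⟩
  · algebraize [f.hom]
    exact Algebra.Smooth.flat P A
  · exact expand_injective (Fact.out : p.Prime).pos
  · obtain ⟨c, hc⟩ := exists_sum_of_isPushout h3 (fun I => monom (X (R := k)) I)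
      (fun q => mvPolynomial_exists_sum_expand p k n q) a
    refine ⟨c, hc.trans (Finset.sum_congr rfl fun I _ => ?_)⟩
    congr 1
    change f.hom (monom _ I) = _
    rw [map_monom]
    congr 1
    ext i
    exact eval₂Hom_X' _ _ i

end Coordinates


/-! ### Gluing sections of sheaves -/

section Gluing

open TopologicalSpace

/-- Sections which exist locally and are locally unique glue. -/
lemma exists_glue {T : TopCat.{u}} (F : T.Presheaf (Type u)) (hF : F.IsSheaf) (U : Opens T)
    (P : ∀ W : Opens T, W ≤ U → F.obj (op W) → Prop)
    (res : ∀ (W W' : Opens T) (h : W ≤ U) (i : W' ≤ W) (a : F.obj (op W)), P W h a →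
      P W' (i.trans h) (F.map (homOfLE i).op a))
    (uniq : ∀ (W : Opens T) (h : W ≤ U) (a b : F.obj (op W)), P W h a → P W h b → a = b)
    (loc : ∀ y ∈ U, ∃ (W : Opens T) (h : W ≤ U), y ∈ W ∧ ∃ a, P W h a) :
    ∃ a : F.obj (op U), ∀ y ∈ U, ∃ (W : Opens T) (h : W ≤ U), y ∈ W ∧
      P W h (F.map (homOfLE h).op a) := by
  choose W h hy a ha using loc
  obtain ⟨s, hs, -⟩ := TopCat.Sheaf.existsUnique_gluing' (C := Type u) ⟨F, hF⟩
    (fun y : U => W y y.2) U (fun y => homOfLE (h y y.2))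
    (fun y hy' => Opens.mem_iSup.mpr ⟨⟨y, hy'⟩, hy y hy'⟩) (fun y => a y y.2) (by
      intro y z
      refine uniq (W y y.2 ⊓ W z z.2) (inf_le_left.trans (h y y.2)) _ _ ?_ ?_
      · exact res _ _ (h y y.2) inf_le_left _ (ha y y.2)
      · exact res _ _ (h z z.2) inf_le_right _ (ha z z.2))
  exact ⟨s, fun y hy' => ⟨W y hy', h y hy', hy y hy', by
    have := hs ⟨y, hy'⟩
    exact (show F.map (homOfLE (h y hy')).op s = a y hy' from this) ▸ ha y hy'⟩⟩

lemma eq_of_locally {T : TopCat.{u}} (F : T.Presheaf (Type u)) (hF : F.IsSheaf) {U : Opens T}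
    (a b : F.obj (op U)) (h : ∀ y ∈ U, ∃ (W : Opens T) (h : W ≤ U), y ∈ W ∧
      F.map (homOfLE h).op a = F.map (homOfLE h).op b) : a = b := by
  choose W h hy e using h
  exact TopCat.Sheaf.eq_of_locally_eq' (C := Type u) ⟨F, hF⟩ (fun y : U => W y y.2) U
    (fun y => homOfLE (h y y.2)) (fun y hy' => Opens.mem_iSup.mpr ⟨⟨y, hy'⟩, hy y hy'⟩) a b
    fun y => e y y.2

variable {X : Scheme.{u}} {U : X.Opens}

lemma isSheaf_forget (X : Scheme.{u}) :
    TopCat.Presheaf.IsSheaf (X.presheaf ⋙ forget CommRingCat) :=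
  (TopCat.Presheaf.isSheaf_iff_isSheaf_comp' (forget CommRingCat) X.presheaf).mp X.sheaf.2

lemma sections_ext (a b : Γ(X, U)) (h : ∀ y ∈ U, ∃ (W : X.Opens) (h : W ≤ U), y ∈ W ∧
    X.presheaf.map (homOfLE h).op a = X.presheaf.map (homOfLE h).op b) : a = b :=
  eq_of_locally _ (isSheaf_forget X) a b h

lemma exists_section (P : ∀ W : X.Opens, W ≤ U → Γ(X, W) → Prop)
    (res : ∀ (W W' : X.Opens) (h : W ≤ U) (i : W' ≤ W) (a : Γ(X, W)), P W h a →
      P W' (i.trans h) (X.presheaf.map (homOfLE i).op a))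
    (uniq : ∀ (W : X.Opens) (h : W ≤ U) (a b : Γ(X, W)), P W h a → P W h b → a = b)
    (loc : ∀ y ∈ U, ∃ (W : X.Opens) (h : W ≤ U), y ∈ W ∧ ∃ a, P W h a) :
    ∃ a : Γ(X, U), ∀ y ∈ U, ∃ (W : X.Opens) (h : W ≤ U), y ∈ W ∧
      P W h (X.presheaf.map (homOfLE h).op a) :=
  exists_glue _ (isSheaf_forget X) U P res uniq loc

lemma res_res {W W' : X.Opens} (h : W ≤ U) (i : W' ≤ W) (a : Γ(X, U)) :
    X.presheaf.map (homOfLE i).op (X.presheaf.map (homOfLE h).op a) =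
      X.presheaf.map (homOfLE (i.trans h)).op a := by
  rw [← CommRingCat.comp_apply, ← Functor.map_comp]
  rfl

@[simp]
lemma res_self (h : U ≤ U) (a : Γ(X, U)) : X.presheaf.map (homOfLE h).op a = a := by
  change X.presheaf.map (𝟙 _) a = a
  simp

lemma exists_affine_le {y : X} (hy : y ∈ U) : ∃ W : X.Opens, IsAffineOpen W ∧ y ∈ W ∧ W ≤ U := by
  obtain ⟨_, ⟨W, hW, rfl⟩, hyW, hWU⟩ := X.isBasis_affineOpens.exists_subset_of_mem_open hy U.2
  exact ⟨W, hW, hyW, hWU⟩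

lemma appLE_res {X Y : Scheme.{u}} (f : X ⟶ Y) {U : Y.Opens} {V V' : X.Opens} (e : V ≤ f ⁻¹ᵁ U)
    (i : V' ≤ V) (a : Γ(Y, U)) :
    X.presheaf.map (homOfLE i).op (f.appLE U V e a) = f.appLE U V' (i.trans e) a := by
  rw [← CommRingCat.comp_apply, Scheme.Hom.appLE_map]

lemma res_appLE {X Y : Scheme.{u}} (f : X ⟶ Y) {U U' : Y.Opens} {V : X.Opens} (e : V ≤ f ⁻¹ᵁ U)
    (i : U ≤ U') (a : Γ(Y, U')) :
    f.appLE U V e (Y.presheaf.map (homOfLE i).op a) =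
      f.appLE U' V (e.trans (f.preimage_mono i)) a := by
  rw [← CommRingCat.comp_apply, Scheme.Hom.map_appLE]

lemma app_res {X Y : Scheme.{u}} (f : X ⟶ Y) {U U' : Y.Opens} (i : U' ≤ U) (a : Γ(Y, U)) :
    f.app U' (Y.presheaf.map (homOfLE i).op a) =
      X.presheaf.map (homOfLE (f.preimage_mono i)).op (f.app U a) := by
  rw [← CommRingCat.comp_apply, f.naturality]
  rfl

lemma appLE_appLE {X Y Z : Scheme.{u}} {f : X ⟶ Y} {g : Y ⟶ Z} {h : X ⟶ Z} (w : f ≫ g = h)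
    {U : Z.Opens} {V : Y.Opens} {W : X.Opens} (e₁ : V ≤ g ⁻¹ᵁ U) (e₂ : W ≤ f ⁻¹ᵁ V)
    (e₃ : W ≤ h ⁻¹ᵁ U) (a : Γ(Z, U)) :
    f.appLE V W e₂ (g.appLE U V e₁ a) = h.appLE U W e₃ a := by
  subst w
  rw [← CommRingCat.comp_apply, Scheme.Hom.appLE_comp_appLE]

lemma appLE_app {X Y Z : Scheme.{u}} {f : X ⟶ Y} {g : Y ⟶ Z} {h : X ⟶ Z} (w : f ≫ g = h)
    {U : Z.Opens} {W : X.Opens} (e₂ : W ≤ f ⁻¹ᵁ g ⁻¹ᵁ U) (e₃ : W ≤ h ⁻¹ᵁ U) (a : Γ(Z, U)) :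
    f.appLE (g ⁻¹ᵁ U) W e₂ (g.app U a) = h.appLE U W e₃ a := by
  subst w
  rw [← CommRingCat.comp_apply, Scheme.Hom.app_eq_appLE, Scheme.Hom.appLE_comp_appLE]

lemma appLE_const {k : Type u} [CommRing k] {X Y : Scheme.{u}} {f : X ⟶ Y} {y : Y ⟶ Spec (.of k)}
    {x : X ⟶ Spec (.of k)} (w : f ≫ y = x) {U : Y.Opens} {W : X.Opens} (e : W ≤ f ⁻¹ᵁ U) (c : k) :
    f.appLE U W e (const y U c) = const x W c :=
  appLE_appLE w (U := ⊤) (V := U) (W := W) le_top e le_top ((Scheme.ΓSpecIso (.of k)).inv c)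

end Gluing

/-! ### Homeomorphisms of schemes which are bijective up to `p`-th powers -/

section Homeomorphisms

/-- An injective ring map whose image contains all `p`-th powers induces a homeomorphism of spectra.
-/
lemma isHomeomorph_of_affine {X Y : Scheme.{u}} [IsAffine X] [IsAffine Y] (q : X ⟶ Y) {p : ℕ}
    (hp : 0 < p) (hi : Function.Injective q.appTop) (h : ∀ a, ∃ b, a ^ p = q.appTop b) :
    IsHomeomorph q := by
  have h1 : IsHomeomorph (Spec.map q.appTop) := by
    refine PrimeSpectrum.isHomeomorph_comap q.appTop.hom (fun a => ⟨p, hp, ?_⟩) ?_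
    · obtain ⟨b, hb⟩ := h a
      exact ⟨b, hb.symm⟩
    · rw [(RingHom.injective_iff_ker_eq_bot _).mp hi]
      exact bot_le
  have h2 : q = X.isoSpec.hom ≫ Spec.map q.appTop ≫ Y.isoSpec.inv := by
    rw [← Category.assoc, Scheme.isoSpec_hom_naturality, Category.assoc, Iso.hom_inv_id,
      Category.comp_id]
  have h3 : ⇑q = Y.isoSpec.inv ∘ Spec.map q.appTop ∘ X.isoSpec.hom := by
    conv_lhs => rw [h2]
    rfl
  rw [h3]
  exact (Scheme.homeoOfIso Y.isoSpec.symm).isHomeomorph.comp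
    (h1.comp (Scheme.homeoOfIso X.isoSpec).isHomeomorph)

/-- A morphism is a homeomorphism if locally on affines of the target it is affine, injective
on functions, and its image on functions contains the `p`-th powers. -/
lemma isHomeomorph_of_pow {X Y : Scheme.{u}} (q : X ⟶ Y) {p : ℕ} (hp : 0 < p)
    (h : ∀ y : Y, ∃ W : Y.Opens, y ∈ W ∧ IsAffineOpen W ∧ IsAffineOpen (q ⁻¹ᵁ W) ∧
      Function.Injective (q.app W) ∧ ∀ a, ∃ b, a ^ p = q.app W b) : IsHomeomorph q := by
  choose W hy hW hqW hi hpow using h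
  have hc : TopologicalSpace.IsOpenCover W :=
    top_le_iff.mp fun y _ => TopologicalSpace.Opens.mem_iSup.mpr ⟨y, hy y⟩
  rw [hc.isHomeomorph_iff_restrictPreimage q.continuous]
  intro y
  rw [← morphismRestrict_base]
  have : IsAffine (W y).toScheme := hW y
  have : IsAffine (q ⁻¹ᵁ (W y)).toScheme := hqW y
  have key : ∀ W' : Y.Opens, W' = W y → Function.Injective (q.app W') ∧
      ∀ a, ∃ b, a ^ p = q.app W' b := by
    rintro _ rfl
    exact ⟨hi y, hpow y⟩
  obtain ⟨h1, h2⟩ := key ((W y).ι ''ᵁ ⊤) (by simp)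
  have h3 := ConcreteCategory.bijective_of_isIso
    (X.presheaf.map (eqToHom (image_morphismRestrict_preimage q (W y) ⊤)).op)
  refine isHomeomorph_of_affine (q ∣_ (W y)) hp ?_ fun a => ?_
  · rw [morphismRestrict_appTop]
    exact h3.1.comp h1
  · obtain ⟨a', rfl⟩ := h3.2 a
    obtain ⟨b, hb⟩ := h2 a'
    refine ⟨b, ?_⟩
    rw [morphismRestrict_appTop]
    exact (map_pow (X.presheaf.map
      (eqToHom (image_morphismRestrict_preimage q (W y) ⊤)).op).hom a' p).symm.trans
      (congrArg _ hb)

end Homeomorphisms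

/-! ### Affine pullback squares -/

section Pullbacks

lemma isPushout_of_isPullback {X Y S T : Scheme.{u}} {f : T ⟶ S} {g : Y ⟶ X} {iX : X ⟶ S}
    {iY : Y ⟶ T} (H : IsPullback g iY iX f) {US : S.Opens} {UT : T.Opens} {UX : X.Opens}
    (hUST : UT ≤ f ⁻¹ᵁ US) (hUSX : UX ≤ iX ⁻¹ᵁ US) {UY : Y.Opens}
    (hUY : UY = g ⁻¹ᵁ UX ⊓ iY ⁻¹ᵁ UT) (hUS : IsAffineOpen US) (hUT : IsAffineOpen UT)
    (hUX : IsAffineOpen UX) :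
    IsPushout (iX.appLE US UX hUSX) (f.appLE US UT hUST)
      (g.appLE UX UY (by simp [*])) (iY.appLE UT UY (by simp [*])) :=
  (isIso_pushoutSection_iff H hUST hUSX hUY).mp
    (isIso_pushoutSection_of_isAffineOpen H hUST hUSX hUY hUS hUT hUX)

lemma isAffineOpen_of_isPullback {X Y S T : Scheme.{u}} {f : T ⟶ S} {g : Y ⟶ X} {iX : X ⟶ S}
    {iY : Y ⟶ T} (H : IsPullback g iY iX f) {US : S.Opens} {UT : T.Opens} {UX : X.Opens}
    (hUST : UT ≤ f ⁻¹ᵁ US) (hUSX : UX ≤ iX ⁻¹ᵁ US) {UY : Y.Opens}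
    (hUY : UY = g ⁻¹ᵁ UX ⊓ iY ⁻¹ᵁ UT) (hUS : IsAffineOpen US) (hUT : IsAffineOpen UT)
    (hUX : IsAffineOpen UX) : IsAffineOpen UY := by
  have : IsAffine _ := hUS
  have : IsAffine _ := hUT
  have : IsAffine _ := hUX
  exact .of_isIso (Scheme.Hom.isPullback_resLE H hUST hUSX hUY).isoPullback.hom

end Pullbacks

/-! ### The relative Frobenius -/

section Frobenius

variable {k : Type u} [CommRing k] (p : ℕ) [Fact p.Prime] [CharP k p] {S : Scheme.{u}}
  (s : S ⟶ Spec (.of k))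

/-- The projection `S' ⟶ S`. -/
noncomputable def frobTwistFst : frobTwist p s ⟶ S :=
  pullback.fst s (Spec.map (CommRingCat.ofHom (frobenius k p)))

lemma relFrob_fst : relFrob p s ≫ frobTwistFst p s = absFrob p s := pullback.lift_fst _ _ _

lemma relFrob_str : relFrob p s ≫ frobTwistStr p s = s := pullback.lift_snd _ _ _

instance : IsAffineHom (frobTwistFst p s) :=
  MorphismProperty.of_isPullback (P := @IsAffineHom)
    (IsPullback.of_hasPullback s (Spec.map (CommRingCat.ofHom (frobenius k p)))).flip
    inferInstance

/-- The open set `V' = V ×_{k,σ} k` of `S'`. -/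
noncomputable abbrev twist (V : S.Opens) : (frobTwist p s).Opens := frobTwistFst p s ⁻¹ᵁ V

lemma relFrob_preimage_twist (V : S.Opens) : relFrob p s ⁻¹ᵁ twist p s V = V := by
  rw [twist, ← Scheme.Hom.comp_preimage, relFrob_fst]
  rfl

lemma isAffineOpen_twist {V : S.Opens} (hV : IsAffineOpen V) : IsAffineOpen (twist p s V) :=
  hV.preimage (frobTwistFst p s)

lemma le_relFrob_preimage_twist (V : S.Opens) : V ≤ relFrob p s ⁻¹ᵁ twist p s V :=
  (relFrob_preimage_twist p s V).ge

/-- The map `𝒪_{S'}(V') → 𝒪_S(V)`. -/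
noncomputable def frobSection (V : S.Opens) : Γ(frobTwist p s, twist p s V) ⟶ Γ(S, V) :=
  (relFrob p s).appLE (twist p s V) V (le_relFrob_preimage_twist p s V)

lemma frobSection_fst (V : S.Opens) (a : Γ(S, V)) :
    frobSection p s V ((frobTwistFst p s).app V a) = a ^ p := by
  have h2 : ∀ (g : S ⟶ S) (e : V ≤ g ⁻¹ᵁ V), g = absFrob p s → g.appLE V V e a = a ^ p := by
    rintro _ e rfl
    exact res_self (X := S) _ _
  exact (appLE_app rfl _ (relFrob_fst p s ▸ le_rfl) a).trans (h2 _ _ (relFrob_fst p s))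

lemma frobSection_const (V : S.Opens) (c : k) :
    frobSection p s V (const (frobTwistStr p s) (twist p s V) c) = const s V c :=
  appLE_const (relFrob_str p s) _ c

lemma isPushout_twist {V : S.Opens} (hV : IsAffineOpen V) :
    IsPushout (frobHom p (.of k) (CharP.cast_eq_zero k p)) (CommRingCat.ofHom (const s V))
      (CommRingCat.ofHom (const (frobTwistStr p s) (twist p s V)))
      ((frobTwistFst p s).app V) := by
  have H : IsPushout (s.appLE ⊤ V le_top)
      ((Spec.map (CommRingCat.ofHom (frobenius k p))).appLE ⊤ ⊤ le_top)
      ((frobTwistFst p s).appLE V (twist p s V) le_rfl)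
      ((frobTwistStr p s).appLE ⊤ (twist p s V) le_top) :=
    isPushout_of_isPullback
      (IsPullback.of_hasPullback s (Spec.map (CommRingCat.ofHom (frobenius k p))))
      (US := ⊤) (UT := ⊤) (UX := V) (UY := twist p s V) le_top le_top (by simp; rfl)
      (isAffineOpen_top _) (isAffineOpen_top _) hV
  have h1 : (Spec.map (CommRingCat.ofHom (frobenius k p))).appLE ⊤ ⊤ le_top =
      (Spec.map (CommRingCat.ofHom (frobenius k p))).appTop := Scheme.Hom.appLE_eq_app _
  rw [h1] at H
  refine IsPushout.of_iso H.flip (Scheme.ΓSpecIso (.of k)) (Scheme.ΓSpecIso (.of k)) (Iso.refl _)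
    (Iso.refl _) ?_ ?_ ?_ ?_
  · exact Scheme.ΓSpecIso_naturality (CommRingCat.ofHom (frobenius k p))
  · exact (Category.comp_id _).trans
      (Iso.hom_inv_id_assoc (Scheme.ΓSpecIso (.of k)) (s.appLE ⊤ V le_top)).symm
  · exact (Category.comp_id _).trans (Iso.hom_inv_id_assoc (Scheme.ΓSpecIso (.of k))
      ((frobTwistStr p s).appLE ⊤ (twist p s V) le_top)).symm
  · exact (Category.comp_id _).trans ((Scheme.Hom.appLE_eq_app (frobTwistFst p s)).trans
      (Category.id_comp _).symm)

/-! ### Charts -/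

/-- An affine open of the smooth `k`-scheme `S` with coordinates `x_i` and the dual derivations. -/
structure Coordinates (V : S.Opens) where
  affine : IsAffineOpen V
  /-- the number of coordinates -/
  n : ℕ
  /-- the coordinates -/
  x : Fin n → Γ(S, V)
  /-- the coordinate derivations -/
  der : Fin n → Derivation ℤ Γ(S, V) Γ(S, V)
  der_const : ∀ i c, der i (const s V c) = 0
  der_x : ∀ i j, der i (x j) = if i = j then 1 else 0
  injective : Function.Injective (frobSection p s V)
  exists_sum : ∀ a, ∃ c : (Fin n → Fin p) → Γ(frobTwist p s, twist p s V),
    a = ∑ I, monom x I * frobSection p s V (c I)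

/-- A smooth map is locally standard smooth, and a standard smooth algebra has étale coordinates;
`relativeFrobenius_of_etale` then describes the relative Frobenius on such a chart. -/
theorem exists_coordinates_nhds [Smooth s] {y : S} {U : S.Opens} (hy : y ∈ U) :
    ∃ V ≤ U, y ∈ V ∧ Nonempty (Coordinates p s V) := by
  obtain ⟨W, hW, hyW, hWU⟩ := exists_affine_le hy
  have h1 := s.smooth_appLE (isAffineOpen_top _) hW (le_top)
  have h2 : (const s W).Smooth := by
    have := RingHom.Smooth.respectsIso.cancel_left_isIso (Scheme.ΓSpecIso (.of k)).inv
      (s.appLE ⊤ W le_top)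
    exact this.mpr h1
  obtain ⟨t, ht, hst⟩ := RingHom.smooth_iff_locally_isStandardSmooth.mp h2
  obtain ⟨f, hf, hyf⟩ : ∃ f ∈ t, y ∈ S.basicOpen f := by
    have := hW.self_le_iSup_basicOpen_iff.mpr ht hyW
    obtain ⟨⟨f, hf⟩, hyf⟩ := TopologicalSpace.Opens.mem_iSup.mp this
    exact ⟨f, hf, hyf⟩
  have hV := hW.basicOpen f
  refine ⟨S.basicOpen f, (S.basicOpen_le f).trans hWU, hyf, ?_⟩
  have h3 : (const s (S.basicOpen f)).IsStandardSmooth := by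
    have h4 := hst f hf
    -- The criterion speaks of `Localization.Away f`, which is identified here with the sections
    -- over the basic open set.
    let _ : Algebra Γ(S, W) Γ(S, S.basicOpen f) :=
      (S.presheaf.map (homOfLE (S.basicOpen_le f)).op).hom.toAlgebra
    have : IsLocalization.Away f Γ(S, S.basicOpen f) := hW.isLocalization_basicOpen f
    let e := IsLocalization.algEquiv (Submonoid.powers f) (Localization.Away f)
      Γ(S, S.basicOpen f)
    have h5 := RingHom.isStandardSmooth_respectsIso.1 _ e.toRingEquiv h4
    convert h5 using 1
    ext c
    change const s (S.basicOpen f) c = e (algebraMap _ _ (const s W c))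
    rw [e.commutes]
    exact (res_const s (S.basicOpen_le f) c).symm
  algebraize [const s (S.basicOpen f)]
  obtain ⟨n, x, D, hD, hx⟩ := exists_coordinates k Γ(S, S.basicOpen f)
  obtain ⟨hi, hs⟩ := relativeFrobenius_of_etale p (CharP.cast_eq_zero k p)
    (natCast_eq_zero s p (S.basicOpen f)) (isPushout_twist p s hV)
    (φ := frobSection p s (S.basicOpen f))
    (by ext a; exact frobSection_fst p s _ a) (by ext c; exact frobSection_const p s _ c) x hx
  exact ⟨⟨hV, n, x, fun i => (D i).restrictScalars ℤ, fun i c => (D i).map_algebraMap c, hD, hi,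
    hs⟩⟩

end Frobenius


/-! ### Constants of derivations, and monomial bases -/

section Constants

/-- The subring of elements killed by a derivation. -/
def derConst {A : Type*} [CommRing A] (D : Derivation ℤ A A) : Subring A where
  carrier := {a | D a = 0}
  mul_mem' {a b} ha hb := by
    rw [Set.mem_ofPred_eq] at *
    simp [ha, hb]
  one_mem' := D.map_one_eq_zero
  add_mem' {a b} ha hb := by
    rw [Set.mem_ofPred_eq] at *
    simp [ha, hb]
  zero_mem' := map_zero D
  neg_mem' {a} ha := by
    rw [Set.mem_ofPred_eq] at *
    simp [ha]

lemma monom_mem {A : Type*} [CommRing A] {R : Subring A} {n p : ℕ} {x : Fin n → A}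
    (hx : ∀ i, x i ∈ R) (I : Fin n → Fin p) : monom x I ∈ R :=
  R.prod_mem fun i _ => R.pow_mem (hx i) _

lemma derivation_pow_p {A : Type*} [CommRing A] (D : Derivation ℤ A A) {p : ℕ} (hp : (p : A) = 0)
    (a : A) : D (a ^ p) = 0 := by
  rw [D.leibniz_pow, ← Nat.cast_smul_eq_nsmul A, hp, zero_smul]

lemma iterate_eq_zero_of_two_le {A : Type*} [CommRing A] {D : Derivation ℤ A A} {n : ℕ}
    (hn : 2 ≤ n) {a : A} (h : D (D a) = 0) : D^[n] a = 0 := by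
  obtain ⟨r, rfl⟩ := Nat.exists_eq_add_of_le' hn
  rw [Function.iterate_add_apply]
  exact (congrArg _ h).trans (Function.iterate_fixed (map_zero D) r)

end Constants

section Coordinates

variable {k : Type u} [CommRing k] {p : ℕ} [Fact p.Prime] [CharP k p] {S : Scheme.{u}}
  {s : S ⟶ Spec (.of k)}

/-- The ring `𝒪_{S'}(V')` is generated by constants and by functions pulled back from `S`. The
former map to constants and the latter to `p`-th powers in `𝒪_S(V)`, and `D` kills both. -/
lemma derivation_frobSection {V : S.Opens} (hV : IsAffineOpen V) (D : Derivation ℤ Γ(S, V) Γ(S, V))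
    (hD : ∀ c, D (const s V c) = 0) (c : Γ(frobTwist p s, twist p s V)) :
    D (frobSection p s V c) = 0 := by
  have h := CommRingCat.closure_range_union_range_eq_top_of_isPushout (isPushout_twist p s hV)
  have h2 : Subring.closure (Set.range (CommRingCat.ofHom (const (frobTwistStr p s) (twist p s V)))
      ∪ Set.range ((frobTwistFst p s).app V)) ≤
      (derConst D).comap (frobSection p s V).hom := by
    rw [Subring.closure_le]
    rintro _ (⟨c, rfl⟩ | ⟨a, rfl⟩)
    · exact (congrArg D (frobSection_const p s V c)).trans (hD c)
    · exact (congrArg D (frobSection_fst p s V a)).trans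
        (derivation_pow_p D (natCast_eq_zero s p V) a)
  exact h2 (h ▸ Subring.mem_top c)

namespace Coordinates

variable {V : S.Opens} (C : Coordinates p s V)

-- Functions are sums of monomials times functions of `S'`, and the latter are always killed.
-- Applied to `[∂_i, ∂_j]` and to the derivation `∂_i^p`, this gives the two relations that follow.
include C in
lemma der_eq_zero {D : Derivation ℤ Γ(S, V) Γ(S, V)} (hD : ∀ c, D (const s V c) = 0)
    (hx : ∀ i, D (C.x i) = 0) : D = 0 := by
  ext a
  obtain ⟨c, rfl⟩ := C.exists_sum a
  exact (derConst D).sum_mem fun I _ => (derConst D).mul_mem (monom_mem hx I)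
    (derivation_frobSection C.affine D hD (c I))

lemma der_comm (i j : Fin C.n) (a : Γ(S, V)) :
    C.der i (C.der j a) = C.der j (C.der i a) := by
  have h := C.der_eq_zero (D := ⁅C.der i, C.der j⁆)
    (by simp [Derivation.commutator_apply, C.der_const])
    (fun l => by
      rw [Derivation.commutator_apply, C.der_x, C.der_x]
      split_ifs <;> simp)
  exact sub_eq_zero.mp ((Derivation.commutator_apply a).symm.trans (congrArg (· a) h))

lemma der_iterate (i : Fin C.n) (a : Γ(S, V)) : (C.der i)^[p] a = 0 := by
  have hp : 2 ≤ p := (Fact.out : p.Prime).two_le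
  have h := C.der_eq_zero (D := derivPow p (natCast_eq_zero s p V) (C.der i))
    (fun c => iterate_eq_zero_of_two_le hp (by rw [C.der_const, map_zero]))
    (fun l => iterate_eq_zero_of_two_le hp (by rw [C.der_x]; split_ifs <;> simp))
  exact congrArg (· a) h

lemma weylModule : WeylModule p C.x (fun i => (C.der i).toLinearMap.toAddMonoidHom) where
  char := natCast_eq_zero s p V
  comm := C.der_comm
  leibniz i j m := by
    change C.der i (C.x j * m) = C.x j * C.der i m + _
    rw [Derivation.leibniz, C.der_x]
    split_ifs <;> simp
  iterate_eq_zero := C.der_iterate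

/-- Functions of `S'` are killed by all `∂_i`, so the uniqueness of coefficients over the Weyl
algebra applies; injectivity of Frobenius on sections brings it back to `S'`. -/
lemma existsUnique_sum (a : Γ(S, V)) :
    ∃! c : (Fin C.n → Fin p) → Γ(frobTwist p s, twist p s V),
      a = ∑ I, monom C.x I * frobSection p s V (c I) := by
  obtain ⟨c, hc⟩ := C.exists_sum a
  refine ⟨c, hc, fun c' hc' => ?_⟩
  have h := C.weylModule.eq_of_sum_eq_sum (n := fun I => frobSection p s V (c' I))
    (n' := fun I => frobSection p s V (c I))
    (fun I i => derivation_frobSection C.affine _ (C.der_const i) _)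
    (fun I i => derivation_frobSection C.affine _ (C.der_const i) _) (hc'.symm.trans hc)
  exact funext fun I => C.injective (congrFun h I)

end Coordinates

-- On a chart `F` is injective on functions, and the `p`-th power of a function of `S` is the image
-- of its pullback to `S'`.
variable (p s) in
theorem isHomeomorph_relFrob [Smooth s] : IsHomeomorph (relFrob p s) := by
  refine isHomeomorph_of_pow (relFrob p s) (Fact.out : p.Prime).pos fun y => ?_
  obtain ⟨V, -, hy, ⟨C⟩⟩ := exists_coordinates_nhds p s
    (show frobTwistFst p s y ∈ (⊤ : S.Opens) from trivial)
  -- The preimage of `V'` under `F` equals `V` only propositionally; `h` and `h1` move sections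
  -- across this equality.
  have h : ∀ V' (e : V' = V) (a : Γ(frobTwist p s, twist p s V)),
      frobSection p s V a = S.presheaf.map (eqToHom e.symm).op
        ((relFrob p s).appLE (twist p s V) V' (e ▸ le_relFrob_preimage_twist p s V') a) := by
    rintro _ rfl a
    simp [frobSection]
  have h1 : ∀ a, frobSection p s V a =
      S.presheaf.map (eqToHom (relFrob_preimage_twist p s V).symm).op
        ((relFrob p s).app (twist p s V) a) := fun a => by
    rw [h _ (relFrob_preimage_twist p s V), Scheme.Hom.app_eq_appLE]
  refine ⟨twist p s V, hy, isAffineOpen_twist p s C.affine, ?_, ?_, ?_⟩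
  · rw [relFrob_preimage_twist]; exact C.affine
  · intro a b hab
    apply C.injective
    rw [h1, h1, hab]
  · intro a
    refine ⟨(frobTwistFst p s).app V
      (S.presheaf.map (eqToHom (relFrob_preimage_twist p s V).symm).op a), ?_⟩
    apply (ConcreteCategory.bijective_of_isIso
      (S.presheaf.map (eqToHom (relFrob_preimage_twist p s V).symm).op)).1
    rw [← h1, frobSection_fst, map_pow]

section
variable [Smooth s]

/-- Open sets of `S` and `S'` correspond through the homeomorphism `F`; `twist` turns out to be the
inverse of taking preimages under `F`. -/
lemma relFrob_preimage_le_iff {U U' : (frobTwist p s).Opens} :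
    relFrob p s ⁻¹ᵁ U ≤ relFrob p s ⁻¹ᵁ U' ↔ U ≤ U' := by
  refine ⟨fun h y hy => ?_, fun h => Scheme.Hom.preimage_mono _ h⟩
  obtain ⟨z, rfl⟩ := (isHomeomorph_relFrob p s).surjective y
  exact h hy

lemma twist_le_iff {V : S.Opens} {U : (frobTwist p s).Opens} :
    twist p s V ≤ U ↔ V ≤ relFrob p s ⁻¹ᵁ U := by
  rw [← relFrob_preimage_le_iff, relFrob_preimage_twist]

lemma le_twist_iff {V : S.Opens} {U : (frobTwist p s).Opens} :
    U ≤ twist p s V ↔ relFrob p s ⁻¹ᵁ U ≤ V := by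
  rw [← relFrob_preimage_le_iff, relFrob_preimage_twist]

lemma twist_preimage (U : (frobTwist p s).Opens) : twist p s (relFrob p s ⁻¹ᵁ U) = U :=
  le_antisymm (twist_le_iff.mpr le_rfl) (le_twist_iff.mpr le_rfl)

/-- A vector field on `S` kills the functions pulled back from `S'`. -/
lemma VectorField.act_relFrob {U : S.Opens} (D : VectorField s U) {W : S.Opens} (h : W ≤ U)
    {W' : (frobTwist p s).Opens} (e : W ≤ relFrob p s ⁻¹ᵁ W') (c : Γ(frobTwist p s, W')) :
    D.act W h ((relFrob p s).appLE W' W e c) = 0 := by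
  refine sections_ext _ _ fun y hy => ?_
  obtain ⟨V, hV, hy, hVW⟩ := exists_affine_le hy
  refine ⟨V, hVW, hy, ?_⟩
  rw [← D.act_res _ _ h hVW, appLE_res, map_zero]
  have := derivation_frobSection hV (D.act V (hVW.trans h)) (D.act_const V _)
    ((frobTwist p s).presheaf.map (homOfLE (twist_le_iff.mpr (hVW.trans e))).op c)
  rwa [frobSection, res_appLE] at this

end

end Coordinates

/-! ### Monomial bases of sections -/

section MonomialBasis

variable {T Y S : Scheme.{u}}

/-- The sections of `𝒪_T` over `W` are free over those of `𝒪_Y` over `W'` (by means of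
`q : T ⟶ Y`) on the monomials of exponents `< p` in functions pulled back by `f : T ⟶ S`. -/
def MonomialBasis (p : ℕ) (f : T ⟶ S) (q : T ⟶ Y) {V : S.Opens} {n : ℕ} (x : Fin n → Γ(S, V))
    (W : T.Opens) (W' : Y.Opens) (h : W ≤ f ⁻¹ᵁ V) (h' : W ≤ q ⁻¹ᵁ W') : Prop :=
  ∀ a : Γ(T, W), ∃! c : (Fin n → Fin p) → Γ(Y, W'),
    a = ∑ I, f.appLE V W h (monom x I) * q.appLE W' W h' (c I)

variable {p : ℕ} {f : T ⟶ S} {q : T ⟶ Y} {V : S.Opens} {n : ℕ} {x : Fin n → Γ(S, V)}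

lemma res_monomial_sum {W W₁ : T.Opens} {W' W₁' : Y.Opens} (h : W ≤ f ⁻¹ᵁ V) (h' : W ≤ q ⁻¹ᵁ W')
    (h₁' : W₁ ≤ q ⁻¹ᵁ W₁') (i : W₁ ≤ W) (i' : W₁' ≤ W') {ι : Type*} [Fintype ι] (m : ι → Γ(S, V))
    (c : ι → Γ(Y, W')) :
    T.presheaf.map (homOfLE i).op (∑ I, f.appLE V W h (m I) * q.appLE W' W h' (c I)) =
      ∑ I, f.appLE V W₁ (i.trans h) (m I) * q.appLE W₁' W₁ h₁'
        (Y.presheaf.map (homOfLE i').op (c I)) := by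
  simp only [map_sum, map_mul, appLE_res, res_appLE]

/-- Monomial bases may be checked locally on `Y`. -/
lemma MonomialBasis.of_locally {W : Y.Opens} (h : q ⁻¹ᵁ W ≤ f ⁻¹ᵁ V)
    (H : ∀ y ∈ W, ∀ U : Y.Opens, y ∈ U → ∃ (W' : Y.Opens) (i : W' ≤ W), y ∈ W' ∧ W' ≤ U ∧
      MonomialBasis p f q x (q ⁻¹ᵁ W') W' ((q.preimage_mono i).trans h) le_rfl) :
    MonomialBasis p f q x (q ⁻¹ᵁ W) W h le_rfl := by
  -- Uniqueness of the coefficients is proved over every smaller open set, because it is what allows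
  -- local coefficients to be glued.
  have uniq : ∀ (W₁ : Y.Opens) (i : W₁ ≤ W) (c c' : (Fin n → Fin p) → Γ(Y, W₁)),
      ∑ I, f.appLE V (q ⁻¹ᵁ W₁) ((q.preimage_mono i).trans h) (monom x I) *
        q.appLE W₁ (q ⁻¹ᵁ W₁) le_rfl (c I) =
      ∑ I, f.appLE V (q ⁻¹ᵁ W₁) ((q.preimage_mono i).trans h) (monom x I) *
        q.appLE W₁ (q ⁻¹ᵁ W₁) le_rfl (c' I) → c = c' := by
    intro W₁ i c c' hc
    funext I
    refine sections_ext _ _ fun y hy => ?_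
    obtain ⟨W₂, i₂, hy₂, hU, hW₂⟩ := H y (i hy) W₁ hy
    refine ⟨W₂, hU, hy₂, ?_⟩
    have h1 := congrArg (T.presheaf.map (homOfLE (q.preimage_mono hU)).op) hc
    rw [res_monomial_sum _ _ le_rfl _ hU, res_monomial_sum _ _ le_rfl _ hU] at h1
    exact congrFun ((hW₂ _).unique rfl h1) I
  intro a
  -- Each coefficient is glued separately, as the section that is locally the `I`-th entry of an
  -- expansion of `a`. That the glued entries form one expansion is checked afterwards in `hab`.
  have ex : ∀ I : Fin n → Fin p, ∃ b : Γ(Y, W), ∀ y ∈ W, ∃ (W₁ : Y.Opens) (i : W₁ ≤ W), y ∈ W₁ ∧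
      ∃ c : (Fin n → Fin p) → Γ(Y, W₁), c I = Y.presheaf.map (homOfLE i).op b ∧
        T.presheaf.map (homOfLE (q.preimage_mono i)).op a =
          ∑ I, f.appLE V (q ⁻¹ᵁ W₁) ((q.preimage_mono i).trans h) (monom x I) *
            q.appLE W₁ (q ⁻¹ᵁ W₁) le_rfl (c I) := by
    intro I
    refine exists_section (fun W₁ i b => ∃ c : (Fin n → Fin p) → Γ(Y, W₁), c I = b ∧
        T.presheaf.map (homOfLE (q.preimage_mono i)).op a =
          ∑ I, f.appLE V (q ⁻¹ᵁ W₁) ((q.preimage_mono i).trans h) (monom x I) *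
            q.appLE W₁ (q ⁻¹ᵁ W₁) le_rfl (c I)) ?_ ?_ ?_
    · rintro W₁ W₂ i j b ⟨c, rfl, hc⟩
      refine ⟨fun I => Y.presheaf.map (homOfLE j).op (c I), rfl, ?_⟩
      have h1 := congrArg (T.presheaf.map (homOfLE (q.preimage_mono j)).op) hc
      rw [res_monomial_sum _ _ le_rfl _ j, res_res] at h1
      exact h1
    · rintro W₁ i b b' ⟨c, rfl, hc⟩ ⟨c', rfl, hc'⟩
      rw [uniq W₁ i c c' (hc.symm.trans hc')]
    · intro y hy
      obtain ⟨W₁, i, hy₁, -, hW₁⟩ := H y hy W hy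
      obtain ⟨c, hc, -⟩ := hW₁ (T.presheaf.map (homOfLE (q.preimage_mono i)).op a)
      exact ⟨W₁, i, hy₁, _, c, rfl, hc⟩
  choose b hb using ex
  have hab : a = ∑ I, f.appLE V (q ⁻¹ᵁ W) h (monom x I) * q.appLE W (q ⁻¹ᵁ W) le_rfl (b I) := by
    refine sections_ext _ _ fun y hy => ?_
    obtain ⟨W₁, i, hy₁, -, hW₁⟩ := H (q y) hy W hy
    obtain ⟨c, hc, -⟩ := hW₁ (T.presheaf.map (homOfLE (q.preimage_mono i)).op a)
    refine ⟨q ⁻¹ᵁ W₁, q.preimage_mono i, hy₁, ?_⟩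
    rw [res_monomial_sum _ _ le_rfl _ i]
    refine hc.trans (Finset.sum_congr rfl fun I _ => ?_)
    congr 2
    refine sections_ext _ _ fun z hz => ?_
    obtain ⟨W₂, i₂, hz₂, c₂, hc₂, hs₂⟩ := hb I z (i hz)
    refine ⟨W₂ ⊓ W₁, inf_le_right, ⟨hz₂, hz⟩, ?_⟩
    have h1 := congrArg (T.presheaf.map (homOfLE (q.preimage_mono
      (inf_le_right : W₂ ⊓ W₁ ≤ W₁))).op) hc
    have h2 := congrArg (T.presheaf.map (homOfLE (q.preimage_mono
      (inf_le_left : W₂ ⊓ W₁ ≤ W₂))).op) hs₂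
    rw [res_monomial_sum _ _ le_rfl _ inf_le_right, res_res] at h1
    rw [res_monomial_sum _ _ le_rfl _ inf_le_left, res_res] at h2
    have h3 := congrFun (uniq (W₂ ⊓ W₁) (inf_le_right.trans i) _ _ (h1.symm.trans h2)) I
    rw [h3, hc₂, res_res, res_res]
  exact ⟨b, hab, fun c hc => uniq W le_rfl _ _ (hc.symm.trans hab)⟩

/-- A function pulled back from `Y` is the expansion whose only coefficient sits at the monomial
`1`. -/
lemma MonomialBasis.injective [Fact p.Prime] {W : T.Opens} {W' : Y.Opens} {h : W ≤ f ⁻¹ᵁ V}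
    {h' : W ≤ q ⁻¹ᵁ W'} (H : MonomialBasis p f q x W W' h h') :
    Function.Injective (q.appLE W' W h') := by
  classical
  intro b b' hb
  have key : ∀ b : Γ(Y, W'), q.appLE W' W h' b = ∑ I, f.appLE V W h (monom x I) *
      q.appLE W' W h' ((Pi.single (WeylModule.zeroIndex p n) b : (Fin n → Fin p) → _) I) := by
    intro b
    rw [Finset.sum_eq_single (WeylModule.zeroIndex p n) (fun I _ hI => by simp [hI]) (by simp),
      WeylModule.monom_zeroIndex, map_one, one_mul, Pi.single_eq_same]
  have h1 := (H _).unique (key b) (hb.trans (key b'))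
  simpa using congrFun h1 (WeylModule.zeroIndex p n)

end MonomialBasis

section Pullback

variable {k : Type u} [CommRing k] {p : ℕ} [Fact p.Prime] [CharP k p] {S : Scheme.{u}}
  {s : S ⟶ Spec (.of k)} {T Y : Scheme.{u}} {f : T ⟶ S} {q : T ⟶ Y} {g : Y ⟶ frobTwist p s}

lemma preimage_le_of_comm (w : f ≫ relFrob p s = q ≫ g) {V : S.Opens} {W : Y.Opens}
    (hW : W ≤ g ⁻¹ᵁ twist p s V) : q ⁻¹ᵁ W ≤ f ⁻¹ᵁ V := by
  have h : f ⁻¹ᵁ V = q ⁻¹ᵁ g ⁻¹ᵁ twist p s V := by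
    rw [← Scheme.Hom.comp_preimage, ← w, Scheme.Hom.comp_preimage, relFrob_preimage_twist]
  exact h ▸ q.preimage_mono hW

lemma le_preimage_twist_iff (w : f ≫ relFrob p s = q ≫ g) (hq : Function.Surjective q)
    {V : S.Opens} {W : Y.Opens} : W ≤ g ⁻¹ᵁ twist p s V ↔ q ⁻¹ᵁ W ≤ f ⁻¹ᵁ V := by
  refine ⟨preimage_le_of_comm w, fun hW y hy => ?_⟩
  obtain ⟨z, rfl⟩ := hq y
  have h : f ⁻¹ᵁ V = q ⁻¹ᵁ g ⁻¹ᵁ twist p s V := by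
    rw [← Scheme.Hom.comp_preimage, ← w, Scheme.Hom.comp_preimage, relFrob_preimage_twist]
  exact (h ▸ hW) hy

/-- `𝒪_T` is free over `𝒪_Y` for `T = Y ×_{S'} S`. -/
theorem monomialBasis_of_isPullback (H : IsPullback f q (relFrob p s) g) {V : S.Opens}
    (C : Coordinates p s V) {W : Y.Opens} (hW : W ≤ g ⁻¹ᵁ twist p s V) :
    MonomialBasis p f q C.x (q ⁻¹ᵁ W) W (preimage_le_of_comm H.w hW) le_rfl := by
  refine MonomialBasis.of_locally _ fun y hy U hU => ?_
  obtain ⟨W', hW', hy', hle⟩ := exists_affine_le (U := W ⊓ U) ⟨hy, hU⟩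
  refine ⟨W', hle.trans inf_le_left, hy', hle.trans inf_le_right, fun a => ?_⟩
  have hW'' := (hle.trans inf_le_left).trans hW
  have h1 := isPushout_of_isPullback H (US := twist p s V) (UT := W') (UX := V) (UY := q ⁻¹ᵁ W')
    hW'' (le_relFrob_preimage_twist p s V)
    (inf_eq_right.mpr (preimage_le_of_comm H.w hW'')).symm (isAffineOpen_twist p s C.affine) hW'
    C.affine
  exact existsUnique_sum_of_isPushout h1 (fun I => monom C.x I) C.existsUnique_sum a

/-- Locally the projection is injective on functions, by the monomial basis, and its image contains
the `p`-th powers. -/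
theorem isHomeomorph_of_isPullback [Smooth s] (H : IsPullback f q (relFrob p s) g) :
    IsHomeomorph q := by
  refine isHomeomorph_of_pow q (Fact.out : p.Prime).pos fun y => ?_
  obtain ⟨V, -, hy, ⟨C⟩⟩ := exists_coordinates_nhds p s
    (show frobTwistFst p s (g y) ∈ (⊤ : S.Opens) from trivial)
  obtain ⟨W, hW, hyW, hle⟩ := exists_affine_le (U := g ⁻¹ᵁ twist p s V) (y := y) hy
  have hb := monomialBasis_of_isPullback H C hle
  have hinj := hb.injective
  rw [Scheme.Hom.appLE_eq_app] at hinj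
  refine ⟨W, hyW, hW, ?_, hinj, fun a => ?_⟩
  · exact isAffineOpen_of_isPullback H (US := twist p s V) (UT := W) (UX := V) hle
      (le_relFrob_preimage_twist p s V)
      (inf_eq_right.mpr (preimage_le_of_comm H.w hle)).symm (isAffineOpen_twist p s C.affine) hW
      C.affine
  · obtain ⟨c, hc, -⟩ := hb a
    have hp := natCast_eq_zero (f ≫ s) p (q ⁻¹ᵁ W)
    -- The `p`-th power of `∑ x^I c_I` is `∑ (x^I)^p c_I^p`, and `(x^I)^p` comes from `S'`, hence
    -- from `Y`.
    refine ⟨∑ I, g.appLE (twist p s V) W hle ((frobTwistFst p s).app V (monom C.x I)) *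
      (c I) ^ p, ?_⟩
    have h1 : a ^ p = powHom p hp a := rfl
    rw [h1, hc, map_sum, map_sum]
    refine Finset.sum_congr rfl fun I _ => ?_
    rw [map_mul, map_mul, map_pow]
    congr 1
    · have h2 := congrArg (f.appLE V (q ⁻¹ᵁ W) (preimage_le_of_comm H.w hle))
        (frobSection_fst p s V (monom C.x I))
      rw [map_pow] at h2
      rw [Scheme.Hom.app_eq_appLE]
      refine h2.symm.trans ?_
      have e₃ : q ⁻¹ᵁ W ≤ (f ≫ relFrob p s) ⁻¹ᵁ twist p s V := by
        rw [H.w]; exact q.preimage_mono hle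
      exact (appLE_appLE rfl _ _ e₃ _).trans (appLE_appLE H.w.symm _ _ e₃ _).symm
    · rw [Scheme.Hom.app_eq_appLE]
      rfl

end Pullback


/-! ### Vector fields on Frobenius pullbacks -/

noncomputable section

set_option linter.unusedSectionVars false

lemma appLE_id {X : Scheme.{u}} {U V : X.Opens} (e : V ≤ U) (a : Γ(X, U)) :
    (𝟙 X : X ⟶ X).appLE U V e a = X.presheaf.map (homOfLE e).op a := rfl

namespace VectorField

section Basic

variable {k : Type u} [CommRing k] {X : Scheme.{u}} {x : X ⟶ Spec (.of k)} {U : X.Opens}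

lemma ext_apply {D E : VectorField x U} (h : ∀ W hW a, D.act W hW a = E.act W hW a) : D = E :=
  VectorField.ext (funext fun W => funext fun hW => Derivation.ext (h W hW))

@[simp] lemma zero_act (W : X.Opens) (hW : W ≤ U) : (0 : VectorField x U).act W hW = 0 := rfl

@[simp] lemma add_act (D E : VectorField x U) (W : X.Opens) (hW : W ≤ U) :
    (D + E).act W hW = D.act W hW + E.act W hW := rfl

lemma smul_act (b : Γ(X, U)) (D : VectorField x U) (W : X.Opens) (hW : W ≤ U) (a : Γ(X, W)) :
    (b • D).act W hW a = X.presheaf.map (homOfLE hW).op b * D.act W hW a := rfl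

lemma bracket_act (D E : VectorField x U) (W : X.Opens) (hW : W ≤ U) (a : Γ(X, W)) :
    (⁅D, E⁆ : VectorField x U).act W hW a =
      D.act W hW (E.act W hW a) - E.act W hW (D.act W hW a) :=
  Derivation.commutator_apply a

lemma pPow_act (p : ℕ) [Fact p.Prime] [CharP k p] (D : VectorField x U) (W : X.Opens)
    (hW : W ≤ U) (a : Γ(X, W)) : (D.pPow p).act W hW a = (D.act W hW)^[p] a := rfl

@[simp] lemma res_act {V : X.Opens} (i : V ≤ U) (D : VectorField x U) (W : X.Opens) (hW : W ≤ V) :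
    (D.res i).act W hW = D.act W (hW.trans i) := rfl

instance : AddCommMonoid (VectorField x U) where
  add_assoc D E G := ext_apply fun W hW a => by simp [add_assoc]
  zero_add D := ext_apply fun W hW a => by simp
  add_zero D := ext_apply fun W hW a => by simp
  add_comm D E := ext_apply fun W hW a => by simp [add_comm]
  nsmul := nsmulRec

/-- The action on sections as an additive map. -/
def actHom (W : X.Opens) (hW : W ≤ U) (a : Γ(X, W)) : VectorField x U →+ Γ(X, W) where
  toFun D := D.act W hW a
  map_zero' := rfl
  map_add' _ _ := rfl

lemma sum_act {ι : Type*} [Fintype ι] (D : ι → VectorField x U) (W : X.Opens)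
    (hW : W ≤ U) (a : Γ(X, W)) : (∑ i, D i).act W hW a = ∑ i, (D i).act W hW a :=
  map_sum (actHom W hW a) D Finset.univ

lemma act_locally {W : X.Opens} (D : VectorField x U) (hW : W ≤ U) {a b : Γ(X, W)}
    (h : ∀ y ∈ W, ∃ (W' : X.Opens) (i : W' ≤ W), y ∈ W' ∧
      D.act W' (i.trans hW) (X.presheaf.map (homOfLE i).op a) =
        X.presheaf.map (homOfLE i).op b) : D.act W hW a = b := by
  refine sections_ext _ _ fun y hy => ?_
  obtain ⟨W', i, hy, h⟩ := h y hy
  exact ⟨W', i, hy, by rw [← D.act_res W W' hW i, h]⟩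

end Basic

section Canonical

variable {k : Type u} [CommRing k] {p : ℕ} [Fact p.Prime] [CharP k p] {S : Scheme.{u}}
  {s : S ⟶ Spec (.of k)} {T Y : Scheme.{u}} {f : T ⟶ S} {q : T ⟶ Y} {g : Y ⟶ frobTwist p s}
  {t : T ⟶ Spec (.of k)}

lemma appLE_frobSection (w : f ≫ relFrob p s = q ≫ g) {V : S.Opens} {W : T.Opens} {W' : Y.Opens}
    (h : W ≤ f ⁻¹ᵁ V) (h' : W ≤ q ⁻¹ᵁ W') (hg : W' ≤ g ⁻¹ᵁ twist p s V)
    (c : Γ(frobTwist p s, twist p s V)) :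
    f.appLE V W h (frobSection p s V c) =
      q.appLE W' W h' (g.appLE (twist p s V) W' hg c) := by
  have e₃ : W ≤ (f ≫ relFrob p s) ⁻¹ᵁ twist p s V := by
    rw [w]; exact h'.trans (q.preimage_mono hg)
  exact (appLE_appLE rfl _ _ e₃ _).trans (appLE_appLE w.symm _ _ e₃ _).symm

/-- Linearity of `∑ f^* s_j q^* b_j ↦ ∑ f^* D(s_j) q^* b_j` over `𝒪_Y`. -/
lemma monomial_expansion (w : f ≫ relFrob p s = q ≫ g) {V : S.Opens} (C : Coordinates p s V)
    {W : T.Opens} {W' : Y.Opens} {h : W ≤ f ⁻¹ᵁ V} {h' : W ≤ q ⁻¹ᵁ W'}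
    (hg : W' ≤ g ⁻¹ᵁ twist p s V) {ι : Type*} [Fintype ι] (m : ι → Γ(S, V)) (b : ι → Γ(Y, W')) :
    ∃ c : (Fin C.n → Fin p) → Γ(Y, W'), ∀ D : Γ(S, V) →+ Γ(S, V),
      (∀ c a, D (frobSection p s V c * a) = frobSection p s V c * D a) →
      ∑ j, f.appLE V W h (D (m j)) * q.appLE W' W h' (b j) =
        ∑ I, f.appLE V W h (D (monom C.x I)) * q.appLE W' W h' (c I) := by
  choose d hd using fun j => C.exists_sum (m j)
  -- The new coefficients come from expanding each `m j` over `𝒪_{S'}` and do not involve `D`. So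
  -- the same ones serve for the identity and for a derivation, which makes the extension of `D`
  -- well defined.
  refine ⟨fun I => ∑ j, g.appLE _ W' hg (d j I) * b j, fun D hD => ?_⟩
  simp only [map_sum, map_mul, Finset.mul_sum]
  rw [Finset.sum_comm]
  refine Finset.sum_congr rfl fun j _ => ?_
  conv_lhs => rw [hd j, map_sum, map_sum, Finset.sum_mul]
  refine Finset.sum_congr rfl fun I _ => ?_
  rw [mul_comm (monom C.x I), hD, map_mul, appLE_frobSection w h h' hg]
  ring

variable (w : f ≫ relFrob p s = q ≫ g) (ht : f ≫ s = t) (hq : IsHomeomorph q)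
  {V : S.Opens} (C : Coordinates p s V) {U : T.Opens} (hU : U ≤ f ⁻¹ᵁ V)
  (hb : ∀ (W : T.Opens) (W' : Y.Opens) (i : W ≤ U) (e : W = q ⁻¹ᵁ W'),
    MonomialBasis p f q C.x W W' (i.trans hU) e.le)

include w in
lemma le_twist_of_eq (hq : IsHomeomorph q) {V : S.Opens} {W : T.Opens} {W' : Y.Opens}
    (h : W ≤ f ⁻¹ᵁ V) (e : W = q ⁻¹ᵁ W') : W' ≤ g ⁻¹ᵁ twist p s V :=
  (le_preimage_twist_iff w hq.surjective).mpr (e ▸ h)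

/-- The image of an open set under a homeomorphism of schemes. -/
def imageOpen (hq : IsHomeomorph q) (W : T.Opens) : Y.Opens := ⟨q '' W, hq.isOpenMap _ W.2⟩

lemma preimage_imageOpen (hq : IsHomeomorph q) (W : T.Opens) : W = q ⁻¹ᵁ imageOpen hq W :=
  TopologicalSpace.Opens.ext (Set.preimage_image_eq _ hq.injective).symm

lemma imageOpen_mono (hq : IsHomeomorph q) {W W' : T.Opens} (i : W' ≤ W) :
    imageOpen hq W' ≤ imageOpen hq W := Set.image_mono i

include w ht hq hb in
/-- The derivation `D` of `𝒪_S(V)` extends to a vector field which kills the functions of `Y`. -/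
theorem exists_canonical (D : Derivation ℤ Γ(S, V) Γ(S, V)) (hD : ∀ c, D (const s V c) = 0) :
    ∃ E : VectorField t U,
      (∀ (W : T.Opens) (i : W ≤ U) (a : Γ(S, V)),
        E.act W i (f.appLE V W (i.trans hU) a) = f.appLE V W (i.trans hU) (D a)) ∧
      ∀ (W : T.Opens) (i : W ≤ U) (W' : Y.Opens) (h' : W ≤ q ⁻¹ᵁ W') (b : Γ(Y, W')),
        E.act W i (q.appLE W' W h' b) = 0 := by
  have hDlin : ∀ c a, D.toLinearMap.toAddMonoidHom (frobSection p s V c * a) =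
      frobSection p s V c * D.toLinearMap.toAddMonoidHom a := fun c a => by
    change D _ = _ * D _
    rw [D.leibniz, derivation_frobSection C.affine D hD]
    simp
  have P : ∀ W : T.Opens, ∃ W' : Y.Opens, W = q ⁻¹ᵁ W' := fun W => ⟨_, preimage_imageOpen hq W⟩
  choose c hc using fun (W : T.Opens) (i : W ≤ U) (a : Γ(T, W)) =>
    (hb W (imageOpen hq W) i (preimage_imageOpen hq W) a).exists
  -- The derivative is defined by differentiating the monomials in the unique expansion and leaving
  -- the coefficients alone.
  let φ : ∀ (W : T.Opens) (i : W ≤ U), Γ(T, W) → Γ(T, W) := fun W i a =>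
    ∑ I, f.appLE V W (i.trans hU) (D (monom C.x I)) *
      q.appLE (imageOpen hq W) W (preimage_imageOpen hq W).le (c W i a I)
  -- The defining formula holds for every presentation `∑ f^* m_j q^* b_j`, not only the monomial
  -- one. Additivity and the Leibniz rule then follow by indexing sums by `ι ⊕ ι'` and products by
  -- `ι × ι'`.
  have key : ∀ (W : T.Opens) (i : W ≤ U) (ι : Type u) (_ : Fintype ι) (m : ι → Γ(S, V))
      (b : ι → Γ(Y, imageOpen hq W)),
      φ W i (∑ j, f.appLE V W (i.trans hU) (m j) *
        q.appLE (imageOpen hq W) W (preimage_imageOpen hq W).le (b j)) =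
      ∑ j, f.appLE V W (i.trans hU) (D (m j)) *
        q.appLE (imageOpen hq W) W (preimage_imageOpen hq W).le (b j) := by
    intro W i ι _ m b
    have hg := le_twist_of_eq w hq (i.trans hU) (preimage_imageOpen hq W)
    obtain ⟨d, hd⟩ := monomial_expansion w C (h := i.trans hU)
      (h' := (preimage_imageOpen hq W).le) hg m b
    refine Eq.trans ?_ (hd D.toLinearMap.toAddMonoidHom hDlin).symm
    have h1 := (hb W (imageOpen hq W) i (preimage_imageOpen hq W) _).unique (hc W i _)
      (hd (AddMonoidHom.id _) fun _ _ => rfl)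
    change φ W i _ = ∑ I, f.appLE V W _ (D (monom C.x I)) * _
    simp only [φ]
    exact Finset.sum_congr rfl fun I _ => congrArg (fun z => f.appLE V W (i.trans hU)
      (D (monom C.x I)) * q.appLE (imageOpen hq W) W (preimage_imageOpen hq W).le z)
      (congrFun h1 I)
  have repr : ∀ (W : T.Opens) (i : W ≤ U) (a : Γ(T, W)), ∃ (ι : Type u) (_ : Fintype ι)
      (m : ι → Γ(S, V)) (b : ι → Γ(Y, imageOpen hq W)),
      a = ∑ j, f.appLE V W (i.trans hU) (m j) *
        q.appLE (imageOpen hq W) W (preimage_imageOpen hq W).le (b j) := fun W i a =>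
    ⟨ULift (Fin C.n → Fin p), inferInstance, fun I => monom C.x I.down,
      fun I => c W i a I.down, (hc W i a).trans
        (Equiv.sum_comp Equiv.ulift (fun I => f.appLE V W (i.trans hU) (monom C.x I) *
          q.appLE (imageOpen hq W) W (preimage_imageOpen hq W).le (c W i a I))).symm⟩
  have add : ∀ (W : T.Opens) (i : W ≤ U) (a b : Γ(T, W)), φ W i (a + b) = φ W i a + φ W i b := by
    intro W i a a'
    obtain ⟨ι, _, m, b, rfl⟩ := repr W i a
    obtain ⟨ι', _, m', b', rfl⟩ := repr W i a'
    have := key W i (ι ⊕ ι') inferInstance (Sum.elim m m') (Sum.elim b b')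
    simp only [Fintype.sum_sum_type, Sum.elim_inl, Sum.elim_inr] at this
    rw [this, key, key]
  have mul : ∀ (W : T.Opens) (i : W ≤ U) (a b : Γ(T, W)),
      φ W i (a * b) = a * φ W i b + b * φ W i a := by
    intro W i a a'
    obtain ⟨ι, _, m, b, rfl⟩ := repr W i a
    obtain ⟨ι', _, m', b', rfl⟩ := repr W i a'
    have := key W i (ι × ι') inferInstance (fun j => m j.1 * m' j.2) (fun j => b j.1 * b' j.2)
    simp only [Fintype.sum_prod_type, Derivation.leibniz, smul_eq_mul, map_mul, map_add] at this
    rw [key, key, Finset.sum_mul_sum, Finset.sum_mul_sum, Finset.sum_mul_sum]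
    refine (congrArg (φ W i) (Finset.sum_congr rfl fun j _ => Finset.sum_congr rfl fun j' _ =>
      mul_mul_mul_comm _ _ _ _)).trans (this.trans ?_)
    rw [Finset.sum_comm (s := Finset.univ (α := ι')), ← Finset.sum_add_distrib]
    refine Finset.sum_congr rfl fun j _ => ?_
    rw [← Finset.sum_add_distrib]
    exact Finset.sum_congr rfl fun j' _ => by ring
  have one : ∀ (W : T.Opens) (i : W ≤ U) (a : Γ(S, V)) (b : Γ(Y, imageOpen hq W)),
      φ W i (f.appLE V W (i.trans hU) a *
        q.appLE (imageOpen hq W) W (preimage_imageOpen hq W).le b) =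
      f.appLE V W (i.trans hU) (D a) *
        q.appLE (imageOpen hq W) W (preimage_imageOpen hq W).le b := fun W i a b => by
    simpa using key W i PUnit inferInstance (fun _ => a) (fun _ => b)
  have pull : ∀ (W : T.Opens) (i : W ≤ U) (a : Γ(S, V)), φ W i (f.appLE V W (i.trans hU) a) =
      f.appLE V W (i.trans hU) (D a) := fun W i a => by
    simpa using one W i a 1
  refine ⟨⟨fun W i => Derivation.mk' (AddMonoidHom.mk' (φ W i) (add W i)).toIntLinearMap (mul W i),
    fun W i c => ?_, fun W W₁ i j a => ?_⟩, pull, fun W i W' h' b => ?_⟩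
  · have := pull W i (const s V c)
    rwa [hD, map_zero, appLE_const ht] at this
  · change φ W₁ _ _ = T.presheaf.map (homOfLE j).op (φ W i a)
    obtain ⟨ι, _, m, b, rfl⟩ := repr W i a
    rw [key, res_monomial_sum _ _ (preimage_imageOpen hq W₁).le _ (imageOpen_mono hq j),
      res_monomial_sum _ _ (preimage_imageOpen hq W₁).le _ (imageOpen_mono hq j), key]
  -- The coefficients live over the image of `W`, so `b` is restricted to it first; there it is the
  -- presentation `1 * b`, and `D 1 = 0`.
  · have hle : imageOpen hq W ≤ W' := by
      rintro _ ⟨z, hz, rfl⟩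
      exact h' hz
    have := one W i 1 (Y.presheaf.map (homOfLE hle).op b)
    rw [D.map_one_eq_zero, map_zero, zero_mul, map_one, one_mul, res_appLE] at this
    exact this

include hq hb in
/-- A vector field which kills the functions of `Y` is determined by its effect on the
coordinates. -/
theorem eq_of_coordinates {E E' : VectorField t U}
    (hE : ∀ (W : T.Opens) (i : W ≤ U) (W' : Y.Opens) (h' : W ≤ q ⁻¹ᵁ W') (b : Γ(Y, W')),
      E.act W i (q.appLE W' W h' b) = E'.act W i (q.appLE W' W h' b))
    (hx : ∀ j, E.act U le_rfl (f.appLE V U hU (C.x j)) =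
      E'.act U le_rfl (f.appLE V U hU (C.x j))) : E = E' := by
  refine ext_apply fun W i a => ?_
  obtain ⟨c, hc, -⟩ := hb W (imageOpen hq W) i (preimage_imageOpen hq W) a
  let R : Subring Γ(T, W) := derConst (E.act W i - E'.act W i)
  have hR : ∀ {a}, a ∈ R ↔ E.act W i a = E'.act W i a := sub_eq_zero
  rw [← hR, hc]
  refine R.sum_mem fun I _ => R.mul_mem ?_ (hR.mpr (hE _ _ _ _ _))
  change (f.appLE V W (i.trans hU)).hom (monom C.x I) ∈ R
  rw [map_monom]
  refine monom_mem (fun j => hR.mpr ?_) I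
  have h1 := congrArg (T.presheaf.map (homOfLE i).op) (hx j)
  rwa [← E.act_res, ← E'.act_res, appLE_res] at h1

end Canonical

end VectorField

/-! ### Coordinate vector fields -/

section Partial

variable {k : Type u} [CommRing k] {p : ℕ} [Fact p.Prime] [CharP k p] {S : Scheme.{u}}
  {s : S ⟶ Spec (.of k)}

lemma monomialBasis_of_eq {T Y : Scheme.{u}} {f : T ⟶ S} {q : T ⟶ Y} {g : Y ⟶ frobTwist p s}
    [Smooth s] (H : IsPullback f q (relFrob p s) g) {V : S.Opens}
    (C : Coordinates p s V) (W : T.Opens) (W' : Y.Opens) (h : W ≤ f ⁻¹ᵁ V) (e : W = q ⁻¹ᵁ W') :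
    MonomialBasis p f q C.x W W' h e.le := by
  subst e
  exact monomialBasis_of_isPullback H C
    (VectorField.le_twist_of_eq H.w (isHomeomorph_of_isPullback H) h rfl)

-- The scheme `S` is itself the Frobenius pullback of `S'`, so the statements on vector fields of
-- Frobenius pullbacks apply to `S`.
variable (p s) in
lemma isPullback_relFrob : IsPullback (𝟙 S) (relFrob p s) (relFrob p s) (𝟙 _) :=
  IsPullback.of_horiz_isIso ⟨by simp⟩

namespace Coordinates

variable [Smooth s] {V : S.Opens} (C : Coordinates p s V)

/-- A derivation of the ring `𝒪_S(V)` must be extended to all smaller open sets; this is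
`exists_canonical` for `S` over `S'`. -/
lemma exists_tangent (i : Fin C.n) : ∃ E : VectorField s V, ∀ (W : S.Opens) (h : W ≤ V) a,
    E.act W h (S.presheaf.map (homOfLE h).op a) = S.presheaf.map (homOfLE h).op (C.der i a) := by
  obtain ⟨E, hE, -⟩ := VectorField.exists_canonical (t := s) (isPullback_relFrob p s).w
    (Category.id_comp s) (isHomeomorph_relFrob p s) C (U := V) le_rfl
    (fun W W' h e => monomialBasis_of_eq (isPullback_relFrob p s) C W W' h e) (C.der i)
    (C.der_const i)
  exact ⟨E, fun W h a => by simpa only [appLE_id] using! hE W h a⟩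

/-- The coordinate vector field `∂ / ∂ x_i`. -/
def tangent (i : Fin C.n) : VectorField s V := (C.exists_tangent i).choose

lemma tangent_res (i : Fin C.n) {W : S.Opens} (h : W ≤ V) (a : Γ(S, V)) :
    (C.tangent i).act W h (S.presheaf.map (homOfLE h).op a) =
      S.presheaf.map (homOfLE h).op (C.der i a) := (C.exists_tangent i).choose_spec W h a

lemma tangent_act (i : Fin C.n) (a : Γ(S, V)) : (C.tangent i).act V le_rfl a = C.der i a := by
  simpa using C.tangent_res i le_rfl a

lemma tangent_x (i j : Fin C.n) {W : S.Opens} (h : W ≤ V) :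
    (C.tangent i).act W h (S.presheaf.map (homOfLE h).op (C.x j)) = if i = j then 1 else 0 := by
  rw [C.tangent_res, C.der_x]
  split_ifs <;> simp

include C in
lemma vectorField_ext {U : S.Opens} (hU : U ≤ V) {D E : VectorField s U}
    (h : ∀ i, D.act U le_rfl (S.presheaf.map (homOfLE hU).op (C.x i)) =
      E.act U le_rfl (S.presheaf.map (homOfLE hU).op (C.x i))) : D = E := by
  refine VectorField.eq_of_coordinates (f := 𝟙 S) (isHomeomorph_relFrob p s) C hU
    (fun W W' i e => monomialBasis_of_eq (isPullback_relFrob p s) C W W' (i.trans hU) e)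
    (fun W i W' h' b => ?_) fun j => by simpa only [appLE_id] using! h j
  rw [D.act_relFrob, E.act_relFrob]

lemma bracket_tangent (i j : Fin C.n) : ⁅C.tangent i, C.tangent j⁆ = (0 : VectorField s V) := by
  refine C.vectorField_ext le_rfl fun l => ?_
  rw [VectorField.bracket_act, res_self, tangent_act, tangent_act, tangent_act, tangent_act,
    C.der_comm, sub_self]
  rfl

lemma pPow_tangent (i : Fin C.n) : (C.tangent i).pPow p = 0 := by
  refine C.vectorField_ext le_rfl fun l => ?_
  have : ⇑((C.tangent i).act V le_rfl) = C.der i := funext (C.tangent_act i)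
  rw [VectorField.pPow_act, this, C.der_iterate]
  rfl

lemma vectorField_eq_sum {U : S.Opens} (hU : U ≤ V) (D : VectorField s U) :
    D = ∑ i, D.act U le_rfl (S.presheaf.map (homOfLE hU).op (C.x i)) • (C.tangent i).res hU := by
  refine C.vectorField_ext hU fun j => ?_
  rw [VectorField.sum_act, Finset.sum_eq_single j, VectorField.smul_act, VectorField.res_act,
    C.tangent_x, if_pos rfl, mul_one, res_self]
  · intro i _ hij
    rw [VectorField.smul_act, VectorField.res_act, C.tangent_x, if_neg hij, mul_zero]
  · simp

end Coordinates

end Partial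

/-! ### Connections in coordinates -/

namespace LambdaConnection

variable {k : Type u} [CommRing k] {p : ℕ} [Fact p.Prime] [CharP k p] {S : Scheme.{u}}
  {s : S ⟶ Spec (.of k)} {lam : k} {X : Scheme.{u}} {f : X ⟶ S} (c : LambdaConnection s lam f)

lemma nabla_zero (V : S.Opens) : c.nabla V 0 = 0 := by
  have h : (0 : VectorField s V) = (0 : Γ(S, V)) • 0 :=
    VectorField.ext_apply fun W h a => by simp [VectorField.smul_act]
  rw [h, c.nabla_smul]
  exact VectorField.ext_apply fun W h a => by simp [VectorField.smul_act]

/-- The value of a connection as an additive map. -/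
def nablaHom (V : S.Opens) : VectorField s V →+ VectorField (f ≫ s) (f ⁻¹ᵁ V) where
  toFun := c.nabla V
  map_zero' := c.nabla_zero V
  map_add' := c.nabla_add V

variable [Smooth s] {V : S.Opens} (C : Coordinates p s V)

lemma nabla_act_eq_sum {U : S.Opens} (hU : U ≤ V) (D : VectorField s U) {W : X.Opens}
    (hW : W ≤ f ⁻¹ᵁ U) (a : Γ(X, W)) :
    (c.nabla U D).act W hW a =
      ∑ i, f.appLE U W hW (D.act U le_rfl (S.presheaf.map (homOfLE hU).op (C.x i))) *
        (c.nabla V (C.tangent i)).act W (hW.trans (f.preimage_mono hU)) a := by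
  conv_lhs => rw [C.vectorField_eq_sum hU D]
  refine (congrArg (fun E : VectorField (f ≫ s) (f ⁻¹ᵁ U) => E.act W hW a)
    (map_sum (c.nablaHom U) _ Finset.univ)).trans ?_
  rw [VectorField.sum_act]
  refine Finset.sum_congr rfl fun i _ => ?_
  change (c.nabla U (_ • _)).act W hW a = _
  rw [c.nabla_smul, VectorField.smul_act, c.nabla_res]
  rfl

lemma nabla_act_appLE {U : S.Opens} (D : VectorField s U) {U' : S.Opens} (hU : U' ≤ U)
    {W : X.Opens} (h : W ≤ f ⁻¹ᵁ U') (a : Γ(S, U')) :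
    (c.nabla U D).act W (h.trans (f.preimage_mono hU)) (f.appLE U' W h a) =
      const (f ≫ s) W lam * f.appLE U' W h (D.act U' hU a) := by
  have h1 := congrArg (X.presheaf.map (homOfLE h).op) (c.symbol U U' hU D a)
  rw [← VectorField.act_res _ _ _ (f.preimage_mono hU) h, map_mul, res_const] at h1
  exact h1

lemma isFlat_res {U U' : X.Opens} (i : U' ≤ U) {a : Γ(X, U)} (h : c.IsFlat U a) :
    c.IsFlat U' (X.presheaf.map (homOfLE i).op a) := fun V D W hV hU => by
  rw [res_res]
  exact h V D W hV (hU.trans i)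

lemma isFlat_of_locally {U : X.Opens} {a : Γ(X, U)}
    (h : ∀ y ∈ U, ∃ (W : X.Opens) (i : W ≤ U), y ∈ W ∧
      c.IsFlat W (X.presheaf.map (homOfLE i).op a)) : c.IsFlat U a := by
  intro V D W hV hU
  refine VectorField.act_locally _ _ fun y hy => ?_
  obtain ⟨W', i, hy', h⟩ := h y (hU hy)
  refine ⟨W ⊓ W', inf_le_left, ⟨hy, hy'⟩, ?_⟩
  have := h V D (W ⊓ W') (inf_le_left.trans hV) inf_le_right
  rw [res_res] at this
  rw [res_res, map_zero]
  exact this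

-- The fields `∂_i` generate the tangent sheaf below `V`, and `∇` is linear; an arbitrary field over
-- `V'` is first restricted to `V' ⊓ V`.
include C in
lemma isFlat_iff {U : X.Opens} (hU : U ≤ f ⁻¹ᵁ V) (a : Γ(X, U)) :
    c.IsFlat U a ↔ ∀ i, (c.nabla V (C.tangent i)).act U hU a = 0 := by
  refine ⟨fun h i => by simpa using h V (C.tangent i) U hU le_rfl, fun h V' D W hV hW => ?_⟩
  have hWV : W ≤ f ⁻¹ᵁ (V' ⊓ V) := le_inf hV (hW.trans hU)
  have h1 := c.nabla_act_eq_sum C inf_le_right (D.res (inf_le_left : V' ⊓ V ≤ V')) hWV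
    (X.presheaf.map (homOfLE hW).op a)
  rw [c.nabla_res] at h1
  refine h1.trans (Finset.sum_eq_zero fun i _ => ?_)
  rw [VectorField.act_res _ _ _ hU hW, h, map_zero, mul_zero]

/-- The subring of flat functions. -/
def flatSubring (U : X.Opens) : Subring Γ(X, U) where
  carrier := {a | c.IsFlat U a}
  mul_mem' ha hb V D W hV hU := by
    rw [map_mul, Derivation.leibniz, ha V D W hV hU, hb V D W hV hU]
    simp
  one_mem' V D W hV hU := by rw [map_one, Derivation.map_one_eq_zero]
  add_mem' ha hb V D W hV hU := by
    rw [map_add, map_add, ha V D W hV hU, hb V D W hV hU, add_zero]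
  zero_mem' V D W hV hU := by rw [map_zero, map_zero]
  neg_mem' ha V D W hV hU := by rw [map_neg, map_neg, ha V D W hV hU, neg_zero]

include p in
lemma isFlat_pow_p {U : X.Opens} (a : Γ(X, U)) : c.IsFlat U (a ^ p) := fun V D W hV hU => by
  rw [map_pow]
  exact derivation_pow_p _ (natCast_eq_zero (f ≫ s) p W) _

/-- By the symbol condition `∇(D)` acts on functions of `S` as `λ D`, and `D` kills the functions
coming from `S'`. -/
lemma isFlat_comp_relFrob {r : X ⟶ frobTwist p s} (hr : f ≫ relFrob p s = r) {U : X.Opens}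
    {U' : (frobTwist p s).Opens} (e : U ≤ r ⁻¹ᵁ U') (a : Γ(frobTwist p s, U')) :
    c.IsFlat U (r.appLE U' U e a) := by
  intro V D W hV hU
  have h : W ≤ f ⁻¹ᵁ (V ⊓ relFrob p s ⁻¹ᵁ U') := by
    subst hr
    exact fun y hy => ⟨hV hy, e (hU hy)⟩
  have h1 := c.nabla_act_appLE D inf_le_left h
    ((relFrob p s).appLE U' (V ⊓ relFrob p s ⁻¹ᵁ U') inf_le_right a)
  have h2 : f.appLE (V ⊓ relFrob p s ⁻¹ᵁ U') W h
      ((relFrob p s).appLE U' (V ⊓ relFrob p s ⁻¹ᵁ U') inf_le_right a) =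
      X.presheaf.map (homOfLE hU).op (r.appLE U' U e a) :=
    (appLE_appLE hr _ _ (hU.trans e) a).trans (appLE_res r e hU a).symm
  rw [VectorField.act_relFrob, map_zero, mul_zero, h2] at h1
  exact h1

end LambdaConnection

end


/-! ### Quotients by foliations of vanishing `p`-curvature -/

noncomputable section

set_option linter.unusedSectionVars false

lemma isLocalHom_stalkMap_of_comp {X Y Z : PresheafedSpace CommRingCat.{u}} {a : X ⟶ Y} {b : Y ⟶ Z}
    {c : X ⟶ Z} (h : a ≫ b = c) (x : X) (hc : IsLocalHom (c.stalkMap x).hom) :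
    IsLocalHom (b.stalkMap (a.base x)).hom := by
  subst h
  rw [PresheafedSpace.stalkMap.comp] at hc
  change IsLocalHom ((a.stalkMap x).hom.comp (b.stalkMap (a.base x)).hom) at hc
  exact isLocalHom_of_comp (b.stalkMap (a.base x)).hom (a.stalkMap x).hom

section FlatQuotient

variable {k : Type u} [CommRing k] {S : Scheme.{u}} {s : S ⟶ Spec (.of k)} [Smooth s]
  {lam : k} {X : Scheme.{u}} {f : X ⟶ S} (c : LambdaConnection s lam f)

/-- `q : X ⟶ Y` is a homeomorphism which identifies the functions on `Y` with the flat functions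
on `X`. -/
structure IsFlatQuotient {Y : Scheme.{u}} (q : X ⟶ Y) : Prop where
  isHomeomorph : IsHomeomorph q
  injective : ∀ W, Function.Injective (q.app W)
  isFlat : ∀ W b, c.IsFlat (q ⁻¹ᵁ W) (q.app W b)
  exists_eq : ∀ W a, c.IsFlat (q ⁻¹ᵁ W) a → ∃ b, q.app W b = a

variable {c}

namespace IsFlatQuotient

variable {Y : Scheme.{u}} {q : X ⟶ Y}

lemma of_basis (hq : IsHomeomorph q)
    (H : ∀ (y : Y) (U : Y.Opens), y ∈ U → ∃ W : Y.Opens, y ∈ W ∧ W ≤ U ∧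
      Function.Injective (q.app W) ∧ (∀ b, c.IsFlat (q ⁻¹ᵁ W) (q.app W b)) ∧
      ∀ a, c.IsFlat (q ⁻¹ᵁ W) a → ∃ b, q.app W b = a) : IsFlatQuotient c q := by
  have inj : ∀ W, Function.Injective (q.app W) := by
    intro W b b' hb
    refine sections_ext _ _ fun y hy => ?_
    obtain ⟨W', hy', hle, hi, -⟩ := H y W hy
    refine ⟨W', hle, hy', hi ?_⟩
    rw [app_res, app_res, hb]
  refine ⟨hq, inj, fun W b => c.isFlat_of_locally fun x hx => ?_, fun W a ha => ?_⟩
  · obtain ⟨W', hy', hle, -, hf, -⟩ := H (q x) W hx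
    refine ⟨q ⁻¹ᵁ W', q.preimage_mono hle, hy', ?_⟩
    rw [← app_res _ hle]
    exact hf _
  · obtain ⟨b, hb⟩ := exists_section (X := Y) (U := W)
      (fun W' h b => q.app W' b = X.presheaf.map (homOfLE (q.preimage_mono h)).op a)
      (fun W₁ W₂ h i b hb => by rw [app_res, hb, res_res])
      (fun W' h b b' hb hb' => inj W' (hb.trans hb'.symm))
      (fun y hy => by
        obtain ⟨W', hy', hle, -, -, he⟩ := H y W hy
        exact ⟨W', hle, hy', he _ (c.isFlat_res _ ha)⟩)
    refine ⟨b, sections_ext _ _ fun x hx => ?_⟩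
    obtain ⟨W', i, hy, hW⟩ := hb (q x) hx
    refine ⟨q ⁻¹ᵁ W', q.preimage_mono i, hy, ?_⟩
    rw [← app_res _ i]
    exact hW

variable (h : IsFlatQuotient c q)
include h

lemma isFlat_appLE {W : X.Opens} {W' : Y.Opens} (e : W ≤ q ⁻¹ᵁ W') (b : Γ(Y, W')) :
    c.IsFlat W (q.appLE W' W e b) := c.isFlat_res e (h.isFlat W' b)

lemma injective_appLE {W : X.Opens} {W' : Y.Opens} (e : W = q ⁻¹ᵁ W') :
    Function.Injective (q.appLE W' W e.le) := by
  subst e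
  rw [Scheme.Hom.appLE_eq_app]
  exact h.injective W'

lemma exists_appLE_eq {W : X.Opens} {W' : Y.Opens} (e : W = q ⁻¹ᵁ W') {a : Γ(X, W)}
    (ha : c.IsFlat W a) : ∃ b, q.appLE W' W e.le b = a := by
  subst e
  rw [Scheme.Hom.appLE_eq_app]
  exact h.exists_eq W' a ha

/-- The quotient map is surjective on points and injective on functions, hence an epimorphism of
schemes. -/
lemma hom_ext {T : Scheme.{u}} {t t' : Y ⟶ T} (w : q ≫ t = q ≫ t') : t = t' := by
  have hb : t.base = t'.base := by
    ext y
    obtain ⟨x, rfl⟩ := h.isHomeomorph.surjective y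
    exact congrArg (fun φ : X ⟶ T => φ x) w
  refine Scheme.Hom.ext hb fun U => ?_
  ext b
  refine h.injective _ ?_
  have e : t' ⁻¹ᵁ U ≤ t ⁻¹ᵁ U := fun y hy => by
    change t.base y ∈ U
    rw [hb]
    exact hy
  have e₃ : q ⁻¹ᵁ t' ⁻¹ᵁ U ≤ (q ≫ t') ⁻¹ᵁ U := le_rfl
  have h1 := appLE_app (f := q) (g := t) w (q.preimage_mono e) e₃ b
  have h2 := appLE_app (f := q) (g := t') rfl le_rfl e₃ b
  rw [Scheme.Hom.appLE_eq_app] at h2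
  refine Eq.trans ?_ h2.symm
  rw [← h1, ← res_appLE q le_rfl e, Scheme.Hom.appLE_eq_app]
  rfl

/-- The universal property of the quotient. -/
theorem exists_desc {T : Scheme.{u}} (t : X ⟶ T) (ht : ∀ U b, c.IsFlat (t ⁻¹ᵁ U) (t.app U b)) :
    ∃ t' : Y ⟶ T, q ≫ t' = t := by
  let e := h.isHomeomorph.homeomorph q
  let β : Y.toPresheafedSpace.carrier ⟶ T.toPresheafedSpace.carrier :=
    TopCat.ofHom ⟨fun y => t (e.symm y), t.continuous.comp e.symm.continuous⟩
  have hβ : q.base ≫ β = t.base := by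
    ext x
    change t (e.symm (e x)) = t x
    rw [e.symm_apply_apply]
  have hU : ∀ U : T.Opens, t ⁻¹ᵁ U = q ⁻¹ᵁ (TopologicalSpace.Opens.map β).obj U := fun U => by
    ext x
    change t.base x ∈ U ↔ (q.base ≫ β) x ∈ U
    rw [hβ]
  -- A flat function on `X` has a unique preimage on `Y`. Uniqueness makes `φ` a ring homomorphism
  -- compatible with restriction.
  choose φ hφ using fun U b => h.exists_appLE_eq (hU U) (ht U b)
  have hφ' : ∀ {U : T.Opens} {b : Γ(T, U)} {a}, q.appLE _ _ (hU U).le a = t.app U b → φ U b = a :=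
    fun {U b a} ha => h.injective_appLE (hU U) ((hφ U b).trans ha.symm)
  let t₀ : Y.toPresheafedSpace.Hom T.toPresheafedSpace :=
    { base := β
      c :=
        { app := fun U => CommRingCat.ofHom
            { toFun := φ U.unop
              map_one' := hφ' (by simp)
              map_zero' := hφ' (by simp)
              map_add' := fun a b => hφ' (by simp [hφ])
              map_mul' := fun a b => hφ' (by simp [hφ]) }
          naturality := fun U U' i => by
            ext b
            refine hφ' (b := T.presheaf.map i b) ?_
            obtain ⟨U, rfl⟩ := op_surjective U
            obtain ⟨U', rfl⟩ := op_surjective U'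
            have hi : U' ≤ U := i.unop.le
            refine (res_appLE q (hU U').le ((TopologicalSpace.Opens.map β).map i.unop).le _).trans ?_
            refine Eq.trans ?_ (app_res t hi b).symm
            refine Eq.trans ?_ (congrArg (X.presheaf.map (homOfLE (t.preimage_mono hi)).op) (hφ U b))
            exact (appLE_res q (hU U).le (t.preimage_mono hi) _).symm } }
  have K : (show X.toPresheafedSpace ⟶ Y.toPresheafedSpace from q.toLRSHom.toHom) ≫
      (show Y.toPresheafedSpace ⟶ T.toPresheafedSpace from t₀) = t.toLRSHom.toHom := by
    refine PresheafedSpace.Hom.ext _ _ hβ ?_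
    ext U b
    refine Eq.trans ?_ (hφ U b)
    change X.presheaf.map _ (q.app _ (φ U b)) = _
    rfl
  -- Every point of `Y` is the image of a point of `X`, and the stalk maps are local because those
  -- of the composite `t` are.
  let t' : Y ⟶ T :=
    { toHom := t₀
      prop := fun y => by
        obtain ⟨x, rfl⟩ := h.isHomeomorph.surjective y
        exact isLocalHom_stalkMap_of_comp K x (t.toLRSHom.prop x) }
  exact ⟨t', Scheme.Hom.ext' (LocallyRingedSpace.Hom.ext' K)⟩

end IsFlatQuotient

end FlatQuotient

section Decomposition

variable {k : Type u} [CommRing k] {p : ℕ} [Fact p.Prime] [CharP k p] {S : Scheme.{u}}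
  {s : S ⟶ Spec (.of k)} [Smooth s] {X : Scheme.{u}} {f : X ⟶ S} {c : LambdaConnection s 1 f}
  {V : S.Opens} (C : Coordinates p s V)

namespace LambdaConnection

/-- Commutation is integrability together with `[∂_i, ∂_j] = 0`. The vanishing of `p`-th powers is
that of the `p`-curvature together with `∂_i^p = 0`. The mixed relation is the symbol condition for
`λ = 1`. -/
lemma weylModule (hi : c.Integrable) (hp : c.PCurvatureZero p) {W : X.Opens} (h : W ≤ f ⁻¹ᵁ V) :
    WeylModule p (M := Γ(X, W)) (fun i => f.appLE V W h (C.x i))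
      (fun i => ((c.nabla V (C.tangent i)).act W h).toLinearMap.toAddMonoidHom) where
  char := natCast_eq_zero (f ≫ s) p W
  comm i j m := by
    have h1 := congrArg (fun E : VectorField (f ≫ s) (f ⁻¹ᵁ V) => E.act W h m)
      (hi V (C.tangent i) (C.tangent j))
    simp only [C.bracket_tangent, c.nabla_zero, VectorField.bracket_act, VectorField.smul_act,
      VectorField.zero_act] at h1
    exact sub_eq_zero.mp (h1.trans (by simp))
  leibniz i j m := by
    change (c.nabla V (C.tangent i)).act W h (f.appLE V W h (C.x j) * m) =
      f.appLE V W h (C.x j) * (c.nabla V (C.tangent i)).act W h m + _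
    rw [Derivation.leibniz, c.nabla_act_appLE _ le_rfl h, C.tangent_act, C.der_x, map_one]
    split_ifs <;> simp
  iterate_eq_zero i m := by
    have h1 := congrArg (fun E : VectorField (f ≫ s) (f ⁻¹ᵁ V) => E.act W h m) (hp V (C.tangent i))
    simpa only [C.pPow_tangent, c.nabla_zero] using! h1

end LambdaConnection

/-- This is Cartier's decomposition for functions: the Weyl relations give unique flat coefficients,
and flat functions are the functions of `Y`. -/
lemma IsFlatQuotient.monomialBasis {Y : Scheme.{u}} {q : X ⟶ Y} (H : IsFlatQuotient c q)
    (hi : c.Integrable) (hp : c.PCurvatureZero p) {W : X.Opens} {W' : Y.Opens}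
    (h : W ≤ f ⁻¹ᵁ V) (e : W = q ⁻¹ᵁ W') : MonomialBasis p f q C.x W W' h e.le := by
  have hw := c.weylModule C hi hp h
  intro a
  obtain ⟨n, hn, hs⟩ := hw.exists_sum a
  choose b hb using fun I => H.exists_appLE_eq e ((c.isFlat_iff C h (n I)).mpr (hn I))
  refine ⟨b, ?_, fun b' hb' => ?_⟩
  · simp only [hb]
    refine hs.trans (Finset.sum_congr rfl fun I _ => ?_)
    rw [smul_eq_mul]
    congr 1
    exact (map_monom (f.appLE V W h).hom C.x I).symm
  · have h1 := hw.eq_of_sum_eq_sum (n := fun I => q.appLE W' W e.le (b' I)) (n' := n)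
      (fun I => (c.isFlat_iff C h _).mp (H.isFlat_appLE _ _)) hn (by
        rw [← hs, hb']
        refine Finset.sum_congr rfl fun I _ => ?_
        rw [smul_eq_mul]
        congr 1
        exact (map_monom (f.appLE V W h).hom C.x I).symm)
    exact funext fun I => H.injective_appLE e ((congrFun h1 I).trans (hb I).symm)

end Decomposition

end


/-! ### Existence of the quotient -/

noncomputable section

set_option linter.unusedSectionVars false

/-- This is meant for `φ` the restriction to a basic open set, `R` and `R'` the flat functions, and
`x` a `p`-th power. -/
lemma isLocalizationAway_restrict {A B : Type*} [CommRing A] [CommRing B] (φ : A →+* B)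
    (R : Subring A) (R' : Subring B) (hφ : ∀ a ∈ R, φ a ∈ R') (x : R)
    (unit : ∃ v ∈ R', φ x * v = 1) (surj : ∀ b ∈ R', ∃ n, ∃ a ∈ R, φ a = φ x ^ n * b)
    (inj : ∀ a ∈ R, φ a = 0 → ∃ n : ℕ, (x : A) ^ n * a = 0) :
    letI := (φ.restrict R R' hφ).toAlgebra
    IsLocalization.Away x R' := by
  let := (φ.restrict R R' hφ).toAlgebra
  refine ⟨?_, ?_, ?_⟩
  · rintro ⟨_, n, rfl⟩
    obtain ⟨v, hv, h⟩ := unit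
    rw [map_pow]
    exact (IsUnit.of_mul_eq_one (⟨v, hv⟩ : R') (Subtype.ext h)).pow n
  · intro b
    obtain ⟨n, a, ha, h⟩ := surj b b.2
    refine ⟨⟨⟨a, ha⟩, ⟨x ^ n, n, rfl⟩⟩, Subtype.ext ?_⟩
    rw [map_pow, mul_comm]
    exact h.symm
  · intro a a' h
    obtain ⟨n, hn⟩ := inj (a - a' : R) (a - a').2 (by
      have h1 : φ a = φ a' := congrArg Subtype.val h
      simp [h1])
    refine ⟨⟨x ^ n, n, rfl⟩, Subtype.ext (sub_eq_zero.mp ?_)⟩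
    rw [← hn]
    simp [mul_sub]

/-- This identifies the functions on an affine piece of the glued quotient with a ring of flat
functions, and the quotient map with their inclusion. -/
lemma exists_bijective_of_affine {X Y : Scheme.{u}} {q : X ⟶ Y} {U : X.Opens} (hU : IsAffineOpen U)
    {B : CommRingCat.{u}} (φ : B ⟶ Γ(X, U)) (j : Spec B ⟶ Y) [IsOpenImmersion j]
    (w : hU.fromSpec ≫ q = Spec.map φ ≫ j) (e : U ≤ q ⁻¹ᵁ j.opensRange) :
    ∃ ε : Γ(Y, j.opensRange) → B, Function.Bijective ε ∧
      ∀ b, q.appLE j.opensRange U e b = φ (ε b) := by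
  have hj : j ⁻¹ᵁ j.opensRange = ⊤ := j.preimage_opensRange
  have h1 : Function.Bijective (j.appLE j.opensRange ⊤ hj.ge) := by
    have := j.isIso_app j.opensRange le_rfl
    have h2 := ConcreteCategory.bijective_of_isIso (j.app j.opensRange)
    have h3 := ConcreteCategory.bijective_of_isIso ((Spec B).presheaf.map (eqToHom hj.symm).op)
    exact h3.comp h2
  have h2 : ∀ a, hU.fromSpec.appLE U ⊤ hU.fromSpec_preimage_self.ge a =
      (Scheme.ΓSpecIso Γ(X, U)).inv a := fun a => by
    rw [Scheme.Hom.appLE, hU.fromSpec_app_self, Category.assoc, ← Functor.map_comp]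
    exact res_self (X := Spec Γ(X, U)) (U := ⊤) le_rfl _
  have h3 := ConcreteCategory.bijective_of_isIso (Scheme.ΓSpecIso B).hom
  refine ⟨fun b => (Scheme.ΓSpecIso B).hom (j.appLE j.opensRange ⊤ hj.ge b), h3.comp h1,
    fun b => ?_⟩
  refine (ConcreteCategory.bijective_of_isIso (Scheme.ΓSpecIso Γ(X, U)).inv).1 ?_
  have e₃ : ⊤ ≤ (hU.fromSpec ≫ q) ⁻¹ᵁ j.opensRange :=
    hU.fromSpec_preimage_self.ge.trans (hU.fromSpec.preimage_mono e)
  rw [← h2, appLE_appLE rfl e hU.fromSpec_preimage_self.ge e₃,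
    ← appLE_appLE w.symm hj.ge le_top e₃]
  set b' := j.appLE j.opensRange ⊤ hj.ge b
  have h4 := congrArg (fun ψ => ψ.hom ((Scheme.ΓSpecIso B).hom b'))
    (Scheme.ΓSpecIso_inv_naturality φ)
  refine Eq.trans ?_ h4.symm
  change _ = (Spec.map φ).appTop ((Scheme.ΓSpecIso B).inv ((Scheme.ΓSpecIso B).hom b'))
  rw [Iso.hom_inv_id_apply]
  exact res_self (X := Spec Γ(X, U)) (U := ⊤) le_rfl _

section Existence

open Scheme.AffineZariskiSite

variable {k : Type u} [CommRing k] {p : ℕ} [Fact p.Prime] [CharP k p] {S : Scheme.{u}}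
  {s : S ⟶ Spec (.of k)} [Smooth s] {lam : k} {X : Scheme.{u}} {f : X ⟶ S}
  (c : LambdaConnection s lam f)

namespace LambdaConnection

/-- The presheaf of rings of flat functions. -/
def flatPresheaf : X.Opensᵒᵖ ⥤ CommRingCat where
  obj U := .of (c.flatSubring U.unop)
  map {U U'} i := CommRingCat.ofHom
    ((X.presheaf.map (homOfLE i.unop.le).op).hom.restrict (c.flatSubring U.unop)
      (c.flatSubring U'.unop) fun _ ha => c.isFlat_res i.unop.le ha)
  map_id U := by
    refine CommRingCat.hom_ext (RingHom.ext fun a => Subtype.ext ?_)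
    exact res_self (X := X) _ _
  map_comp {U V W} i j := by
    refine CommRingCat.hom_ext (RingHom.ext fun a => Subtype.ext ?_)
    exact (res_res (X := X) i.unop.le j.unop.le _).symm

/-- The inclusion of the flat functions. -/
def flatInclusion : c.flatPresheaf ⟶ X.presheaf where
  app U := CommRingCat.ofHom (c.flatSubring U.unop).subtype
  naturality U V i := by
    ext a
    rfl

variable (p) in
/-- The `p`-th power map into the flat functions. -/
def flatPow : X.presheaf ⟶ c.flatPresheaf where
  app U := CommRingCat.ofHom ((powHom p (natCast_eq_zero (f ≫ s) p U.unop)).codRestrict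
    (c.flatSubring U.unop) fun a => c.isFlat_pow_p a)
  naturality U V i := by
    ext a
    exact Subtype.ext (map_pow (X.presheaf.map i).hom a p).symm

-- In a chart each `∇(∂_j) b` vanishes on the basic open set of `a`, hence is killed by a power of
-- `a`. As `∇` is linear over `p`-th powers, multiplying `b` by a large power of `a^p` makes it
-- flat. Quasi-compactness of `U` gives one exponent for all charts.
include p in
lemma exists_isFlat_pow_mul {U : X.Opens} (hU : IsAffineOpen U) (a b : Γ(X, U))
    (h : c.IsFlat (X.basicOpen a) (X.presheaf.map (homOfLE (X.basicOpen_le a)).op b)) :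
    ∃ n : ℕ, c.IsFlat U ((a ^ p) ^ n * b) := by
  have mono : ∀ {W : X.Opens} (i : W ≤ U) {n m : ℕ}, n ≤ m →
      c.IsFlat W (X.presheaf.map (homOfLE i).op ((a ^ p) ^ n * b)) →
      c.IsFlat W (X.presheaf.map (homOfLE i).op ((a ^ p) ^ m * b)) := by
    intro W i n m hnm hn
    obtain ⟨r, rfl⟩ := Nat.exists_eq_add_of_le' hnm
    rw [pow_add, mul_assoc, map_mul, map_pow, map_pow]
    exact (c.flatSubring W).mul_mem ((c.flatSubring W).pow_mem (c.isFlat_pow_p _) r) hn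
  have key : ∃ (W : X.Opens) (i : W ≤ U) (n : ℕ), (U : Set X) ⊆ W ∧
      c.IsFlat W (X.presheaf.map (homOfLE i).op ((a ^ p) ^ n * b)) := by
    have hc : IsCompact (U : Set X) := hU.isCompact
    refine hc.induction_on (p := fun Z => ∃ (W : X.Opens) (i : W ≤ U) (n : ℕ), Z ⊆ W ∧
      c.IsFlat W (X.presheaf.map (homOfLE i).op ((a ^ p) ^ n * b))) ?_ ?_ ?_ ?_
    · exact ⟨⊥, bot_le, 0, Set.empty_subset _, c.isFlat_of_locally fun y hy => hy.elim⟩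
    · rintro Z Z' hZ ⟨W, i, n, h1, h2⟩
      exact ⟨W, i, n, hZ.trans h1, h2⟩
    · rintro Z Z' ⟨W, i, n, h1, h2⟩ ⟨W', i', n', h1', h2'⟩
      refine ⟨W ⊔ W', sup_le i i', max n n', Set.union_subset_union h1 h1',
        c.isFlat_of_locally fun y hy => ?_⟩
      rcases hy with hy | hy
      · refine ⟨W, le_sup_left, hy, ?_⟩
        rw [res_res]
        exact mono i (le_max_left _ _) h2
      · refine ⟨W', le_sup_right, hy, ?_⟩
        rw [res_res]
        exact mono i' (le_max_right _ _) h2'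
    · intro y hy
      obtain ⟨V, -, hyV, ⟨C⟩⟩ := exists_coordinates_nhds p s (show f y ∈ (⊤ : S.Opens) from trivial)
      obtain ⟨W, hW, hyW, hWU⟩ := exists_affine_le (U := U ⊓ f ⁻¹ᵁ V) ⟨hy, hyV⟩
      have i : W ≤ U := hWU.trans inf_le_left
      have hV : W ≤ f ⁻¹ᵁ V := hWU.trans inf_le_right
      set a' := X.presheaf.map (homOfLE i).op a with ha'
      set b' := X.presheaf.map (homOfLE i).op b with hb'
      have hle : X.basicOpen a' ≤ X.basicOpen a := by
        rw [ha', X.basicOpen_res]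
        exact inf_le_right
      have h0 : ∀ j, ∃ n : ℕ, a' ^ n * (c.nabla V (C.tangent j)).act W hV b' = 0 := by
        intro j
        refine exists_pow_mul_eq_zero_of_res_basicOpen_eq_zero_of_isCompact X hW.isCompact _ a' ?_
        have h1 := c.isFlat_res hle h V (C.tangent j) (X.basicOpen a')
          ((X.basicOpen_le a').trans hV) le_rfl
        rw [res_res, res_res, ← res_res i (X.basicOpen_le a'),
          VectorField.act_res _ _ _ hV (X.basicOpen_le a')] at h1
        exact h1
      choose n hn using h0
      let N := ∑ j, n j
      refine ⟨W, mem_nhdsWithin_of_mem_nhds (W.2.mem_nhds hyW), W, i, N, subset_rfl, ?_⟩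
      rw [map_mul, map_pow, map_pow, c.isFlat_iff C hV]
      intro j
      rw [Derivation.leibniz, ← pow_mul, mul_comm p, pow_mul,
        derivation_pow_p _ (natCast_eq_zero (f ≫ s) p W), smul_zero, add_zero, smul_eq_mul]
      have hle : n j ≤ N * p := (Finset.single_le_sum (fun _ _ => Nat.zero_le _)
        (Finset.mem_univ j)).trans (Nat.le_mul_of_pos_right _ (Fact.out : p.Prime).pos)
      obtain ⟨r, hr⟩ := Nat.exists_eq_add_of_le' hle
      rw [← pow_mul, hr, pow_add, mul_assoc, hn, mul_zero]
  obtain ⟨W, i, n, hUW, hn⟩ := key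
  obtain rfl : W = U := le_antisymm i hUW
  exact ⟨n, by simpa using hn⟩

/-- Since `r` need not be flat, the localization is at `r^p`, which is flat and has the same basic
open set. Denominators are cleared by `exists_isFlat_pow_mul`. -/
lemma isLocalizationAway_flat {U : X.Opens} (hU : IsAffineOpen U) (r : Γ(X, U)) :
    letI := (c.flatPresheaf.map (homOfLE (X.basicOpen_le r)).op).hom.toAlgebra
    IsLocalization.Away ((c.flatPow p).app (op U) r) (c.flatPresheaf.obj (op (X.basicOpen r))) := by
  refine isLocalizationAway_restrict (X.presheaf.map (homOfLE (X.basicOpen_le r)).op).hom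
    (c.flatSubring U) (c.flatSubring (X.basicOpen r))
    (fun _ ha => c.isFlat_res (X.basicOpen_le r) ha) ⟨r ^ p, c.isFlat_pow_p r⟩ ?_ ?_ ?_
  · obtain ⟨v, hv⟩ : ∃ v : Γ(X, X.basicOpen r),
        X.presheaf.map (homOfLE (X.basicOpen_le r)).op r * v = 1 :=
      (RingedSpace.isUnit_res_basicOpen X.toRingedSpace r).exists_right_inv
    refine ⟨v ^ p, c.isFlat_pow_p v, ?_⟩
    rw [map_pow, ← mul_pow]
    exact (congrArg (· ^ p) hv).trans (one_pow p)
  · intro b hb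
    obtain ⟨n, a, ha⟩ := exists_eq_pow_mul_of_isAffineOpen X U hU r b
    replace ha : X.presheaf.map (homOfLE (X.basicOpen_le r)).op a =
      X.presheaf.map (homOfLE (X.basicOpen_le r)).op r ^ n * b := ha
    -- The extra factor `r^(n(p-1))` turns the denominator `r^n` into the flat denominator
    -- `(r^p)^n`.
    have h1 : X.presheaf.map (homOfLE (X.basicOpen_le r)).op (r ^ (n * (p - 1)) * a) =
        (X.presheaf.map (homOfLE (X.basicOpen_le r)).op r ^ p) ^ n * b := by
      rw [map_mul, ha, map_pow, ← mul_assoc, ← pow_add, ← pow_mul]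
      congr 2
      obtain ⟨m, hm⟩ := Nat.exists_eq_succ_of_ne_zero (Fact.out : p.Prime).ne_zero
      rw [hm, Nat.succ_sub_one, Nat.succ_mul, Nat.mul_comm, Nat.add_comm]
    obtain ⟨m, hm⟩ := c.exists_isFlat_pow_mul (p := p) hU r (r ^ (n * (p - 1)) * a) (by
      rw [h1]
      exact (c.flatSubring _).mul_mem ((c.flatSubring _).pow_mem (c.isFlat_pow_p _) n) hb)
    refine ⟨m + n, _, hm, ?_⟩
    change X.presheaf.map (homOfLE (X.basicOpen_le r)).op _ =
      X.presheaf.map (homOfLE (X.basicOpen_le r)).op (r ^ p) ^ (m + n) * b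
    rw [map_mul, h1, map_pow, map_pow]
    ring
  · intro a _ h
    obtain ⟨n, hn⟩ := exists_pow_mul_eq_zero_of_res_basicOpen_eq_zero_of_isCompact X hU.isCompact
      a r h
    refine ⟨n, ?_⟩
    change (r ^ p) ^ n * a = 0
    rw [← pow_mul, mul_comm p, pow_mul]
    obtain ⟨m, hm⟩ := Nat.exists_eq_succ_of_ne_zero (Fact.out : p.Prime).ne_zero
    rw [hm, pow_succ, mul_assoc, hn, mul_zero]

-- Through `a ↦ a^p` the flat functions form an `𝒪_X`-algebra, and the localization property makes
-- it quasi-coherent. So its affine spectra glue to a scheme over `X`.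
variable (p) in
lemma coequifibered_flatPow :
    ((toOpensFunctor X).op.whiskerLeft (c.flatPow p)).Coequifibered :=
  coequifibered_iff_forall_isLocalizationAway.mpr fun U r => c.isLocalizationAway_flat U.2 r

variable (p) in
/-- The gluing datum of the spectra of the rings of flat functions. -/
def flatGluingData : (directedCover X).RelativeGluingData :=
  relativeGluingData (c.coequifibered_flatPow p)

instance : ((c.flatGluingData p).functor ⋙ Scheme.forget).IsLocallyDirected :=
  Scheme.Cover.RelativeGluingData.instIsLocallyDirectedI₀CompFunctorForgetOfIsThin _

variable (p) in
/-- The quotient of `X` by the foliation: its functions are the flat functions. -/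
def quotient : Scheme.{u} := (c.flatGluingData p).glued

variable (p) in
/-- The natural map from the quotient, through which the absolute Frobenius factors. -/
def quotientFrob : c.quotient p ⟶ X := (c.flatGluingData p).toBase

variable (p) in
/-- The affine pieces of the quotient. -/
def quotientι (U : X.AffineZariskiSite) : Spec (c.flatPresheaf.obj (op U.1)) ⟶ c.quotient p :=
  colimit.ι (c.flatGluingData p).functor U

variable (p) in
/-- The projection to the quotient. -/
def quotientMk : X ⟶ c.quotient p :=
  (isColimitCocone X).desc
    { pt := c.quotient p
      ι := Functor.whiskerLeft (toOpensFunctor X)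
          (Functor.whiskerRight c.flatInclusion.rightOp Scheme.Spec) ≫
        (colimit.cocone (c.flatGluingData p).functor).ι }

lemma fromSpec_quotientMk (U : X.AffineZariskiSite) :
    U.2.fromSpec ≫ c.quotientMk p = Spec.map (c.flatInclusion.app (op U.1)) ≫ c.quotientι p U :=
  (isColimitCocone X).fac _ U

lemma quotientι_frob (U : X.AffineZariskiSite) :
    c.quotientι p U ≫ c.quotientFrob p = Spec.map ((c.flatPow p).app (op U.1)) ≫ U.2.fromSpec := by
  exact ((c.flatGluingData p).ι_toBase U).trans (Category.assoc _ _ _)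

instance (U : X.AffineZariskiSite) : IsOpenImmersion (c.quotientι p U) :=
  inferInstanceAs (IsOpenImmersion (colimit.ι (c.flatGluingData p).functor U))

lemma quotientFrob_preimage (U : X.AffineZariskiSite) :
    c.quotientFrob p ⁻¹ᵁ U.1 = (c.quotientι p U).opensRange := by
  have h := (c.flatGluingData p).toBase_preimage_eq_opensRange_ι U
  exact (congrArg (fun W => (c.flatGluingData p).toBase ⁻¹ᵁ W)
    (Scheme.Opens.opensRange_ι U.1).symm).trans h

/-- On functions the composite is `a ↦ a^p`, so it fixes every prime ideal. -/
lemma quotientFrob_quotientMk (x : X) : c.quotientFrob p (c.quotientMk p x) = x := by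
  obtain ⟨W, hW, hx, -⟩ := exists_affine_le (show x ∈ (⊤ : X.Opens) from trivial)
  let U : X.AffineZariskiSite := ⟨W, hW⟩
  have hx' : x ∈ hW.fromSpec.opensRange := by rwa [hW.opensRange_fromSpec]
  obtain ⟨y, rfl⟩ := hx'
  have h1 := c.fromSpec_quotientMk (p := p) U
  have h2 := c.quotientι_frob (p := p) U
  have h3 : hW.fromSpec ≫ c.quotientMk p ≫ c.quotientFrob p =
      Spec.map ((c.flatPow p).app (op W) ≫ c.flatInclusion.app (op W)) ≫ hW.fromSpec := by
    rw [Spec.map_comp, Category.assoc, ← h2, ← Category.assoc, ← Category.assoc]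
    exact congrArg (· ≫ c.quotientFrob p) h1
  have h4 : Spec.map ((c.flatPow p).app (op W) ≫ c.flatInclusion.app (op W)) y = y := by
    refine PrimeSpectrum.ext (Ideal.ext fun a => ?_)
    exact y.2.pow_mem_iff_mem p (Fact.out : p.Prime).pos
  have h5 := congrArg (fun ψ : Spec Γ(X, W) ⟶ X => ψ y) h3
  refine h5.trans ?_
  exact congrArg hW.fromSpec h4

lemma quotientMk_preimage (U : X.Opens) :
    c.quotientMk p ⁻¹ᵁ c.quotientFrob p ⁻¹ᵁ U = U := by
  ext x
  change c.quotientFrob p (c.quotientMk p x) ∈ U ↔ x ∈ U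
  rw [quotientFrob_quotientMk]

lemma app_quotientMk (U : X.AffineZariskiSite) :
    ∃ ε : Γ(c.quotient p, c.quotientFrob p ⁻¹ᵁ U.1) → c.flatSubring U.1, Function.Bijective ε ∧
      ∀ b, (c.quotientMk p).appLE (c.quotientFrob p ⁻¹ᵁ U.1) U.1
        (c.quotientMk_preimage U.1).ge b = (ε b : Γ(X, U.1)) := by
  have H := exists_bijective_of_affine U.2 (c.flatInclusion.app (op U.1)) (c.quotientι p U)
    (c.fromSpec_quotientMk U)
  have key : ∀ (W : (c.quotient p).Opens) (_ : W = (c.quotientι p U).opensRange)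
      (e : U.1 ≤ c.quotientMk p ⁻¹ᵁ W), ∃ ε : Γ(c.quotient p, W) → c.flatSubring U.1,
      Function.Bijective ε ∧ ∀ b, (c.quotientMk p).appLE W U.1 e b = (ε b : Γ(X, U.1)) := by
    rintro _ rfl e
    exact H e
  exact key _ (c.quotientFrob_preimage U) _

lemma isAffineOpen_quotientFrob (U : X.AffineZariskiSite) :
    IsAffineOpen (c.quotientFrob p ⁻¹ᵁ U.1) := by
  rw [c.quotientFrob_preimage U]
  exact isAffineOpen_opensRange _

/-- Over affine open sets of `X` the functions of the quotient are the flat functions by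
construction. The map is a homeomorphism because flat functions contain all `p`-th powers, so these
open sets form a basis on either side. -/
theorem isFlatQuotient_quotientMk : IsFlatQuotient c (c.quotientMk p) := by
  have key : ∀ U : X.Opens, IsAffineOpen U → ∀ (U' : X.Opens) (e : U' = U)
      (e' : U' ≤ c.quotientMk p ⁻¹ᵁ c.quotientFrob p ⁻¹ᵁ U),
      Function.Injective ((c.quotientMk p).appLE (c.quotientFrob p ⁻¹ᵁ U) U' e') ∧
      (∀ b, c.IsFlat U' ((c.quotientMk p).appLE (c.quotientFrob p ⁻¹ᵁ U) U' e' b)) ∧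
      ∀ a, c.IsFlat U' a → ∃ b, (c.quotientMk p).appLE (c.quotientFrob p ⁻¹ᵁ U) U' e' b = a := by
    rintro _ hU U rfl e'
    obtain ⟨ε, h1, h2⟩ := c.app_quotientMk (p := p) ⟨U, hU⟩
    refine ⟨fun b b' hb => h1.1 (Subtype.ext ?_), fun b => ?_, fun a ha => ?_⟩
    · rw [← h2, ← h2]
      exact hb
    · rw [h2]
      exact (ε b).2
    · obtain ⟨b, hb⟩ := h1.2 ⟨a, ha⟩
      exact ⟨b, (h2 b).trans (congrArg Subtype.val hb)⟩
  have key' : ∀ U : X.Opens, IsAffineOpen U →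
      Function.Injective ((c.quotientMk p).app (c.quotientFrob p ⁻¹ᵁ U)) ∧
      (∀ b, c.IsFlat _ ((c.quotientMk p).app (c.quotientFrob p ⁻¹ᵁ U) b)) ∧
      ∀ a, c.IsFlat _ a → ∃ b, (c.quotientMk p).app (c.quotientFrob p ⁻¹ᵁ U) b = a := by
    intro U hU
    have := key U hU _ (c.quotientMk_preimage U) le_rfl
    rwa [Scheme.Hom.appLE_eq_app] at this
  have hq : IsHomeomorph (c.quotientMk p) := by
    refine isHomeomorph_of_pow _ (Fact.out : p.Prime).pos fun y => ?_
    obtain ⟨U, hU, hy, -⟩ :=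
      exists_affine_le (show c.quotientFrob p y ∈ (⊤ : X.Opens) from trivial)
    obtain ⟨h1, -, h3⟩ := key' U hU
    refine ⟨c.quotientFrob p ⁻¹ᵁ U, hy, ?_, ?_, h1, fun a => ?_⟩
    · exact c.isAffineOpen_quotientFrob ⟨U, hU⟩
    · rwa [quotientMk_preimage]
    · obtain ⟨b, hb⟩ := h3 (a ^ p) (c.isFlat_pow_p a)
      exact ⟨b, hb.symm⟩
  refine IsFlatQuotient.of_basis hq fun y W hy => ?_
  obtain ⟨x, rfl⟩ := hq.surjective y
  obtain ⟨U, hU, hx, hle⟩ := exists_affine_le (U := c.quotientMk p ⁻¹ᵁ W) hy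
  refine ⟨c.quotientFrob p ⁻¹ᵁ U, ?_, fun z hz => ?_, key' U hU⟩
  · change c.quotientFrob p (c.quotientMk p x) ∈ U
    rwa [quotientFrob_quotientMk]
  · obtain ⟨x', rfl⟩ := hq.surjective z
    change c.quotientFrob p (c.quotientMk p x') ∈ U at hz
    rw [quotientFrob_quotientMk] at hz
    exact hle hz

end LambdaConnection

end Existence

end


/-! ### The canonical connection of a Frobenius pullback -/

noncomputable section

set_option linter.unusedSectionVars false

namespace VectorField

/-- The value of the glued field on a function is glued from the values of the local fields; local
uniqueness makes these agree on overlaps. -/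
theorem exists_glue {k : Type u} [CommRing k] {X : Scheme.{u}} {x : X ⟶ Spec (.of k)} {U : X.Opens}
    (P : ∀ W : X.Opens, W ≤ U → VectorField x W → Prop)
    (res : ∀ (W W' : X.Opens) (h : W ≤ U) (i : W' ≤ W) (E : VectorField x W), P W h E →
      P W' (i.trans h) (E.res i))
    (uniq : ∀ (W : X.Opens) (h : W ≤ U) (E E' : VectorField x W), P W h E → P W h E' → E = E')
    (loc : ∀ y ∈ U, ∃ (W : X.Opens) (h : W ≤ U), y ∈ W ∧ ∃ E, P W h E) :
    ∃ E : VectorField x U, ∀ y ∈ U, ∃ (W : X.Opens) (h : W ≤ U), y ∈ W ∧ P W h (E.res h) := by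
  have key : ∀ (W : X.Opens) (h : W ≤ U) (a : Γ(X, W)), ∃ b : Γ(X, W),
      ∀ (W' : X.Opens) (i : W' ≤ W) (E : VectorField x W'), P W' (i.trans h) E →
        X.presheaf.map (homOfLE i).op b =
          E.act W' le_rfl (X.presheaf.map (homOfLE i).op a) := by
    intro W h a
    obtain ⟨b, hb⟩ := exists_section (X := X) (U := W)
      (fun W' i b => ∃ E, P W' (i.trans h) E ∧
        b = E.act W' le_rfl (X.presheaf.map (homOfLE i).op a))
      (fun W₁ W₂ h₁ i b ⟨E, hE, hb⟩ => ⟨E.res i, res _ _ _ _ _ hE, by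
        rw [hb, res_act, ← E.act_res _ _ _ i, res_res]⟩)
      (fun W' i b b' ⟨E, hE, hb⟩ ⟨E', hE', hb'⟩ => by
        rw [hb, hb', uniq _ _ E E' hE hE'])
      (fun y hy => by
        obtain ⟨W', h', hy', E, hE⟩ := loc y (h hy)
        exact ⟨W ⊓ W', inf_le_left, ⟨hy, hy'⟩, _, E.res inf_le_right,
          res _ _ h' inf_le_right _ hE, rfl⟩)
    refine ⟨b, fun W' i E hE => sections_ext _ _ fun y hy => ?_⟩
    obtain ⟨W₁, i₁, hy₁, E₁, hE₁, hb₁⟩ := hb y (i hy)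
    refine ⟨W' ⊓ W₁, inf_le_left, ⟨hy, hy₁⟩, ?_⟩
    have h1 := congrArg (X.presheaf.map (homOfLE (inf_le_right : W' ⊓ W₁ ≤ W₁)).op) hb₁
    rw [res_res, ← E₁.act_res _ _ _ inf_le_right, res_res] at h1
    rw [res_res, ← E.act_res _ _ _ inf_le_left, res_res, h1]
    exact congrArg (fun G : VectorField x (W' ⊓ W₁) => G.act _ le_rfl
      (X.presheaf.map (homOfLE (inf_le_left.trans i)).op a))
      (uniq _ _ (E₁.res inf_le_right) (E.res inf_le_left) (res _ _ _ _ _ hE₁) (res _ _ _ _ _ hE))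
  choose φ hφ using key
  -- To identify a value of `φ` it suffices to compare with the local fields; all the axioms of a
  -- vector field are checked this way.
  have hφ' : ∀ (W : X.Opens) (h : W ≤ U) (a b : Γ(X, W)),
      (∀ (W' : X.Opens) (i : W' ≤ W) (E : VectorField x W'), P W' (i.trans h) E →
        E.act W' le_rfl (X.presheaf.map (homOfLE i).op a) = X.presheaf.map (homOfLE i).op b) →
      φ W h a = b := by
    intro W h a b H
    refine sections_ext _ _ fun y hy => ?_
    obtain ⟨W', h', hy', E, hE⟩ := loc y (h hy)
    have hE' := res _ _ h' (inf_le_right : W ⊓ W' ≤ W') _ hE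
    exact ⟨W ⊓ W', inf_le_left, ⟨hy, hy'⟩,
      (hφ W h a _ inf_le_left _ hE').trans (H _ inf_le_left _ hE')⟩
  let E : VectorField x U :=
    { act := fun W h => Derivation.mk' (AddMonoidHom.mk' (φ W h) fun a b =>
        hφ' W h _ _ fun W' i E hE => by
          rw [map_add, map_add, map_add, hφ W h a W' i E hE, hφ W h b W' i E hE]).toIntLinearMap
        fun a b => hφ' W h _ _ fun W' i E hE => by
          change _ = X.presheaf.map _ (a * φ W h b + b * φ W h a)
          rw [map_mul, Derivation.leibniz, map_add, map_mul, map_mul, hφ W h a W' i E hE,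
            hφ W h b W' i E hE]
          rfl
      act_const := fun W h c => hφ' W h _ _ fun W' i E hE => by
        rw [res_const, E.act_const, map_zero]
      act_res := fun W W' h i a => hφ' W' _ _ _ fun W₁ j E hE => by
        rw [res_res]
        refine (hφ W h a W₁ (j.trans i) E hE).symm.trans ?_
        exact (res_res i j _).symm }
  refine ⟨E, fun y hy => ?_⟩
  obtain ⟨W', h', hy', E', hE'⟩ := loc y hy
  refine ⟨W', h', hy', ?_⟩
  have : E.res h' = E' := ext_apply fun W i a => hφ' W _ _ _ fun W₁ j E₁ hE₁ => by
    rw [← E'.act_res _ _ _ j]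
    exact congrArg (fun G : VectorField x W₁ => G.act _ le_rfl _)
      (uniq _ _ E₁ (E'.res (j.trans i)) hE₁ (res _ _ _ _ _ hE'))
  rwa [this]

section Lift

variable {k : Type u} [CommRing k] {p : ℕ} [Fact p.Prime] [CharP k p] {S : Scheme.{u}}
  {s : S ⟶ Spec (.of k)} {T Y : Scheme.{u}} {f : T ⟶ S} {q : T ⟶ Y} {t : T ⟶ Spec (.of k)}

/-- The vector field `E` on `T` lifts the vector field `D` on `S` and kills the functions of
`Y`. -/
structure IsLift (f : T ⟶ S) (q : T ⟶ Y) {V : S.Opens} (D : VectorField s V) {U : T.Opens}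
    (E : VectorField t U) : Prop where
  act_left : ∀ (W : T.Opens) (i : W ≤ U) (V' : S.Opens) (hV : V' ≤ V) (h : W ≤ f ⁻¹ᵁ V') (a),
    E.act W i (f.appLE V' W h a) = f.appLE V' W h (D.act V' hV a)
  act_right : ∀ (W : T.Opens) (i : W ≤ U) (W' : Y.Opens) (h : W ≤ q ⁻¹ᵁ W') (b),
    E.act W i (q.appLE W' W h b) = 0

namespace IsLift

variable {V : S.Opens} {D D' : VectorField s V} {U : T.Opens} {E E' : VectorField t U}

lemma res (h : IsLift f q D E) {V' : S.Opens} {U' : T.Opens} (j : V' ≤ V) (i : U' ≤ U) :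
    IsLift f q (D.res j) (E.res i) :=
  ⟨fun W i' V₁ hV => h.act_left W (i'.trans i) V₁ (hV.trans j),
    fun W i' => h.act_right W (i'.trans i)⟩

lemma res_right (h : IsLift f q D E) {U' : T.Opens} (i : U' ≤ U) : IsLift f q D (E.res i) :=
  ⟨fun W i' => h.act_left W (i'.trans i), fun W i' => h.act_right W (i'.trans i)⟩

lemma of_locally (H : ∀ y ∈ U, ∃ (W : T.Opens) (h : W ≤ U), y ∈ W ∧ IsLift f q D (E.res h)) :
    IsLift f q D E := by
  constructor
  · intro W i V' hV h a
    refine E.act_locally _ fun y hy => ?_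
    obtain ⟨W', h', hy', H⟩ := H y (i hy)
    refine ⟨W ⊓ W', inf_le_left, ⟨hy, hy'⟩, ?_⟩
    rw [appLE_res, appLE_res]
    exact H.act_left _ inf_le_right _ hV _ _
  · intro W i W₁ h b
    refine E.act_locally _ fun y hy => ?_
    obtain ⟨W', h', hy', H⟩ := H y (i hy)
    refine ⟨W ⊓ W', inf_le_left, ⟨hy, hy'⟩, ?_⟩
    rw [appLE_res, map_zero]
    exact H.act_right _ inf_le_right _ _ _

lemma add (h : IsLift f q D E) (h' : IsLift f q D' E') : IsLift f q (D + D') (E + E') :=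
  ⟨fun W i V' hV hW a => by
    simp only [add_act, Derivation.add_apply, map_add, h.act_left W i V' hV hW,
      h'.act_left W i V' hV hW],
  fun W i W' hW b => by
    simp only [add_act, Derivation.add_apply, h.act_right W i W' hW, h'.act_right W i W' hW,
      add_zero]⟩

lemma smul (h : IsLift f q D E) (b : Γ(S, V)) (hU : U ≤ f ⁻¹ᵁ V) :
    IsLift f q (b • D) ((f.appLE V U hU b) • E) :=
  ⟨fun W i V' hV hW a => by
    rw [smul_act, smul_act, map_mul, h.act_left W i V' hV hW, appLE_res, res_appLE],
  fun W i W' hW b => by rw [smul_act, h.act_right W i W' hW, mul_zero]⟩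

lemma bracket (h : IsLift f q D E) (h' : IsLift f q D' E') : IsLift f q ⁅D, D'⁆ ⁅E, E'⁆ :=
  ⟨fun W i V' hV hW a => by
    simp only [bracket_act, map_sub, h.act_left W i V' hV hW, h'.act_left W i V' hV hW],
  fun W i W' hW b => by
    simp only [bracket_act, h.act_right W i W' hW, h'.act_right W i W' hW, map_zero, sub_zero]⟩

lemma pPow (h : IsLift f q D E) : IsLift f q (D.pPow p) (E.pPow p) :=
  ⟨fun W i V' hV hW a => by
    rw [pPow_act, pPow_act]
    exact (Function.Semiconj.iterate_right (f := fun a : Γ(S, V') => f.appLE V' W hW a)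
      (fun a => (h.act_left W i V' hV hW a).symm) p a).symm,
  fun W i W' hW b => by
    rw [pPow_act]
    obtain ⟨m, hm⟩ := Nat.exists_eq_succ_of_ne_zero (Fact.out : p.Prime).ne_zero
    rw [hm, Function.iterate_succ_apply, h.act_right W i W' hW]
    exact Function.iterate_fixed (map_zero _) m⟩

variable [Smooth s] {g : Y ⟶ frobTwist p s}

/-- The functions on which `E` lifts `D` form a subring. It contains the coordinates by `hx`, and
the functions of `S'` because both fields kill them; the monomial basis shows that these generate.
-/
lemma of_coordinates (w : f ≫ relFrob p s = q ≫ g)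
    {V₀ : S.Opens} (C : Coordinates p s V₀) (hV : V₀ ≤ V) (hU : U ≤ f ⁻¹ᵁ V₀)
    (hx : ∀ j, E.act U le_rfl (f.appLE V₀ U hU (C.x j)) =
      f.appLE V₀ U hU (D.act V₀ hV (C.x j)))
    (hr : ∀ (W : T.Opens) (i : W ≤ U) (W' : Y.Opens) (h : W ≤ q ⁻¹ᵁ W') (b),
      E.act W i (q.appLE W' W h b) = 0) : IsLift f q D E := by
  refine ⟨fun W i V' hV' h a => ?_, hr⟩
  let V₁ := V' ⊓ V₀
  have hV₁ : V₁ ≤ V := inf_le_left.trans hV'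
  have h₁ : W ≤ f ⁻¹ᵁ V₁ := le_inf h (i.trans hU)
  let R : Subring Γ(S, V₁) :=
    { carrier := {a | E.act W i (f.appLE V₁ W h₁ a) = f.appLE V₁ W h₁ (D.act V₁ hV₁ a)}
      mul_mem' := fun {a b} ha hb => by
        rw [Set.mem_ofPred_eq] at *
        simp only [map_mul, map_add, Derivation.leibniz, smul_eq_mul, ha, hb]
      one_mem' := by simp
      add_mem' := fun {a b} ha hb => by
        rw [Set.mem_ofPred_eq] at *
        simp only [map_add, ha, hb]
      zero_mem' := by simp
      neg_mem' := fun {a} ha => by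
        rw [Set.mem_ofPred_eq] at *
        simp only [map_neg, ha] }
  have hR : ∀ a, a ∈ R := fun a => by
    obtain ⟨c, hc, -⟩ := monomialBasis_of_eq (isPullback_relFrob p s) C V₁ _ inf_le_right
      (preimage_imageOpen (isHomeomorph_relFrob p s) V₁) a
    rw [hc]
    refine R.sum_mem fun I _ => R.mul_mem ?_ ?_
    · change ((𝟙 S : S ⟶ S).appLE V₀ V₁ inf_le_right).hom (monom C.x I) ∈ R
      rw [map_monom]
      refine monom_mem (fun j => ?_) I
      change E.act W i (f.appLE V₁ W h₁ (S.presheaf.map (homOfLE inf_le_right).op (C.x j))) =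
        f.appLE V₁ W h₁ (D.act V₁ hV₁ (S.presheaf.map (homOfLE inf_le_right).op (C.x j)))
      rw [D.act_res _ _ hV inf_le_right, res_appLE, res_appLE, ← appLE_res f hU i,
        ← appLE_res f hU i, E.act_res _ _ le_rfl i, hx]
    · change E.act W i (f.appLE V₁ W h₁ ((relFrob p s).appLE _ V₁ _ (c I))) =
        f.appLE V₁ W h₁ (D.act V₁ hV₁ ((relFrob p s).appLE _ V₁ _ (c I)))
      have e₃ : W ≤ (f ≫ relFrob p s) ⁻¹ᵁ imageOpen (isHomeomorph_relFrob p s) V₁ :=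
        h₁.trans (f.preimage_mono (preimage_imageOpen (isHomeomorph_relFrob p s) V₁).le)
      have e₄ : W ≤ q ⁻¹ᵁ g ⁻¹ᵁ imageOpen (isHomeomorph_relFrob p s) V₁ := by
        rw [← Scheme.Hom.comp_preimage, ← w]
        exact e₃
      rw [D.act_relFrob, map_zero, appLE_appLE rfl _ _ e₃, ← appLE_app w.symm e₄ e₃, hr]
  have h2 := hR (S.presheaf.map (homOfLE inf_le_left).op a)
  change E.act W i (f.appLE V₁ W h₁ _) = f.appLE V₁ W h₁ (D.act V₁ hV₁ _) at h2
  rwa [D.act_res _ _ hV' inf_le_left, res_appLE, res_appLE] at h2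

variable (H : IsPullback f q (relFrob p s) g)
include H

/-- On a chart `𝒪_T` is generated over `𝒪_Y` by coordinates, so a lift is determined by the values
prescribed on both. -/
lemma unique (hU : U ≤ f ⁻¹ᵁ V) (h : IsLift f q D E) (h' : IsLift f q D E') : E = E' := by
  refine ext_apply fun W i a => E.act_locally _ fun y hy => ?_
  obtain ⟨V₀, hV, hyV, ⟨C⟩⟩ := exists_coordinates_nhds p s (hU (i hy))
  refine ⟨W ⊓ f ⁻¹ᵁ V₀, inf_le_left, ⟨hy, hyV⟩, ?_⟩
  have h1 : E.res (inf_le_left.trans i) = E'.res (inf_le_left.trans i) :=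
    eq_of_coordinates (f := f) (isHomeomorph_of_isPullback H) C
      (U := W ⊓ f ⁻¹ᵁ V₀) inf_le_right
      (fun W W' i e => monomialBasis_of_eq H C W W' (i.trans inf_le_right) e)
      (fun W₁ i' W' h'' b => (h.act_right _ _ _ _ _).trans (h'.act_right _ _ _ _ _).symm)
      (fun j => (h.act_left _ _ _ hV inf_le_right _).trans
        (h'.act_left _ _ _ hV inf_le_right _).symm)
  rw [← E'.act_res _ _ i inf_le_left]
  exact congrArg (fun G : VectorField t (W ⊓ f ⁻¹ᵁ V₀) => G.act _ le_rfl _) h1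

/-- Lifts exist over charts by `exists_canonical` and glue because they are unique. -/
lemma exists_lift (ht : f ≫ s = t) (D : VectorField s V) :
    ∃ E : VectorField t (f ⁻¹ᵁ V), IsLift f q D E := by
  obtain ⟨E, hE⟩ := VectorField.exists_glue (x := t) (U := f ⁻¹ᵁ V) (fun W h E => IsLift f q D E)
    (fun W W' h i E hE => hE.res_right i) (fun W h E E' hE hE' => hE.unique H h hE')
    (fun y hy => by
      obtain ⟨V₀, hV, hyV, ⟨C⟩⟩ := exists_coordinates_nhds p s (show f y ∈ V from hy)
      obtain ⟨E, hE, hE'⟩ := exists_canonical (f := f) (q := q) (t := t) H.w ht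
        (isHomeomorph_of_isPullback H) C (U := f ⁻¹ᵁ V₀) le_rfl
        (fun W W' i e => monomialBasis_of_eq H C W W' i e) (D.act V₀ hV) (D.act_const V₀ hV)
      exact ⟨f ⁻¹ᵁ V₀, f.preimage_mono hV, hyV, E,
        of_coordinates H.w C hV le_rfl (fun j => hE _ _ _) hE'⟩)
  exact ⟨E, of_locally hE⟩

/-- Compatibility of lifts with morphisms of Frobenius pullbacks. -/
lemma comm {T₁ : Scheme.{u}} {t₁ : T₁ ⟶ Spec (.of k)} {h : T₁ ⟶ T} {f₁ : T₁ ⟶ S}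
    (hf : h ≫ f = f₁) (hU : U ≤ f ⁻¹ᵁ V) (hE : IsLift f q D E) {U₁ : T₁.Opens}
    {E₁ : VectorField t₁ U₁} (hE₁ : IsLift f₁ (h ≫ q) D E₁) {W : T.Opens} {W₁ : T₁.Opens}
    (i : W ≤ U) (i₁ : W₁ ≤ U₁) (e : W₁ ≤ h ⁻¹ᵁ W) (a : Γ(T, W)) :
    E₁.act W₁ i₁ (h.appLE W W₁ e a) = h.appLE W W₁ e (E.act W i a) := by
  refine E₁.act_locally _ fun y hy => ?_
  obtain ⟨V₀, hV, hyV, ⟨C⟩⟩ := exists_coordinates_nhds p s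
    (show f (h y) ∈ V from hU (i (e hy)))
  let W' := W ⊓ f ⁻¹ᵁ V₀
  let W₁' := W₁ ⊓ h ⁻¹ᵁ W'
  have e' : W₁' ≤ h ⁻¹ᵁ W' := inf_le_right
  have hV' : W' ≤ f ⁻¹ᵁ V₀ := inf_le_right
  have i' : W' ≤ U := inf_le_left.trans i
  refine ⟨W₁', inf_le_left, ⟨hy, e hy, hyV⟩, ?_⟩
  let R : Subring Γ(T, W') :=
    { carrier := {a | E₁.act W₁' (inf_le_left.trans i₁) (h.appLE W' W₁' e' a) =
        h.appLE W' W₁' e' (E.act W' i' a)}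
      mul_mem' := fun {a b} ha hb => by
        rw [Set.mem_ofPred_eq] at *
        simp only [map_mul, map_add, Derivation.leibniz, smul_eq_mul, ha, hb]
      one_mem' := by simp
      add_mem' := fun {a b} ha hb => by
        rw [Set.mem_ofPred_eq] at *
        simp only [map_add, ha, hb]
      zero_mem' := by simp
      neg_mem' := fun {a} ha => by
        rw [Set.mem_ofPred_eq] at *
        simp only [map_neg, ha] }
  have hR : ∀ a, a ∈ R := fun a => by
    obtain ⟨c, hc, -⟩ := monomialBasis_of_eq H C W' _ hV'
      (preimage_imageOpen (isHomeomorph_of_isPullback H) W') a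
    rw [hc]
    refine R.sum_mem fun I _ => R.mul_mem ?_ ?_
    · change E₁.act W₁' _ (h.appLE W' W₁' e' (f.appLE V₀ W' hV' _)) =
        h.appLE W' W₁' e' (E.act W' i' (f.appLE V₀ W' hV' _))
      have e₃ : W₁' ≤ f₁ ⁻¹ᵁ V₀ := by
        rw [← hf]
        exact e'.trans (h.preimage_mono hV')
      rw [hE.act_left _ _ _ hV, appLE_appLE hf _ _ e₃, appLE_appLE hf _ _ e₃,
        hE₁.act_left _ _ _ hV]
    · change E₁.act W₁' _ (h.appLE W' W₁' e' (q.appLE _ W' _ _)) =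
        h.appLE W' W₁' e' (E.act W' i' (q.appLE _ W' _ _))
      have e₃ : W₁' ≤ (h ≫ q) ⁻¹ᵁ imageOpen (isHomeomorph_of_isPullback H) W' :=
        e'.trans (h.preimage_mono (preimage_imageOpen (isHomeomorph_of_isPullback H) W').le)
      rw [hE.act_right, appLE_appLE rfl _ _ e₃, hE₁.act_right, map_zero]
  have h2 := hR (T.presheaf.map (homOfLE inf_le_left).op a)
  change E₁.act W₁' _ (h.appLE W' W₁' e' _) = h.appLE W' W₁' e' (E.act W' i' _) at h2
  rw [E.act_res _ _ i inf_le_left, res_appLE, res_appLE] at h2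
  rw [appLE_res, appLE_res]
  exact h2

end IsLift

end Lift

end VectorField

namespace LambdaConnection

variable {k : Type u} [CommRing k] {p : ℕ} [Fact p.Prime] [CharP k p] {S : Scheme.{u}}
  {s : S ⟶ Spec (.of k)} [Smooth s] {T Y : Scheme.{u}} {f : T ⟶ S} {q : T ⟶ Y}
  {g : Y ⟶ frobTwist p s}

open NonlinearCartier.VectorField

/-- Any connection for which the functions of `Y` are flat thus consists of the unique lifts. This
is how connections on a Frobenius pullback are compared. -/
lemma isLift (c : LambdaConnection s 1 f) (hq : ∀ W b, c.IsFlat (q ⁻¹ᵁ W) (q.app W b))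
    {V : S.Opens} (D : VectorField s V) : IsLift f q D (c.nabla V D) := by
  refine ⟨fun W i V' hV h a => ?_, fun W i W' h b => ?_⟩
  · rw [c.nabla_act_appLE D hV h, map_one, one_mul]
  · exact hq W' b V D W i h

variable (H : IsPullback f q (relFrob p s) g)

/-- The canonical connection on a Frobenius pullback, for which the functions of `Y` are flat. -/
def canonical : LambdaConnection s 1 f where
  nabla V D := (IsLift.exists_lift H rfl D).choose
  nabla_add V D E := IsLift.unique H le_rfl (IsLift.exists_lift H rfl _).choose_spec
    ((IsLift.exists_lift H rfl D).choose_spec.add (IsLift.exists_lift H rfl E).choose_spec)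
  nabla_smul V a D := IsLift.unique H le_rfl (IsLift.exists_lift H rfl _).choose_spec (by
    rw [← Scheme.Hom.appLE_eq_app]
    exact (IsLift.exists_lift H rfl D).choose_spec.smul a le_rfl)
  nabla_res V V' i D := IsLift.unique H le_rfl (IsLift.exists_lift H rfl _).choose_spec
    ((IsLift.exists_lift H rfl D).choose_spec.res i _)
  symbol V W h D a := by
    have := (IsLift.exists_lift H (t := f ≫ s) rfl D).choose_spec.act_left (f ⁻¹ᵁ W)
      (f.preimage_mono h) W h le_rfl a
    rw [map_one, one_mul]
    rwa [Scheme.Hom.appLE_eq_app] at this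

lemma isLift_canonical {V : S.Opens} (D : VectorField s V) :
    IsLift f q D ((canonical H).nabla V D) := (IsLift.exists_lift H rfl D).choose_spec

lemma isFlat_canonical (W : Y.Opens) (b : Γ(Y, W)) :
    (canonical H).IsFlat (q ⁻¹ᵁ W) (q.app W b) := fun _ D W' hV hU =>
  (isLift_canonical H D).act_right W' hV W hU b

-- Both `[∇ D, ∇ E]` and `∇ [D, E]` lift `[D, E]` and kill the functions of `Y`, so they coincide.
include H in
lemma integrable_of_isFlat (c : LambdaConnection s 1 f)
    (hq : ∀ W b, c.IsFlat (q ⁻¹ᵁ W) (q.app W b)) : c.Integrable := fun V D E => by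
  have h : const (f ≫ s) (f ⁻¹ᵁ V) 1 • c.nabla V ⁅D, E⁆ = c.nabla V ⁅D, E⁆ :=
    ext_apply fun W i a => by rw [smul_act, map_one, map_one, one_mul]
  rw [h]
  exact IsLift.unique H le_rfl ((c.isLift hq D).bracket (c.isLift hq E)) (c.isLift hq _)

-- Both sides lift `D^p` and kill the functions of `Y`.
include H in
lemma pCurvatureZero_of_isFlat (c : LambdaConnection s 1 f)
    (hq : ∀ W b, c.IsFlat (q ⁻¹ᵁ W) (q.app W b)) : c.PCurvatureZero p := fun _ D =>
  IsLift.unique H le_rfl (c.isLift hq D).pPow (c.isLift hq _)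

/-- Compatibility of connections with morphisms of Frobenius pullbacks. -/
lemma nabla_comm (c : LambdaConnection s 1 f) (hc : ∀ W b, c.IsFlat (q ⁻¹ᵁ W) (q.app W b))
    {T' Y' : Scheme.{u}} {f' : T' ⟶ S} {q' : T' ⟶ Y'} {g' : Y' ⟶ frobTwist p s}
    (H' : IsPullback f' q' (relFrob p s) g') (c' : LambdaConnection s 1 f')
    (hc' : ∀ W b, c'.IsFlat (q' ⁻¹ᵁ W) (q'.app W b)) {h : T ⟶ T'} (hf : h ≫ f' = f) {y : Y ⟶ Y'}
    (w : h ≫ q' = q ≫ y) {V : S.Opens} (D : VectorField s V) {W : T'.Opens} (hW : W ≤ f' ⁻¹ᵁ V)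
    (hW' : h ⁻¹ᵁ W ≤ f ⁻¹ᵁ V) (a : Γ(T', W)) :
    (c.nabla V D).act (h ⁻¹ᵁ W) hW' (h.app W a) = h.app W ((c'.nabla V D).act W hW a) := by
  have h1 := IsLift.comm H' (h := h) hf le_rfl (c'.isLift hc' D) (E₁ := c.nabla V D)
    ⟨(c.isLift hc D).act_left, fun W₁ i W' e b => by
      have e₃ : W₁ ≤ (q ≫ y) ⁻¹ᵁ W' := by
        rw [← w]
        exact e
      have h2 : (h ≫ q').appLE W' W₁ e b = q.appLE (y ⁻¹ᵁ W') W₁ e₃ (y.app W' b) :=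
        (appLE_app w.symm e₃ e b).symm
      rw [h2]
      exact (c.isLift hc D).act_right _ _ _ _ _⟩ hW hW' le_rfl a
  rwa [Scheme.Hom.appLE_eq_app] at h1

include H in
/-- A Frobenius pullback of `Y` has quotient `Y`. -/
theorem isFlatQuotient_of_isFlat (c : LambdaConnection s 1 f)
    (hq : ∀ W b, c.IsFlat (q ⁻¹ᵁ W) (q.app W b)) : IsFlatQuotient c q := by
  refine IsFlatQuotient.of_basis (isHomeomorph_of_isPullback H) fun y U hy => ?_
  obtain ⟨V, -, hyV, ⟨C⟩⟩ := exists_coordinates_nhds p s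
    (show frobTwistFst p s (g y) ∈ (⊤ : S.Opens) from trivial)
  let W := U ⊓ g ⁻¹ᵁ twist p s V
  have hW : W ≤ g ⁻¹ᵁ twist p s V := inf_le_right
  have hb := monomialBasis_of_isPullback H C hW
  refine ⟨W, ⟨hy, hyV⟩, inf_le_left, ?_, hq W, fun a ha => ?_⟩
  · have := hb.injective
    rwa [Scheme.Hom.appLE_eq_app] at this
  · obtain ⟨b, h1, -⟩ := hb a
    have hV : q ⁻¹ᵁ W ≤ f ⁻¹ᵁ V := preimage_le_of_comm H.w hW
    have hw := c.weylModule C (c.integrable_of_isFlat H hq) (c.pCurvatureZero_of_isFlat H hq) hV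
    have h2 : a = ∑ I, monom (fun i => f.appLE V (q ⁻¹ᵁ W) hV (C.x i)) I • q.app W (b I) := by
      rw [h1]
      refine Finset.sum_congr rfl fun I _ => ?_
      rw [Scheme.Hom.appLE_eq_app, smul_eq_mul]
      congr 1
      exact map_monom (f.appLE V (q ⁻¹ᵁ W) hV).hom C.x I
    -- A flat function equals its constant coefficient, which is a function of `Y`.
    refine ⟨b (WeylModule.zeroIndex p C.n), ?_⟩
    refine Eq.trans ?_ h2.symm
    refine (hw.sum_eq_of_flat (n := fun I => q.app W (b I))
      (fun I i => (c.isFlat_iff C hV _).mp (hq W (b I)) i) fun i => ?_).1.symm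
    rw [← h2]
    exact (c.isFlat_iff C hV _).mp ha i

end LambdaConnection

end


/-! ### The equivalence of categories -/

noncomputable section

set_option linter.unusedSectionVars false

section Descent

variable {k : Type u} [CommRing k] {p : ℕ} [Fact p.Prime] [CharP k p] {S : Scheme.{u}}
  {s : S ⟶ Spec (.of k)} [Smooth s]

variable (s) in
/-- The zero `0`-connection. -/
def zeroConnection {X : Scheme.{u}} (f : X ⟶ S) : LambdaConnection s 0 f where
  nabla _ _ := 0
  nabla_add _ _ _ := (add_zero _).symm
  nabla_smul _ _ _ := VectorField.ext_apply fun W h b => by simp [VectorField.smul_act]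
  nabla_res _ _ _ _ := rfl
  symbol V W h D a := by simp

/-- For a zero connection every function is flat, so `h` is a quotient in the sense of
`IsFlatQuotient`; its universal property applied to the identity produces the inverse. -/
lemma isIso_of_bijective {X Y : Scheme.{u}} (h : X ⟶ Y) (hh : IsHomeomorph h)
    (H : ∀ (y : Y) (U : Y.Opens), y ∈ U → ∃ W : Y.Opens, y ∈ W ∧ W ≤ U ∧
      Function.Bijective (h.app W)) : IsIso h := by
  -- Any scheme maps to the spectrum of `ℤ`, taken as its own smooth base; this only supplies a base
  -- over which `X` carries a zero connection.
  let f : X ⟶ Spec (.of (ULift.{u} ℤ)) := specULiftZIsTerminal.from X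
  have hc : ∀ U a, (zeroConnection (𝟙 (Spec (.of (ULift.{u} ℤ)))) f).IsFlat U a :=
    fun U a V D W hV hU => rfl
  have hq : IsFlatQuotient (zeroConnection (𝟙 _) f) h := by
    refine IsFlatQuotient.of_basis hh fun y U hy => ?_
    obtain ⟨W, hy, hW, hb⟩ := H y U hy
    exact ⟨W, hy, hW, hb.1, fun b => hc _ _, fun a _ => hb.2 a⟩
  obtain ⟨t, ht⟩ := hq.exists_desc (𝟙 X) fun U b => hc _ _
  exact ⟨t, ht, hq.hom_ext (by rw [reassoc_of% ht, Category.comp_id])⟩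

/-- The map sends the monomial expansion over `T'` to the one over `T` with the same coefficients
from `Y`. -/
lemma MonomialBasis.bijective {T T' Y : Scheme.{u}} {f : T ⟶ S} {q : T ⟶ Y} {f' : T' ⟶ S}
    {q' : T' ⟶ Y} {h : T ⟶ T'} (hf : h ≫ f' = f) (hq : h ≫ q' = q) {V : S.Opens} {n : ℕ}
    {x : Fin n → Γ(S, V)} {W : T.Opens} {W' : T'.Opens} {U : Y.Opens} {hW : W ≤ f ⁻¹ᵁ V}
    {hU : W ≤ q ⁻¹ᵁ U} {hW' : W' ≤ f' ⁻¹ᵁ V} {hU' : W' ≤ q' ⁻¹ᵁ U}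
    (hb : MonomialBasis p f q x W U hW hU) (hb' : MonomialBasis p f' q' x W' U hW' hU')
    (e : W ≤ h ⁻¹ᵁ W') : Function.Bijective (h.appLE W' W e) := by
  have key : ∀ c : (Fin n → Fin p) → Γ(Y, U), h.appLE W' W e
      (∑ I, f'.appLE V W' hW' (monom x I) * q'.appLE U W' hU' (c I)) =
      ∑ I, f.appLE V W hW (monom x I) * q.appLE U W hU (c I) := fun c => by
    rw [map_sum]
    refine Finset.sum_congr rfl fun I _ => ?_
    rw [map_mul, appLE_appLE hf _ _ hW, appLE_appLE hq _ _ hU]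
  refine ⟨fun a a' haa => ?_, fun b => ?_⟩
  · obtain ⟨c, hc, -⟩ := hb' a
    obtain ⟨c', hc', -⟩ := hb' a'
    rw [hc, hc', key, key] at haa
    obtain rfl := (hb _).unique rfl haa
    rw [hc, hc']
  · obtain ⟨c, hc, -⟩ := hb b
    exact ⟨_, (key c).trans hc.symm⟩

/-- A scheme with an integrable connection of vanishing `p`-curvature is the Frobenius pullback of
its quotient. -/
theorem IsFlatQuotient.isPullback {X Y : Scheme.{u}} {f : X ⟶ S} {c : LambdaConnection s 1 f}
    {q : X ⟶ Y} {g : Y ⟶ frobTwist p s} (h : IsFlatQuotient c q) (hi : c.Integrable)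
    (hp : c.PCurvatureZero p) (w : f ≫ relFrob p s = q ≫ g) :
    IsPullback f q (relFrob p s) g := by
  have H := IsPullback.of_hasPullback (relFrob p s) g
  -- The comparison map is a homeomorphism because both projections to `Y` are, and on functions it
  -- matches two monomial bases over `𝒪_Y`.
  let φ : X ⟶ pullback (relFrob p s) g := pullback.lift f q w
  have h1 : φ ≫ pullback.fst _ _ = f := pullback.lift_fst _ _ _
  have h2 : φ ≫ pullback.snd _ _ = q := pullback.lift_snd _ _ _
  have hT := isHomeomorph_of_isPullback H
  have hφ : IsHomeomorph φ := by
    have h3 : ⇑φ = (hT.homeomorph _).symm ∘ q := funext fun x => by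
      rw [Function.comp_apply, Homeomorph.eq_symm_apply]
      exact congrArg (fun ψ : X ⟶ Y => ψ x) h2
    rw [h3]
    exact (hT.homeomorph _).symm.isHomeomorph.comp h.isHomeomorph
  have : IsIso φ := by
    refine isIso_of_bijective φ hφ fun z U hz => ?_
    obtain ⟨V, -, hzV, ⟨C⟩⟩ := exists_coordinates_nhds p s
      (show frobTwistFst p s (g (pullback.snd (relFrob p s) g z)) ∈ (⊤ : S.Opens) from trivial)
    let U' := VectorField.imageOpen hT U ⊓ g ⁻¹ᵁ twist p s V
    have hU' : U' ≤ g ⁻¹ᵁ twist p s V := inf_le_right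
    have e : φ ⁻¹ᵁ pullback.snd (relFrob p s) g ⁻¹ᵁ U' = q ⁻¹ᵁ U' := by
      rw [← Scheme.Hom.comp_preimage, h2]
    refine ⟨pullback.snd (relFrob p s) g ⁻¹ᵁ U', ⟨⟨z, hz, rfl⟩, hzV⟩, ?_, ?_⟩
    · exact (Scheme.Hom.preimage_mono _ inf_le_left).trans
        (VectorField.preimage_imageOpen hT U).ge
    · have hb := monomialBasis_of_isPullback H C hU'
      have hb' := h.monomialBasis C hi hp (W' := U')
        (e.trans_le (preimage_le_of_comm w hU')) e
      have := MonomialBasis.bijective h1 h2 hb' hb le_rfl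
      rwa [Scheme.Hom.appLE_eq_app] at this
  exact H.of_iso (asIso φ).symm (Iso.refl _) (Iso.refl _) (Iso.refl _) (by simp [← h1])
    (by simp [← h2]) (by simp) (by simp)

theorem IsFlatQuotient.exists_structure {X Y : Scheme.{u}} {f : X ⟶ S} {c : LambdaConnection s 1 f}
    {q : X ⟶ Y} (h : IsFlatQuotient c q) : ∃ g : Y ⟶ frobTwist p s, q ≫ g = f ≫ relFrob p s :=
  h.exists_desc _ fun U b => by
    have := c.isFlat_comp_relFrob (p := p) (hr := rfl) (U' := U) le_rfl b
    rwa [Scheme.Hom.appLE_eq_app] at this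

end Descent

section Hom

variable {k : Type u} [CommRing k] {S : Scheme.{u}} {s : S ⟶ Spec (.of k)} {lam : k}

lemma LambdaScheme.Hom.isFlat {P Q : LambdaScheme s lam} (h : P ⟶ Q) {W : Q.X.left.Opens}
    {a : Γ(Q.X.left, W)} (ha : Q.conn.IsFlat W a) :
    P.conn.IsFlat (h.hom.left ⁻¹ᵁ W) (h.hom.left.app W a) := by
  intro V D W' hV hU
  let W₁ := W ⊓ Q.X.hom ⁻¹ᵁ V
  have e : W' ≤ h.hom.left ⁻¹ᵁ W₁ := fun y hy => ⟨hU hy, by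
    have h1 := hV hy
    rw [← Over.w h.hom] at h1
    exact h1⟩
  have h1 := h.comm V D W₁ inf_le_right (Hom.preimage_le h.hom inf_le_right)
    (Q.X.left.presheaf.map (homOfLE inf_le_left).op a)
  rw [ha V D W₁ inf_le_right inf_le_left, map_zero, app_res _ inf_le_left] at h1
  have h2 := congrArg (P.X.left.presheaf.map (homOfLE e).op) h1
  rwa [← VectorField.act_res _ _ _ _ e, res_res, map_zero] at h2

/-- A morphism of schemes with zero connections. -/
def LambdaScheme.homOfIsZero {P Q : LambdaScheme s lam} (hP : P.conn.IsZero) (hQ : Q.conn.IsZero)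
    (h : P.X ⟶ Q.X) : P ⟶ Q where
  hom := h
  comm V D W hW hW' a := by
    rw [hP V D, hQ V D]
    exact (map_zero _).symm

end Hom

section Functor

variable {k : Type u} [CommRing k] (p : ℕ) [Fact p.Prime] [CharP k p] {S : Scheme.{u}}
  (s : S ⟶ Spec (.of k)) [Smooth s]

variable {p s} in
lemma isPullback_frob (Y : Over (frobTwist p s)) :
    IsPullback ((Over.pullback (relFrob p s)).obj Y).hom (pullback.fst Y.hom (relFrob p s))
      (relFrob p s) Y.hom := (IsPullback.of_hasPullback Y.hom (relFrob p s)).flip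

lemma mapSquare {Y Y' : Over (frobTwist p s)} (y : Y ⟶ Y') :
    ((Over.pullback (relFrob p s)).map y).left ≫ pullback.fst Y'.hom (relFrob p s) =
      pullback.fst Y.hom (relFrob p s) ≫ y.left :=
  pullback.lift_fst _ _ _

lemma isFlat_frob (Y : Over (frobTwist p s)) (W : Y.left.Opens) (b : Γ(Y.left, W)) :
    (LambdaConnection.canonical (isPullback_frob Y)).IsFlat
      (pullback.fst Y.hom (relFrob p s) ⁻¹ᵁ W) ((pullback.fst Y.hom (relFrob p s)).app W b) :=
  LambdaConnection.isFlat_canonical (isPullback_frob Y) W b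

/-- Frobenius pullback with the canonical connection. -/
def frobPullbackObj (Y : NHIG₀ (frobTwistStr p s)) : NMIC₀ p s :=
  ⟨⟨(Over.pullback (relFrob p s)).obj Y.obj.X,
      LambdaConnection.canonical (isPullback_frob Y.obj.X)⟩,
    by
      have : QuasiCompact Y.obj.X.hom := Y.property.1
      exact inferInstanceAs (QuasiCompact (pullback.snd Y.obj.X.hom (relFrob p s))),
    LambdaConnection.integrable_of_isFlat (isPullback_frob Y.obj.X) _ (isFlat_frob p s Y.obj.X),
    LambdaConnection.pCurvatureZero_of_isFlat (isPullback_frob Y.obj.X) _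
      (isFlat_frob p s Y.obj.X)⟩

/-- Frobenius pullback of a morphism. -/
def frobPullbackMap {Y Y' : NHIG₀ (frobTwistStr p s)} (y : Y ⟶ Y') :
    frobPullbackObj p s Y ⟶ frobPullbackObj p s Y' :=
  ObjectProperty.homMk
    ⟨(Over.pullback (relFrob p s)).map y.hom.hom, fun _ D _ hW hW' a =>
      LambdaConnection.nabla_comm _ (isFlat_frob p s Y.obj.X) (isPullback_frob Y'.obj.X) _
        (isFlat_frob p s Y'.obj.X) (Over.w ((Over.pullback (relFrob p s)).map y.hom.hom))
        (mapSquare p s y.hom.hom) D hW hW' a⟩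

/-- Frobenius pullback with the canonical connection, as a functor. -/
def frobPullback : NHIG₀ (frobTwistStr p s) ⥤ NMIC₀ p s where
  obj := frobPullbackObj p s
  map := frobPullbackMap p s
  map_id _ := ObjectProperty.hom_ext _ (LambdaScheme.Hom.ext ((Over.pullback _).map_id _))
  map_comp _ _ := ObjectProperty.hom_ext _ (LambdaScheme.Hom.ext ((Over.pullback _).map_comp _ _))

/-- The projection from the Frobenius pullback. -/
def frobProj (Y : NHIG₀ (frobTwistStr p s)) :
    ((frobPullback p s).obj Y).obj.X.left ⟶ Y.obj.X.left :=
  pullback.fst Y.obj.X.hom (relFrob p s)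

lemma isPullback_frobProj (Y : NHIG₀ (frobTwistStr p s)) :
    IsPullback ((frobPullback p s).obj Y).obj.X.hom (frobProj p s Y) (relFrob p s) Y.obj.X.hom :=
  isPullback_frob Y.obj.X

lemma frobProj_map {Y Y' : NHIG₀ (frobTwistStr p s)} (y : Y ⟶ Y') :
    ((frobPullback p s).map y).hom.hom.left ≫ frobProj p s Y' =
      frobProj p s Y ≫ y.hom.hom.left :=
  mapSquare p s y.hom.hom

lemma isFlatQuotient_frobProj (Y : NHIG₀ (frobTwistStr p s)) :
    IsFlatQuotient ((frobPullback p s).obj Y).obj.conn (frobProj p s Y) :=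
  LambdaConnection.isFlatQuotient_of_isFlat (isPullback_frob Y.obj.X) _
    (isFlat_frob p s Y.obj.X)

instance : (frobPullback p s).Faithful where
  map_injective {Y Y'} y y' h := by
    refine ObjectProperty.hom_ext _ (LambdaScheme.Hom.ext (Over.OverMorphism.ext
      ((isFlatQuotient_frobProj p s Y).hom_ext ?_)))
    rw [← frobProj_map, ← frobProj_map, h]

instance : (frobPullback p s).Full where
  map_surjective {Y Y'} φ := by
    have hq := isFlatQuotient_frobProj p s Y
    have hq' := isFlatQuotient_frobProj p s Y'
    -- A horizontal map pulls flat functions back to flat functions, so its composite with the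
    -- projection to `Y'` descends to `Y`.
    obtain ⟨y, hy⟩ := hq.exists_desc (φ.hom.hom.left ≫ frobProj p s Y')
      fun U b => φ.hom.isFlat (hq'.isFlat U b)
    have h1 := Over.w φ.hom.hom
    have hw : y ≫ Y'.obj.X.hom = Y.obj.X.hom := hq.hom_ext (by
      rw [reassoc_of% hy, ← (isPullback_frobProj p s Y).w, ← (isPullback_frobProj p s Y').w,
        reassoc_of% h1])
    refine ⟨ObjectProperty.homMk (LambdaScheme.homOfIsZero Y.property.2.2 Y'.property.2.2
      (Over.homMk y hw)), ?_⟩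
    refine ObjectProperty.hom_ext _ (LambdaScheme.Hom.ext (Over.OverMorphism.ext ?_))
    refine (isPullback_frobProj p s Y').hom_ext ((Over.w _).trans h1.symm)
      ((frobProj_map p s _).trans hy)

variable {p s} in
/-- Two Frobenius pullbacks of the same scheme are isomorphic as schemes with connection. -/
def isoOfIsPullback {P Q : NMIC₀ p s} {Y : Scheme.{u}} {q : P.obj.X.left ⟶ Y}
    {q' : Q.obj.X.left ⟶ Y} {g : Y ⟶ frobTwist p s} (H : IsPullback P.obj.X.hom q (relFrob p s) g)
    (H' : IsPullback Q.obj.X.hom q' (relFrob p s) g)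
    (hq : ∀ W b, P.obj.conn.IsFlat (q ⁻¹ᵁ W) (q.app W b))
    (hq' : ∀ W b, Q.obj.conn.IsFlat (q' ⁻¹ᵁ W) (q'.app W b)) : P ≅ Q where
  hom := ObjectProperty.homMk
    ⟨Over.homMk (H.isoIsPullback _ _ H').hom (H.isoIsPullback_hom_fst _ _ H'),
      fun V D W hW hW' a => LambdaConnection.nabla_comm _ hq H' _ hq' (y := 𝟙 Y)
        (H.isoIsPullback_hom_fst _ _ H') (by
          rw [Category.comp_id]
          exact H.isoIsPullback_hom_snd _ _ H') D hW hW' a⟩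
  inv := ObjectProperty.homMk
    ⟨Over.homMk (H.isoIsPullback _ _ H').inv (H.isoIsPullback_inv_fst _ _ H'),
      fun V D W hW hW' a => LambdaConnection.nabla_comm _ hq' H _ hq (y := 𝟙 Y)
        (H.isoIsPullback_inv_fst _ _ H') (by
          rw [Category.comp_id]
          exact H.isoIsPullback_inv_snd _ _ H') D hW hW' a⟩
  hom_inv_id := ObjectProperty.hom_ext _ (LambdaScheme.Hom.ext (Over.OverMorphism.ext
    (H.isoIsPullback _ _ H').hom_inv_id))
  inv_hom_id := ObjectProperty.hom_ext _ (LambdaScheme.Hom.ext (Over.OverMorphism.ext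
    (H.isoIsPullback _ _ H').inv_hom_id))

instance : (frobPullback p s).EssSurj where
  mem_essImage P := by
    have hq := P.obj.conn.isFlatQuotient_quotientMk (p := p)
    obtain ⟨g, hg⟩ := hq.exists_structure (p := p)
    have H := hq.isPullback P.property.2.1 P.property.2.2 hg.symm
    -- Compactness passes through the homeomorphisms `F` and `q`: the preimage of `U` under `g` is
    -- the image under `q` of a compact set.
    have hg' : QuasiCompact g := by
      have hf : QuasiCompact P.obj.X.hom := P.property.1
      refine ⟨fun U hU hU' => ?_⟩
      have h1 : IsCompact (relFrob p s ⁻¹' U) :=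
        (isHomeomorph_relFrob p s).isClosedEmbedding.isCompact_preimage hU'
      have h2 := hf.isCompact_preimage _ (hU.preimage (relFrob p s).continuous) h1
      have h3 : P.obj.X.hom ⁻¹' (relFrob p s ⁻¹' U) =
          P.obj.conn.quotientMk p ⁻¹' (g ⁻¹' U) := by
        have h4 := congrArg (fun ψ : P.obj.X.left ⟶ frobTwist p s => ψ ⁻¹' U) hg.symm
        exact h4
      have h5 := h2.image (P.obj.conn.quotientMk p).continuous
      rwa [h3, Set.image_preimage_eq _ hq.isHomeomorph.surjective] at h5
    let Y : NHIG₀ (frobTwistStr p s) := ⟨⟨Over.mk g, zeroConnection _ g⟩, hg',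
      fun V D E => VectorField.ext_apply fun W hW a => by
        rw [VectorField.bracket_act, VectorField.smul_act]
        exact (sub_self _).trans (mul_zero _).symm, fun V D => rfl⟩
    exact ⟨Y, ⟨isoOfIsPullback (isPullback_frobProj p s Y) H
      (isFlatQuotient_frobProj p s Y).isFlat hq.isFlat⟩⟩

instance : (frobPullback p s).IsEquivalence where

/-- Cartier descent. -/
def cartier : NMIC₀ p s ≌ NHIG₀ (frobTwistStr p s) := (frobPullback p s).asEquivalence.symm

/-- The inverse of Cartier descent is Frobenius pullback. -/
def cartierInverseIso : (cartier p s).inverse ⋙ NMIC₀.toOver p s ≅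
    NHIG₀.toOver (frobTwistStr p s) ⋙ Over.pullback (relFrob p s) :=
  NatIso.ofComponents (fun _ => Iso.refl _) fun _ => (Category.comp_id _).trans (Category.id_comp _).symm

lemma proj_cartier (Y : NHIG₀ (frobTwistStr p s)) :
    proj (cartierInverseIso p s) Y = frobProj p s Y :=
  Category.id_comp (pullback.fst Y.obj.X.hom (relFrob p s))

/-- The unit isomorphism. -/
def cartierUnit (P : NMIC₀ p s) : P ≅ (frobPullback p s).obj ((cartier p s).functor.obj P) :=
  (cartier p s).unitIso.app P

lemma descentMap_cartier (P : NMIC₀ p s) :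
    descentMap (cartierInverseIso p s) P = (cartierUnit p s P).hom.hom.hom.left ≫
      frobProj p s ((cartier p s).functor.obj P) := by
  rw [← proj_cartier]
  rfl

lemma isPullback_descentMap (P : NMIC₀ p s) :
    IsPullback P.obj.X.hom (descentMap (cartierInverseIso p s) P) (relFrob p s)
      ((cartier p s).functor.obj P).obj.X.hom := by
  let e : P.obj.X.left ≅ ((frobPullback p s).obj ((cartier p s).functor.obj P)).obj.X.left :=
    (NMIC₀.toOver p s ⋙ Over.forget S).mapIso (cartierUnit p s P)
  rw [descentMap_cartier]
  refine (isPullback_frobProj p s _).of_iso e.symm (Iso.refl _) (Iso.refl _) (Iso.refl _) ?_ ?_ ?_ ?_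
  · rw [Iso.refl_hom, Category.comp_id, Iso.symm_hom, Iso.eq_inv_comp]
    exact Over.w (cartierUnit p s P).hom.hom.hom
  · rw [Iso.refl_hom, Category.comp_id, Iso.symm_hom, Iso.eq_inv_comp]
    rfl
  · simp
  · simp

lemma isFlatQuotient_descentMap (P : NMIC₀ p s) :
    IsFlatQuotient P.obj.conn (descentMap (cartierInverseIso p s) P) := by
  refine P.obj.conn.isFlatQuotient_of_isFlat (isPullback_descentMap p s P) fun W b => ?_
  have key : ∀ r, r = (cartierUnit p s P).hom.hom.hom.left ≫
      frobProj p s ((cartier p s).functor.obj P) → P.obj.conn.IsFlat (r ⁻¹ᵁ W) (r.app W b) := by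
    rintro _ rfl
    exact (cartierUnit p s P).hom.hom.isFlat ((isFlatQuotient_frobProj p s _).isFlat W b)
  exact key _ (descentMap_cartier p s P)

end Functor

end


/-! ### Geometric properties under Frobenius pullback -/

noncomputable section

set_option linter.unusedSectionVars false

lemma restrictsTo_of_iff {C D : Type*} [Category C] [Category D] (e : C ≌ D) {P : C → Prop}
    {Q : D → Prop} (h : ∀ X, P X ↔ Q (e.functor.obj X))
    (hQ : ∀ Y Y', (Y ≅ Y') → Q Y → Q Y') : RestrictsTo e P Q := by
  have : ObjectProperty.IsClosedUnderIsomorphisms (C := D) Q := ⟨fun i => hQ _ _ i⟩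
  exact ⟨e.congrFullSubcategory (P := P) (Q := Q) (funext fun X => propext (h X).symm),
    ⟨Iso.refl _⟩⟩

section Frobenius

variable {k : Type u} [CommRing k] (p : ℕ) [Fact p.Prime] [CharP k p] {S : Scheme.{u}}
  (s : S ⟶ Spec (.of k)) [Smooth s]

/-- The monomials make `𝒪_S(V)` free over `𝒪_{S'}(V')`. -/
lemma Coordinates.flat {p : ℕ} [Fact p.Prime] [CharP k p] {s : S ⟶ Spec (.of k)} {V : S.Opens}
    (C : Coordinates p s V) : (frobSection p s V).hom.Flat := by
  let _ : Algebra Γ(frobTwist p s, twist p s V) Γ(S, V) := (frobSection p s V).hom.toAlgebra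
  let φ : ((Fin C.n → Fin p) → Γ(frobTwist p s, twist p s V)) →ₗ[Γ(frobTwist p s, twist p s V)]
      Γ(S, V) := Fintype.linearCombination _ (monom C.x)
  have hφ : ∀ c, φ c = ∑ I, monom C.x I * frobSection p s V (c I) := fun c => by
    rw [Fintype.linearCombination_apply]
    exact Finset.sum_congr rfl fun I _ => (Algebra.smul_def _ _).trans (mul_comm _ _)
  have hb : Function.Bijective φ := by
    constructor
    · intro c c' h
      exact (C.existsUnique_sum (φ c)).unique (hφ c) (h.trans (hφ c'))
    · intro a
      obtain ⟨c, hc, -⟩ := C.existsUnique_sum a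
      exact ⟨c, (hφ c).trans hc.symm⟩
  exact Module.Flat.of_linearEquiv (LinearEquiv.ofBijective φ hb).symm

instance : Flat (relFrob p s) := by
  refine (HasRingHomProperty.iff_exists_appLE (P := @Flat)
    (RingHom.Flat.stableUnderComposition.stableUnderCompositionWithLocalizationAway
      RingHom.Flat.holdsForLocalizationAway).1).mpr fun y => ?_
  obtain ⟨V, -, hyV, ⟨C⟩⟩ := exists_coordinates_nhds p s (show y ∈ (⊤ : S.Opens) from trivial)
  exact ⟨⟨_, isAffineOpen_twist p s C.affine⟩, ⟨V, C.affine⟩, hyV,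
    le_relFrob_preimage_twist p s V, C.flat⟩

instance : IsAffineHom (relFrob p s) :=
  isAffineHom_of_forall_exists_isAffineOpen _ fun y => by
    obtain ⟨V, -, hyV, ⟨C⟩⟩ := exists_coordinates_nhds p s
      (show frobTwistFst p s y ∈ (⊤ : S.Opens) from trivial)
    exact ⟨twist p s V, hyV, isAffineOpen_twist p s C.affine, by
      rw [relFrob_preimage_twist]; exact C.affine⟩

instance : Surjective (relFrob p s) := ⟨(isHomeomorph_relFrob p s).surjective⟩

instance : LocallyOfFiniteType (frobTwistStr p s) :=
  inferInstanceAs (LocallyOfFiniteType (pullback.snd s _))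

instance : LocallyOfFiniteType (relFrob p s) := by
  have : LocallyOfFiniteType (relFrob p s ≫ frobTwistStr p s) := by
    rw [relFrob_str]; infer_instance
  exact locallyOfFiniteType_of_comp _ (frobTwistStr p s)

lemma relFrob_mem : (@Surjective ⊓ @Flat ⊓ @QuasiCompact : MorphismProperty Scheme.{u})
    (relFrob p s) :=
  ⟨⟨inferInstance, inferInstance⟩, inferInstance⟩

/-- Every base change of `F` is a homeomorphism by `isHomeomorph_of_isPullback`. -/
instance : UniversallyClosed (relFrob p s) where
  universally_isClosedMap _ _ _ _ _ H := (isHomeomorph_of_isPullback H.flip).isClosedMap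

-- On a chart `a ↦ a^p` is the composite of `𝒪_S ⟶ 𝒪_{S'}`, a flat base change of the injective
-- Frobenius of `k`, and the injective `𝒪_{S'} ⟶ 𝒪_S`. So `a^p = 0` forces `a = 0`.
include p s in
lemma isReduced_of_smooth_of_isField (hk : IsField k) : IsReduced S := by
  refine ⟨fun U => ⟨fun a ha => ?_⟩⟩
  refine sections_ext (X := S) _ _ fun y hy => ?_
  obtain ⟨V, hVU, hyV, ⟨C⟩⟩ := exists_coordinates_nhds p s hy
  refine ⟨V, hVU, hyV, ?_⟩
  rw [map_zero]
  have hred : _root_.IsReduced k := by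
    let _ := hk.toField
    infer_instance
  have h1 : Function.Injective ((frobTwistFst p s).app V) := by
    refine injective_of_isPushout (isPushout_twist p s C.affine) ?_ (frobenius_inj k p)
    let _ := hk.toField
    algebraize [const s V]
    exact inferInstanceAs (Module.Flat k Γ(S, V))
  have h2 : ∀ b : Γ(S, V), b ^ p = 0 → b = 0 := fun b hb => by
    refine h1 (C.injective ?_)
    rw [frobSection_fst, map_zero, map_zero, hb]
  have h3 : _root_.IsReduced Γ(S, V) :=
    (isReduced_iff_pow_one_lt p (Fact.out : p.Prime).one_lt).mpr h2
  exact (ha.map (S.presheaf.map (homOfLE hVU).op).hom).eq_zero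

end Frobenius

/-- The diagonal of `q ≫ y` followed by the universally closed map `q × q` is `q` followed by the
diagonal of `y`. As `q` is surjective, the diagonal of `y` has closed image. -/
lemma isSeparated_of_comp {X Y Z : Scheme.{u}} (q : X ⟶ Y) (y : Y ⟶ Z) [Surjective q]
    [UniversallyClosed q] [IsSeparated (q ≫ y)] : IsSeparated y := by
  refine ⟨.of_isPreimmersion _ ?_⟩
  let r := pullback.map (q ≫ y) (q ≫ y) y y q q (𝟙 _) (by simp) (by simp)
  have hr : UniversallyClosed r :=
    MorphismProperty.pullbackMap (P := @UniversallyClosed) ‹_› ‹_› rfl rfl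
  have h1 : pullback.diagonal (q ≫ y) ≫ r = q ≫ pullback.diagonal y := by
    refine pullback.hom_ext ?_ ?_
    · rw [Category.assoc, Category.assoc, pullback.diagonal_fst]
      exact (congrArg (_ ≫ ·) (pullback.lift_fst _ _ _)).trans (by simp)
    · rw [Category.assoc, Category.assoc, pullback.diagonal_snd]
      exact (congrArg (_ ≫ ·) (pullback.lift_snd _ _ _)).trans (by simp)
  have h2 : UniversallyClosed (q ≫ pullback.diagonal y) := by
    rw [← h1]; infer_instance
  have := UniversallyClosed.of_comp_surjective q (pullback.diagonal y)
  exact (pullback.diagonal y).isClosedMap.isClosed_range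

section Pullback

variable {k : Type u} [CommRing k] {p : ℕ} [Fact p.Prime] [CharP k p] {S : Scheme.{u}}
  {s : S ⟶ Spec (.of k)} [Smooth s] {X Y : Scheme.{u}} {f : X ⟶ S} {q : X ⟶ Y}
  {g : Y ⟶ frobTwist p s} (H : IsPullback f q (relFrob p s) g)

include H

lemma str_eq : f ≫ s = q ≫ g ≫ frobTwistStr p s := by
  rw [← reassoc_of% H.w, relFrob_str]

lemma smooth_iff : Smooth f ↔ Smooth g :=
  MorphismProperty.iff_of_isPullback (P := @Smooth) H (relFrob_mem p s)

lemma locallyOfFiniteType_iff :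
    LocallyOfFiniteType (f ≫ s) ↔ LocallyOfFiniteType (g ≫ frobTwistStr p s) := by
  constructor
  · intro h
    have h1 : LocallyOfFiniteType f := locallyOfFiniteType_of_comp f s
    have h2 : LocallyOfFiniteType g :=
      (MorphismProperty.iff_of_isPullback (P := @LocallyOfFiniteType) H (relFrob_mem p s)).mp h1
    infer_instance
  · intro h
    have : LocallyOfFiniteType q :=
      MorphismProperty.of_isPullback (P := @LocallyOfFiniteType) H inferInstance
    rw [str_eq H]
    infer_instance

lemma quasiCompact_iff :
    QuasiCompact (f ≫ s) ↔ QuasiCompact (g ≫ frobTwistStr p s) := by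
  have hq := isHomeomorph_of_isPullback H
  have : Surjective q := ⟨hq.surjective⟩
  constructor
  · intro h
    rw [str_eq H] at h
    refine ⟨fun U hU hU' => ?_⟩
    have h1 := h.isCompact_preimage U hU hU'
    have h2 := h1.image q.continuous
    rwa [show (q ≫ g ≫ frobTwistStr p s) ⁻¹' U = q ⁻¹' ((g ≫ frobTwistStr p s) ⁻¹' U) from rfl,
      Set.image_preimage_eq _ hq.surjective] at h2
  · intro h
    have : IsAffineHom q := MorphismProperty.of_isPullback (P := @IsAffineHom) H inferInstance
    rw [str_eq H]
    infer_instance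

lemma isSeparated_iff :
    IsSeparated (f ≫ s) ↔ IsSeparated (g ≫ frobTwistStr p s) := by
  have : Surjective q := ⟨(isHomeomorph_of_isPullback H).surjective⟩
  have : UniversallyClosed q :=
    MorphismProperty.of_isPullback (P := @UniversallyClosed) H inferInstance
  constructor
  · intro h
    rw [str_eq H] at h
    exact isSeparated_of_comp q _
  · intro h
    have : IsAffineHom q := MorphismProperty.of_isPullback (P := @IsAffineHom) H inferInstance
    rw [str_eq H]
    infer_instance

omit [Smooth s] H in
lemma irreducibleSpace_of_isHomeomorph {α β : Type*} [TopologicalSpace α] [TopologicalSpace β]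
    {h : α → β} (hh : IsHomeomorph h) [IrreducibleSpace α] : IrreducibleSpace β := by
  have := (IrreducibleSpace.isIrreducible_univ α).image h hh.continuous.continuousOn
  rw [Set.image_univ, hh.surjective.range_eq] at this
  exact (irreducibleSpace_def β).mpr this

/-- Irreducibility passes through the homeomorphism, and `Y` is reduced because its functions inject
into those of `X`. -/
lemma isIntegral_of_isIntegral [IsIntegral X] : IsIntegral Y := by
  have hq := isHomeomorph_of_isPullback H
  have : Surjective q := ⟨hq.surjective⟩
  have : Flat q := MorphismProperty.of_isPullback (P := @Flat) H inferInstance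
  have := irreducibleSpace_of_isHomeomorph hq
  have : IsReduced Y := ⟨fun U => ⟨fun a ha => by
    have h1 : Function.Injective (q.app U) :=
      (LambdaConnection.isFlatQuotient_of_isFlat H (LambdaConnection.canonical H)
        (LambdaConnection.isFlat_canonical H)).injective U
    exact h1 (((ha.map (q.app U).hom).eq_zero).trans (map_zero _).symm)⟩⟩
  exact isIntegral_of_irreducibleSpace_of_isReduced Y

lemma isVariety_iff : IsVariety (f ≫ s) ↔
    IsVariety (g ≫ frobTwistStr p s) ∧ IsIntegral (pullback g (relFrob p s)) := by
  have h1 : IsIntegral X ↔ IsIntegral (pullback g (relFrob p s)) :=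
    ⟨fun _ => .of_isIso H.flip.isoPullback.hom, fun _ => .of_isIso H.flip.isoPullback.inv⟩
  rw [IsVariety, IsVariety, isSeparated_iff H, locallyOfFiniteType_iff H, quasiCompact_iff H, h1]
  refine ⟨fun h => ⟨⟨?_, h.2⟩, h.1⟩, fun h => ⟨h.2, h.1.2⟩⟩
  have := h1.mpr h.1
  exact isIntegral_of_isIntegral H

/-- Over a field a smooth scheme is reduced, and `X` is homeomorphic to the irreducible `Y`; hence
integrality of the pullback is automatic here, unlike in `isVariety_iff`. -/
lemma smooth_isVariety_iff (hk : IsField k) : Smooth f ∧ IsVariety (f ≫ s) ↔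
    Smooth g ∧ IsVariety (g ≫ frobTwistStr p s) := by
  rw [isVariety_iff H, smooth_iff H]
  refine ⟨fun h => ⟨h.1, h.2.1⟩, fun h => ⟨h.1, h.2, ?_⟩⟩
  have := h.2.1
  have hf := (smooth_iff H).mpr h.1
  have := isReduced_of_smooth_of_isField p (f ≫ s) hk
  have := irreducibleSpace_of_isHomeomorph ((isHomeomorph_of_isPullback H).homeomorph _).symm.isHomeomorph
  have := isIntegral_of_irreducibleSpace_of_isReduced X
  exact .of_isIso H.flip.isoPullback.hom

end Pullback

section RestrictsTo

variable {k : Type u} [CommRing k] (p : ℕ) [Fact p.Prime] [CharP k p] {S : Scheme.{u}}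
  (s : S ⟶ Spec (.of k)) [Smooth s]

/-- An isomorphism of schemes with connection is one of schemes over the base. -/
def NHIG₀.overIso {s : S ⟶ Spec (.of k)} {Y Y' : NHIG₀ s} (i : Y ≅ Y') :
    Y.obj.X ≅ Y'.obj.X := (NHIG₀.toOver s).mapIso i

lemma restrictsTo_cartier {P : NMIC₀ p s → Prop}
    {Q : ∀ {Y : Scheme.{u}}, (Y ⟶ frobTwist p s) → Prop}
    (h : ∀ {P' : NMIC₀ p s} {Y : Scheme.{u}} {q : P'.obj.X.left ⟶ Y} {g : Y ⟶ frobTwist p s},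
      IsPullback P'.obj.X.hom q (relFrob p s) g → (P P' ↔ Q g)) :
    RestrictsTo (cartier p s) P fun Y => Q Y.obj.X.hom := by
  refine restrictsTo_of_iff _ (fun P' => h (isPullback_descentMap p s P')) fun Y Y' i hY => ?_
  -- For isomorphic `Y` and `Y'`, the Frobenius pullback of `Y` is also one of `Y'`. So invariance
  -- of `Q` under isomorphism follows from using `h` twice.
  have H := isPullback_frobProj p s Y
  refine (h (H.of_iso (Iso.refl _) (Iso.refl _) ((Over.forget _).mapIso (NHIG₀.overIso i))
    (Iso.refl _) (snd' := frobProj p s Y ≫ (NHIG₀.overIso i).hom.left) (by simp) (by simp) (by simp)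
    (by simp))).mp ((h H).mpr hY)

theorem restrictsTo_finiteType : RestrictsTo (cartier p s)
    (fun P => IsSeparated (P.obj.X.hom ≫ s) ∧ LocallyOfFiniteType (P.obj.X.hom ≫ s) ∧
      QuasiCompact (P.obj.X.hom ≫ s))
    (fun Y => IsSeparated (Y.obj.X.hom ≫ frobTwistStr p s) ∧
      LocallyOfFiniteType (Y.obj.X.hom ≫ frobTwistStr p s) ∧
      QuasiCompact (Y.obj.X.hom ≫ frobTwistStr p s)) :=
  restrictsTo_cartier p s (Q := fun g => IsSeparated (g ≫ frobTwistStr p s) ∧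
    LocallyOfFiniteType (g ≫ frobTwistStr p s) ∧ QuasiCompact (g ≫ frobTwistStr p s)) fun H => by
    rw [isSeparated_iff H, locallyOfFiniteType_iff H, quasiCompact_iff H]

theorem restrictsTo_isVariety : RestrictsTo (cartier p s)
    (fun P => IsVariety (P.obj.X.hom ≫ s))
    (fun Y => IsVariety (Y.obj.X.hom ≫ frobTwistStr p s) ∧
      IsIntegral (pullback Y.obj.X.hom (relFrob p s))) :=
  restrictsTo_cartier p s (Q := fun g => IsVariety (g ≫ frobTwistStr p s) ∧
    IsIntegral (pullback g (relFrob p s))) isVariety_iff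

theorem restrictsTo_smooth : RestrictsTo (cartier p s)
    (fun P => Smooth P.obj.X.hom) (fun Y => Smooth Y.obj.X.hom) :=
  restrictsTo_cartier p s (Q := fun g => Smooth g) smooth_iff

theorem restrictsTo_smooth_isVariety (hk : IsField k) : RestrictsTo (cartier p s)
    (fun P => Smooth P.obj.X.hom ∧ IsVariety (P.obj.X.hom ≫ s))
    (fun Y => Smooth Y.obj.X.hom ∧ IsVariety (Y.obj.X.hom ≫ frobTwistStr p s)) :=
  restrictsTo_cartier p s (Q := fun g => Smooth g ∧ IsVariety (g ≫ frobTwistStr p s))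
    fun H => smooth_isVariety_iff H hk

end RestrictsTo

end


/-! ### Sheaves of modules in terms of sections -/

noncomputable section

set_option linter.unusedSectionVars false

section Sections

variable {X : Scheme.{u}} {M N T : X.Modules} {U : X.Opens}

lemma Modules.isSheaf_forget (M : X.Modules) :
    TopCat.Presheaf.IsSheaf (M.presheaf ⋙ forget Ab) :=
  (TopCat.Presheaf.isSheaf_iff_isSheaf_comp' (forget Ab) M.presheaf).mp M.isSheaf

lemma Modules.eq_of_locally (a b : Γ(M, U)) (h : ∀ y ∈ U, ∃ (W : X.Opens) (h : W ≤ U), y ∈ W ∧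
    M.presheaf.map (homOfLE h).op a = M.presheaf.map (homOfLE h).op b) : a = b :=
  NonlinearCartier.eq_of_locally _ (Modules.isSheaf_forget M) a b h

lemma Modules.exists_section (P : ∀ W : X.Opens, W ≤ U → Γ(M, W) → Prop)
    (res : ∀ (W W' : X.Opens) (h : W ≤ U) (i : W' ≤ W) (a : Γ(M, W)), P W h a →
      P W' (i.trans h) (M.presheaf.map (homOfLE i).op a))
    (uniq : ∀ (W : X.Opens) (h : W ≤ U) (a b : Γ(M, W)), P W h a → P W h b → a = b)
    (loc : ∀ y ∈ U, ∃ (W : X.Opens) (h : W ≤ U), y ∈ W ∧ ∃ a, P W h a) :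
    ∃ a : Γ(M, U), ∀ y ∈ U, ∃ (W : X.Opens) (h : W ≤ U), y ∈ W ∧
      P W h (M.presheaf.map (homOfLE h).op a) :=
  exists_glue _ (Modules.isSheaf_forget M) U P res uniq loc

lemma Modules.res_res {W W' : X.Opens} (h : W ≤ U) (i : W' ≤ W) (a : Γ(M, U)) :
    M.presheaf.map (homOfLE i).op (M.presheaf.map (homOfLE h).op a) =
      M.presheaf.map (homOfLE (i.trans h)).op a := by
  rw [← ConcreteCategory.comp_apply, ← Functor.map_comp]
  rfl

@[simp]
lemma Modules.res_self (h : U ≤ U) (a : Γ(M, U)) : M.presheaf.map (homOfLE h).op a = a := by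
  change M.presheaf.map (𝟙 _) a = a
  simp

lemma Modules.hom_res (φ : M ⟶ N) {W : X.Opens} (i : W ≤ U) (a : Γ(M, U)) :
    φ.app W (M.presheaf.map (homOfLE i).op a) = N.presheaf.map (homOfLE i).op (φ.app U a) :=
  ConcreteCategory.congr_hom (φ.mapPresheaf.naturality (homOfLE i).op) a

/-- A map of modules from its action on sections. -/
def Modules.mkHom (φ : ∀ U : X.Opens, Γ(M, U) →+ Γ(N, U))
    (hs : ∀ (U : X.Opens) (a : Γ(X, U)) (v : Γ(M, U)), φ U (a • v) = a • φ U v)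
    (hr : ∀ (U W : X.Opens) (i : W ≤ U) (v : Γ(M, U)),
      φ W (M.presheaf.map (homOfLE i).op v) = N.presheaf.map (homOfLE i).op (φ U v)) : M ⟶ N :=
  (Scheme.Modules.fullyFaithfulToPresheafOfModules (X := X)).preimage
    (PresheafOfModules.homMk
      { app := fun U => AddCommGrpCat.ofHom (φ U.unop)
        naturality := fun U W i => by
          ext v
          exact hr U.unop W.unop (leOfHom i.unop) v }
      fun U a v => hs U.unop a v)

lemma Modules.hom_ext_apply {φ ψ : M ⟶ N} (h : ∀ U v, φ.app U v = ψ.app U v) : φ = ψ :=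
  Scheme.Modules.hom_ext _ _ fun U => by ext v; exact h U v

lemma Modules.isIso_of_bijective (φ : M ⟶ N) (h : ∀ U, Function.Bijective (φ.app U)) :
    IsIso φ :=
  Scheme.Modules.Hom.isIso_iff_isIso_app.mpr fun U =>
    (ConcreteCategory.isIso_iff_bijective _).mpr (h U)

end Sections

/-- The data of a sheaf of modules, in terms of sections. -/
structure ModuleData (X : Scheme.{u}) where
  /-- the sections -/
  obj : X.Opens → Type u
  [group : ∀ U, AddCommGroup (obj U)]
  [module : ∀ U, Module Γ(X, U) (obj U)]
  /-- the restriction maps -/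
  res : ∀ {U W : X.Opens}, W ≤ U → (obj U →+ obj W)
  res_self : ∀ {U : X.Opens} (v : obj U), res (le_refl U) v = v
  res_res : ∀ {U V W : X.Opens} (i : V ≤ U) (j : W ≤ V) (v : obj U),
    res j (res i v) = res (j.trans i) v
  res_smul : ∀ {U W : X.Opens} (i : W ≤ U) (a : Γ(X, U)) (v : obj U),
    res i (a • v) = X.presheaf.map (homOfLE i).op a • res i v
  ext : ∀ {ι : Type u} (W : ι → X.Opens) (U : X.Opens) (h : ∀ i, W i ≤ U) (_ : U ≤ ⨆ i, W i)
    (v w : obj U), (∀ i, res (h i) v = res (h i) w) → v = w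
  glue : ∀ {ι : Type u} (W : ι → X.Opens) (U : X.Opens) (h : ∀ i, W i ≤ U) (_ : U ≤ ⨆ i, W i)
    (v : ∀ i, obj (W i)), (∀ i j, res (inf_le_left : W i ⊓ W j ≤ W i) (v i) =
      res (inf_le_right : W i ⊓ W j ≤ W j) (v j)) → ∃ w : obj U, ∀ i, res (h i) w = v i

namespace ModuleData

attribute [instance] group module

variable {X : Scheme.{u}} (d : ModuleData X)

/-- The presheaf of abelian groups. -/
def presheaf : X.Opensᵒᵖ ⥤ Ab.{u} where
  obj U := .of (d.obj U.unop)
  map i := AddCommGrpCat.ofHom (d.res (leOfHom i.unop))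
  map_id _ := by ext v; exact d.res_self v
  map_comp i j := by ext v; exact (d.res_res (leOfHom i.unop) (leOfHom j.unop) v).symm

lemma isSheaf : TopCat.Presheaf.IsSheaf d.presheaf := by
  refine (TopCat.Presheaf.isSheaf_iff_isSheaf_comp' (forget Ab) d.presheaf).mpr ?_
  refine TopCat.Presheaf.isSheaf_of_isSheafUniqueGluing_types _ fun ι W v hv => ?_
  obtain ⟨w, hw⟩ := d.glue W (iSup W) (le_iSup W) le_rfl v hv
  exact ⟨w, hw, fun w' hw' => d.ext W (iSup W) (le_iSup W) le_rfl w' w fun i =>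
    (hw' i).trans (hw i).symm⟩

/-- The sheaf of modules. -/
def toModules : X.Modules where
  val :=
    letI (U : X.Opensᵒᵖ) : Module (X.ringCatSheaf.obj.obj U) (d.presheaf.obj U) := d.module U.unop
    PresheafOfModules.ofPresheaf d.presheaf fun _ _ i a v => d.res_smul (leOfHom i.unop) a v
  isSheaf := d.isSheaf

/-- The sections of the sheaf. -/
def equiv (U : X.Opens) : d.obj U ≃+ Γ(d.toModules, U) := AddEquiv.refl (d.obj U)

end ModuleData

end


/-! ### Flat sections of modules with connection -/

noncomputable section

set_option linter.unusedSectionVars false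

section Pushforward

variable {X Y : Scheme.{u}} {f : X ⟶ Y} {M : X.Modules} {N : Y.Modules}
  (j : N ⟶ (Scheme.Modules.pushforward f).obj M)

/-- The action on sections of a map to a direct image. -/
def Modules.pushApp (U : Y.Opens) : Γ(N, U) →+ Γ(M, f ⁻¹ᵁ U) := (j.app U).hom

lemma Modules.pushApp_smul {U : Y.Opens} (a : Γ(Y, U)) (n : Γ(N, U)) :
    pushApp j U (a • n) = f.app U a • pushApp j U n := Scheme.Modules.Hom.app_smul j a n

lemma Modules.pushApp_res {U W : Y.Opens} (i : W ≤ U) (n : Γ(N, U)) :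
    pushApp j W (N.presheaf.map (homOfLE i).op n) =
      M.presheaf.map (homOfLE (f.preimage_mono i)).op (pushApp j U n) := Modules.hom_res j i n

end Pushforward

section LambdaModule

variable {k : Type u} [CommRing k] {S : Scheme.{u}} {s : S ⟶ Spec (.of k)}

namespace LambdaModule

section

variable {lam : k} (N : LambdaModule s lam)

/-- The covariant derivative as a homomorphism in the vector field. -/
lemma nabla_sum {ι : Type*} (t : Finset ι) {U : S.Opens} (D : ι → VectorField s U)
    (v : Γ(N.M, U)) : N.nabla U (∑ i ∈ t, D i) v = ∑ i ∈ t, N.nabla U (D i) v := by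
  let φ : VectorField s U →+ Γ(N.M, U) := AddMonoidHom.mk' (fun D => N.nabla U D v)
    fun D E => N.nabla_add U D E v
  exact map_sum φ D t

lemma nabla_zero (U : S.Opens) (v : Γ(N.M, U)) : N.nabla U 0 v = 0 := by
  simpa using N.nabla_sum (∅ : Finset Empty) (U := U) (fun _ => 0) v

lemma isFlat_res {U W : S.Opens} (i : W ≤ U) {v : Γ(N.M, U)} (h : N.IsFlat U v) :
    N.IsFlat W (N.M.presheaf.map (homOfLE i).op v) := fun W' i' D => by
  rw [Modules.res_res]
  exact h W' (i'.trans i) D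

lemma isFlat_of_locally {U : S.Opens} {v : Γ(N.M, U)} (h : ∀ y ∈ U, ∃ (W : S.Opens) (i : W ≤ U),
    y ∈ W ∧ N.IsFlat W (N.M.presheaf.map (homOfLE i).op v)) : N.IsFlat U v := fun W i D => by
  refine Modules.eq_of_locally _ _ fun y hy => ?_
  obtain ⟨W', i', hy', h'⟩ := h y (i hy)
  refine ⟨W' ⊓ W, inf_le_right, ⟨hy', hy⟩, ?_⟩
  have := h' (W' ⊓ W) inf_le_left (D.res inf_le_right)
  rw [Modules.res_res] at this
  rw [map_zero, ← N.nabla_res, Modules.res_res, this]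

/-- A module with the zero `0`-connection. -/
def ofModule (s : S ⟶ Spec (.of k)) (M : S.Modules) : LambdaModule s 0 where
  M := M
  nabla _ _ := 0
  nabla_add _ _ _ _ := (add_zero _).symm
  nabla_smul _ _ _ _ := (smul_zero _).symm
  leibniz _ _ _ _ := by simp
  nabla_res _ _ _ _ _ := (map_zero _).symm

end

variable {p : ℕ} [Fact p.Prime] [CharP k p] (N : LambdaModule s 1)

/-- Flat sections over the open sets of the Frobenius twist. -/
def flatSections (p : ℕ) [Fact p.Prime] [CharP k p] (U : (frobTwist p s).Opens) :
    AddSubgroup Γ(N.M, relFrob p s ⁻¹ᵁ U) where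
  carrier := {v | N.IsFlat _ v}
  add_mem' ha hb W h D := by rw [map_add, map_add, ha W h D, hb W h D, add_zero]
  zero_mem' W h D := by rw [map_zero, map_zero]
  neg_mem' ha W h D := by rw [map_neg, map_neg, ha W h D, neg_zero]

section

variable [Smooth s]

lemma isFlat_smul {U : (frobTwist p s).Opens} {W : S.Opens} (e : W ≤ relFrob p s ⁻¹ᵁ U)
    (a : Γ(frobTwist p s, U)) {v : Γ(N.M, W)} (h : N.IsFlat _ v) :
    N.IsFlat _ ((relFrob p s).appLE U W e a • v) := fun W' i D => by
  rw [Scheme.Modules.map_smul, N.leibniz, h, smul_zero, add_zero]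
  have : D.act W' le_rfl (S.presheaf.map (homOfLE i).op ((relFrob p s).appLE U W e a)) = 0 := by
    rw [appLE_res]
    exact D.act_relFrob _ _ _
  rw [this, mul_zero, zero_smul]

/-- The sheaf of flat sections. -/
def flatData (p : ℕ) [Fact p.Prime] [CharP k p] : ModuleData (frobTwist p s) where
  obj U := N.flatSections p U
  module U :=
    { smul := fun a v => ⟨(relFrob p s).appLE U _ le_rfl a • v.1, N.isFlat_smul le_rfl a v.2⟩
      one_smul := fun v => Subtype.ext (by
        change (relFrob p s).appLE U _ le_rfl 1 • v.1 = _
        rw [map_one, one_smul])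
      mul_smul := fun a b v => Subtype.ext (by
        change (relFrob p s).appLE U _ le_rfl (a * b) • v.1 = _ • _ • _
        rw [map_mul, mul_smul])
      smul_zero := fun a => Subtype.ext (smul_zero _)
      smul_add := fun a v w => Subtype.ext (smul_add _ _ _)
      add_smul := fun a b v => Subtype.ext (by
        change (relFrob p s).appLE U _ le_rfl (a + b) • v.1 = _ • _ + _ • _
        rw [map_add, add_smul])
      zero_smul := fun v => Subtype.ext (by
        change (relFrob p s).appLE U _ le_rfl 0 • v.1 = 0
        rw [map_zero, zero_smul]) }
  res i := ((N.M.presheaf.map (homOfLE ((relFrob p s).preimage_mono i)).op).hom.comp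
    (N.flatSections p _).subtype).codRestrict (N.flatSections p _) fun v => N.isFlat_res _ v.2
  res_self v := Subtype.ext (Modules.res_self _ _)
  res_res i j v := Subtype.ext (Modules.res_res _ _ _)
  res_smul i a v := Subtype.ext (by
    change N.M.presheaf.map _ ((relFrob p s).appLE _ _ le_rfl a • v.1) =
      (relFrob p s).appLE _ _ le_rfl _ • N.M.presheaf.map _ v.1
    rw [Scheme.Modules.map_smul, appLE_res, res_appLE])
  ext W U h hU v w hvw := Subtype.ext (Modules.eq_of_locally _ _ fun y hy => by
    obtain ⟨i, hi⟩ := TopologicalSpace.Opens.mem_iSup.mp (hU hy)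
    exact ⟨_, (relFrob p s).preimage_mono (h i), hi, congrArg Subtype.val (hvw i)⟩)
  glue {ι} W U h hU v hv := by
    -- The predicate asks for agreement with every `v i` on all common open sets; this makes the
    -- glued section unique. Flatness of the result is then checked locally.
    have hex := Modules.exists_section (M := N.M) (U := relFrob p s ⁻¹ᵁ U)
      (fun V _ w => ∀ (i : ι) (V' : S.Opens) (hV : V' ≤ V) (hi : V' ≤ relFrob p s ⁻¹ᵁ W i),
        N.M.presheaf.map (homOfLE hV).op w = N.M.presheaf.map (homOfLE hi).op (v i).1)
      (fun V V' hV hV' w hw i V'' h1 h2 => by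
        rw [Modules.res_res]
        exact hw i V'' _ h2)
      (fun V hV a b ha hb => by
        refine Modules.eq_of_locally _ _ fun y hy => ?_
        obtain ⟨i, hi⟩ := TopologicalSpace.Opens.mem_iSup.mp (hU (hV hy))
        refine ⟨V ⊓ relFrob p s ⁻¹ᵁ W i, inf_le_left, ⟨hy, hi⟩, ?_⟩
        rw [ha i _ _ inf_le_right, hb i _ _ inf_le_right])
      (fun y hy => by
        obtain ⟨i, hi⟩ := TopologicalSpace.Opens.mem_iSup.mp (hU hy)
        refine ⟨_, (relFrob p s).preimage_mono (h i), hi, (v i).1, fun j V' h1 h2 => ?_⟩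
        have h3 := congrArg (fun w => N.M.presheaf.map (homOfLE (le_inf h1 h2 :
          V' ≤ relFrob p s ⁻¹ᵁ (W i ⊓ W j))).op w.1) (hv i j)
        exact ((Modules.res_res _ _ _).symm.trans h3).trans (Modules.res_res _ _ _))
    obtain ⟨w, hw⟩ := hex
    have key : ∀ i, N.M.presheaf.map (homOfLE ((relFrob p s).preimage_mono (h i))).op w =
        (v i).1 := fun i => by
      refine Modules.eq_of_locally _ _ fun y hy => ?_
      obtain ⟨V, hV, hyV, H⟩ := hw y (h i hy)
      refine ⟨V ⊓ relFrob p s ⁻¹ᵁ W i, inf_le_right, ⟨hyV, hy⟩, ?_⟩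
      rw [← H i _ inf_le_left inf_le_right, Modules.res_res, Modules.res_res]
    refine ⟨⟨w, N.isFlat_of_locally fun y hy => ?_⟩, fun i => Subtype.ext (key i)⟩
    obtain ⟨i, hi⟩ := TopologicalSpace.Opens.mem_iSup.mp (hU hy)
    refine ⟨_, (relFrob p s).preimage_mono (h i), hi, ?_⟩
    rw [key]
    exact (v i).2

/-- The module of flat sections, over the Frobenius twist. -/
def flatModule (p : ℕ) [Fact p.Prime] [CharP k p] : (frobTwist p s).Modules :=
  (N.flatData p).toModules

/-- The inclusion of the flat sections. -/
def flatι (p : ℕ) [Fact p.Prime] [CharP k p] :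
    N.flatModule p ⟶ (Scheme.Modules.pushforward (relFrob p s)).obj N.M :=
  Modules.mkHom (fun U => (N.flatSections p U).subtype)
    (fun U a v => by
      change (relFrob p s).appLE U _ le_rfl a • (v : N.flatSections p U).1 = _
      rw [Scheme.Hom.appLE_eq_app]
      rfl)
    (fun _ _ _ _ => rfl)

end

/-- `N'` is the module of flat sections of `N`. -/
structure IsFlatModel {N' : (frobTwist p s).Modules}
    (j : N' ⟶ (Scheme.Modules.pushforward (relFrob p s)).obj N.M) : Prop where
  injective : ∀ U, Function.Injective (j.app U)
  range_eq : ∀ U, Set.range (j.app U) = {v : Γ(N.M, relFrob p s ⁻¹ᵁ U) | N.IsFlat _ v}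

lemma isFlatModel_flatι [Smooth s] : N.IsFlatModel (N.flatι p) where
  injective _ := Subtype.val_injective
  range_eq _ := Subtype.range_coe

end LambdaModule

end LambdaModule

section Decomposition

variable {k : Type u} [CommRing k] {p : ℕ} [Fact p.Prime] [CharP k p] {S : Scheme.{u}}
  {s : S ⟶ Spec (.of k)} [Smooth s] {N : LambdaModule s 1} {V : S.Opens} (C : Coordinates p s V)

namespace LambdaModule

lemma isFlat_iff {W : S.Opens} (h : W ≤ V) (v : Γ(N.M, W)) :
    N.IsFlat W v ↔ ∀ i, N.nabla W ((C.tangent i).res h) v = 0 := by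
  refine ⟨fun H i => by simpa using H W le_rfl ((C.tangent i).res h), fun H W' i D => ?_⟩
  rw [C.vectorField_eq_sum (i.trans h) D, N.nabla_sum]
  refine Finset.sum_eq_zero fun j _ => ?_
  rw [N.nabla_smul]
  have : (C.tangent j).res (i.trans h) = ((C.tangent j).res h).res i := rfl
  rw [this, N.nabla_res, H, map_zero, smul_zero]

/-- These are the relations found above for functions, with the Leibniz rule of `∇` in place of the
symbol condition. -/
lemma weylModule (hi : N.Integrable) (hp : N.PCurvatureZero p) {W : S.Opens} (h : W ≤ V) :
    WeylModule p (M := Γ(N.M, W)) (fun i => S.presheaf.map (homOfLE h).op (C.x i))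
      (fun i => N.nabla W ((C.tangent i).res h)) where
  char := natCast_eq_zero s p W
  comm i j m := by
    have h1 := hi W ((C.tangent i).res h) ((C.tangent j).res h) m
    have h2 : ⁅(C.tangent i).res h, (C.tangent j).res h⁆ = ⁅C.tangent i, C.tangent j⁆.res h := rfl
    have h3 : (0 : VectorField s V).res h = 0 := rfl
    rw [h2, C.bracket_tangent, h3, N.nabla_zero, smul_zero] at h1
    exact sub_eq_zero.mp h1
  leibniz i j m := by
    rw [N.leibniz, map_one, one_mul, VectorField.res_act, C.tangent_x, add_comm]
    split_ifs <;> simp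
  iterate_eq_zero i m := by
    have h2 : ((C.tangent i).res h).pPow p = ((C.tangent i).pPow p).res h := rfl
    have h3 : (0 : VectorField s V).res h = 0 := rfl
    rw [hp W ((C.tangent i).res h) m, h2, C.pPow_tangent, h3, N.nabla_zero]

end LambdaModule

/-- The sections of `M` over `V` are free on monomials over those of `N'`. -/
def ModuleBasis {N' : (frobTwist p s).Modules} {M : S.Modules}
    (j : N' ⟶ (Scheme.Modules.pushforward (relFrob p s)).obj M) (U : (frobTwist p s).Opens)
    (h : relFrob p s ⁻¹ᵁ U ≤ V) : Prop :=
  ∀ v : Γ(M, relFrob p s ⁻¹ᵁ U), ∃! c : (Fin C.n → Fin p) → Γ(N', U),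
    v = ∑ I, S.presheaf.map (homOfLE h).op (monom C.x I) • Modules.pushApp j U (c I)

/-- Cartier's theorem for modules in local form: the Weyl relations give unique flat coefficients,
which are the sections of `N'`. -/
lemma LambdaModule.IsFlatModel.moduleBasis (hi : N.Integrable) (hp : N.PCurvatureZero p)
    {N' : (frobTwist p s).Modules} {j : N' ⟶ (Scheme.Modules.pushforward (relFrob p s)).obj N.M}
    (H : N.IsFlatModel j) (U : (frobTwist p s).Opens) (h : relFrob p s ⁻¹ᵁ U ≤ V) :
    ModuleBasis C j U h := by
  have hw := weylModule C hi hp h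
  have key : ∀ c : (Fin C.n → Fin p) → Γ(N', U), ∀ I i, N.nabla _ ((C.tangent i).res h)
      (Modules.pushApp j U (c I)) = 0 := fun c I =>
    (isFlat_iff C h _).mp ((H.range_eq U).le ⟨c I, rfl⟩)
  have hm : ∀ I : Fin C.n → Fin p, S.presheaf.map (homOfLE h).op (monom C.x I) =
      monom (fun i => S.presheaf.map (homOfLE h).op (C.x i)) I := fun I =>
    map_monom (S.presheaf.map (homOfLE h).op).hom C.x I
  intro v
  obtain ⟨n, hn, hs⟩ := hw.exists_sum v
  choose c hc using fun I => (H.range_eq U).ge ((isFlat_iff C h (n I)).mpr (hn I))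
  refine ⟨c, ?_, fun c' hc' => funext fun I => H.injective U ?_⟩
  · refine hs.trans (Finset.sum_congr rfl fun I _ => ?_)
    rw [hm, ← hc]
    rfl
  · have h1 := hw.eq_of_sum_eq_sum (key c') hn (by
      rw [← hs, hc']
      exact Finset.sum_congr rfl fun I _ => by rw [hm])
    exact (congrFun h1 I).trans (hc I).symm

end Decomposition

end


/-! ### Maps out of Frobenius pullbacks of modules -/

noncomputable section

set_option linter.unusedSectionVars false

section Expansion

variable {k : Type u} [CommRing k] {p : ℕ} [Fact p.Prime] [CharP k p] {S : Scheme.{u}}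
  {s : S ⟶ Spec (.of k)} [Smooth s]

lemma exists_coordinates_preimage (p : ℕ) [Fact p.Prime] [CharP k p] (s : S ⟶ Spec (.of k))
    [Smooth s] {W : S.Opens} {y : S} (hy : y ∈ W) :
    ∃ (U : (frobTwist p s).Opens) (V : S.Opens) (_ : Coordinates p s V),
      relFrob p s ⁻¹ᵁ U ≤ V ∧ relFrob p s ⁻¹ᵁ U ≤ W ∧ y ∈ relFrob p s ⁻¹ᵁ U := by
  obtain ⟨V, hV, hy, ⟨C⟩⟩ := exists_coordinates_nhds p s hy
  refine ⟨twist p s V, V, C, ?_, ?_, ?_⟩ <;> rw [relFrob_preimage_twist]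
  exacts [hV, hy]

variable {V : S.Opens} (C : Coordinates p s V)

lemma Coordinates.existsUnique_expansion {U : (frobTwist p s).Opens} (h : relFrob p s ⁻¹ᵁ U ≤ V)
    (a : Γ(S, relFrob p s ⁻¹ᵁ U)) : ∃! c : (Fin C.n → Fin p) → Γ(frobTwist p s, U),
      a = ∑ I, S.presheaf.map (homOfLE h).op (monom C.x I) * (relFrob p s).app U (c I) := by
  have key : ∀ c : (Fin C.n → Fin p) → Γ(frobTwist p s, U),
      ∑ I, S.presheaf.map (homOfLE h).op (monom C.x I) * (relFrob p s).app U (c I) =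
        ∑ I, (𝟙 S : S ⟶ S).appLE V (relFrob p s ⁻¹ᵁ U) h (monom C.x I) *
          (relFrob p s).appLE U _ le_rfl (c I) := fun c => by
    rw [Scheme.Hom.appLE_eq_app]
    rfl
  simp only [key]
  exact monomialBasis_of_isPullback (isPullback_relFrob p s) C (W := U) (le_twist_iff.mpr h) a

lemma Coordinates.exists_expansion {U : (frobTwist p s).Opens} (h : relFrob p s ⁻¹ᵁ U ≤ V)
    (a : Γ(S, relFrob p s ⁻¹ᵁ U)) : ∃ c : (Fin C.n → Fin p) → Γ(frobTwist p s, U),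
      a = ∑ I, S.presheaf.map (homOfLE h).op (monom C.x I) * (relFrob p s).app U (c I) :=
  (C.existsUnique_expansion h a).exists

variable {N' : (frobTwist p s).Modules}

/-- The coefficients depend on the functions `a` alone. So one rearrangement is valid for all
modules `N'`, all targets and all maps `t`, which allows images under two different maps to be
compared. -/
lemma exists_coeff_rearrangement {U : (frobTwist p s).Opens} (h : relFrob p s ⁻¹ᵁ U ≤ V)
    {ι : Type*} [Fintype ι] (a : ι → Γ(S, relFrob p s ⁻¹ᵁ U)) :
    ∃ b : ι → (Fin C.n → Fin p) → Γ(frobTwist p s, U), ∀ {N' : (frobTwist p s).Modules}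
      {T : S.Modules} (t : N' ⟶ (Scheme.Modules.pushforward (relFrob p s)).obj T)
      (n : ι → Γ(N', U)), ∑ i, a i • Modules.pushApp t U (n i) =
        ∑ I, S.presheaf.map (homOfLE h).op (monom C.x I) •
          Modules.pushApp t U (∑ i, b i I • n i) := by
  choose b hb using fun i => C.exists_expansion h (a i)
  refine ⟨b, fun t n => ?_⟩
  simp only [map_sum, Finset.smul_sum, Modules.pushApp_smul]
  rw [Finset.sum_comm]
  refine Finset.sum_congr rfl fun i _ => ?_
  conv_lhs => rw [hb i, Finset.sum_smul]
  exact Finset.sum_congr rfl fun I _ => mul_smul _ _ _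

lemma exists_rearrangement {U : (frobTwist p s).Opens} (h : relFrob p s ⁻¹ᵁ U ≤ V)
    {ι : Type*} [Fintype ι] (a : ι → Γ(S, relFrob p s ⁻¹ᵁ U)) (n : ι → Γ(N', U)) :
    ∃ c : (Fin C.n → Fin p) → Γ(N', U),
      ∀ {T : S.Modules} (t : N' ⟶ (Scheme.Modules.pushforward (relFrob p s)).obj T),
        ∑ i, a i • Modules.pushApp t U (n i) =
          ∑ I, S.presheaf.map (homOfLE h).op (monom C.x I) • Modules.pushApp t U (c I) := by
  obtain ⟨b, hb⟩ := exists_coeff_rearrangement C h a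
  exact ⟨fun I => ∑ i, b i I • n i, fun t => hb t n⟩

variable {M : S.Modules} (j : N' ⟶ (Scheme.Modules.pushforward (relFrob p s)).obj M)

/-- `j` exhibits `M` as the Frobenius pullback of `N'`. -/
def IsFrobPullback : Prop :=
  ∀ ⦃V : S.Opens⦄ (C : Coordinates p s V) (U : (frobTwist p s).Opens)
    (h : relFrob p s ⁻¹ᵁ U ≤ V), ModuleBasis C j U h

lemma LambdaModule.IsFlatModel.isFrobPullback {N : LambdaModule s 1} (hi : N.Integrable)
    (hp : N.PCurvatureZero p) {j : N' ⟶ (Scheme.Modules.pushforward (relFrob p s)).obj N.M}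
    (H : N.IsFlatModel j) : IsFrobPullback j :=
  fun _ C U h => H.moduleBasis C hi hp U h

variable {T : S.Modules} (t : N' ⟶ (Scheme.Modules.pushforward (relFrob p s)).obj T)

/-- `v` and `b` are the same combination of sections of `N'`. -/
def Corresponds (W : S.Opens) (v : Γ(M, W)) (b : Γ(T, W)) : Prop :=
  ∀ ⦃V : S.Opens⦄ (C : Coordinates p s V) (U : (frobTwist p s).Opens)
    (h : relFrob p s ⁻¹ᵁ U ≤ V) (i : relFrob p s ⁻¹ᵁ U ≤ W),
    ∃ c : (Fin C.n → Fin p) → Γ(N', U),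
      M.presheaf.map (homOfLE i).op v =
        ∑ I, S.presheaf.map (homOfLE h).op (monom C.x I) • Modules.pushApp j U (c I) ∧
      T.presheaf.map (homOfLE i).op b =
        ∑ I, S.presheaf.map (homOfLE h).op (monom C.x I) • Modules.pushApp t U (c I)

namespace Corresponds

variable {j t} {W : S.Opens}

lemma of_sum {ι : Type*} [Fintype ι] {U : (frobTwist p s).Opens}
    (a : ι → Γ(S, relFrob p s ⁻¹ᵁ U)) (n : ι → Γ(N', U)) :
    Corresponds j t (relFrob p s ⁻¹ᵁ U) (∑ i, a i • Modules.pushApp j U (n i))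
      (∑ i, a i • Modules.pushApp t U (n i)) := fun _ C U' h i => by
  have i' := relFrob_preimage_le_iff.mp i
  obtain ⟨c, hc⟩ := exists_rearrangement C h (fun l => S.presheaf.map (homOfLE i).op (a l))
    (fun l => N'.presheaf.map (homOfLE i').op (n l))
  refine ⟨c, ?_, ?_⟩
  all_goals
    rw [← hc, map_sum]
    exact Finset.sum_congr rfl fun l _ => by
      rw [Scheme.Modules.map_smul, Modules.pushApp_res]

lemma pushApp (U : (frobTwist p s).Opens) (n : Γ(N', U)) :
    Corresponds j t (relFrob p s ⁻¹ᵁ U) (Modules.pushApp j U n) (Modules.pushApp t U n) := by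
  have := of_sum (j := j) (t := t) (fun _ : Unit => 1) (fun _ : Unit => n)
  simp only [Finset.univ_unique, Finset.sum_singleton, one_smul] at this
  exact this

lemma res {W' : S.Opens} (i : W' ≤ W) {v : Γ(M, W)} {b : Γ(T, W)} (H : Corresponds j t W v b) :
    Corresponds j t W' (M.presheaf.map (homOfLE i).op v) (T.presheaf.map (homOfLE i).op b) :=
  fun _ C U h i' => by
    obtain ⟨c, h1, h2⟩ := H C U h (i'.trans i)
    exact ⟨c, (Modules.res_res _ _ _).trans h1, (Modules.res_res _ _ _).trans h2⟩

lemma add {v v' : Γ(M, W)} {b b' : Γ(T, W)} (H : Corresponds j t W v b)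
    (H' : Corresponds j t W v' b') : Corresponds j t W (v + v') (b + b') := fun _ C U h i => by
  obtain ⟨c, h1, h2⟩ := H C U h i
  obtain ⟨c', h1', h2'⟩ := H' C U h i
  refine ⟨c + c', ?_, ?_⟩
  · rw [map_add, h1, h1', ← Finset.sum_add_distrib]
    exact Finset.sum_congr rfl fun I _ => by rw [Pi.add_apply, map_add, smul_add]
  · rw [map_add, h2, h2', ← Finset.sum_add_distrib]
    exact Finset.sum_congr rfl fun I _ => by rw [Pi.add_apply, map_add, smul_add]

lemma smul (a : Γ(S, W)) {v : Γ(M, W)} {b : Γ(T, W)} (H : Corresponds j t W v b) :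
    Corresponds j t W (a • v) (a • b) := fun _ C U h i => by
  obtain ⟨c, h1, h2⟩ := H C U h i
  obtain ⟨c', hc'⟩ := exists_rearrangement C h (fun I => S.presheaf.map (homOfLE i).op a *
    S.presheaf.map (homOfLE h).op (monom C.x I)) c
  refine ⟨c', ?_, ?_⟩
  · rw [Scheme.Modules.map_smul, h1, ← hc', Finset.smul_sum]
    exact Finset.sum_congr rfl fun I _ => (mul_smul _ _ _).symm
  · rw [Scheme.Modules.map_smul, h2, ← hc', Finset.smul_sum]
    exact Finset.sum_congr rfl fun I _ => (mul_smul _ _ _).symm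

/-- The coefficients of `v` over the large open set restrict to those found locally, by uniqueness
in `M`; so the corresponding combination in `T` is locally `b`. -/
lemma of_locally {v : Γ(M, W)} {b : Γ(T, W)} (H : ∀ y ∈ W, ∃ (W' : S.Opens) (i : W' ≤ W),
      y ∈ W' ∧ Corresponds j t W' (M.presheaf.map (homOfLE i).op v)
        (T.presheaf.map (homOfLE i).op b)) (hj : IsFrobPullback j) : Corresponds j t W v b :=
  fun _ C U h i => by
    obtain ⟨c, hc, -⟩ := hj C U h (M.presheaf.map (homOfLE i).op v)
    refine ⟨c, hc, Modules.eq_of_locally _ _ fun y hy => ?_⟩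
    obtain ⟨W', i', hy', H'⟩ := H y (i hy)
    have hle : relFrob p s ⁻¹ᵁ (twist p s W' ⊓ U) ≤ W' :=
      ((relFrob p s).preimage_mono inf_le_left).trans (relFrob_preimage_twist p s W').le
    have hle' : relFrob p s ⁻¹ᵁ (twist p s W' ⊓ U) ≤ relFrob p s ⁻¹ᵁ U :=
      (relFrob p s).preimage_mono inf_le_right
    obtain ⟨c', h1, h2⟩ := H' C (twist p s W' ⊓ U) (hle'.trans h) hle
    refine ⟨_, hle', ⟨(relFrob_preimage_twist p s W').ge hy', hy⟩, ?_⟩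
    have key : ∀ {T' : S.Modules} (t' : N' ⟶ (Scheme.Modules.pushforward (relFrob p s)).obj T'),
        T'.presheaf.map (homOfLE hle').op
          (∑ I, S.presheaf.map (homOfLE h).op (monom C.x I) • Modules.pushApp t' U (c I)) =
        ∑ I, S.presheaf.map (homOfLE (hle'.trans h)).op (monom C.x I) •
          Modules.pushApp t' _ (N'.presheaf.map (homOfLE inf_le_right).op (c I)) := fun t' => by
      rw [map_sum]
      exact Finset.sum_congr rfl fun I _ => by
        rw [Scheme.Modules.map_smul, Modules.pushApp_res, res_res]
    have hcc : c' = fun I => N'.presheaf.map (homOfLE inf_le_right).op (c I) := by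
      refine (hj C _ (hle'.trans h) _).unique h1 ?_
      rw [Modules.res_res, ← key, ← hc, Modules.res_res]
    rw [key, Modules.res_res, ← Modules.res_res i' hle, h2, hcc]

/-- Together with `exists_corresponds` this makes the relation the graph of a map `M ⟶ T`, which is
the extension `IsFrobPullback.desc`. -/
lemma unique {v : Γ(M, W)} {b b' : Γ(T, W)} (hj : IsFrobPullback j) (H : Corresponds j t W v b)
    (H' : Corresponds j t W v b') : b = b' := by
  refine Modules.eq_of_locally _ _ fun y hy => ?_
  obtain ⟨U, V, C, h, i, hy⟩ := exists_coordinates_preimage p s hy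
  obtain ⟨c, h1, h2⟩ := H C U h i
  obtain ⟨c', h1', h2'⟩ := H' C U h i
  exact ⟨_, i, hy, by rw [h2, h2', (hj C U h _).unique h1 h1']⟩

variable (t) in
lemma exists_corresponds (hj : IsFrobPullback j) (v : Γ(M, W)) : ∃ b, Corresponds j t W v b := by
  obtain ⟨b, hb⟩ := Modules.exists_section (M := T) (U := W)
    (fun W' h b => Corresponds j t W' (M.presheaf.map (homOfLE h).op v) b)
    (fun W' W'' h i b H => by
      have := H.res i
      rwa [Modules.res_res] at this)
    (fun W' h b b' H H' => H.unique hj H') (fun y hy => by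
      obtain ⟨U, V, C, h, i, hy⟩ := exists_coordinates_preimage p s hy
      obtain ⟨c, hc, -⟩ := hj C U h (M.presheaf.map (homOfLE i).op v)
      exact ⟨_, i, hy, _, by rw [hc]; exact of_sum _ c⟩)
  exact ⟨b, of_locally hb hj⟩

end Corresponds

variable {j}

/-- Extension of a map from `N'` to its Frobenius pullback. -/
def IsFrobPullback.desc (hj : IsFrobPullback j) : M ⟶ T :=
  Modules.mkHom
    (fun U => AddMonoidHom.mk' (fun v => (Corresponds.exists_corresponds t hj v).choose)
      fun v w => Corresponds.unique hj (Corresponds.exists_corresponds t hj (v + w)).choose_spec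
        ((Corresponds.exists_corresponds t hj v).choose_spec.add
          (Corresponds.exists_corresponds t hj w).choose_spec))
    (fun U a v => Corresponds.unique hj
      (Corresponds.exists_corresponds t hj (a • v)).choose_spec
      ((Corresponds.exists_corresponds t hj v).choose_spec.smul a))
    (fun U W i v => Corresponds.unique hj
      (Corresponds.exists_corresponds t hj (M.presheaf.map (homOfLE i).op v)).choose_spec
      ((Corresponds.exists_corresponds t hj v).choose_spec.res i))

lemma IsFrobPullback.corresponds_desc (hj : IsFrobPullback j) {W : S.Opens} (v : Γ(M, W)) :
    Corresponds j t W v ((hj.desc t).app W v) :=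
  (Corresponds.exists_corresponds t hj v).choose_spec

lemma IsFrobPullback.desc_pushApp (hj : IsFrobPullback j) {U : (frobTwist p s).Opens}
    (n : Γ(N', U)) : (hj.desc t).app _ (Modules.pushApp j U n) = Modules.pushApp t U n :=
  (hj.corresponds_desc t _).unique hj (Corresponds.pushApp U n)

/-- The maps need not be morphisms of sheaves: compatibility with restriction is required only for
the given `v`. This lets the lemma apply to operators that are meaningful only below one open set.
-/
lemma IsFrobPullback.eq_of_sections (hj : IsFrobPullback j) {φ ψ : ∀ W, Γ(M, W) →+ Γ(T, W)}
    (hφ : ∀ (W : S.Opens) (a : Γ(S, W)) (v : Γ(M, W)), φ W (a • v) = a • φ W v)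
    (hψ : ∀ (W : S.Opens) (a : Γ(S, W)) (v : Γ(M, W)), ψ W (a • v) = a • ψ W v)
    {W : S.Opens} (v : Γ(M, W))
    (hφr : ∀ (W' : S.Opens) (i : W' ≤ W), φ W' (M.presheaf.map (homOfLE i).op v) =
      T.presheaf.map (homOfLE i).op (φ W v))
    (hψr : ∀ (W' : S.Opens) (i : W' ≤ W), ψ W' (M.presheaf.map (homOfLE i).op v) =
      T.presheaf.map (homOfLE i).op (ψ W v))
    (H : ∀ (U : (frobTwist p s).Opens) (_ : relFrob p s ⁻¹ᵁ U ≤ W) (n : Γ(N', U)),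
      φ _ (Modules.pushApp j U n) = ψ _ (Modules.pushApp j U n)) :
    φ W v = ψ W v := by
  refine Modules.eq_of_locally _ _ fun y hy => ?_
  obtain ⟨U, V, C, h, i, hy⟩ := exists_coordinates_preimage p s hy
  obtain ⟨c, hc, -⟩ := hj C U h (M.presheaf.map (homOfLE i).op v)
  refine ⟨_, i, hy, ?_⟩
  rw [← hφr, ← hψr, hc, map_sum, map_sum]
  exact Finset.sum_congr rfl fun I _ => by rw [hφ, hψ, H U i]

lemma IsFrobPullback.hom_ext (hj : IsFrobPullback j) {φ ψ : M ⟶ T}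
    (H : ∀ U n, φ.app _ (Modules.pushApp j U n) = ψ.app _ (Modules.pushApp j U n)) : φ = ψ :=
  Modules.hom_ext_apply fun W v => hj.eq_of_sections (φ := fun W => (φ.app W).hom)
    (ψ := fun W => (ψ.app W).hom) (fun _ a v => φ.app_smul a v) (fun _ a v => ψ.app_smul a v) v
    (fun _ i => Modules.hom_res φ i v) (fun _ i => Modules.hom_res ψ i v) (fun U _ n => H U n)

end Expansion

end


/-! ### Local homomorphisms of sheaves of modules -/

noncomputable section

set_option linter.unusedSectionVars false

namespace ModuleData

variable {X : Scheme.{u}}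

/-- The sections of a sheaf of modules. -/
def ofModules (M : X.Modules) : ModuleData X where
  obj U := Γ(M, U)
  res i := (M.presheaf.map (homOfLE i).op).hom
  res_self v := Modules.res_self le_rfl v
  res_res i j v := Modules.res_res i j v
  res_smul i a v := Scheme.Modules.map_smul M (homOfLE i) a v
  ext W U h hU v w hvw := Modules.eq_of_locally _ _ fun y hy => by
    obtain ⟨i, hi⟩ := TopologicalSpace.Opens.mem_iSup.mp (hU hy)
    exact ⟨_, h i, hi, hvw i⟩
  glue W U h hU v hv := by
    obtain ⟨w, hw, -⟩ := TopCat.Sheaf.existsUnique_gluing' ⟨M.presheaf, M.isSheaf⟩ W U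
      (fun i => homOfLE (h i)) hU v fun i j => hv i j
    exact ⟨w, hw⟩

/-- The direct image of the structure sheaf. -/
def ofHom {Y : Scheme.{u}} (f : X ⟶ Y) : ModuleData Y where
  obj U := Γ(X, f ⁻¹ᵁ U)
  module U := (f.app U).hom.toModule
  res i := (X.presheaf.map (homOfLE (f.preimage_mono i)).op).hom.toAddMonoidHom
  res_self v := NonlinearCartier.res_self _ v
  res_res i j v := NonlinearCartier.res_res _ _ v
  res_smul {U W} i a v := by
    change X.presheaf.map _ (f.app U a * v) = f.app W _ * X.presheaf.map _ v
    rw [map_mul, app_res]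
  ext W U h hU v w hvw := sections_ext _ _ fun y hy => by
    obtain ⟨i, hi⟩ := TopologicalSpace.Opens.mem_iSup.mp (hU hy)
    exact ⟨_, f.preimage_mono (h i), hi, hvw i⟩
  glue W U h hU v hv := by
    obtain ⟨w, hw, -⟩ := TopCat.Sheaf.existsUnique_gluing' X.sheaf (fun i => f ⁻¹ᵁ W i) (f ⁻¹ᵁ U)
      (fun i => homOfLE (f.preimage_mono (h i))) (fun y hy => by
        obtain ⟨i, hi⟩ := TopologicalSpace.Opens.mem_iSup.mp (hU hy)
        exact TopologicalSpace.Opens.mem_iSup.mpr ⟨i, hi⟩) v fun i j => hv i j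
    exact ⟨w, hw⟩

/-- The structure sheaf. -/
def unit (X : Scheme.{u}) : ModuleData X where
  obj U := Γ(X, U)
  res i := (X.presheaf.map (homOfLE i).op).hom.toAddMonoidHom
  res_self v := NonlinearCartier.res_self _ v
  res_res i j v := NonlinearCartier.res_res _ _ v
  res_smul i a v := map_mul (X.presheaf.map (homOfLE i).op).hom a v
  ext W U h hU v w hvw := sections_ext _ _ fun y hy => by
    obtain ⟨i, hi⟩ := TopologicalSpace.Opens.mem_iSup.mp (hU hy)
    exact ⟨_, h i, hi, hvw i⟩
  glue W U h hU v hv := by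
    obtain ⟨w, hw, -⟩ := TopCat.Sheaf.existsUnique_gluing' X.sheaf W U
      (fun i => homOfLE (h i)) hU v fun i j => hv i j
    exact ⟨w, hw⟩

variable (d₁ d₂ d₃ d₄ : ModuleData X)

/-- Linear maps between the restrictions to `U`. -/
def localHoms (U : X.Opens) : AddSubgroup (∀ V : {V : X.Opens // V ≤ U}, d₁.obj V →+ d₂.obj V) where
  carrier := {φ | (∀ V (a : Γ(X, V.1)) v, φ V (a • v) = a • φ V v) ∧
    ∀ (V W : {V : X.Opens // V ≤ U}) (i : W.1 ≤ V.1) v, φ W (d₁.res i v) = d₂.res i (φ V v)}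
  add_mem' {φ ψ} hφ hψ := ⟨fun V a v => by
      rw [Pi.add_apply, AddMonoidHom.add_apply, hφ.1, hψ.1, ← smul_add]; rfl,
    fun V W i v => by
      rw [Pi.add_apply, AddMonoidHom.add_apply, hφ.2 V W i, hψ.2 V W i, ← map_add]; rfl⟩
  zero_mem' := ⟨fun V a v => (smul_zero a).symm, fun V W i v => (map_zero _).symm⟩
  neg_mem' {φ} hφ := ⟨fun V a v => by
      rw [Pi.neg_apply, AddMonoidHom.neg_apply, hφ.1, ← smul_neg]; rfl,
    fun V W i v => by
      rw [Pi.neg_apply, AddMonoidHom.neg_apply, hφ.2 V W i, ← map_neg]; rfl⟩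

variable {d₁ d₂ d₃ d₄}

namespace LocalHom

variable {U : X.Opens}

/-- The action on the sections over a smaller open set. -/
def app (φ : localHoms d₁ d₂ U) {V : X.Opens} (h : V ≤ U) : d₁.obj V →+ d₂.obj V := φ.1 ⟨V, h⟩

lemma app_smul (φ : localHoms d₁ d₂ U) {V : X.Opens} (h : V ≤ U) (a : Γ(X, V)) (v : d₁.obj V) :
    app φ h (a • v) = a • app φ h v := φ.2.1 ⟨V, h⟩ a v

lemma app_res (φ : localHoms d₁ d₂ U) {V W : X.Opens} (h : V ≤ U) (i : W ≤ V) (v : d₁.obj V) :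
    app φ (i.trans h) (d₁.res i v) = d₂.res i (app φ h v) := φ.2.2 ⟨V, h⟩ ⟨W, i.trans h⟩ i v

lemma ext {φ ψ : localHoms d₁ d₂ U} (h : ∀ V (hV : V ≤ U) v, app φ hV v = app ψ hV v) : φ = ψ :=
  Subtype.ext (funext fun V => AddMonoidHom.ext (h V.1 V.2))

/-- A local homomorphism from its action on sections. -/
def mk (φ : ∀ V : X.Opens, V ≤ U → (d₁.obj V →+ d₂.obj V))
    (hs : ∀ (V : X.Opens) (h : V ≤ U) (a : Γ(X, V)) (v : d₁.obj V), φ V h (a • v) = a • φ V h v)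
    (hr : ∀ (V W : X.Opens) (h : V ≤ U) (i : W ≤ V) (v : d₁.obj V),
      φ W (i.trans h) (d₁.res i v) = d₂.res i (φ V h v)) : localHoms d₁ d₂ U :=
  ⟨fun V => φ V.1 V.2, fun V a v => hs V.1 V.2 a v, fun V W i v => hr V.1 W.1 V.2 i v⟩

instance : Module Γ(X, U) (localHoms d₁ d₂ U) where
  smul a φ := mk (fun V h => DistribSMul.toAddMonoidHom _ (X.presheaf.map (homOfLE h).op a) |>.comp
      (app φ h))
    (fun V h b v => by
      change X.presheaf.map (homOfLE h).op a • app φ h (b • v) =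
        b • X.presheaf.map (homOfLE h).op a • app φ h v
      rw [app_smul, smul_comm])
    (fun V W h i v => by
      change X.presheaf.map (homOfLE (i.trans h)).op a • app φ (i.trans h) (d₁.res i v) =
        d₂.res i (X.presheaf.map (homOfLE h).op a • app φ h v)
      rw [app_res, d₂.res_smul, NonlinearCartier.res_res])
  one_smul φ := ext fun V h v => by
    change X.presheaf.map (homOfLE h).op 1 • app φ h v = _
    rw [map_one, one_smul]
  mul_smul a b φ := ext fun V h v => by
    change X.presheaf.map (homOfLE h).op (a * b) • app φ h v =
      X.presheaf.map (homOfLE h).op a • X.presheaf.map (homOfLE h).op b • app φ h v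
    rw [map_mul, mul_smul]
  smul_zero a := ext fun V h v =>
    smul_zero (M := Γ(X, V)) (A := d₂.obj V) (X.presheaf.map (homOfLE h).op a)
  smul_add a φ ψ := ext fun V h v => smul_add (X.presheaf.map (homOfLE h).op a) _ _
  add_smul a b φ := ext fun V h v => by
    change X.presheaf.map (homOfLE h).op (a + b) • app φ h v =
      X.presheaf.map (homOfLE h).op a • app φ h v + X.presheaf.map (homOfLE h).op b • app φ h v
    rw [map_add, add_smul]
  zero_smul φ := ext fun V h v => by
    change X.presheaf.map (homOfLE h).op 0 • app φ h v = 0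
    rw [map_zero, zero_smul]

lemma smul_app (a : Γ(X, U)) (φ : localHoms d₁ d₂ U) {V : X.Opens} (h : V ≤ U) (v : d₁.obj V) :
    app (a • φ) h v = X.presheaf.map (homOfLE h).op a • app φ h v := rfl

/-- Restriction. -/
def res {W : X.Opens} (i : W ≤ U) : localHoms d₁ d₂ U →+ localHoms d₁ d₂ W where
  toFun φ := mk (fun _ h => app φ (h.trans i)) (fun _ h => app_smul φ (h.trans i))
    fun _ _ h j => app_res φ (h.trans i) j
  map_zero' := rfl
  map_add' _ _ := rfl

@[simp]
lemma res_app {W : X.Opens} (i : W ≤ U) (φ : localHoms d₁ d₂ U) {V : X.Opens} (h : V ≤ W)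
    (v : d₁.obj V) : app (res i φ) h v = app φ (h.trans i) v := rfl

/-- Composition. -/
def comp (ψ : localHoms d₂ d₃ U) (φ : localHoms d₁ d₂ U) : localHoms d₁ d₃ U :=
  mk (fun _ h => (app ψ h).comp (app φ h))
    (fun V h a v => by
      rw [AddMonoidHom.comp_apply, app_smul, app_smul]
      rfl)
    (fun V W h i v => by
      rw [AddMonoidHom.comp_apply, app_res, app_res]
      rfl)

end LocalHom

open LocalHom

variable (d₁ d₂) in
/-- The sheaf of local homomorphisms. -/
def hom : ModuleData X where
  obj U := localHoms d₁ d₂ U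
  res i := LocalHom.res i
  res_self _ := rfl
  res_res _ _ _ := rfl
  res_smul i a φ := LocalHom.ext fun V h v => by
    rw [res_app, smul_app, smul_app, res_app, NonlinearCartier.res_res]
  ext {ι} W U h hU φ ψ H := LocalHom.ext fun V hV v => by
    refine d₂.ext (fun i => V ⊓ W i) V (fun _ => inf_le_left)
      (by rw [← inf_iSup_eq]; exact le_inf le_rfl (hV.trans hU)) _ _ fun i => ?_
    rw [← LocalHom.app_res, ← LocalHom.app_res]
    exact congrArg (fun χ => app χ (inf_le_right : V ⊓ W i ≤ W i) (d₁.res inf_le_left v)) (H i)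
  glue {ι} W U h hU φ H := by
    have hc : ∀ V ≤ U, V ≤ ⨆ i, V ⊓ W i := fun V hV => by
      rw [← inf_iSup_eq]; exact le_inf le_rfl (hV.trans hU)
    -- The value on `v` is glued from the values of the `φ i` on the restrictions of `v` to `V ⊓ W
    -- i`.
    have hex : ∀ (V : X.Opens) (_ : V ≤ U) (v : d₁.obj V), ∃ w : d₂.obj V, ∀ i,
        d₂.res (inf_le_left : V ⊓ W i ≤ V) w =
          app (φ i) (inf_le_right : V ⊓ W i ≤ W i) (d₁.res inf_le_left v) := fun V hV v => by
      refine d₂.glue (fun i => V ⊓ W i) V (fun _ => inf_le_left) (hc V hV) _ fun i j => ?_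
      have h1 : (V ⊓ W i) ⊓ (V ⊓ W j) ≤ W i ⊓ W j := inf_le_inf inf_le_right inf_le_right
      rw [← LocalHom.app_res, ← LocalHom.app_res, d₁.res_res, d₁.res_res]
      exact congrArg (fun χ => app χ h1 (d₁.res (inf_le_left.trans inf_le_left) v)) (H i j)
    have uniq : ∀ (V : X.Opens) (_ : V ≤ U) (w w' : d₂.obj V), (∀ i,
        d₂.res (inf_le_left : V ⊓ W i ≤ V) w = d₂.res (inf_le_left : V ⊓ W i ≤ V) w') → w = w' :=
      fun V hV w w' => d₂.ext (fun i => V ⊓ W i) V (fun _ => inf_le_left) (hc V hV) w w'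
    choose w hw using hex
    let w' : ∀ V : X.Opens, V ≤ U → (d₁.obj V →+ d₂.obj V) := fun V hV =>
      AddMonoidHom.mk' (w V hV) fun a b => uniq V hV _ _ fun i => by
        rw [hw, map_add, map_add, map_add, hw, hw]
    refine ⟨LocalHom.mk w' (fun V hV a v => uniq V hV _ _ fun i => ?_)
      (fun V V' hV j v => uniq V' (j.trans hV) _ _ fun i => ?_),
      fun i => LocalHom.ext fun V hV v => ?_⟩
    · change d₂.res _ (w V hV _) = d₂.res _ (a • w V hV _)
      rw [hw, d₂.res_smul, hw, d₁.res_smul, app_smul]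
    · change d₂.res _ (w V' _ _) = d₂.res _ (d₂.res j (w V hV _))
      have h1 : V' ⊓ W i ≤ V ⊓ W i := inf_le_inf_right _ j
      rw [hw, d₂.res_res, ← d₂.res_res inf_le_left h1, hw, ← LocalHom.app_res, d₁.res_res, d₁.res_res]
    · change w V (hV.trans (h i)) v = _
      have h1 : V ≤ V ⊓ W i := le_inf le_rfl hV
      have h2 := congrArg (d₂.res h1) (hw V (hV.trans (h i)) v i)
      rw [d₂.res_res, ← LocalHom.app_res, d₁.res_res] at h2
      exact (d₂.res_self _).symm.trans (h2.trans (congrArg (app (φ i) hV) (d₁.res_self _)))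

end ModuleData

end


/-! ### The Frobenius pullback of a module, with its canonical connection -/

noncomputable section

set_option linter.unusedSectionVars false

open ModuleData ModuleData.LocalHom

variable {k : Type u} [CommRing k] {p : ℕ} [Fact p.Prime] [CharP k p] {S : Scheme.{u}}
  {s : S ⟶ Spec (.of k)} [Smooth s]

namespace FrobPullback

/-- Local endomorphisms of `F_* 𝒪_S`. -/
abbrev endos (p : ℕ) [Fact p.Prime] [CharP k p] (s : S ⟶ Spec (.of k))
    (U : (frobTwist p s).Opens) : Type u :=
  localHoms (ofHom (relFrob p s)) (ofHom (relFrob p s)) U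

lemma endos_ext {U : (frobTwist p s).Opens} {T T' : endos p s U}
    (h : ∀ (V : (frobTwist p s).Opens) (hV : V ≤ U) (v : Γ(S, relFrob p s ⁻¹ᵁ V)),
      (LocalHom.app T hV v : Γ(S, relFrob p s ⁻¹ᵁ V)) = LocalHom.app T' hV v) : T = T' :=
  LocalHom.ext h

section

variable {U : (frobTwist p s).Opens} {W : S.Opens} (e : relFrob p s ⁻¹ᵁ U ≤ W)

/-- Multiplication by a function, as a local endomorphism of `F_* 𝒪_S`. -/
def mulHom (a : Γ(S, W)) : endos p s U :=
  LocalHom.mk (fun _ h => AddMonoidHom.mulLeft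
      (S.presheaf.map (homOfLE (((relFrob p s).preimage_mono h).trans e)).op a))
    (fun V h b v => mul_left_comm _ ((relFrob p s).app V b) v)
    (fun V V' h i (v : Γ(S, relFrob p s ⁻¹ᵁ V)) => by
      change S.presheaf.map _ a * S.presheaf.map _ v =
        S.presheaf.map _ (S.presheaf.map (homOfLE (((relFrob p s).preimage_mono h).trans e)).op a
          * v)
      rw [map_mul, NonlinearCartier.res_res])

lemma mulHom_app (a : Γ(S, W)) {V : (frobTwist p s).Opens} (h : V ≤ U)
    (v : Γ(S, relFrob p s ⁻¹ᵁ V)) : (LocalHom.app (mulHom e a) h v : Γ(S, relFrob p s ⁻¹ᵁ V)) =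
      S.presheaf.map (homOfLE (((relFrob p s).preimage_mono h).trans e)).op a * v := rfl

lemma mulHom_one : mulHom e 1 = LocalHom.mk (fun _ _ => AddMonoidHom.id _)
    (fun _ _ _ _ => rfl) (fun _ _ _ _ _ => rfl) := endos_ext fun V h v => by
  rw [mulHom_app, map_one, one_mul]
  rfl

lemma mulHom_mul (a b : Γ(S, W)) :
    mulHom e (a * b) = LocalHom.comp (mulHom e a) (mulHom e b) := endos_ext fun V h v => by
  rw [mulHom_app, map_mul, mul_assoc]
  rfl

lemma mulHom_add (a b : Γ(S, W)) :
    mulHom e (a + b) = mulHom e a + mulHom e b := endos_ext fun V h v => by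
  rw [mulHom_app, map_add, add_mul]
  rfl

lemma mulHom_zero : mulHom e 0 = 0 := endos_ext fun V h v => by
  rw [mulHom_app, map_zero, zero_mul]
  rfl

lemma res_mulHom {U' : (frobTwist p s).Opens} {W' : S.Opens} (e' : relFrob p s ⁻¹ᵁ U' ≤ W')
    (i : U' ≤ U) (j : W' ≤ W) (a : Γ(S, W)) :
    LocalHom.res i (mulHom e a) = mulHom e' (S.presheaf.map (homOfLE j).op a) :=
  endos_ext fun V h v => by
    rw [mulHom_app, NonlinearCartier.res_res]
    rfl

/-- A vector field, as a local endomorphism of `F_* 𝒪_S`. -/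
def derHom (D : VectorField s W) : endos p s U :=
  LocalHom.mk (fun V h => (D.act (relFrob p s ⁻¹ᵁ V)
      (((relFrob p s).preimage_mono h).trans e)).toLinearMap.toAddMonoidHom)
    (fun V h b (v : Γ(S, relFrob p s ⁻¹ᵁ V)) => by
      change D.act _ _ ((relFrob p s).app V b * v) = (relFrob p s).app V b * D.act _ _ v
      have := D.act_relFrob (((relFrob p s).preimage_mono h).trans e) le_rfl b
      rw [Scheme.Hom.appLE_eq_app] at this
      rw [Derivation.leibniz, this, smul_zero, add_zero, smul_eq_mul])
    (fun V V' h i v => D.act_res _ _ _ _ v)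

lemma derHom_mulHom (D : VectorField s W) (a : Γ(S, W)) :
    LocalHom.comp (derHom e D) (mulHom e a) = mulHom e (const s W 1 * D.act W le_rfl a) +
      LocalHom.comp (mulHom e a) (derHom e D) := endos_ext fun V h v => by
  have h1 := D.act_res _ _ le_rfl (((relFrob p s).preimage_mono h).trans e) a
  change D.act _ _ (S.presheaf.map _ a * v) =
      S.presheaf.map _ (const s W 1 * D.act W le_rfl a) * v + S.presheaf.map _ a * D.act _ _ v
  rw [map_one, one_mul, Derivation.leibniz, h1, smul_eq_mul, smul_eq_mul, add_comm, mul_comm v]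

lemma derHom_bracket (D E : VectorField s W) :
    LocalHom.comp (derHom e D) (derHom e E) = derHom e ⁅D, E⁆ +
      LocalHom.comp (derHom e E) (derHom e D) := endos_ext fun V h v => by
  change D.act _ _ (E.act _ _ v) = ⁅D.act (relFrob p s ⁻¹ᵁ V) _, E.act (relFrob p s ⁻¹ᵁ V) _⁆ v + E.act _ _ (D.act _ _ v)
  rw [Derivation.commutator_apply, sub_add_cancel]

end

variable (p s) in
/-- The dual of `F_* 𝒪_S`. -/
abbrev dual : ModuleData (frobTwist p s) := (ofHom (relFrob p s)).hom (unit (frobTwist p s))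

/-- The value of a functional. -/
def eval {V : (frobTwist p s).Opens} (ℓ : (dual p s).obj V) (a : Γ(S, relFrob p s ⁻¹ᵁ V)) :
    Γ(frobTwist p s, V) := LocalHom.app ℓ le_rfl a

variable (N' : (frobTwist p s).Modules)

/-- Precomposition with local endomorphisms of `F_* 𝒪_S`. -/
def precomp {U : (frobTwist p s).Opens}
    (T : endos p s U) :
    localHoms (dual p s) (ofModules N') U →+ localHoms (dual p s) (ofModules N') U where
  toFun φ := LocalHom.mk
    (fun V h => (LocalHom.app φ h).comp (AddMonoidHom.mk'
      (fun ℓ : localHoms _ _ V => (LocalHom.comp ℓ (LocalHom.res h T) : localHoms _ _ V))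
      fun _ _ => rfl))
    (fun V h a ℓ => LocalHom.app_smul φ h a (LocalHom.comp ℓ (LocalHom.res h T)))
    (fun V V' h i ℓ => LocalHom.app_res φ h i (LocalHom.comp ℓ (LocalHom.res h T)))
  map_zero' := rfl
  map_add' _ _ := rfl

variable {N'}

/-- Dualizing twice restores the order of composition, so local endomorphisms act from the left and
the operator identities above carry over unchanged. -/
lemma precomp_precomp {U : (frobTwist p s).Opens}
    (T T' : endos p s U)
    (φ : localHoms (dual p s) (ofModules N') U) :
    precomp N' T (precomp N' T' φ) = precomp N' (LocalHom.comp T T') φ := rfl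

lemma precomp_add {U : (frobTwist p s).Opens}
    (T T' : endos p s U)
    (φ : localHoms (dual p s) (ofModules N') U) :
    precomp N' (T + T') φ = precomp N' T φ + precomp N' T' φ := LocalHom.ext fun V h ℓ => by
  refine Eq.trans ?_ (map_add (LocalHom.app φ h) _ _)
  exact congrArg (LocalHom.app φ h) (LocalHom.ext fun V' h' v => map_add (LocalHom.app ℓ h') _ _)

lemma precomp_zero {U : (frobTwist p s).Opens} (φ : localHoms (dual p s) (ofModules N') U) :
    precomp N' 0 φ = 0 := by
  have := precomp_add (N' := N') 0 0 φ
  rw [add_zero] at this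
  exact left_eq_add.mp this

lemma precomp_res {U U' : (frobTwist p s).Opens} (i : U' ≤ U)
    (T : endos p s U)
    (φ : localHoms (dual p s) (ofModules N') U) :
    precomp N' (LocalHom.res i T) (LocalHom.res i φ) = LocalHom.res i (precomp N' T φ) := rfl

variable (N')

/-- The Frobenius pullback in terms of sections. -/
def data : ModuleData S where
  -- As `F_* 𝒪_S` is locally free of finite rank, `F_* 𝒪_S ⊗ N'` is the sheaf of linear maps from
  -- its dual to `N'`. This form needs no sheafification, and functions and vector fields act
  -- through the factor `F_* 𝒪_S`.
  obj W := localHoms (dual p s) (ofModules N') (twist p s W)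
  module W :=
    { smul := fun a φ => precomp N' (mulHom (relFrob_preimage_twist p s W).le a) φ
      one_smul := fun φ => congrArg (precomp N' · φ) (mulHom_one _)
      mul_smul := fun a b φ => (congrArg (precomp N' · φ) (mulHom_mul _ a b)).trans
        (precomp_precomp _ _ φ).symm
      smul_zero := fun a => rfl
      smul_add := fun a φ ψ => rfl
      add_smul := fun a b φ => (congrArg (precomp N' · φ) (mulHom_add _ a b)).trans
        (precomp_add _ _ φ)
      zero_smul := fun φ => (congrArg (precomp N' · φ) (mulHom_zero _)).trans (precomp_zero φ) }
  res i := LocalHom.res ((frobTwistFst p s).preimage_mono i)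
  res_self _ := rfl
  res_res _ _ _ := rfl
  res_smul {W W'} i a φ := by
    refine (precomp_res ((frobTwistFst p s).preimage_mono i) _ φ).symm.trans ?_
    exact congrArg (precomp N' · _) (res_mulHom _ _ _ i a)
  ext W U h hU φ ψ H := ((dual p s).hom (ofModules N')).ext (fun i => twist p s (W i)) _
    (fun i => (frobTwistFst p s).preimage_mono (h i)) (fun y hy => by
      obtain ⟨i, hi⟩ := TopologicalSpace.Opens.mem_iSup.mp (hU hy)
      exact TopologicalSpace.Opens.mem_iSup.mpr ⟨i, hi⟩) φ ψ H
  glue W U h hU φ H := ((dual p s).hom (ofModules N')).glue (fun i => twist p s (W i)) _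
    (fun i => (frobTwistFst p s).preimage_mono (h i)) (fun y hy => by
      obtain ⟨i, hi⟩ := TopologicalSpace.Opens.mem_iSup.mp (hU hy)
      exact TopologicalSpace.Opens.mem_iSup.mpr ⟨i, hi⟩) φ H

section

variable {N'} {W : S.Opens} (D E : VectorField s W)
  (φ : localHoms (dual p s) (ofModules N') (twist p s W))

lemma leibniz_aux (a : Γ(S, W)) :
    precomp N' (derHom (relFrob_preimage_twist p s W).le D)
        (precomp N' (mulHom (relFrob_preimage_twist p s W).le a) φ) =
      precomp N' (mulHom (relFrob_preimage_twist p s W).le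
        (const s W 1 * D.act W le_rfl a)) φ +
      precomp N' (mulHom (relFrob_preimage_twist p s W).le a)
        (precomp N' (derHom (relFrob_preimage_twist p s W).le D) φ) := by
  rw [precomp_precomp, derHom_mulHom, precomp_add, precomp_precomp]

lemma bracket_aux :
    precomp N' (derHom (relFrob_preimage_twist p s W).le D)
        (precomp N' (derHom (relFrob_preimage_twist p s W).le E) φ) =
      precomp N' (derHom (relFrob_preimage_twist p s W).le ⁅D, E⁆) φ +
      precomp N' (derHom (relFrob_preimage_twist p s W).le E)
        (precomp N' (derHom (relFrob_preimage_twist p s W).le D) φ) := by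
  rw [precomp_precomp, derHom_bracket, precomp_add, precomp_precomp]

lemma pPow_aux : (precomp N' (derHom (relFrob_preimage_twist p s W).le D))^[p] φ =
    precomp N' (derHom (relFrob_preimage_twist p s W).le (D.pPow p)) φ := by
  -- The iterates of the action are again actions of single endomorphisms, namely of the iterates of
  -- `D`.
  have key : ∀ n : ℕ, ∃ T : endos p s (twist p s W), (∀ (V : (frobTwist p s).Opens)
      (hV : V ≤ twist p s W) (v : Γ(S, relFrob p s ⁻¹ᵁ V)),
        (LocalHom.app T hV v : Γ(S, relFrob p s ⁻¹ᵁ V)) =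
          (D.act (relFrob p s ⁻¹ᵁ V) (le_twist_iff.mp hV))^[n] v) ∧
      (precomp N' (derHom (relFrob_preimage_twist p s W).le D))^[n] φ = precomp N' T φ := fun n => by
    induction n with
    | zero =>
      refine ⟨mulHom (relFrob_preimage_twist p s W).le 1, fun V h v => ?_, ?_⟩
      · rw [mulHom_app, map_one, one_mul]
        rfl
      · rw [mulHom_one]
        rfl
    | succ n ih =>
      obtain ⟨T, hT, h⟩ := ih
      refine ⟨LocalHom.comp (derHom (relFrob_preimage_twist p s W).le D) T, fun V h v => ?_, ?_⟩
      · rw [Function.iterate_succ_apply', ← hT]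
        rfl
      · rw [Function.iterate_succ_apply', h]
        rfl
  obtain ⟨T, hT, h⟩ := key p
  rw [h, endos_ext (T' := derHom (relFrob_preimage_twist p s W).le (D.pPow p)) hT]

end

/-- The Frobenius pullback with its canonical connection. -/
def lambdaModule : LambdaModule s 1 where
  M := (data N').toModules
  nabla W D := precomp N' (derHom (relFrob_preimage_twist p s W).le D)
  nabla_add W D E φ := precomp_add (derHom _ D) (derHom _ E) φ
  nabla_smul W a D φ := rfl
  leibniz W D a φ := leibniz_aux D φ a
  nabla_res W W' i D φ := rfl

lemma integrable : (lambdaModule N').Integrable := fun W D E φ => by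
  rw [map_one, one_smul, sub_eq_iff_eq_add]
  exact bracket_aux D E φ

lemma pCurvatureZero : (lambdaModule N').PCurvatureZero p := fun W D φ => pPow_aux D φ

variable {N'} in
lemma eval_smul {V : (frobTwist p s).Opens} (b : Γ(frobTwist p s, V)) (ℓ : (dual p s).obj V)
    (a : Γ(S, relFrob p s ⁻¹ᵁ V)) : eval (b • ℓ) a = b * eval ℓ a := by
  change (frobTwist p s).presheaf.map (homOfLE le_rfl).op b * eval ℓ a = _
  rw [NonlinearCartier.res_self]

lemma eval_res {V V' : (frobTwist p s).Opens} (i : V' ≤ V) (ℓ : (dual p s).obj V)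
    (a : Γ(S, relFrob p s ⁻¹ᵁ V)) :
    eval (LocalHom.res i ℓ : (dual p s).obj V')
      (S.presheaf.map (homOfLE ((relFrob p s).preimage_mono i)).op a) =
      (frobTwist p s).presheaf.map (homOfLE i).op (eval ℓ a) :=
  LocalHom.app_res ℓ le_rfl i a

/-- The canonical map on sections. -/
def ιFun {U : (frobTwist p s).Opens} (n : Γ(N', U)) :
    localHoms (dual p s) (ofModules N') (twist p s (relFrob p s ⁻¹ᵁ U)) :=
  LocalHom.mk (fun V h => AddMonoidHom.mk'
      -- The section `n` is sent to `1 ⊗ n`, which as a map on the dual is `ℓ ↦ ℓ(1) n`.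
      (fun ℓ : (dual p s).obj V => eval ℓ 1 •
          N'.presheaf.map (homOfLE (h.trans (twist_preimage U).le)).op n)
      fun ℓ ℓ' => by exact add_smul (eval ℓ 1) (eval ℓ' 1) _)
    (fun V h a ℓ => by
      change eval (a • ℓ) 1 • N'.presheaf.map (homOfLE (h.trans (twist_preimage U).le)).op n = _
      rw [eval_smul, mul_smul]
      rfl)
    (fun V V' h i ℓ => by
      change eval (LocalHom.res i ℓ) 1 • N'.presheaf.map _ n =
        N'.presheaf.map (homOfLE i).op (eval ℓ 1 •
          N'.presheaf.map (homOfLE (h.trans (twist_preimage U).le)).op n)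
      have h1 := eval_res i ℓ 1
      rw [map_one] at h1
      rw [h1, Scheme.Modules.map_smul, Modules.res_res])

variable {N'} in
lemma ιFun_app {U : (frobTwist p s).Opens} (n : Γ(N', U)) {V : (frobTwist p s).Opens}
    (h : V ≤ twist p s (relFrob p s ⁻¹ᵁ U)) (ℓ : (dual p s).obj V) :
    (LocalHom.app (ιFun N' n) h ℓ : Γ(N', V)) =
      eval ℓ 1 • N'.presheaf.map (homOfLE (h.trans (twist_preimage U).le)).op n := rfl

variable {N'} in
lemma sections_ext' {U : (frobTwist p s).Opens} {φ ψ : localHoms (dual p s) (ofModules N') U}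
    (H : ∀ (V : (frobTwist p s).Opens) (h : V ≤ U) (ℓ : (dual p s).obj V),
      (LocalHom.app φ h ℓ : Γ(N', V)) = LocalHom.app ψ h ℓ) : φ = ψ := LocalHom.ext H

/-- The canonical map on sections, as a homomorphism. -/
def ιApp (U : (frobTwist p s).Opens) : Γ(N', U) →+
    localHoms (dual p s) (ofModules N') (twist p s (relFrob p s ⁻¹ᵁ U)) :=
  AddMonoidHom.mk' (ιFun N') fun n n' => sections_ext' fun V h ℓ => by
    rw [ιFun_app, map_add, smul_add]
    rfl

variable {N'} in
-- This is the tensor `a ⊗ n`, seen as the map `ℓ ↦ ℓ(a) n`.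
lemma precomp_mulHom_ιApp {U : (frobTwist p s).Opens} (a : Γ(S, relFrob p s ⁻¹ᵁ U)) (n : Γ(N', U))
    {V : (frobTwist p s).Opens} (h : V ≤ twist p s (relFrob p s ⁻¹ᵁ U)) (ℓ : (dual p s).obj V) :
    (LocalHom.app (precomp N' (mulHom (relFrob_preimage_twist p s _).le a) (ιApp N' U n)) h ℓ :
      Γ(N', V)) = eval ℓ (S.presheaf.map (homOfLE (le_twist_iff.mp h)).op a) •
        N'.presheaf.map (homOfLE (h.trans (twist_preimage U).le)).op n := by
  refine congrArg (fun r : Γ(frobTwist p s, V) => r • N'.presheaf.map (homOfLE (h.trans (twist_preimage U).le)).op n) ?_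
  exact congrArg (eval ℓ) (mul_one (S.presheaf.map (homOfLE (le_twist_iff.mp h)).op a))

variable {N'} in
lemma eval_relFrob_mul {V : (frobTwist p s).Opens} (ℓ : (dual p s).obj V)
    (b : Γ(frobTwist p s, V)) (a : Γ(S, relFrob p s ⁻¹ᵁ V)) :
    eval ℓ ((relFrob p s).app V b * a) = b * eval ℓ a := LocalHom.app_smul ℓ le_rfl b a

lemma ιApp_smul {U : (frobTwist p s).Opens} (a : Γ(frobTwist p s, U)) (n : Γ(N', U)) :
    ιApp N' U (a • n) = precomp N' (mulHom (relFrob_preimage_twist p s _).le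
      ((relFrob p s).app U a)) (ιApp N' U n) := sections_ext' fun V h ℓ => by
  rw [precomp_mulHom_ιApp]
  refine (ιFun_app _ _ _).trans ?_
  have h1 := eval_relFrob_mul ℓ
    ((frobTwist p s).presheaf.map (homOfLE (h.trans (twist_preimage U).le)).op a) 1
  rw [mul_one, app_res] at h1
  rw [Scheme.Modules.map_smul, smul_smul, h1, mul_comm]

lemma ιApp_res {U W : (frobTwist p s).Opens} (i : W ≤ U) (n : Γ(N', U)) :
    ιApp N' W (N'.presheaf.map (homOfLE i).op n) =
      LocalHom.res ((frobTwistFst p s).preimage_mono ((relFrob p s).preimage_mono i))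
        (ιApp N' U n) := sections_ext' fun V h ℓ => by
  refine (ιFun_app _ _ _).trans ?_
  rw [Modules.res_res]
  rfl

/-- The canonical map `N' ⟶ F_* F^* N'`. -/
def ι : N' ⟶ (Scheme.Modules.pushforward (relFrob p s)).obj (lambdaModule N').M :=
  Modules.mkHom (fun U => ιApp N' U) (fun U a n => ιApp_smul N' a n)
    (fun U W i n => ιApp_res N' i n)

end FrobPullback

end


/-! ### Dual bases of the monomials, and flat sections of Frobenius pullbacks -/

noncomputable section

set_option linter.unusedSectionVars false

open ModuleData

variable {k : Type u} [CommRing k] {p : ℕ} [Fact p.Prime] [CharP k p] {S : Scheme.{u}}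
  {s : S ⟶ Spec (.of k)} [Smooth s]

namespace Coordinates

variable {V : S.Opens} (C : Coordinates p s V)

/-- The monomials over smaller open sets. -/
abbrev mono {W : S.Opens} (h : W ≤ V) (I : Fin C.n → Fin p) : Γ(S, W) :=
  S.presheaf.map (homOfLE h).op (monom C.x I)

section

variable {U : (frobTwist p s).Opens} (h : relFrob p s ⁻¹ᵁ U ≤ V)

/-- The coefficients of a function with respect to the monomials. -/
def coeff (a : Γ(S, relFrob p s ⁻¹ᵁ U)) (I : Fin C.n → Fin p) : Γ(frobTwist p s, U) :=
  (C.exists_expansion h a).choose I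

lemma sum_coeff (a : Γ(S, relFrob p s ⁻¹ᵁ U)) :
    a = ∑ I, C.mono h I * (relFrob p s).app U (C.coeff h a I) :=
  (C.exists_expansion h a).choose_spec

lemma coeff_eq {a : Γ(S, relFrob p s ⁻¹ᵁ U)} {c : (Fin C.n → Fin p) → Γ(frobTwist p s, U)}
    (hc : a = ∑ I, C.mono h I * (relFrob p s).app U (c I)) : C.coeff h a = c :=
  (C.existsUnique_expansion h a).unique (C.sum_coeff h a) hc

lemma coeff_add (a b : Γ(S, relFrob p s ⁻¹ᵁ U)) :
    C.coeff h (a + b) = C.coeff h a + C.coeff h b := C.coeff_eq h (by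
  conv_lhs => rw [C.sum_coeff h a, C.sum_coeff h b, ← Finset.sum_add_distrib]
  exact Finset.sum_congr rfl fun I _ => by rw [Pi.add_apply, map_add, mul_add])

lemma coeff_mul (b : Γ(frobTwist p s, U)) (a : Γ(S, relFrob p s ⁻¹ᵁ U)) :
    C.coeff h ((relFrob p s).app U b * a) = fun I => b * C.coeff h a I := C.coeff_eq h (by
  conv_lhs => rw [C.sum_coeff h a, Finset.mul_sum]
  exact Finset.sum_congr rfl fun I _ => by rw [map_mul, mul_left_comm])

lemma coeff_res {U' : (frobTwist p s).Opens} (i : U' ≤ U) (a : Γ(S, relFrob p s ⁻¹ᵁ U)) :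
    C.coeff (((relFrob p s).preimage_mono i).trans h)
      (S.presheaf.map (homOfLE ((relFrob p s).preimage_mono i)).op a) =
      fun I => (frobTwist p s).presheaf.map (homOfLE i).op (C.coeff h a I) := C.coeff_eq _ (by
  conv_lhs => rw [C.sum_coeff h a, map_sum]
  exact Finset.sum_congr rfl fun I _ => by rw [map_mul, res_res, app_res])

lemma coeff_mono (I : Fin C.n → Fin p) : C.coeff h (C.mono h I) = Pi.single I 1 := by
  classical
  refine C.coeff_eq h ?_
  rw [Finset.sum_eq_single I, Pi.single_eq_same, map_one, mul_one]
  · intro J _ hJ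
    rw [Pi.single_eq_of_ne hJ, map_zero, mul_zero]
  · simp

/-- The dual basis of the monomials. -/
def dualBasis (I : Fin C.n → Fin p) : (FrobPullback.dual p s).obj U :=
  LocalHom.mk (fun V' h' => AddMonoidHom.mk'
      (fun a : Γ(S, relFrob p s ⁻¹ᵁ V') => (C.coeff (((relFrob p s).preimage_mono h').trans h) a I :
        Γ(frobTwist p s, V')))
      fun a b => congrFun (C.coeff_add _ a b) I)
    (fun V' h' b a => congrFun (C.coeff_mul _ b a) I)
    (fun V' V'' h' i a => congrFun (C.coeff_res (((relFrob p s).preimage_mono h').trans h) i a) I)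

lemma eval_dualBasis (I : Fin C.n → Fin p) (a : Γ(S, relFrob p s ⁻¹ᵁ U)) :
    FrobPullback.eval (C.dualBasis h I) a = C.coeff h a I := rfl

end

lemma eval_eq_sum {U : (frobTwist p s).Opens} (h : relFrob p s ⁻¹ᵁ U ≤ V)
    (ℓ : (FrobPullback.dual p s).obj U) (a : Γ(S, relFrob p s ⁻¹ᵁ U)) :
    FrobPullback.eval ℓ a = ∑ I, C.coeff h a I * FrobPullback.eval ℓ (C.mono h I) := by
  let e : Γ(S, relFrob p s ⁻¹ᵁ U) →+ Γ(frobTwist p s, U) := LocalHom.app ℓ le_rfl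
  change e a = ∑ I, C.coeff h a I * e (C.mono h I)
  conv_lhs => rw [C.sum_coeff h a]
  rw [map_sum]
  exact Finset.sum_congr rfl fun I _ => by
    rw [mul_comm]
    exact FrobPullback.eval_relFrob_mul ℓ _ _

lemma functional_eq_sum {U : (frobTwist p s).Opens} (h : relFrob p s ⁻¹ᵁ U ≤ V)
    {U' : (frobTwist p s).Opens} (i : U' ≤ U) (ℓ : (FrobPullback.dual p s).obj U') :
    ℓ = ∑ I, FrobPullback.eval ℓ (C.mono (((relFrob p s).preimage_mono i).trans h) I) •
      (FrobPullback.dual p s).res i (C.dualBasis h I) := by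
  refine LocalHom.ext fun V' h' (a : Γ(S, relFrob p s ⁻¹ᵁ V')) => ?_
  let e : (FrobPullback.dual p s).obj U' →+ Γ(frobTwist p s, V') :=
    AddMonoidHom.mk' (fun ℓ => FrobPullback.eval ((FrobPullback.dual p s).res h' ℓ) a)
      fun _ _ => rfl
  change e ℓ = e _
  rw [map_sum]
  have h1 := C.eval_eq_sum (((relFrob p s).preimage_mono (h'.trans i)).trans h)
    ((FrobPullback.dual p s).res h' ℓ) a
  refine h1.trans (Finset.sum_congr rfl fun I _ => ?_)
  have h2 := FrobPullback.eval_res h' ℓ (C.mono (((relFrob p s).preimage_mono i).trans h) I)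
  rw [res_res] at h2
  rw [mul_comm]
  exact congrArg (· * _) h2

end Coordinates

namespace FrobPullback

variable (N' : (frobTwist p s).Modules)

/-- Over a chart the dual of `F_* 𝒪_S` is free on the dual basis of the monomials, so a linear map
on it is determined by its values there. -/
lemma isFrobPullback_ι : IsFrobPullback (ι N') := by
  intro V C U h v
  have key : ∀ φ : localHoms (dual p s) (ofModules N') (twist p s (relFrob p s ⁻¹ᵁ U)),
      ∃! c : (Fin C.n → Fin p) → Γ(N', U), φ = ∑ I,
        precomp N' (mulHom (relFrob_preimage_twist p s _).le (C.mono h I)) (ιApp N' U (c I)) := by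
    intro φ
    have sum_app : ∀ (c : (Fin C.n → Fin p) → Γ(N', U)) (V' : (frobTwist p s).Opens)
        (h' : V' ≤ twist p s (relFrob p s ⁻¹ᵁ U)) (ℓ : (dual p s).obj V'),
        (LocalHom.app (∑ I, precomp N' (mulHom (relFrob_preimage_twist p s _).le (C.mono h I))
          (ιApp N' U (c I))) h' ℓ : Γ(N', V')) =
        ∑ I, eval ℓ (C.mono ((le_twist_iff.mp h').trans h) I) •
          N'.presheaf.map (homOfLE (h'.trans (twist_preimage U).le)).op (c I) := by
      intro c V' h' ℓ
      let e : localHoms (dual p s) (ofModules N') (twist p s (relFrob p s ⁻¹ᵁ U)) →+ Γ(N', V') :=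
        AddMonoidHom.mk' (fun φ => LocalHom.app φ h' ℓ) fun _ _ => rfl
      change e _ = _
      rw [map_sum]
      refine Finset.sum_congr rfl fun I _ => (precomp_mulHom_ιApp _ _ h' ℓ).trans ?_
      rw [res_res]
    have hU : U ≤ twist p s (relFrob p s ⁻¹ᵁ U) := (twist_preimage U).ge
    -- The coefficient at `I` is the value of `φ` on the `I`-th dual basis element.
    refine ⟨fun I => (LocalHom.app φ hU (C.dualBasis h I) : Γ(N', U)),
      sections_ext' fun V' h' ℓ => ?_, fun c hc => funext fun J => ?_⟩
    · refine Eq.trans ?_ (sum_app _ V' h' ℓ).symm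
      have i : V' ≤ U := h'.trans (twist_preimage U).le
      let e : (dual p s).obj V' →+ Γ(N', V') := LocalHom.app φ h'
      have h1 := congrArg e (C.functional_eq_sum h i ℓ)
      rw [map_sum] at h1
      refine h1.trans (Finset.sum_congr rfl fun I _ => ?_)
      refine (LocalHom.app_smul φ h' _ _).trans (congrArg (fun n : Γ(N', V') =>
        eval ℓ (C.mono ((le_twist_iff.mp h').trans h) I) • n) ?_)
      exact LocalHom.app_res φ hU i (C.dualBasis h I)
    · have h1 := sum_app c U hU (C.dualBasis h J)
      have hc' : φ = _ := hc
      rw [← hc'] at h1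
      refine Eq.trans ?_ h1.symm
      classical
      rw [Finset.sum_eq_single J]
      · rw [C.eval_dualBasis, C.coeff_mono, Pi.single_eq_same, one_smul, Modules.res_self]
      · intro I _ hI
        rw [C.eval_dualBasis, C.coeff_mono, Pi.single_eq_of_ne hI.symm, zero_smul]
      · simp
  exact key v

/-- The section is `1 ⊗ n`, and every derivation kills `1`. -/
lemma nabla_ι {U : (frobTwist p s).Opens} (n : Γ(N', U)) :
    (lambdaModule N').IsFlat _ (Modules.pushApp (ι N') U n) := by
  intro W i D
  have key : precomp N' (derHom (relFrob_preimage_twist p s W).le D)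
      (LocalHom.res ((frobTwistFst p s).preimage_mono i) (ιApp N' U n)) = 0 :=
    sections_ext' fun V' h' ℓ => by
      have h1 : (D.act (relFrob p s ⁻¹ᵁ V') (le_twist_iff.mp h')) 1 = 0 :=
        Derivation.map_one_eq_zero _
      have h2 : eval ℓ (0 : Γ(S, relFrob p s ⁻¹ᵁ V')) = 0 := map_zero (LocalHom.app ℓ le_rfl)
      have h3 : V' ≤ U := (h'.trans ((frobTwistFst p s).preimage_mono i)).trans (twist_preimage U).le
      change eval ℓ (D.act (relFrob p s ⁻¹ᵁ V') (le_twist_iff.mp h') 1) •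
        N'.presheaf.map (homOfLE h3).op n = 0
      rw [h1, h2, zero_smul]
  exact key

end FrobPullback

variable {N' : (frobTwist p s).Modules}

/-- If `N` is a Frobenius pullback with connection killing the sections of `N'`, then `N'` is its
module of flat sections. -/
lemma IsFrobPullback.isFlatModel {N : LambdaModule s 1} (hi : N.Integrable)
    (hp : N.PCurvatureZero p) {j : N' ⟶ (Scheme.Modules.pushforward (relFrob p s)).obj N.M}
    (hj : IsFrobPullback j) (hf : ∀ (U : (frobTwist p s).Opens) (n : Γ(N', U)),
      N.IsFlat _ (Modules.pushApp j U n)) : N.IsFlatModel j := by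
  have inj : ∀ U, Function.Injective (Modules.pushApp j U) := fun U =>
    (injective_iff_map_eq_zero _).mpr fun n hn => by
      refine Modules.eq_of_locally _ _ fun y hy => ?_
      obtain ⟨z, rfl⟩ := (isHomeomorph_relFrob p s).surjective y
      obtain ⟨U', V, C, h, i, hz⟩ := exists_coordinates_preimage p s
        (W := relFrob p s ⁻¹ᵁ U) (y := z) hy
      have i' := relFrob_preimage_le_iff.mp i
      refine ⟨U', i', hz, ?_⟩
      classical
      have h1 := (hj C U' h 0).unique (y₁ := 0)
        (y₂ := Pi.single (WeylModule.zeroIndex p C.n) (N'.presheaf.map (homOfLE i').op n))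
        (by simp) (by
          symm
          refine Finset.sum_eq_zero fun I _ => ?_
          by_cases hI : I = WeylModule.zeroIndex p C.n
          · rw [hI, Pi.single_eq_same, Modules.pushApp_res, hn, map_zero, smul_zero]
          · rw [Pi.single_eq_of_ne hI, map_zero, smul_zero])
      have h2 := congrFun h1 (WeylModule.zeroIndex p C.n)
      rw [Pi.single_eq_same] at h2
      rw [map_zero, ← h2]
      rfl
  refine ⟨inj, fun U => Set.Subset.antisymm ?_ fun (v : Γ(N.M, relFrob p s ⁻¹ᵁ U)) hv => ?_⟩
  · rintro _ ⟨n, rfl⟩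
    exact hf U n
  · obtain ⟨n, hn⟩ := Modules.exists_section (M := N') (U := U)
      (fun W i n => Modules.pushApp j W n =
        N.M.presheaf.map (homOfLE ((relFrob p s).preimage_mono i)).op v)
      (fun W W' i i' n hn => by rw [Modules.pushApp_res, hn, Modules.res_res])
      (fun W i a b ha hb => inj W (ha.trans hb.symm))
      (fun y hy => by
        obtain ⟨z, rfl⟩ := (isHomeomorph_relFrob p s).surjective y
        obtain ⟨U', V, C, h, i, hz⟩ := exists_coordinates_preimage p s
          (W := relFrob p s ⁻¹ᵁ U) (y := z) hy
        obtain ⟨c, hc, -⟩ := hj C U' h (N.M.presheaf.map (homOfLE i).op v)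
        refine ⟨U', relFrob_preimage_le_iff.mp i, hz, c (WeylModule.zeroIndex p C.n), ?_⟩
        have hm : ∀ I : Fin C.n → Fin p, S.presheaf.map (homOfLE h).op (monom C.x I) =
            monom (fun i => S.presheaf.map (homOfLE h).op (C.x i)) I := fun I =>
          map_monom (S.presheaf.map (homOfLE h).op).hom C.x I
        have hs : ∑ I, monom (fun i => S.presheaf.map (homOfLE h).op (C.x i)) I •
            Modules.pushApp j U' (c I) = N.M.presheaf.map (homOfLE i).op v := by
          rw [hc]
          exact Finset.sum_congr rfl fun I _ => by rw [hm]
        -- A flat section equals its constant coefficient, which comes from `N'`.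
        have h1 := (LambdaModule.weylModule C hi hp h).sum_eq_of_flat
          (fun I => (LambdaModule.isFlat_iff C h _).mp (hf U' (c I))) (fun l => by
            rw [hs]
            exact (LambdaModule.isFlat_iff C h _).mp (N.isFlat_res i hv) l)
        rw [← h1.1, hs])
    refine ⟨n, Modules.eq_of_locally (M := N.M) (Modules.pushApp j U n) v fun y hy => ?_⟩
    obtain ⟨W, i, hy', h⟩ := hn (relFrob p s y) hy
    refine ⟨relFrob p s ⁻¹ᵁ W, (relFrob p s).preimage_mono i, hy', ?_⟩
    exact (Modules.pushApp_res j i n).symm.trans h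

lemma FrobPullback.isFlatModel_ι (N' : (frobTwist p s).Modules) :
    (lambdaModule N').IsFlatModel (ι N') :=
  (isFrobPullback_ι N').isFlatModel (integrable N') (pCurvatureZero N') fun _ => nabla_ι N'

end


/-! ### Coherence in terms of sections over affine open sets -/

noncomputable section

set_option linter.unusedSectionVars false

section Spec

variable {R : CommRingCat.{u}} (Q : (Spec R).Modules)

lemma epi_hom_comp_comp {C : Type*} [Category C] {A B D E : C} (i : A ≅ B) (f : B ⟶ D)
    (hf : Epi f) (g : E ≅ D) : Epi (i.hom ≫ f ≫ g.inv) :=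
  epi_comp' inferInstance (epi_comp' hf inferInstance)

/-- Finitely many generators give an epimorphism from a free tilde module onto `Q`. The tilde
functor is full and reflects epimorphisms, so it comes from a surjection of `R`-modules. -/
lemma finite_of_generatingSections [IsIso Q.fromTildeΓ]
    (G : SheafOfModules.GeneratingSections.{u} (R := (Spec R).ringCatSheaf) Q) [G.IsFiniteType] :
    Module.Finite R Γ(Q, ⊤) := by
  let K : ModuleCat.{u} R := (modulesSpecToSheaf.obj Q).presheaf.obj (.op ⊤)
  let g : tilde (ModuleCat.of R (G.I →₀ R)) ⟶ tilde K :=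
    (tildeFinsupp G.I).hom ≫ G.π ≫ (asIso Q.fromTildeΓ).inv
  have hg : Epi g := epi_hom_comp_comp _ _ G.epi _
  obtain ⟨g', hg'⟩ := (tilde.functor R).map_surjective g
  have : Epi g' := by
    apply (tilde.functor R).epi_of_epi_map
    rw [hg']
    exact hg
  have hs := (ModuleCat.epi_iff_surjective g').mp this
  have hI : Finite G.I := SheafOfModules.GeneratingSections.IsFiniteType.finite
  have : Module.Finite R (G.I →₀ R) := inferInstance
  exact Module.Finite.of_surjective (M := G.I →₀ R) g'.hom hs

lemma exists_presentation_of_finite (hQ : IsIso Q.fromTildeΓ) (h : Module.Finite R Γ(Q, ⊤)) :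
    ∃ P : SheafOfModules.Presentation.{u} (R := (Spec R).ringCatSheaf) Q,
      P.generators.IsFiniteType := by
  let K : ModuleCat.{u} R := (modulesSpecToSheaf.obj Q).presheaf.obj (.op ⊤)
  have hK : Module.Finite R K := h
  obtain ⟨t, ht⟩ := hK.fg_top
  let P := presentationTilde K (t : Set K) ht _ (Submodule.span_eq _)
  let e : SheafOfModules.Hom.{u} (R := (Spec R).ringCatSheaf) (tilde K) Q := Q.fromTildeΓ
  have he : IsIso (C := SheafOfModules.{u} (Spec R).ringCatSheaf) e := hQ
  refine ⟨SheafOfModules.Presentation.ofIsIso.{u, u, u}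
    (R := (Spec R).ringCatSheaf) e P, ⟨?_⟩⟩
  exact inferInstanceAs (Finite (t : Set K))

/-- Of the three conditions for a localized module, invertibility of `f` holds for every sheaf of
modules, so only the other two have to be stated. -/
lemma isLocalizing_iff : IsLocalizing (modulesSpecToSheaf.obj Q) ↔
    ∀ (f : R) (U : (Spec R).Opens), U = PrimeSpectrum.basicOpen f →
      (∀ v : Γ(Q, U), ∃ (n : ℕ) (t : Γ(Q, ⊤)),
        Q.presheaf.map (homOfLE le_top).op t = f ^ n • v) ∧
      ∀ t : Γ(Q, ⊤), Q.presheaf.map (homOfLE le_top).op t =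
        (0 : Γ(Q, U)) → ∃ n : ℕ, f ^ n • t = 0 := by
  let φ (f : R) := ((modulesSpecToSheaf.obj Q).obj.map (PrimeSpectrum.basicOpen f).leTop.op).hom
  refine ⟨fun h f => ?_, fun h f ↦ IsLocalizedModule.Away.mk_of_addCommGroup ?_ ?_ ?_⟩
  · have hf : IsLocalizedModule.Away f (φ f) := h f
    rintro _ rfl
    refine ⟨fun v ↦ ?_, fun t ht ↦ ?_⟩
    · obtain ⟨n, y, hy⟩ := hf.surj _ _ v
      exact ⟨n, y, hy.symm⟩
    · obtain ⟨⟨_, n, rfl⟩, hn⟩ := (IsLocalizedModule.eq_zero_iff (.powers f) (φ f)).mp ht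
      exact ⟨n, hn⟩
  · exact Scheme.Modules.isUnit_algebraMap_end_of_le_basicOpen f le_rfl
  · intro x
    obtain ⟨n, t, ht⟩ := (h f _ rfl).1 x
    exact ⟨n, t, ht.symm⟩
  · exact (h f _ rfl).2

end Spec

section Affine

variable {X : Scheme.{u}} (M : X.Modules)

/-- The sections of `M` over the basic open subsets of `U` are the localizations. -/
def Modules.LocalizesOn (U : X.Opens) : Prop := ∀ f : Γ(X, U),
  (∀ v : Γ(M, X.basicOpen f), ∃ (n : ℕ) (t : Γ(M, U)),
    M.presheaf.map (homOfLE (X.basicOpen_le f)).op t =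
      X.presheaf.map (homOfLE (X.basicOpen_le f)).op (f ^ n) • v) ∧
  ∀ t : Γ(M, U), M.presheaf.map (homOfLE (X.basicOpen_le f)).op t = 0 → ∃ n : ℕ, f ^ n • t = 0

variable {M} {U : X.Opens} (hU : IsAffineOpen U)

lemma fromSpec_smul (V : (Spec Γ(X, U)).Opens) (h : hU.fromSpec ''ᵁ V ≤ U) (r : Γ(X, U))
    (v : Γ(M.restrict hU.fromSpec, V)) :
    (M.restrictAppIso hU.fromSpec V).hom (r • v) =
      X.presheaf.map (homOfLE h).op r • (M.restrictAppIso hU.fromSpec V).hom v := by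
  rw [Scheme.Modules.smul_Spec_def]
  change (hU.fromSpec.appIso V).inv _ • (M.restrictAppIso hU.fromSpec V).hom v = _
  congr 1
  apply ((ConcreteCategory.isIso_iff_bijective (hU.fromSpec.appIso V).hom).mp inferInstance).1
  rw [← CommRingCat.comp_apply, Iso.inv_hom_id, CommRingCat.id_apply, ← CommRingCat.comp_apply,
    Scheme.Hom.appIso_hom', res_appLE]
  have h1 : hU.fromSpec.appLE U V (hU.fromSpec_preimage_self.ge.trans' le_top) =
      hU.fromSpec.app U ≫ (Spec Γ(X, U)).presheaf.map
        (homOfLE (hU.fromSpec_preimage_self.ge.trans' le_top)).op := rfl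
  rw [h1, hU.fromSpec_app_self, Category.assoc, ← Functor.map_comp]
  rfl

/-- Sections of the restriction of `M` to an affine open set. -/
def restrictEquiv {V : (Spec Γ(X, U)).Opens} {W : X.Opens} (e : hU.fromSpec ''ᵁ V = W) :
    Γ(M.restrict hU.fromSpec, V) ≃+ Γ(M, W) where
  toFun v := M.presheaf.map (homOfLE e.ge).op ((M.restrictAppIso hU.fromSpec V).hom v)
  invFun v := (M.restrictAppIso hU.fromSpec V).inv (M.presheaf.map (homOfLE e.le).op v)
  left_inv v := (Modules.res_res _ _ _).trans (Modules.res_self _ _)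
  right_inv v := (Modules.res_res _ _ _).trans (Modules.res_self _ _)
  map_add' v w := by rw [map_add, map_add]

lemma restrictEquiv_smul {V : (Spec Γ(X, U)).Opens} {W : X.Opens} (e : hU.fromSpec ''ᵁ V = W)
    (h : W ≤ U) (r : Γ(X, U)) (v : Γ(M.restrict hU.fromSpec, V)) :
    restrictEquiv hU e (r • v) = X.presheaf.map (homOfLE h).op r • restrictEquiv hU e v := by
  change M.presheaf.map (homOfLE e.ge).op ((M.restrictAppIso hU.fromSpec V).hom (r • v)) = _
  rw [fromSpec_smul hU V (e.le.trans h), Scheme.Modules.map_smul, res_res]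
  rfl

lemma restrictEquiv_res {V V' : (Spec Γ(X, U)).Opens} {W W' : X.Opens}
    (e : hU.fromSpec ''ᵁ V = W) (e' : hU.fromSpec ''ᵁ V' = W') (i : V' ≤ V) (i' : W' ≤ W)
    (v : Γ(M.restrict hU.fromSpec, V)) :
    restrictEquiv hU e' ((M.restrict hU.fromSpec).presheaf.map (homOfLE i).op v) =
      M.presheaf.map (homOfLE i').op (restrictEquiv hU e v) :=
  (Modules.res_res (M := M) (hU.fromSpec.image_mono i) e'.ge
    ((M.restrictAppIso hU.fromSpec V).hom v)).trans
    (Modules.res_res (M := M) e.ge i' ((M.restrictAppIso hU.fromSpec V).hom v)).symm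

lemma fromSpec_image_top : hU.fromSpec ''ᵁ ⊤ = U := by
  rw [Scheme.Hom.image_top_eq_opensRange, hU.opensRange_fromSpec]

variable (M) in
lemma isLocalizing_restrict_iff :
    IsLocalizing (modulesSpecToSheaf.obj (M.restrict hU.fromSpec)) ↔ Modules.LocalizesOn M U := by
  rw [isLocalizing_iff]
  have e := fromSpec_image_top hU
  have aux : (∀ (f : Γ(X, U)) (V : (Spec Γ(X, U)).Opens), V = PrimeSpectrum.basicOpen f →
      (∀ v : Γ(M.restrict hU.fromSpec, V), ∃ (n : ℕ) (t : Γ(M.restrict hU.fromSpec, ⊤)),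
        (M.restrict hU.fromSpec).presheaf.map (homOfLE le_top).op t = f ^ n • v) ∧
      ∀ t : Γ(M.restrict hU.fromSpec, ⊤),
        (M.restrict hU.fromSpec).presheaf.map (homOfLE le_top).op t =
        (0 : Γ(M.restrict hU.fromSpec, V)) → ∃ n : ℕ, f ^ n • t = 0) ↔
      ∀ (f : Γ(X, U)) (V : (Spec Γ(X, U)).Opens), V = PrimeSpectrum.basicOpen f →
        (∀ v : Γ(M, X.basicOpen f), ∃ (n : ℕ) (t : Γ(M, U)),
          M.presheaf.map (homOfLE (X.basicOpen_le f)).op t =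
            X.presheaf.map (homOfLE (X.basicOpen_le f)).op (f ^ n) • v) ∧
        ∀ t : Γ(M, U), M.presheaf.map (homOfLE (X.basicOpen_le f)).op t = 0 →
          ∃ n : ℕ, f ^ n • t = 0 := by
    refine forall_congr' fun f => forall_congr' fun V => forall_congr' fun hV => ?_
    have eV : hU.fromSpec ''ᵁ V = X.basicOpen f := by rw [hV, hU.fromSpec_image_basicOpen]
    refine and_congr ?_ ?_
    · refine (restrictEquiv hU eV).toEquiv.forall_congr fun v => exists_congr fun n =>
        (restrictEquiv hU e).toEquiv.exists_congr fun t => ?_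
      rw [← (restrictEquiv hU eV).injective.eq_iff, restrictEquiv_smul hU eV (X.basicOpen_le f),
        restrictEquiv_res hU e eV le_top (X.basicOpen_le f)]
      rfl
    · refine (restrictEquiv hU e).toEquiv.forall_congr fun t => imp_congr ?_
        (exists_congr fun n => ?_)
      · rw [← (restrictEquiv hU eV).injective.eq_iff,
          restrictEquiv_res hU e eV le_top (X.basicOpen_le f), map_zero]
        rfl
      · rw [← (restrictEquiv hU e).injective.eq_iff, restrictEquiv_smul hU e le_rfl, res_self,
          map_zero]
        rfl
  exact aux.trans ⟨fun h f => h f _ rfl, fun h f _ _ => h f⟩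

variable (M) in
lemma finite_restrict_iff :
    Module.Finite Γ(X, U) Γ(M.restrict hU.fromSpec, ⊤) ↔ Module.Finite Γ(X, U) Γ(M, U) := by
  refine Module.Finite.equiv_iff { restrictEquiv hU (fromSpec_image_top hU) with
    map_smul' := fun r v => ?_ }
  refine (restrictEquiv_smul hU (fromSpec_image_top hU) le_rfl r v).trans ?_
  rw [res_self]
  rfl

end Affine

end


/-! ### Local criterion for quasi-coherence and finite type -/

noncomputable section

set_option linter.unusedSectionVars false

section Criterion

variable {X : Scheme.{u}} (M : X.Modules)

lemma restrictFunctor_preserves {Y Z : Scheme.{u}} (f : Y ⟶ Z) [IsOpenImmersion f] :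
    PreservesColimitsOfSize.{u, u} (Scheme.Modules.restrictFunctor f) := inferInstance

/-- Generating sections of the restriction of `M` to an affine open subset. -/
lemma exists_generatingSections_restrict {W U : X.Opens} (hU : IsAffineOpen U) (h : U ≤ W)
    (G : SheafOfModules.GeneratingSections.{u}
      (SheafOfModules.over (R := X.ringCatSheaf) M W)) (hG : G.IsFiniteType) :
    ∃ G' : SheafOfModules.GeneratingSections.{u} (R := (Spec Γ(X, U)).ringCatSheaf)
      (M.restrict hU.fromSpec), G'.IsFiniteType := by
  let v : Spec Γ(X, U) ⟶ W.toScheme := hU.isoSpec.inv ≫ X.homOfLE h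
  have hv : v ≫ W.ι = hU.fromSpec := by
    simp only [v, Category.assoc, Scheme.homOfLE_ι]
    exact hU.isoSpec_inv_ι
  have := restrictFunctor_preserves v
  let F : SheafOfModules.{u} (X.ringCatSheaf.over W) ⥤
      SheafOfModules.{u} (Spec Γ(X, U)).ringCatSheaf :=
    (Scheme.Modules.overEquiv W).functor ⋙ Scheme.Modules.restrictFunctor v
  have hF : PreservesColimitsOfSize.{u, u} F :=
    comp_preservesColimits (Scheme.Modules.overEquiv W).functor
      (Scheme.Modules.restrictFunctor v)
  let iso : SheafOfModules.overFunctor X.ringCatSheaf W ⋙ F ≅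
      Scheme.Modules.restrictFunctor hU.fromSpec :=
    (Functor.associator _ _ _).symm ≪≫
      Functor.isoWhiskerRight (Scheme.Modules.overFunctorEquiv _) _ ≪≫
      (Scheme.Modules.restrictFunctorComp _ _).symm ≪≫ Scheme.Modules.restrictFunctorCongr hv
  let G₁ := G.map F (Scheme.Modules.restrictUnitIso v).symm
  let e := (iso.app M).hom
  have he : Epi (C := SheafOfModules.{u} (Spec Γ(X, U)).ringCatSheaf) e :=
    (inferInstance : Epi (iso.app M).hom)
  have hfin : Finite G.I := hG.finite
  exact ⟨SheafOfModules.GeneratingSections.ofEpi (R := (Spec Γ(X, U)).ringCatSheaf) G₁ e,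
    ⟨hfin⟩⟩

lemma Modules.localizesOn_of_isQuasicoherent {M : X.Modules}
    (hM : SheafOfModules.IsQuasicoherent (R := X.ringCatSheaf) M) {V : X.Opens}
    (hV : IsAffineOpen V) : Modules.LocalizesOn M V := by
  have h1 : M.IsQuasicoherent := hM
  have h2 : (M.restrict hV.fromSpec).IsQuasicoherent :=
    Scheme.Modules.isQuasicoherent_restrictFunctor hV.fromSpec M
  have h3 : IsIso (M.restrict hV.fromSpec).fromTildeΓ := inferInstance
  exact (isLocalizing_restrict_iff M hV).mp ((isIso_fromTildeΓ_iff_isLocalizing _).mp h3)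

lemma exists_coherent_nhds (hM : SheafOfModules.IsQuasicoherent (R := X.ringCatSheaf) M)
    (hM' : SheafOfModules.IsFiniteType.{u} (R := X.ringCatSheaf) M) {O : X.Opens} {y : X}
    (hy : y ∈ O) : ∃ U ≤ O, y ∈ U ∧ IsAffineOpen U ∧
      ∀ V ≤ U, IsAffineOpen V → Modules.LocalizesOn M V ∧ Module.Finite Γ(X, V) Γ(M, V) := by
  obtain ⟨⟨I, W, cov, G⟩, hG⟩ := hM'.exists_localGeneratorsData
  obtain ⟨i, hi⟩ : ∃ i, y ∈ W i := by
    have := (Opens.coversTop_iff _ _).mp cov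
    exact TopologicalSpace.Opens.mem_iSup.mp (this.ge trivial)
  obtain ⟨U, hU, hyU, hle⟩ := exists_affine_le (U := O ⊓ W i) ⟨hy, hi⟩
  refine ⟨U, hle.trans inf_le_left, hyU, hU, fun V hV hV' => ?_⟩
  refine ⟨Modules.localizesOn_of_isQuasicoherent hM hV', (finite_restrict_iff M hV').mp ?_⟩
  obtain ⟨G', hG'⟩ := exists_generatingSections_restrict M hV' (hV.trans (hle.trans inf_le_right))
    (G i) (hG.isFiniteType i)
  exact finite_of_generatingSections _ G'

lemma exists_presentation_over {U : X.Opens} (hU : IsAffineOpen U)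
    (h : Modules.LocalizesOn M U) (h' : Module.Finite Γ(X, U) Γ(M, U)) :
    ∃ P : SheafOfModules.Presentation.{u} (SheafOfModules.over (R := X.ringCatSheaf) M U),
      P.generators.IsFiniteType := by
  have h1 := (isIso_fromTildeΓ_iff_isLocalizing _).mpr ((isLocalizing_restrict_iff M hU).mpr h)
  obtain ⟨P, hP⟩ := exists_presentation_of_finite _ h1 ((finite_restrict_iff M hU).mpr h')
  have := restrictFunctor_preserves hU.isoSpec.hom
  let F : SheafOfModules.{u} (Spec Γ(X, U)).ringCatSheaf ⥤
      SheafOfModules.{u} (X.ringCatSheaf.over U) :=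
    Scheme.Modules.restrictFunctor hU.isoSpec.hom ⋙ (Scheme.Modules.overEquiv U).inverse
  have hF : PreservesColimitsOfSize.{u, u} F :=
    comp_preservesColimits (Scheme.Modules.restrictFunctor hU.isoSpec.hom)
      (Scheme.Modules.overEquiv U).inverse
  have hv : hU.isoSpec.hom ≫ hU.fromSpec = U.ι := by
    rw [← hU.isoSpec_inv_ι, Iso.hom_inv_id_assoc]
  let iso : Scheme.Modules.restrictFunctor hU.fromSpec ⋙ F ≅
      SheafOfModules.overFunctor X.ringCatSheaf U :=
    (Functor.associator _ _ _).symm ≪≫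
      Functor.isoWhiskerRight ((Scheme.Modules.restrictFunctorComp _ _).symm ≪≫
        Scheme.Modules.restrictFunctorCongr hv ≪≫
        (Scheme.Modules.overFunctorEquiv U).symm) _ ≪≫
      Functor.associator _ _ _ ≪≫
      Functor.isoWhiskerLeft _ (Scheme.Modules.overEquiv U).unitIso.symm ≪≫
      Functor.rightUnitor _
  let η : SheafOfModules.unit (X.ringCatSheaf.over U) ≅
      F.obj (SheafOfModules.unit (Spec Γ(X, U)).ringCatSheaf) :=
    (Scheme.Modules.overEquiv U).unitIso.app _ ≪≫ (Scheme.Modules.overEquiv U).inverse.mapIso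
      (Scheme.Modules.restrictUnitIso hU.isoSpec.hom).symm
  have hfin : Finite P.generators.I := hP.finite
  have he : IsIso (C := SheafOfModules.{u} (X.ringCatSheaf.over U)) (iso.app M).hom :=
    (inferInstance : IsIso (iso.app M).hom)
  exact ⟨SheafOfModules.Presentation.ofIsIso (R := X.ringCatSheaf.over U) (iso.app M).hom
    (SheafOfModules.Presentation.map P F η), ⟨hfin⟩⟩

/-- On an affine open set with localizing sections `M` is the tilde of its sections; finitely many
generators then give a local presentation with finitely many generating sections. -/
theorem coherent_of_locally (h : ∀ y : X, ∃ U : X.Opens, y ∈ U ∧ IsAffineOpen U ∧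
      Modules.LocalizesOn M U ∧ Module.Finite Γ(X, U) Γ(M, U)) :
    SheafOfModules.IsQuasicoherent (R := X.ringCatSheaf) M ∧
      SheafOfModules.IsFiniteType.{u} (R := X.ringCatSheaf) M := by
  choose U hy hU h1 h2 using h
  choose P hP using fun y => exists_presentation_over M (hU y) (h1 y) (h2 y)
  have cov : (Opens.grothendieckTopology X).CoversTop U :=
    (Opens.coversTop_iff _ _).mpr
      (top_le_iff.mp fun y _ => TopologicalSpace.Opens.mem_iSup.mpr ⟨y, hy y⟩)
  let q : SheafOfModules.QuasicoherentData.{u, u, u, u} (R := X.ringCatSheaf) M :=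
    { I := X, X := U, coversTop := cov, presentation := P }
  have hq : q.localGeneratorsData.IsFiniteType := { isFiniteType := fun y => hP y }
  have h3 : SheafOfModules.IsQuasicoherent (R := X.ringCatSheaf) M :=
    { nonempty_quasicoherentData := ⟨q⟩ }
  have h4 : SheafOfModules.IsFiniteType.{u} (R := X.ringCatSheaf) M :=
    { exists_localGeneratorsData := ⟨q.localGeneratorsData, hq⟩ }
  exact ⟨h3, h4⟩

end Criterion

end


/-! ### Coherence of Frobenius pullbacks -/

noncomputable section
set_option linter.unusedSectionVars false

section Transfer

lemma Modules.LocalizesOn.of_eq {X : Scheme.{u}} {M : X.Modules} {U : X.Opens}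
    (h : Modules.LocalizesOn M U) (f : Γ(X, U)) {B : X.Opens} (hB : B = X.basicOpen f)
    (i : B ≤ U) : (∀ v : Γ(M, B), ∃ (n : ℕ) (t : Γ(M, U)), M.presheaf.map (homOfLE i).op t =
      X.presheaf.map (homOfLE i).op (f ^ n) • v) ∧
    ∀ t : Γ(M, U), M.presheaf.map (homOfLE i).op t = 0 → ∃ n : ℕ, f ^ n • t = 0 := by
  subst hB
  exact h f

lemma Modules.LocalizesOn.mk' {X : Scheme.{u}} {M : X.Modules} {U : X.Opens}
    (h : ∀ f : Γ(X, U), ∃ (B : X.Opens) (_ : B = X.basicOpen f) (i : B ≤ U),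
      (∀ v : Γ(M, B), ∃ (n : ℕ) (t : Γ(M, U)), M.presheaf.map (homOfLE i).op t =
        X.presheaf.map (homOfLE i).op (f ^ n) • v) ∧
      ∀ t : Γ(M, U), M.presheaf.map (homOfLE i).op t = 0 → ∃ n : ℕ, f ^ n • t = 0) :
    Modules.LocalizesOn M U := fun f => by
  obtain ⟨_, rfl, _, h⟩ := h f
  exact h

lemma Modules.LocalizesOn.exists_pow {X : Scheme.{u}} {M : X.Modules} {U : X.Opens}
    (h : Modules.LocalizesOn M U) (f : Γ(X, U)) {ι : Type*} [Finite ι]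
    (v : ι → Γ(M, X.basicOpen f)) : ∃ (n : ℕ) (t : ι → Γ(M, U)), ∀ i,
      M.presheaf.map (homOfLE (X.basicOpen_le f)).op (t i) =
        X.presheaf.map (homOfLE (X.basicOpen_le f)).op (f ^ n) • v i := by
  cases nonempty_fintype ι
  choose n t ht using fun i => (h f).1 (v i)
  refine ⟨Finset.univ.sup n, fun i => f ^ (Finset.univ.sup n - n i) • t i, fun i => ?_⟩
  rw [Scheme.Modules.map_smul, ht, ← mul_smul, ← map_mul, ← pow_add,
    Nat.sub_add_cancel (Finset.le_sup (Finset.mem_univ i))]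

lemma Modules.LocalizesOn.exists_pow_smul_eq_zero {X : Scheme.{u}} {M : X.Modules} {U : X.Opens}
    (h : Modules.LocalizesOn M U) (f : Γ(X, U)) {ι : Type*} [Finite ι]
    (t : ι → Γ(M, U)) (ht : ∀ i, M.presheaf.map (homOfLE (X.basicOpen_le f)).op (t i) = 0) :
    ∃ n : ℕ, ∀ i, f ^ n • t i = 0 := by
  cases nonempty_fintype ι
  choose n hn using fun i => (h f).2 (t i) (ht i)
  refine ⟨Finset.univ.sup n, fun i => ?_⟩
  rw [← Nat.sub_add_cancel (Finset.le_sup (f := n) (Finset.mem_univ i)), pow_add, mul_smul, hn,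
    smul_zero]

variable {k : Type u} [CommRing k] {p : ℕ} [Fact p.Prime] [CharP k p] {S : Scheme.{u}}
  {s : S ⟶ Spec (.of k)} [Smooth s]

/-- The `p`-th power of a function comes from the Frobenius twist. -/
lemma exists_relFrob_eq_pow {U : (frobTwist p s).Opens} (f : Γ(S, relFrob p s ⁻¹ᵁ U)) :
    ∃ b : Γ(frobTwist p s, U), (relFrob p s).app U b = f ^ p := by
  have i : U ≤ twist p s (relFrob p s ⁻¹ᵁ U) :=
    (twist_preimage (p := p) (s := s) U).ge
  refine ⟨(frobTwist p s).presheaf.map (homOfLE i).op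
    ((frobTwistFst p s).app (relFrob p s ⁻¹ᵁ U) f), ?_⟩
  rw [Scheme.Hom.app_eq_appLE, res_appLE]
  exact frobSection_fst p s _ f

variable {V : S.Opens} (C : Coordinates p s V) {N' : (frobTwist p s).Modules}
  {M : S.Modules} {j : N' ⟶ (Scheme.Modules.pushforward (relFrob p s)).obj M}
  {U : (frobTwist p s).Opens} (h : relFrob p s ⁻¹ᵁ U ≤ V)

/-- The multi-index of the constant monomial. -/
def Coordinates.zeroIndex : Fin C.n → Fin p := fun _ => ⟨0, (Fact.out : p.Prime).pos⟩

lemma Coordinates.monom_zeroIndex : monom C.x C.zeroIndex = 1 := by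
  simp [monom, zeroIndex]

lemma pushApp_eq_sum (n : Γ(N', U)) : Modules.pushApp j U n =
    ∑ I, S.presheaf.map (homOfLE h).op (monom C.x I) •
      Modules.pushApp j U ((Pi.single C.zeroIndex n : (Fin C.n → Fin p) → Γ(N', U)) I) := by
  rw [Finset.sum_eq_single C.zeroIndex, Pi.single_eq_same, C.monom_zeroIndex, map_one, one_smul]
  · intro I _ hI
    rw [Pi.single_eq_of_ne hI, map_zero, smul_zero]
  · simp

-- Every basic open set of the preimage of `U` is the preimage of one in `U`, since `f^p` comes from
-- a function `b`. Localization is then carried out on coefficients; the exponents become `p * n`,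
-- as `b^n` acts as `f^(p n)`.
include C h in
lemma IsFrobPullback.localizesOn (hj : IsFrobPullback j) (H : Modules.LocalizesOn N' U) :
    Modules.LocalizesOn M (relFrob p s ⁻¹ᵁ U) := by
  refine .mk' fun f => ?_
  obtain ⟨b, hb⟩ := exists_relFrob_eq_pow f
  have i : (frobTwist p s).basicOpen b ≤ U := (frobTwist p s).basicOpen_le b
  have i' := (relFrob p s).preimage_mono i
  refine ⟨relFrob p s ⁻¹ᵁ (frobTwist p s).basicOpen b, ?_, i', fun v => ?_, fun t ht => ?_⟩
  · rw [Scheme.preimage_basicOpen, hb, Scheme.basicOpen_pow _ _ (Fact.out : p.Prime).pos]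
  · obtain ⟨c, hc, -⟩ := hj C _ (i'.trans h) v
    obtain ⟨n, t, ht⟩ := H.exists_pow b c
    refine ⟨p * n, ∑ I, S.presheaf.map (homOfLE h).op (monom C.x I) • Modules.pushApp j U (t I), ?_⟩
    rw [map_sum, hc, Finset.smul_sum]
    refine Finset.sum_congr rfl fun I _ => ?_
    rw [Scheme.Modules.map_smul, res_res, ← Modules.pushApp_res j i, ht, Modules.pushApp_smul, app_res,
      map_pow, hb, pow_mul, smul_comm]
  · obtain ⟨c, hc, -⟩ := hj C U h t
    obtain ⟨n, hn⟩ := H.exists_pow_smul_eq_zero b c fun I => by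
      have h0 : (0 : Γ(M, relFrob p s ⁻¹ᵁ (frobTwist p s).basicOpen b)) = ∑ I,
          S.presheaf.map (homOfLE (i'.trans h)).op (monom C.x I) • Modules.pushApp j _
            ((0 : (Fin C.n → Fin p) → Γ(N', (frobTwist p s).basicOpen b)) I) := by
        simp
      refine congrFun ((hj C _ (i'.trans h) 0).unique (y₁ := fun I =>
        N'.presheaf.map (homOfLE i).op (c I)) ?_ h0) I
      rw [← ht, hc, map_sum]
      exact Finset.sum_congr rfl fun I _ => by
        rw [Scheme.Modules.map_smul, res_res, Modules.pushApp_res]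
    refine ⟨p * n, ?_⟩
    rw [hc, pow_mul, ← hb, ← map_pow, Finset.smul_sum]
    exact Finset.sum_eq_zero fun I _ => by
      rw [smul_comm, ← Modules.pushApp_smul, hn, map_zero, smul_zero]

include C h in
lemma IsFrobPullback.finite (hj : IsFrobPullback j)
    (H : Module.Finite Γ(frobTwist p s, U) Γ(N', U)) :
    Module.Finite Γ(S, relFrob p s ⁻¹ᵁ U) Γ(M, relFrob p s ⁻¹ᵁ U) := by
  classical
  obtain ⟨t, ht⟩ := H.fg_top
  refine ⟨⟨t.image (Modules.pushApp j U), eq_top_iff.mpr fun v _ => ?_⟩⟩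
  have key : ∀ c : Γ(N', U), Modules.pushApp j U c ∈
      Submodule.span Γ(S, relFrob p s ⁻¹ᵁ U) (t.image (Modules.pushApp j U) : Set _) := by
    intro c
    have hc : c ∈ Submodule.span Γ(frobTwist p s, U) (t : Set Γ(N', U)) := ht ▸ trivial
    induction hc using Submodule.span_induction with
    | mem x hx => exact Submodule.subset_span (Finset.mem_coe.mpr (Finset.mem_image_of_mem _ hx))
    | zero => rw [map_zero]; exact Submodule.zero_mem _
    | add x y _ _ hx hy => rw [map_add]; exact Submodule.add_mem _ hx hy
    | smul a x _ hx => rw [Modules.pushApp_smul]; exact Submodule.smul_mem _ _ hx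
  obtain ⟨c, hc, -⟩ := hj C U h v
  rw [hc]
  exact Submodule.sum_mem _ fun I _ => Submodule.smul_mem _ _ (key _)

-- Taking the constant coefficient is a retraction of `j`. The descent of properties from `M` to
-- `N'` rests on it.
include C h in
lemma IsFrobPullback.eq_zeroIndex (hj : IsFrobPullback j) {n : Γ(N', U)}
    {c : (Fin C.n → Fin p) → Γ(N', U)} (e : Modules.pushApp j U n =
      ∑ I, S.presheaf.map (homOfLE h).op (monom C.x I) • Modules.pushApp j U (c I)) :
    n = c C.zeroIndex := by
  rw [← (hj C U h _).unique (pushApp_eq_sum C h n) e, Pi.single_eq_same]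

include C h in
lemma IsFrobPullback.pushApp_injective (hj : IsFrobPullback j) :
    Function.Injective (Modules.pushApp j U) := fun n n' e => by
  rw [hj.eq_zeroIndex C h (e.trans (pushApp_eq_sum C h n')), Pi.single_eq_same]

include C h in
lemma IsFrobPullback.localizesOn_of_localizesOn (hj : IsFrobPullback j)
    (H : Modules.LocalizesOn M (relFrob p s ⁻¹ᵁ U)) : Modules.LocalizesOn N' U := by
  intro f
  have i : (frobTwist p s).basicOpen f ≤ U := (frobTwist p s).basicOpen_le f
  have i' := (relFrob p s).preimage_mono i
  obtain ⟨h1, h2⟩ := H.of_eq ((relFrob p s).app U f) (Scheme.preimage_basicOpen _ f) i'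
  refine ⟨fun c => ?_, fun c hc => ?_⟩
  · obtain ⟨n, t, ht⟩ := h1 (Modules.pushApp j _ c)
    obtain ⟨d, hd, -⟩ := hj C U h t
    refine ⟨n, d C.zeroIndex, ?_⟩
    refine (hj.eq_zeroIndex C (i'.trans h) (c := fun I => N'.presheaf.map (homOfLE i).op (d I))
      ?_).symm
    rw [Modules.pushApp_smul, app_res, map_pow, ← ht, hd, map_sum]
    exact Finset.sum_congr rfl fun I _ => by
      rw [Scheme.Modules.map_smul, res_res, Modules.pushApp_res]
  · obtain ⟨n, hn⟩ := h2 (Modules.pushApp j U c) (by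
      rw [← Modules.pushApp_res j i, hc, map_zero])
    refine ⟨n, hj.pushApp_injective C h ?_⟩
    rw [Modules.pushApp_smul, map_pow, hn, map_zero]

-- If sections `v l` generate `M`, then all their coefficients generate `N'`: expand `j(n)` in the
-- `v l` and take the constant coefficient.
include C h in
lemma IsFrobPullback.finite_of_finite (hj : IsFrobPullback j)
    (H : Module.Finite Γ(S, relFrob p s ⁻¹ᵁ U) Γ(M, relFrob p s ⁻¹ᵁ U)) :
    Module.Finite Γ(frobTwist p s, U) Γ(N', U) := by
  obtain ⟨m, v, hv⟩ := Submodule.fg_iff_exists_fin_generating_family.mp H.fg_top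
  choose c hc _ using fun l => hj C U h (v l)
  refine ⟨Submodule.fg_iff_exists_finite_generating_family.mpr
    ⟨Fin m × (Fin C.n → Fin p), inferInstance, fun l => c l.1 l.2, eq_top_iff.mpr fun n _ => ?_⟩⟩
  obtain ⟨a, ha⟩ := (Submodule.mem_span_range_iff_exists_fun _).mp
    (hv.ge (Submodule.mem_top (x := Modules.pushApp j U n)))
  obtain ⟨b, hb⟩ := exists_coeff_rearrangement C h (fun l : Fin m × (Fin C.n → Fin p) =>
    a l.1 * S.presheaf.map (homOfLE h).op (monom C.x l.2))
  have e : Modules.pushApp j U n = ∑ I, S.presheaf.map (homOfLE h).op (monom C.x I) •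
      Modules.pushApp j U (∑ l : Fin m × (Fin C.n → Fin p), b l I • c l.1 l.2) := by
    refine Eq.trans ?_ (hb j fun l => c l.1 l.2)
    rw [← ha, Fintype.sum_prod_type]
    refine Finset.sum_congr rfl fun l _ => ?_
    conv_lhs => rw [hc l, Finset.smul_sum]
    exact Finset.sum_congr rfl fun I _ => (mul_smul _ _ _).symm
  rw [hj.eq_zeroIndex C h e]
  exact Submodule.sum_mem _ fun l _ => Submodule.smul_mem _ _
    (Submodule.subset_span (Set.mem_range_self l))

lemma IsFrobPullback.coherent (hj : IsFrobPullback j)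
    (h1 : SheafOfModules.IsQuasicoherent (R := (frobTwist p s).ringCatSheaf) N')
    (h2 : SheafOfModules.IsFiniteType.{u} (R := (frobTwist p s).ringCatSheaf) N') :
    SheafOfModules.IsQuasicoherent (R := S.ringCatSheaf) M ∧
      SheafOfModules.IsFiniteType.{u} (R := S.ringCatSheaf) M := by
  refine coherent_of_locally M fun y => ?_
  obtain ⟨V, -, hy, ⟨C⟩⟩ := exists_coordinates_nhds p s (U := ⊤) (y := y) trivial
  obtain ⟨U, hU, hyU, hU', H⟩ := exists_coherent_nhds N' h1 h2 (O := twist p s V)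
    (y := relFrob p s y) (le_relFrob_preimage_twist p s V hy)
  obtain ⟨h3, h4⟩ := H U le_rfl hU'
  exact ⟨relFrob p s ⁻¹ᵁ U, hyU, hU'.preimage _, hj.localizesOn C (le_twist_iff.mp hU) h3,
    hj.finite C (le_twist_iff.mp hU) h4⟩

lemma IsFrobPullback.coherent_of_coherent (hj : IsFrobPullback j)
    (h1 : SheafOfModules.IsQuasicoherent (R := S.ringCatSheaf) M)
    (h2 : SheafOfModules.IsFiniteType.{u} (R := S.ringCatSheaf) M) :
    SheafOfModules.IsQuasicoherent (R := (frobTwist p s).ringCatSheaf) N' ∧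
      SheafOfModules.IsFiniteType.{u} (R := (frobTwist p s).ringCatSheaf) N' := by
  refine coherent_of_locally N' fun y => ?_
  obtain ⟨y, rfl⟩ := (isHomeomorph_relFrob p s).surjective y
  obtain ⟨V, -, hy, ⟨C⟩⟩ := exists_coordinates_nhds p s (U := ⊤) (y := y) trivial
  obtain ⟨U, hU, hyU, hU', H⟩ := exists_coherent_nhds M h1 h2 hy
  have i : relFrob p s ⁻¹ᵁ twist p s U ≤ U := (relFrob_preimage_twist p s U).le
  have hU2 := isAffineOpen_twist p s hU'
  obtain ⟨h3, h4⟩ := H _ i (hU2.preimage _)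
  exact ⟨twist p s U, le_relFrob_preimage_twist p s U hyU, hU2,
    hj.localizesOn_of_localizesOn C (i.trans hU) h3, hj.finite_of_finite C (i.trans hU) h4⟩

end Transfer

end

/-! ### The Cartier correspondence for modules -/

noncomputable section
set_option linter.unusedSectionVars false

section CartierModules

variable {k : Type u} [CommRing k] {p : ℕ} [Fact p.Prime] [CharP k p] {S : Scheme.{u}}
  {s : S ⟶ Spec (.of k)} [Smooth s]

/-- The defect `φ ∇_D - ∇_D φ` is `𝒪_S`-linear, because the Leibniz terms cancel, and it vanishes on
`N'`, which generates. -/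
lemma IsFrobPullback.horizontal {N N₂ : LambdaModule s 1} {N' : (frobTwist p s).Modules}
    {j : N' ⟶ (Scheme.Modules.pushforward (relFrob p s)).obj N.M} (hj : IsFrobPullback j)
    (φ : N.M ⟶ N₂.M) (h1 : ∀ U n, N.IsFlat _ (Modules.pushApp j U n))
    (h2 : ∀ U n, N₂.IsFlat _ (φ.app _ (Modules.pushApp j U n))) (U : S.Opens)
    (D : VectorField s U) (v : Γ(N.M, U)) :
    φ.app U (N.nabla U D v) = N₂.nabla U D (φ.app U v) := by
  classical
  let δ (W : S.Opens) (h : W ≤ U) : Γ(N.M, W) →+ Γ(N₂.M, W) :=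
    (φ.app W).hom.comp (N.nabla W (D.res h)) - (N₂.nabla W (D.res h)).comp (φ.app W).hom
  have hδ : ∀ W h v, δ W h v = φ.app W (N.nabla W (D.res h) v) -
    N₂.nabla W (D.res h) (φ.app W v) := fun _ _ _ => rfl
  -- The defect makes sense only below `U`, where `D` lives; elsewhere it is given the value `0`.
  let ψ (W : S.Opens) : Γ(N.M, W) →+ Γ(N₂.M, W) := if h : W ≤ U then δ W h else 0
  have hψ : ∀ W (h : W ≤ U), ψ W = δ W h := fun W h => dif_pos h
  have key := hj.eq_of_sections (φ := ψ) (ψ := fun W => 0) (W := U) (fun W a v => by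
      by_cases h : W ≤ U
      · rw [hψ W h, hδ, hδ, N.leibniz, map_add, φ.app_smul, φ.app_smul, φ.app_smul, N₂.leibniz,
          add_sub_add_left_eq_sub, smul_sub]
      · have : ψ W = 0 := dif_neg h
        rw [this, AddMonoidHom.zero_apply, AddMonoidHom.zero_apply, smul_zero])
    (fun W a v => (smul_zero a).symm) v
    (fun W' i => by
      rw [hψ W' i, hψ U le_rfl, hδ, hδ, map_sub, ← Modules.hom_res, ← N.nabla_res U W' i,
        ← N₂.nabla_res U W' i, ← Modules.hom_res]
      rfl)
    (fun W' i => (map_zero _).symm)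
    (fun U' i n => by
      rw [hψ _ i, hδ]
      have e1 := h1 U' n _ le_rfl (D.res i)
      have e2 := h2 U' n _ le_rfl (D.res i)
      rw [Modules.res_self] at e1 e2
      rw [e1, e2, map_zero, sub_zero]
      rfl)
  rw [hψ U le_rfl, hδ] at key
  exact sub_eq_zero.mp key

namespace LambdaModule

lemma integrable_ofModule {T : Scheme.{u}} {t : T ⟶ Spec (.of k)} (M : T.Modules) :
    (ofModule t M).Integrable := fun U D E v =>
  (sub_zero (0 : Γ(M, U))).trans (smul_zero (A := Γ(M, U)) _).symm

lemma isZero_ofModule {T : Scheme.{u}} {t : T ⟶ Spec (.of k)} (M : T.Modules) :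
    (ofModule t M).IsZero := fun _ _ _ => rfl

/-- A map of modules with zero Higgs fields. -/
def homOfIsZero {T : Scheme.{u}} {t : T ⟶ Spec (.of k)} {N N₂ : LambdaModule t 0} (h : N.IsZero)
    (h₂ : N₂.IsZero) (φ : N.M ⟶ N₂.M) : N ⟶ N₂ :=
  ⟨φ, fun U D v => by rw [h, h₂, map_zero]⟩

variable {N N₂ N₃ : LambdaModule s 1}

lemma Hom.isFlat (φ : N ⟶ N₂) {U : S.Opens} {v : Γ(N.M, U)} (h : N.IsFlat U v) :
    N₂.IsFlat U (φ.hom.app U v) := fun W i D => by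
  rw [← Modules.hom_res, ← φ.comm, h W i D, map_zero]

/-- The map on flat sections. -/
def flatMap (p : ℕ) [Fact p.Prime] [CharP k p] (φ : N ⟶ N₂) : N.flatModule p ⟶ N₂.flatModule p :=
  Modules.mkHom (fun U => ((φ.hom.app (relFrob p s ⁻¹ᵁ U)).hom.comp
      (N.flatSections p U).subtype).codRestrict (N₂.flatSections p U) fun v => Hom.isFlat φ v.2)
    (fun U a v => Subtype.ext (φ.hom.app_smul ((relFrob p s).appLE U _ le_rfl a)
      (v : N.flatSections p U).1))
    (fun U W i v => Subtype.ext (Modules.hom_res φ.hom _ (v : N.flatSections p U).1))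

lemma flatMap_flatι (φ : N ⟶ N₂) : flatMap p φ ≫ N₂.flatι p =
    N.flatι p ≫ (Scheme.Modules.pushforward (relFrob p s)).map φ.hom :=
  Modules.hom_ext_apply fun _ _ => rfl

variable {N' : (frobTwist p s).Modules}
  {j : N' ⟶ (Scheme.Modules.pushforward (relFrob p s)).obj N.M}

/-- A map with flat values factors through the flat sections. -/
def IsFlatModel.lift (hj : N.IsFlatModel j) : N' ⟶ N.flatModule p :=
  Modules.mkHom (fun U => (Modules.pushApp j U).codRestrict (N.flatSections p U) fun v =>
      (hj.range_eq U).le (Set.mem_range_self v))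
    (fun U a v => Subtype.ext (by
      change Modules.pushApp j U (a • v) = (relFrob p s).appLE U _ le_rfl a • Modules.pushApp j U v
      rw [Modules.pushApp_smul, ← Scheme.Hom.app_eq_appLE]))
    (fun U W i v => Subtype.ext (Modules.hom_res j i v))

lemma IsFlatModel.isIso_lift (hj : N.IsFlatModel j) : IsIso hj.lift :=
  Modules.isIso_of_bijective _ fun U => ⟨fun v w h => hj.injective U (congrArg Subtype.val h),
    fun v => by
      obtain ⟨w, hw⟩ := (hj.range_eq U).ge (show (v : N.flatSections p U).1 ∈ _ from
        (v : N.flatSections p U).2)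
      exact ⟨w, Subtype.ext hw⟩⟩

end LambdaModule

open LambdaModule

variable (p s)

/-- The module of flat sections as an object of `HIG_0(S')`. -/
def flatObj (N : MIC₀ p s) : HIG₀ (frobTwistStr p s) :=
  ⟨ofModule _ (N.obj.flatModule p),
    (N.obj.isFlatModel_flatι.isFrobPullback N.property.2.1 N.property.2.2).coherent_of_coherent
      N.property.1.1 N.property.1.2, integrable_ofModule _, isZero_ofModule _⟩

/-- The functor of flat sections. -/
def flatFunctor : MIC₀ p s ⥤ HIG₀ (frobTwistStr p s) where
  obj N := flatObj p s N
  map {N N₂} φ := (ObjectProperty.homMk (homOfIsZero (isZero_ofModule _) (isZero_ofModule _)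
    (flatMap p φ.hom)) : flatObj p s N ⟶ flatObj p s N₂)
  map_id _ := by rfl
  map_comp _ _ := by rfl

/-- The inclusion of the flat sections. -/
def flatFunctorι : flatFunctor p s ⋙ HIG₀.toModules (frobTwistStr p s) ⟶
    MIC₀.toModules p s ⋙ Scheme.Modules.pushforward (relFrob p s) where
  app N := N.obj.flatι p
  naturality _ _ φ := flatMap_flatι φ.hom

lemma isFrobPullback_flatι (N : MIC₀ p s) : IsFrobPullback (N.obj.flatι p) :=
  N.obj.isFlatModel_flatι.isFrobPullback N.property.2.1 N.property.2.2

instance : (flatFunctor p s).Faithful where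
  map_injective {N N₂} φ ψ h := by
    have h' : flatMap p φ.hom = flatMap p ψ.hom := congrArg (fun χ => χ.hom.hom) h
    refine ObjectProperty.hom_ext _ (Hom.ext ((isFrobPullback_flatι p s N).hom_ext fun U n => ?_))
    exact congrArg Subtype.val (congrArg (fun χ : N.obj.flatModule p ⟶ N₂.obj.flatModule p =>
      χ.app U n) h')

instance : (flatFunctor p s).Full where
  map_surjective {N N₂} t := by
    let t' : N.obj.flatModule p ⟶ N₂.obj.flatModule p := t.hom.hom
    have hj := isFrobPullback_flatι p s N
    let φ := hj.desc (t' ≫ N₂.obj.flatι p)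
    have hφ : ∀ U n, φ.app _ (Modules.pushApp (N.obj.flatι p) U n) =
        (t'.app U n : N₂.obj.flatSections p U).1 := fun U n => hj.desc_pushApp _ n
    refine ⟨ObjectProperty.homMk ⟨φ, hj.horizontal φ (fun U n => (n : N.obj.flatSections p U).2)
      fun U n => ?_⟩, ?_⟩
    · rw [hφ]
      exact (t'.app U n : N₂.obj.flatSections p U).2
    · refine ObjectProperty.hom_ext _ (Hom.ext (Modules.hom_ext_apply fun U n => ?_))
      exact Subtype.ext (hφ U n)

instance : (flatFunctor p s).EssSurj where
  mem_essImage Q := by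
    have hj := FrobPullback.isFlatModel_ι Q.obj.M
    have hQ := (FrobPullback.isFrobPullback_ι Q.obj.M).coherent Q.property.1.1 Q.property.1.2
    let N : MIC₀ p s := ⟨FrobPullback.lambdaModule Q.obj.M, hQ, FrobPullback.integrable _,
      FrobPullback.pCurvatureZero _⟩
    have hl : IsIso hj.lift := hj.isIso_lift
    let l : Q.obj.M ⟶ ((flatFunctor p s).obj N).obj.M := hj.lift
    have hl' : IsIso l := hl
    let f : (flatFunctor p s).obj N ⟶ Q := ObjectProperty.homMk
      (homOfIsZero (isZero_ofModule _) Q.property.2.2 (inv l))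
    let g : Q ⟶ (flatFunctor p s).obj N := ObjectProperty.homMk
      (homOfIsZero Q.property.2.2 (isZero_ofModule _) l)
    exact ⟨N, ⟨⟨f, g, ObjectProperty.hom_ext _ (Hom.ext (IsIso.inv_hom_id l)),
      ObjectProperty.hom_ext _ (Hom.ext (IsIso.hom_inv_id l))⟩⟩⟩

instance : (flatFunctor p s).IsEquivalence where

end CartierModules

end

/-! ### Symmetric algebras under base change -/

noncomputable section
set_option linter.unusedSectionVars false

open TensorProduct

section BaseChange

variable {R S : Type*} [CommRing R] [CommRing S] [Algebra R S] {N M : Type*} [AddCommGroup N]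
  [Module R N] [AddCommGroup M] [Module R M] [Module S M] [IsScalarTower R S M] (j : N →ₗ[R] M)

lemma isBaseChange_iff_existsUnique {ι : Type*} [Fintype ι] (b : Module.Basis ι R S) :
    IsBaseChange S j ↔ ∀ m, ∃! c : ι → N, m = ∑ i, b i • j (c i) := by
  classical
  let e : (ι → N) ≃ S ⊗[R] N := (Finsupp.linearEquivFunOnFinite R N ι).symm.toEquiv.trans
    (TensorProduct.equivFinsuppOfBasisLeft b).symm.toEquiv
  let ψ : S ⊗[R] N →ₗ[R] M := TensorProduct.lift
    (((Algebra.linearMap S <| Module.End S (N →ₗ[R] M)).flip j).restrictScalars R)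
  have he : ∀ c, ψ (e c) = ∑ i, b i • j (c i) := fun c => by
    have : e c = ∑ i, b i ⊗ₜ[R] c i := by
      change (TensorProduct.equivFinsuppOfBasisLeft b).symm
        ((Finsupp.linearEquivFunOnFinite R N ι).symm c) = _
      rw [TensorProduct.equivFinsuppOfBasisLeft_symm_apply, Finsupp.sum_fintype _ _ (by simp)]
      simp
    rw [this, map_sum]
    rfl
  change Function.Bijective ψ ↔ _
  rw [← e.bijective.of_comp_iff, Function.bijective_iff_existsUnique]
  simp only [Function.comp_apply, he, eq_comm]

/-- The map of symmetric algebras over a ring map. -/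
def symMap : SymmetricAlgebra R N →ₐ[R] SymmetricAlgebra S M :=
  SymmetricAlgebra.lift (((SymmetricAlgebra.ι S M).restrictScalars R).comp j)

lemma symMap_ι (n : N) : symMap (S := S) j (SymmetricAlgebra.ι R N n) = SymmetricAlgebra.ι S M (j n) := by
  simp [symMap]

/-- Maps in both directions come from the universal properties of tensor products and symmetric
algebras, and they are inverse on generators. -/
theorem isBaseChange_symMap (hj : IsBaseChange S j) :
    IsBaseChange S (symMap (S := S) j).toLinearMap := by
  let inc : SymmetricAlgebra R N →ₐ[R] S ⊗[R] SymmetricAlgebra R N :=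
    Algebra.TensorProduct.includeRight
  let φ : S ⊗[R] SymmetricAlgebra R N →ₐ[S] SymmetricAlgebra S M :=
    Algebra.TensorProduct.lift (Algebra.ofId S _) (symMap j) fun _ _ => Commute.all _ _
  let ψ : SymmetricAlgebra S M →ₐ[S] S ⊗[R] SymmetricAlgebra R N :=
    SymmetricAlgebra.lift (hj.lift (inc.toLinearMap.comp (SymmetricAlgebra.ι R N)))
  have h1 : φ.comp ψ = AlgHom.id S _ := by
    refine SymmetricAlgebra.algHom_ext (hj.algHom_ext' _ _ (LinearMap.ext fun n => ?_))
    simp [φ, ψ, inc, hj.lift_eq, symMap_ι]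
  have h2 : ψ.comp φ = AlgHom.id S _ := by
    refine Algebra.TensorProduct.ext (by ext) (SymmetricAlgebra.algHom_ext (LinearMap.ext fun n => ?_))
    simp [φ, ψ, inc, hj.lift_eq, symMap_ι]
  let e : S ⊗[R] SymmetricAlgebra R N ≃ₐ[S] SymmetricAlgebra S M := AlgEquiv.ofAlgHom φ ψ h1 h2
  exact IsBaseChange.of_equiv e.toLinearEquiv fun x => by simp [e, φ]

variable {B B' : Type*} [CommRing B'] [Algebra R B'] [CommRing B] [Algebra S B] [Algebra R B]
  [IsScalarTower R S B] {ι' : N →ₗ[R] B'} {ι : M →ₗ[S] B} {γ : B' →ₐ[R] B}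

lemma lift_symMap (h : ∀ n, ι (j n) = γ (ι' n)) (z : SymmetricAlgebra R N) :
    SymmetricAlgebra.lift ι (symMap j z) = γ (SymmetricAlgebra.lift ι' z) := by
  have : ((SymmetricAlgebra.lift ι).restrictScalars R).comp (symMap j) =
      γ.comp (SymmetricAlgebra.lift ι') :=
    SymmetricAlgebra.algHom_ext (LinearMap.ext fun n => by simp [symMap_ι, h])
  exact congrArg (fun χ => χ z) this

/-- Symmetric algebras and base change along a free ring extension. -/
theorem isSymmetricAlgebra_iff_of_basis {κ : Type*} [Fintype κ] [Nonempty κ]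
    (b : Module.Basis κ R S) (hj : ∀ m, ∃! c : κ → N, m = ∑ i, b i • j (c i))
    (hγ : ∀ a, ∃! c : κ → B', a = ∑ i, b i • γ (c i)) (h : ∀ n, ι (j n) = γ (ι' n)) :
    IsSymmetricAlgebra ι ↔ IsSymmetricAlgebra ι' := by
  have hsym := (isBaseChange_iff_existsUnique (symMap (S := S) j).toLinearMap b).mp
    (isBaseChange_symMap j ((isBaseChange_iff_existsUnique j b).mpr hj))
  let E₁ (c : κ → SymmetricAlgebra R N) : SymmetricAlgebra S M := ∑ i, b i • symMap j (c i)
  let E₂ (c : κ → B') : B := ∑ i, b i • γ (c i)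
  have h₁ : Function.Bijective E₁ := (Function.bijective_iff_existsUnique _).mpr fun m => by
    simpa only [eq_comm] using! hsym m
  have h₂ : Function.Bijective E₂ := (Function.bijective_iff_existsUnique _).mpr fun a => by
    simpa only [eq_comm] using! hγ a
  -- In terms of coefficients the map over `S` is a product of copies of the map over `R`, indexed
  -- by `κ`; as `κ` is nonempty, it is bijective exactly when one copy is.
  have h₃ : SymmetricAlgebra.lift ι ∘ E₁ = E₂ ∘ Pi.map fun _ => SymmetricAlgebra.lift ι' := by
    funext c
    simp only [E₁, E₂, Function.comp_apply, map_sum, map_smul, lift_symMap j h, Pi.map_apply]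
  change Function.Bijective _ ↔ Function.Bijective _
  rw [← Function.Bijective.of_comp_iff _ h₁, h₃, Function.Bijective.of_comp_iff' h₂]
  constructor
  · intro H
    have i₀ := Classical.arbitrary κ
    refine ⟨fun z z' hz => congrFun (H.1 (funext fun i => hz) :
      (fun _ : κ => z) = fun _ => z') i₀, fun a => ?_⟩
    obtain ⟨c, hc⟩ := H.2 fun _ => a
    exact ⟨c i₀, congrFun hc i₀⟩
  · exact fun H => ⟨Function.Injective.piMap fun _ => H.1, Function.Surjective.piMap fun _ => H.2⟩

/-- Forming symmetric algebras commutes with inverting `r`. So an isomorphism after localization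
leaves only `r`-power torsion in the kernel and cokernel, which is the input of the next lemma. -/
lemma exists_pow_of_isSymmetricAlgebra {r : R} [IsLocalization.Away r S]
    [IsLocalizedModule (.powers r) j]
    (hγ : ∀ a, γ a = 0 → ∃ n : ℕ, r ^ n • a = 0) (h : ∀ n, ι (j n) = γ (ι' n))
    (hι : IsSymmetricAlgebra ι) :
    (∀ z, SymmetricAlgebra.lift ι' z = 0 → ∃ n : ℕ, r ^ n • z = 0) ∧
      ∀ a, ∃ (n : ℕ) (z : _), SymmetricAlgebra.lift ι' z = r ^ n • a := by
  have hl : IsLocalizedModule (.powers r) (symMap (S := S) j).toLinearMap :=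
    (isLocalizedModule_iff_isBaseChange (.powers r) S _).mpr
      (isBaseChange_symMap j ((isLocalizedModule_iff_isBaseChange (.powers r) S j).mp inferInstance))
  constructor
  · intro z hz
    have h1 : symMap (S := S) j z = 0 := hι.1 (by rw [lift_symMap j h, hz, map_zero, map_zero])
    obtain ⟨⟨_, n, rfl⟩, hn⟩ := (IsLocalizedModule.eq_zero_iff (.powers r)
      (symMap (S := S) j).toLinearMap).mp h1
    exact ⟨n, hn⟩
  · intro a
    obtain ⟨y, hy⟩ := hι.2 (γ a)
    obtain ⟨⟨z, ⟨_, n, rfl⟩⟩, hz⟩ := hl.surj y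
    have hz' : r ^ n • y = symMap (S := S) j z := hz
    have h2 : γ (SymmetricAlgebra.lift ι' z - r ^ n • a) = 0 := by
      rw [map_sub, ← lift_symMap j h, ← hz', algebra_compatible_smul S, map_smul,
        ← algebra_compatible_smul S, hy, map_smul, sub_self]
    obtain ⟨m, hm⟩ := hγ _ h2
    refine ⟨m + n, r ^ m • z, ?_⟩
    rw [map_smul, pow_add, mul_smul, ← sub_eq_zero, ← smul_sub, hm]

lemma isSymmetricAlgebra_of_span (s : Set R) (hs : Ideal.span s = ⊤)
    (h : ∀ r ∈ s, (∀ z, SymmetricAlgebra.lift ι' z = 0 → ∃ n : ℕ, r ^ n • z = 0) ∧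
      ∀ a, ∃ (n : ℕ) (z : _), SymmetricAlgebra.lift ι' z = r ^ n • a) :
    IsSymmetricAlgebra ι' := by
  constructor
  · refine (injective_iff_map_eq_zero _).mpr fun z hz => ?_
    exact (Submodule.mem_bot R).mp (Submodule.mem_of_span_eq_top_of_smul_pow_mem ⊥ s hs z
      fun r => (h r r.2).1 z hz)
  · intro a
    exact Submodule.mem_of_span_eq_top_of_smul_pow_mem
      (LinearMap.range (SymmetricAlgebra.lift ι').toLinearMap) s hs a fun r => by
        obtain ⟨n, z, hz⟩ := (h r r.2).2 a
        exact ⟨n, z, hz⟩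

end BaseChange

end

/-! ### Linear schemes under Frobenius pullback -/

noncomputable section
set_option linter.unusedSectionVars false

/-- A linear map from a module on `S` to the functions of an `S`-scheme. -/
structure LinearFunctions {X S : Scheme.{u}} (f : X ⟶ S) (M : S.Modules) where
  /-- the action on sections -/
  app : ∀ U : S.Opens, Γ(M, U) →+ Γ(X, f ⁻¹ᵁ U)
  app_smul : ∀ (U : S.Opens) (a : Γ(S, U)) (v : Γ(M, U)), app U (a • v) = f.app U a * app U v
  app_res : ∀ (U U' : S.Opens) (i : U' ≤ U) (v : Γ(M, U)),
    app U' (M.presheaf.map (homOfLE i).op v) =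
      X.presheaf.map (homOfLE (f.preimage_mono i)).op (app U v)

namespace LinearFunctions

section

variable {X S : Scheme.{u}} {f : X ⟶ S} {M : S.Modules} (L : LinearFunctions f M)

/-- The functions over `U` are the symmetric algebra. -/
def IsSymOn (U : S.Opens) : Prop :=
  letI : Algebra Γ(S, U) Γ(X, f ⁻¹ᵁ U) := (f.app U).hom.toAlgebra
  IsSymmetricAlgebra
    ({ toFun := L.app U
       map_add' := map_add (L.app U)
       map_smul' := L.app_smul U } : Γ(M, U) →ₗ[Γ(S, U)] Γ(X, f ⁻¹ᵁ U))

variable {L}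

/-- Sections of `M` localize by `hM`. As `f` is affine, a function vanishing over the basic open set
of `r` is killed by a power of `r`. So the torsion criterion above applies to each `r`. -/
theorem isSymOn_of_span [IsAffineHom f] {U : S.Opens} (hU : IsAffineOpen U)
    (hM : Modules.LocalizesOn M U) (s : Set Γ(S, U)) (hs : Ideal.span s = ⊤)
    (h : ∀ r ∈ s, L.IsSymOn (S.basicOpen r)) : L.IsSymOn U := by
  let algU : Algebra Γ(S, U) Γ(X, f ⁻¹ᵁ U) := (f.app U).hom.toAlgebra
  refine isSymmetricAlgebra_of_span s hs fun r hr => ?_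
  have i := S.basicOpen_le r
  let _ : Algebra Γ(S, U) Γ(S, S.basicOpen r) := (S.presheaf.map (homOfLE i).op).hom.toAlgebra
  have hloc : IsLocalization.Away r Γ(S, S.basicOpen r) := hU.isLocalization_basicOpen r
  let _ : Module Γ(S, U) Γ(M, S.basicOpen r) :=
    Module.compHom _ (algebraMap Γ(S, U) Γ(S, S.basicOpen r))
  have : IsScalarTower Γ(S, U) Γ(S, S.basicOpen r) Γ(M, S.basicOpen r) :=
    ⟨fun a b m => mul_smul (algebraMap Γ(S, U) Γ(S, S.basicOpen r) a) b m⟩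
  let algr : Algebra Γ(S, S.basicOpen r) Γ(X, f ⁻¹ᵁ S.basicOpen r) :=
    (f.app (S.basicOpen r)).hom.toAlgebra
  let _ : Algebra Γ(S, U) Γ(X, f ⁻¹ᵁ S.basicOpen r) :=
    ((algebraMap Γ(S, S.basicOpen r) Γ(X, f ⁻¹ᵁ S.basicOpen r)).comp
      (algebraMap Γ(S, U) Γ(S, S.basicOpen r))).toAlgebra
  have : IsScalarTower Γ(S, U) Γ(S, S.basicOpen r) Γ(X, f ⁻¹ᵁ S.basicOpen r) :=
    .of_algebraMap_eq fun _ => rfl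
  let j : Γ(M, U) →ₗ[Γ(S, U)] Γ(M, S.basicOpen r) :=
    { toFun := fun v => M.presheaf.map (homOfLE i).op v
      map_add' := map_add _
      map_smul' := fun a v => Scheme.Modules.map_smul M (homOfLE i) a v }
  let γ : Γ(X, f ⁻¹ᵁ U) →ₐ[Γ(S, U)] Γ(X, f ⁻¹ᵁ S.basicOpen r) :=
    { (X.presheaf.map (homOfLE (f.preimage_mono i)).op).hom with
      commutes' := fun a => (NonlinearCartier.app_res f i a).symm }
  have hj : IsLocalizedModule (.powers r) j := by
    refine ⟨?_, fun y => ?_, fun {x y} e => ?_⟩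
    · rintro ⟨_, n, rfl⟩
      have hu : IsUnit (algebraMap Γ(S, U) Γ(S, S.basicOpen r) (r ^ n)) := by
        rw [map_pow]
        exact (IsLocalization.Away.algebraMap_isUnit r).pow n
      refine (Module.End.isUnit_iff _).mpr ?_
      obtain ⟨u, hu⟩ := hu
      have e : ∀ v : Γ(M, S.basicOpen r), algebraMap Γ(S, U) (Module.End Γ(S, U) Γ(M, S.basicOpen r))
          (r ^ n) v = (u : Γ(S, S.basicOpen r)) • v := fun v => by rw [hu]; rfl
      exact (funext e : _ = fun v => (u : Γ(S, S.basicOpen r)) • v) ▸ MulAction.bijective u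
    · obtain ⟨n, t, ht⟩ := (hM r).1 y
      exact ⟨(t, ⟨_, n, rfl⟩), ht.symm⟩
    · obtain ⟨n, hn⟩ := (hM r).2 (x - y) (by
        rw [map_sub, sub_eq_zero]
        exact e)
      refine ⟨⟨_, n, rfl⟩, ?_⟩
      rw [smul_sub, sub_eq_zero] at hn
      exact hn
  refine exists_pow_of_isSymmetricAlgebra (S := Γ(S, S.basicOpen r)) j (r := r) (γ := γ) ?_
    (fun n => L.app_res _ _ i n) (h r hr)
  intro a ha
  have key : ∀ (B : X.Opens) (i : B ≤ f ⁻¹ᵁ U), B = X.basicOpen (f.app U r) →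
      X.presheaf.map (homOfLE i).op a = 0 → ∃ n : ℕ, (f.app U r) ^ n * a = 0 := by
    rintro _ i rfl hB
    exact exists_pow_mul_eq_zero_of_res_basicOpen_eq_zero_of_isAffineOpen X (hU.preimage f) a _ hB
  obtain ⟨n, hn⟩ := key _ (f.preimage_mono i) (Scheme.preimage_basicOpen f r) ha
  exact ⟨n, by rw [Algebra.smul_def, map_pow]; exact hn⟩

theorem isSymOn_of_locally [IsAffineHom f] {U : S.Opens} (hU : IsAffineOpen U)
    (hM : Modules.LocalizesOn M U)
    (h : ∀ y ∈ U, ∃ W : S.Opens, y ∈ W ∧ ∀ V ≤ W, V ≤ U → IsAffineOpen V → L.IsSymOn V) :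
    L.IsSymOn U := by
  refine isSymOn_of_span hU hM {r | L.IsSymOn (S.basicOpen r)} ?_ fun r hr => hr
  refine (hU.iSup_basicOpen_eq_self_iff).mp (le_antisymm ?_ fun y hy => ?_)
  · exact iSup_le fun r => S.basicOpen_le _
  · obtain ⟨W, hyW, hW⟩ := h y hy
    obtain ⟨r, hr, hyr⟩ := hU.exists_basicOpen_le ⟨y, hyW⟩ hy
    exact TopologicalSpace.Opens.mem_iSup.mpr
      ⟨⟨r, hW _ hr (S.basicOpen_le r) (hU.basicOpen r)⟩, hyr⟩

end

section Frobenius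

variable {k : Type u} [CommRing k] {p : ℕ} [Fact p.Prime] [CharP k p] {S : Scheme.{u}}
  {s : S ⟶ Spec (.of k)} [Smooth s] {X Y : Scheme.{u}} {f : X ⟶ S} {q : X ⟶ Y}
  {g : Y ⟶ frobTwist p s} (H : IsPullback f q (relFrob p s) g) {M : S.Modules}
  {N' : (frobTwist p s).Modules} {j : N' ⟶ (Scheme.Modules.pushforward (relFrob p s)).obj M}
  (hj : IsFrobPullback j) {L : LinearFunctions f M} {L' : LinearFunctions g N'}

include H in
lemma preimage_preimage (U : (frobTwist p s).Opens) :
    f ⁻¹ᵁ relFrob p s ⁻¹ᵁ U = q ⁻¹ᵁ g ⁻¹ᵁ U := by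
  rw [← Scheme.Hom.comp_preimage, ← Scheme.Hom.comp_preimage, H.w]

include H in
lemma appLE_structure (U : (frobTwist p s).Opens) (a : Γ(frobTwist p s, U)) :
    q.appLE (g ⁻¹ᵁ U) (f ⁻¹ᵁ relFrob p s ⁻¹ᵁ U) (preimage_preimage H U).le (g.app U a) =
      f.app (relFrob p s ⁻¹ᵁ U) ((relFrob p s).app U a) := by
  have e : f ⁻¹ᵁ relFrob p s ⁻¹ᵁ U ≤ (f ≫ relFrob p s) ⁻¹ᵁ U := le_rfl
  refine (appLE_app H.w.symm (preimage_preimage H U).le e a).trans ?_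
  refine (appLE_app rfl le_rfl e a).symm.trans ?_
  rw [Scheme.Hom.appLE_eq_app]

variable (hL : ∀ (U : (frobTwist p s).Opens) (n : Γ(N', U)),
    q.appLE (g ⁻¹ᵁ U) (f ⁻¹ᵁ relFrob p s ⁻¹ᵁ U) (preimage_preimage H U).le (L'.app U n) =
      L.app (relFrob p s ⁻¹ᵁ U) (Modules.pushApp j U n))

include hj hL in
theorem isSymOn_iff {V : S.Opens} (C : Coordinates p s V) {U : (frobTwist p s).Opens}
    (h : relFrob p s ⁻¹ᵁ U ≤ V) : L.IsSymOn (relFrob p s ⁻¹ᵁ U) ↔ L'.IsSymOn U := by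
  let W := relFrob p s ⁻¹ᵁ U
  let _ : Algebra Γ(frobTwist p s, U) Γ(S, W) := ((relFrob p s).app U).hom.toAlgebra
  let _ : Module Γ(frobTwist p s, U) Γ(M, W) :=
    Module.compHom _ (algebraMap Γ(frobTwist p s, U) Γ(S, W))
  have : IsScalarTower Γ(frobTwist p s, U) Γ(S, W) Γ(M, W) :=
    ⟨fun a b m => mul_smul (algebraMap Γ(frobTwist p s, U) Γ(S, W) a) b m⟩
  let _ : Algebra Γ(S, W) Γ(X, f ⁻¹ᵁ W) := (f.app W).hom.toAlgebra
  let _ : Algebra Γ(frobTwist p s, U) Γ(Y, g ⁻¹ᵁ U) := (g.app U).hom.toAlgebra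
  let _ : Algebra Γ(frobTwist p s, U) Γ(X, f ⁻¹ᵁ W) :=
    ((algebraMap Γ(S, W) Γ(X, f ⁻¹ᵁ W)).comp (algebraMap Γ(frobTwist p s, U) Γ(S, W))).toAlgebra
  have : IsScalarTower Γ(frobTwist p s, U) Γ(S, W) Γ(X, f ⁻¹ᵁ W) := .of_algebraMap_eq fun _ => rfl
  let jl : Γ(N', U) →ₗ[Γ(frobTwist p s, U)] Γ(M, W) :=
    { toFun := Modules.pushApp j U
      map_add' := map_add _
      map_smul' := Modules.pushApp_smul j }
  let γ : Γ(Y, g ⁻¹ᵁ U) →ₐ[Γ(frobTwist p s, U)] Γ(X, f ⁻¹ᵁ W) :=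
    { (q.appLE (g ⁻¹ᵁ U) (f ⁻¹ᵁ W) (preimage_preimage H U).le).hom with
      commutes' := appLE_structure H U }
  have hb := fun a => C.existsUnique_expansion h a
  let φ : ((Fin C.n → Fin p) → Γ(frobTwist p s, U)) →ₗ[Γ(frobTwist p s, U)] Γ(S, W) :=
    Fintype.linearCombination _ fun I => S.presheaf.map (homOfLE h).op (monom C.x I)
  have hφ : ∀ c, φ c = ∑ I, S.presheaf.map (homOfLE h).op (monom C.x I) *
      (relFrob p s).app U (c I) := fun c =>
    Finset.sum_congr rfl fun I _ => (Algebra.smul_def _ _).trans (mul_comm _ _)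
  -- The monomials are a basis of `𝒪_S` over `𝒪_{S'}`, and with the same monomials both `M` over
  -- `N'` and `𝒪_X` over `𝒪_Y` have unique expansions.
  let b : Module.Basis (Fin C.n → Fin p) Γ(frobTwist p s, U) Γ(S, W) :=
    .ofEquivFun (LinearEquiv.ofBijective φ ((Function.bijective_iff_existsUnique _).mpr fun a => by
      simpa only [hφ, eq_comm] using! hb a)).symm
  have hbI : ∀ I, b I = S.presheaf.map (homOfLE h).op (monom C.x I) := fun I => by
    classical
    simp [b, φ, Module.Basis.coe_ofEquivFun, Fintype.linearCombination_apply_single]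
  have : Nonempty (Fin C.n → Fin p) := ⟨C.zeroIndex⟩
  refine isSymmetricAlgebra_iff_of_basis jl (γ := γ) b (fun m => ?_) (fun a => ?_)
    fun n => (hL U n).symm
  · simpa only [hbI] using! hj C U h m
  · have hm := monomialBasis_of_eq H C (f ⁻¹ᵁ W) (g ⁻¹ᵁ U) (f.preimage_mono h)
      (preimage_preimage H U) a
    have e : ∀ c : (Fin C.n → Fin p) → Γ(Y, g ⁻¹ᵁ U), ∑ I, b I • γ (c I) =
        ∑ I, f.appLE V (f ⁻¹ᵁ W) (f.preimage_mono h) (monom C.x I) *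
          q.appLE (g ⁻¹ᵁ U) (f ⁻¹ᵁ W) (preimage_preimage H U).le (c I) := fun c =>
      Finset.sum_congr rfl fun I _ => by
        rw [Algebra.smul_def, hbI]
        refine congrArg (· * γ (c I)) (?_ : f.app W _ = _)
        rw [Scheme.Hom.app_eq_appLE, res_appLE]
    simpa only [e] using! hm

end Frobenius

end LinearFunctions

end

/-! ### Affineness and quasi-coherence under Frobenius pullback -/

noncomputable section
set_option linter.unusedSectionVars false

/-- The trivial square-zero extension of `R` by `M` receives an algebra map whose restriction to `M`
is the inclusion. -/
lemma injective_of_isSymmetricAlgebra {R M A : Type*} [CommRing R] [AddCommGroup M] [Module R M]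
    [CommRing A] [Algebra R A] {φ : M →ₗ[R] A} (h : IsSymmetricAlgebra φ) :
    Function.Injective φ := by
  let _ : Module Rᵐᵒᵖ M := Module.compHom _ ((RingHom.id R).fromOpposite mul_comm)
  have : IsCentralScalar R M := ⟨fun r m => rfl⟩
  have e : (h.lift (TrivSqZeroExt.inrHom R M)).toLinearMap ∘ₗ φ = TrivSqZeroExt.inrHom R M :=
    IsSymmetricAlgebra.lift_comp_linearMap _ _
  refine Function.Injective.of_comp (f := h.lift (TrivSqZeroExt.inrHom R M)) fun v w hvw => ?_
  have e' := fun v => LinearMap.congr_fun e v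
  exact TrivSqZeroExt.inr_injective (((e' v).symm.trans hvw).trans (e' w))

namespace IsFlatQuotient

variable {k : Type u} [CommRing k] {S X Y Y' : Scheme.{u}} {s : S ⟶ Spec (.of k)} [Smooth s]
  {f : X ⟶ S} {c : LambdaConnection s 1 f} {q : X ⟶ Y} {q' : X ⟶ Y'}

lemma exists_iso (h : IsFlatQuotient c q) (h' : IsFlatQuotient c q') :
    ∃ i : Y ≅ Y', q ≫ i.hom = q' := by
  obtain ⟨a, ha⟩ := h.exists_desc q' h'.isFlat
  obtain ⟨b, hb⟩ := h'.exists_desc q h.isFlat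
  exact ⟨⟨a, b, h.hom_ext (by rw [reassoc_of% ha, hb, Category.comp_id]),
    h'.hom_ext (by rw [reassoc_of% hb, ha, Category.comp_id])⟩, ha⟩

/-- A flat quotient is unique up to isomorphism, and for the glued one the open sets lying over
affine open sets of `X` are affine by construction. -/
lemma isAffineOpen (p : ℕ) [Fact p.Prime] [CharP k p] (h : IsFlatQuotient c q) {W : Y.Opens}
    (hW : IsAffineOpen (q ⁻¹ᵁ W)) : IsAffineOpen W := by
  have hc := c.isFlatQuotient_quotientMk (p := p)
  obtain ⟨i, hi⟩ := hc.exists_iso h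
  have e : i.hom ⁻¹ᵁ W = c.quotientFrob p ⁻¹ᵁ (q ⁻¹ᵁ W) := by
    ext y
    obtain ⟨x, rfl⟩ := hc.isHomeomorph.surjective y
    change i.hom (c.quotientMk p x) ∈ W ↔ q (c.quotientFrob p (c.quotientMk p x)) ∈ W
    rw [c.quotientFrob_quotientMk, ← hi]
    rfl
  have h1 : IsAffineOpen (i.hom ⁻¹ᵁ W) := e ▸ c.isAffineOpen_quotientFrob (p := p) ⟨_, hW⟩
  have h2 := h1.preimage i.inv
  rwa [← Scheme.Hom.comp_preimage, i.inv_hom_id] at h2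

end IsFlatQuotient

namespace LinearFunctions

variable {k : Type u} [CommRing k] {p : ℕ} [Fact p.Prime] [CharP k p] {S : Scheme.{u}}
  {s : S ⟶ Spec (.of k)} [Smooth s] {X Y : Scheme.{u}} {f : X ⟶ S} {q : X ⟶ Y}
  {g : Y ⟶ frobTwist p s} (H : IsPullback f q (relFrob p s) g)

include H in
lemma isAffineHom_left [IsAffineHom g] : IsAffineHom f :=
  MorphismProperty.of_isPullback (P := @IsAffineHom) H.flip inferInstance

include H in
lemma isAffineHom_right {c : LambdaConnection s 1 f} (h : IsFlatQuotient c q) [IsAffineHom f] :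
    IsAffineHom g :=
  ⟨fun U hU => h.isAffineOpen p (preimage_preimage H U ▸ (hU.preimage (relFrob p s)).preimage f)⟩

variable {M : S.Modules} {N' : (frobTwist p s).Modules}
  {j : N' ⟶ (Scheme.Modules.pushforward (relFrob p s)).obj M}
  (hj : IsFrobPullback j) {L : LinearFunctions f M} {L' : LinearFunctions g N'}
  (hL : ∀ (U : (frobTwist p s).Opens) (n : Γ(N', U)),
    q.appLE (g ⁻¹ᵁ U) (f ⁻¹ᵁ relFrob p s ⁻¹ᵁ U) (preimage_preimage H U).le (L'.app U n) =
      L.app (relFrob p s ⁻¹ᵁ U) (Modules.pushApp j U n))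

-- The comparison `isSymOn_iff` is available only inside charts. Quasi-coherence makes the property
-- local on each side, so affine open sets within charts suffice.
include hj hL in
theorem isSymOn_affine_iff [IsAffineHom f] [IsAffineHom g]
    (hM : SheafOfModules.IsQuasicoherent (R := S.ringCatSheaf) M)
    (hN' : SheafOfModules.IsQuasicoherent (R := (frobTwist p s).ringCatSheaf) N') :
    (∀ U, IsAffineOpen U → L.IsSymOn U) ↔ ∀ U, IsAffineOpen U → L'.IsSymOn U := by
  refine ⟨fun h U hU => ?_, fun h U hU => ?_⟩
  · refine isSymOn_of_locally hU (Modules.localizesOn_of_isQuasicoherent hN' hU) fun y _ => ?_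
    obtain ⟨z, rfl⟩ := (relFrob p s).surjective y
    obtain ⟨V, -, hz, ⟨C⟩⟩ := exists_coordinates_nhds p s (U := ⊤) (y := z) trivial
    refine ⟨twist p s V, ?_, fun V' hV' _ hV'' => ?_⟩
    · exact (relFrob_preimage_twist p s V).ge hz
    · exact (isSymOn_iff H hj hL C (((relFrob p s).preimage_mono hV').trans
        (relFrob_preimage_twist p s V).le)).mp (h _ (hV''.preimage _))
  · refine isSymOn_of_locally hU (Modules.localizesOn_of_isQuasicoherent hM hU) fun y _ => ?_
    obtain ⟨V, -, hy, ⟨C⟩⟩ := exists_coordinates_nhds p s (U := ⊤) (y := y) trivial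
    refine ⟨V, hy, fun V' hV' _ hV'' => ?_⟩
    have e := relFrob_preimage_twist p s V'
    exact e ▸ (isSymOn_iff H hj hL C (e.le.trans hV')).mpr (h _ (isAffineOpen_twist p s hV''))

end LinearFunctions

end

/-! ### Linear functions and Frobenius descent -/

noncomputable section
set_option linter.unusedSectionVars false

lemma LambdaConnection.act_mul_app {k : Type u} [CommRing k] {S X : Scheme.{u}}
    {s : S ⟶ Spec (.of k)} {lam : k} {f : X ⟶ S} (c : LambdaConnection s lam f) (U : S.Opens)
    (D : VectorField s U) (a : Γ(S, U)) (v : Γ(X, f ⁻¹ᵁ U)) :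
    (c.nabla U D).act (f ⁻¹ᵁ U) le_rfl (f.app U a * v) =
      f.app U (const s U lam * D.act U le_rfl a) * v +
        f.app U a * (c.nabla U D).act (f ⁻¹ᵁ U) le_rfl v := by
  rw [Derivation.leibniz, c.symbol U U le_rfl D a, map_mul, smul_eq_mul, smul_eq_mul, add_comm,
    mul_comm v, Scheme.Hom.app_eq_appLE, appLE_const rfl]

/-- The functions of an `S`-scheme with `λ`-connection, as a module with `λ`-connection. -/
def LambdaConnection.functions {k : Type u} [CommRing k] {S X : Scheme.{u}}
    {s : S ⟶ Spec (.of k)} {lam : k} {f : X ⟶ S} (c : LambdaConnection s lam f) :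
    LambdaModule s lam where
  M := (ModuleData.ofHom f).toModules
  nabla U D := (((ModuleData.ofHom f).equiv U).toAddMonoidHom.comp
    ((c.nabla U D).act (f ⁻¹ᵁ U) le_rfl).toLinearMap.toAddMonoidHom).comp
      ((ModuleData.ofHom f).equiv U).symm.toAddMonoidHom
  nabla_add U D E v := by rw [c.nabla_add]; rfl
  nabla_smul U a D v := by
    rw [c.nabla_smul]
    change (X.presheaf.map (homOfLE le_rfl).op (f.app U a)) * _ = f.app U a * _
    rw [NonlinearCartier.res_self]
    rfl
  leibniz U D a v := c.act_mul_app U D a v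
  nabla_res U U' i D v := by
    rw [c.nabla_res]
    exact (c.nabla U D).act_res _ _ le_rfl (f.preimage_mono i) (v : Γ(X, f ⁻¹ᵁ U))

namespace LinearModel

section

variable {k : Type u} [CommRing k] {S : Scheme.{u}} {s : S ⟶ Spec (.of k)} {lam : k}
  {N : LambdaModule s lam} {P : LambdaScheme s lam} (m : LinearModel N P)

/-- The underlying map from the module to the functions. -/
def linearFunctions : LinearFunctions P.X.hom N.M := ⟨m.ι, m.ι_smul, m.ι_res⟩

lemma injective {U : S.Opens} (hU : IsAffineOpen U) : Function.Injective (m.ι U) :=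
  letI : Algebra Γ(S, U) Γ(P.X.left, P.X.hom ⁻¹ᵁ U) := (P.X.hom.app U).hom.toAlgebra
  injective_of_isSymmetricAlgebra (m.isSymmetricAlgebra U hU)

lemma isFlat_ι {U : S.Opens} {v : Γ(N.M, U)} (hv : N.IsFlat U v) :
    P.conn.IsFlat (P.X.hom ⁻¹ᵁ U) (m.ι U v) := fun V D W hV hU => by
  have hW : W ≤ P.X.hom ⁻¹ᵁ (V ⊓ U) := le_inf hV hU
  have h1 : P.X.left.presheaf.map (homOfLE hU).op (m.ι U v) =
      P.X.left.presheaf.map (homOfLE hW).op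
        (m.ι (V ⊓ U) (N.M.presheaf.map (homOfLE inf_le_right).op v)) := by
    rw [m.ι_res, res_res]
  have h2 := (P.conn.nabla (V ⊓ U) (D.res inf_le_left)).act_res _ W le_rfl hW
    (m.ι (V ⊓ U) (N.M.presheaf.map (homOfLE inf_le_right).op v))
  rw [m.horizontal, hv, map_zero, map_zero, P.conn.nabla_res] at h2
  rw [h1]
  exact h2

-- Over affine open sets `M` embeds horizontally in the functions of `P`. Linear objects are only
-- required to have an integrable module, so this is what brings them into Cartier's theorem.
include m in
lemma pCurvatureZero {p : ℕ} [Fact p.Prime] [CharP k p] (h : P.conn.PCurvatureZero p) :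
    N.PCurvatureZero p := fun U D v => by
  refine Modules.eq_of_locally _ _ fun y hy => ?_
  obtain ⟨W, hW, hyW, i⟩ := exists_affine_le (U := U) hy
  refine ⟨W, i, hyW, m.injective hW ?_⟩
  have e1 : N.M.presheaf.map (homOfLE i).op ((N.nabla U D)^[p] v) =
      (N.nabla W (D.res i))^[p] (N.M.presheaf.map (homOfLE i).op v) :=
    (Function.Semiconj.iterate_right (f := fun v => N.M.presheaf.map (homOfLE i).op v)
      (fun v => (N.nabla_res U W i D v).symm) p).eq v
  have e2 : ∀ w, m.ι W ((N.nabla W (D.res i))^[p] w) =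
      ((P.conn.nabla W (D.res i)).pPow p).act _ le_rfl (m.ι W w) := fun w =>
    (Function.Semiconj.iterate_right (f := fun w => m.ι W w)
      (fun w => (m.horizontal W (D.res i) w).symm) p).eq w
  rw [e1, e2, h, m.horizontal, ← N.nabla_res]
  rfl

end

end LinearModel

namespace LinearFunctions

variable {k : Type u} [CommRing k] {p : ℕ} [Fact p.Prime] [CharP k p] {S : Scheme.{u}}
  {s : S ⟶ Spec (.of k)} [Smooth s] {X Y : Scheme.{u}} {f : X ⟶ S} {q : X ⟶ Y}
  {g : Y ⟶ frobTwist p s} (H : IsPullback f q (relFrob p s) g) {M : S.Modules}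
  {N' : (frobTwist p s).Modules} {j : N' ⟶ (Scheme.Modules.pushforward (relFrob p s)).obj M}
  {c : LambdaConnection s 1 f}

/-- Linear functions with flat values on `N'` descend. -/
theorem exists_descent (hq : IsFlatQuotient c q) (L : LinearFunctions f M)
    (hL : ∀ U n, c.IsFlat _ (L.app (relFrob p s ⁻¹ᵁ U) (Modules.pushApp j U n))) :
    ∃ L' : LinearFunctions g N', ∀ (U : (frobTwist p s).Opens) (n : Γ(N', U)),
      q.appLE (g ⁻¹ᵁ U) (f ⁻¹ᵁ relFrob p s ⁻¹ᵁ U) (preimage_preimage H U).le (L'.app U n) =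
        L.app (relFrob p s ⁻¹ᵁ U) (Modules.pushApp j U n) := by
  choose φ hφ using fun U n => hq.exists_appLE_eq (preimage_preimage H U) (hL U n)
  have inj := fun U => hq.injective_appLE (preimage_preimage H U)
  let ψ (U : (frobTwist p s).Opens) : Γ(N', U) →+ Γ(Y, g ⁻¹ᵁ U) :=
    AddMonoidHom.mk' (φ U) fun v w => inj U (by rw [map_add, hφ, hφ, hφ, map_add, map_add])
  have hψ : ∀ U n, q.appLE (g ⁻¹ᵁ U) (f ⁻¹ᵁ relFrob p s ⁻¹ᵁ U) (preimage_preimage H U).le (ψ U n) =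
      L.app (relFrob p s ⁻¹ᵁ U) (Modules.pushApp j U n) := hφ
  refine ⟨⟨ψ, fun U a v => inj U ?_, fun U W i v => inj W ?_⟩, hψ⟩
  · rw [map_mul, hψ, hψ, appLE_structure H, Modules.pushApp_smul, L.app_smul]
  · rw [hψ, Modules.pushApp_res, L.app_res, ← hψ, appLE_res, res_appLE]

/-- Linear functions extend to the Frobenius pullback. -/
theorem exists_extension (hj : IsFrobPullback j) (L' : LinearFunctions g N') :
    ∃ L : LinearFunctions f M, (∀ (U : (frobTwist p s).Opens) (n : Γ(N', U)),
      q.appLE (g ⁻¹ᵁ U) (f ⁻¹ᵁ relFrob p s ⁻¹ᵁ U) (preimage_preimage H U).le (L'.app U n) =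
        L.app (relFrob p s ⁻¹ᵁ U) (Modules.pushApp j U n)) ∧
      ∃ φ : M ⟶ (ModuleData.ofHom f).toModules, ∀ U v,
        φ.app U v = (ModuleData.ofHom f).equiv U (L.app U v) := by
  let d := ModuleData.ofHom f
  let t : N' ⟶ (Scheme.Modules.pushforward (relFrob p s)).obj d.toModules :=
    Modules.mkHom (fun U => (d.equiv (relFrob p s ⁻¹ᵁ U)).toAddMonoidHom.comp
        -- Functions of `X` are regarded as a module over `𝒪_S`, so that linear functions on `Y`,
        -- pulled back to `X`, extend along `j` by the universal property of the Frobenius pullback.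
        ((q.appLE (g ⁻¹ᵁ U) (f ⁻¹ᵁ relFrob p s ⁻¹ᵁ U)
          (preimage_preimage H U).le).hom.toAddMonoidHom.comp (L'.app U)))
      (fun U a n => by
        change q.appLE (g ⁻¹ᵁ U) _ (preimage_preimage H U).le (L'.app U (a • n)) =
          f.app (relFrob p s ⁻¹ᵁ U) ((relFrob p s).app U a) *
            q.appLE (g ⁻¹ᵁ U) _ (preimage_preimage H U).le (L'.app U n)
        rw [L'.app_smul, map_mul, appLE_structure H])
      (fun U W i n => by
        change q.appLE (g ⁻¹ᵁ W) _ (preimage_preimage H W).le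
          (L'.app W (N'.presheaf.map (homOfLE i).op n)) =
          X.presheaf.map (homOfLE (f.preimage_mono ((relFrob p s).preimage_mono i))).op
            (q.appLE (g ⁻¹ᵁ U) _ (preimage_preimage H U).le (L'.app U n))
        rw [L'.app_res, res_appLE, appLE_res])
  refine ⟨⟨fun U => (d.equiv U).symm.toAddMonoidHom.comp ((hj.desc t).app U).hom,
    fun U a v => (hj.desc t).app_smul a v, fun U W i v => Modules.hom_res (hj.desc t) i v⟩,
    fun U n => ?_, hj.desc t, fun U v => rfl⟩
  exact (hj.desc_pushApp t n).symm

end LinearFunctions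

end

/-! ### Cartier descent for linear objects -/

noncomputable section
set_option linter.unusedSectionVars false

/-- A morphism is the linear scheme of a quasi-coherent module of finite type. -/
def IsLinearHom {Y T : Scheme.{u}} (g : Y ⟶ T) : Prop :=
  IsAffineHom g ∧ ∃ (N : T.Modules) (L : LinearFunctions g N),
    (SheafOfModules.IsQuasicoherent (R := T.ringCatSheaf) N ∧
      SheafOfModules.IsFiniteType.{u} (R := T.ringCatSheaf) N) ∧
    ∀ U, IsAffineOpen U → L.IsSymOn U

section ZeroConnection

variable {k : Type u} [CommRing k] {T : Scheme.{u}} {t : T ⟶ Spec (.of k)} {Y : LambdaScheme t 0}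

/-- Linear functions on a scheme with zero connection are horizontal. -/
def LinearModel.ofIsZero (h : Y.conn.IsZero) {N : LambdaModule t 0} (hN : N.IsZero)
    (hY : IsAffineHom Y.X.hom) (L : LinearFunctions Y.X.hom N.M)
    (hL : ∀ U, IsAffineOpen U → L.IsSymOn U) : LinearModel N Y where
  affine := hY
  ι := L.app
  ι_smul := L.app_smul
  ι_res := L.app_res
  isSymmetricAlgebra := hL
  horizontal U D v := by
    rw [h, hN, map_zero]
    rfl

lemma LambdaScheme.isLinear_iff (h : Y.conn.IsZero) : Y.IsLinear ↔ IsLinearHom Y.X.hom := by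
  refine ⟨fun ⟨N, hN, _, ⟨m⟩⟩ => ⟨m.affine, N.M, m.linearFunctions, hN, m.isSymmetricAlgebra⟩,
    fun ⟨hY, N, L, hN, hL⟩ => ⟨.ofModule t N, hN, LambdaModule.integrable_ofModule N,
      ⟨.ofIsZero h (LambdaModule.isZero_ofModule N) hY L hL⟩⟩⟩

end ZeroConnection

section Descent

variable {k : Type u} [CommRing k] {p : ℕ} [Fact p.Prime] [CharP k p] {S : Scheme.{u}}
  {s : S ⟶ Spec (.of k)} [Smooth s] {P : LambdaScheme s 1} {Y : Scheme.{u}} {q : P.X.left ⟶ Y}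
  {g : Y ⟶ frobTwist p s} (H : IsPullback P.X.hom q (relFrob p s) g)
  (hq : IsFlatQuotient P.conn q)

include hq in
theorem LinearModel.exists_descent {N : LambdaModule s 1} (hN : N.Coherent) (hi : N.Integrable)
    (hp : N.PCurvatureZero p) (m : LinearModel N P) : IsAffineHom g ∧
    ∃ L : LinearFunctions g (N.flatModule p), (∀ (U : (frobTwist p s).Opens) (n : _),
      q.appLE (g ⁻¹ᵁ U) (P.X.hom ⁻¹ᵁ relFrob p s ⁻¹ᵁ U)
        (LinearFunctions.preimage_preimage H U).le (L.app U n) =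
        m.ι (relFrob p s ⁻¹ᵁ U) (Modules.pushApp (N.flatι p) U n)) ∧
      ∀ U, IsAffineOpen U → L.IsSymOn U := by
  have hj : IsFrobPullback (N.flatι p) := N.isFlatModel_flatι.isFrobPullback hi hp
  have := m.affine
  have hg := LinearFunctions.isAffineHom_right H hq
  obtain ⟨L, hL⟩ := LinearFunctions.exists_descent H (j := N.flatι p) hq m.linearFunctions
    fun U n => m.isFlat_ι (n : N.flatSections p U).2
  exact ⟨hg, L, hL, (LinearFunctions.isSymOn_affine_iff H hj hL hN.1
    (hj.coherent_of_coherent hN.1 hN.2).1).mp m.isSymmetricAlgebra⟩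

-- The pullback of the module of linear functions, with its canonical connection, is the required
-- module. Its inclusion into the functions of `P` is horizontal because both connections kill the
-- sections coming from `S'`.
include H hq in
theorem isLinear_of_isLinearHom (h : IsLinearHom g) : P.IsLinear := by
  obtain ⟨hg, N', L', hN', hL'⟩ := h
  have hj := FrobPullback.isFrobPullback_ι N'
  have hf := LinearFunctions.isAffineHom_left H
  have hN := hj.coherent hN'.1 hN'.2
  obtain ⟨L, hL, φ, hφ⟩ := LinearFunctions.exists_extension H hj L'
  let φ₂ : (FrobPullback.lambdaModule N').M ⟶ P.conn.functions.M := φ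
  have hφ₂ : ∀ U v, φ₂.app U v = (ModuleData.ofHom P.X.hom).equiv U (L.app U v) := hφ
  have hor := hj.horizontal φ₂ (fun U n => FrobPullback.nabla_ι N' n) fun U n => by
      rw [hφ₂, ← hL]
      exact fun W i D => hq.isFlat_appLE _ (L'.app U n) W D _ le_rfl (P.X.hom.preimage_mono i)
  refine ⟨FrobPullback.lambdaModule N', hN, FrobPullback.integrable N', ⟨⟨hf, L.app, L.app_smul,
    L.app_res, (LinearFunctions.isSymOn_affine_iff H hj hL hN.1 hN'.1).mpr hL', ?_⟩⟩⟩
  intro U D v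
  have h1 := hor U D v
  rw [hφ₂, hφ₂] at h1
  exact h1.symm

include H hq in
theorem isLinear_iff_isLinearHom (hp : P.conn.PCurvatureZero p) :
    P.IsLinear ↔ IsLinearHom g := by
  refine ⟨fun ⟨N, hN, hi, ⟨m⟩⟩ => ?_, isLinear_of_isLinearHom H hq⟩
  have hp' := m.pCurvatureZero hp
  obtain ⟨hg, L, -, hL⟩ := m.exists_descent H hq hN hi hp'
  exact ⟨hg, _, L, (N.isFlatModel_flatι.isFrobPullback hi hp').coherent_of_coherent hN.1 hN.2, hL⟩

end Descent

section Cartier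

variable {k : Type u} [CommRing k] (p : ℕ) [Fact p.Prime] [CharP k p] {S : Scheme.{u}}
  (s : S ⟶ Spec (.of k)) [Smooth s]

theorem restrictsTo_isLinear :
    RestrictsTo (cartier p s) (fun P => P.obj.IsLinear) (fun Y => Y.obj.IsLinear) := by
  have e : ∀ Y : NHIG₀ (frobTwistStr p s), Y.obj.IsLinear ↔ IsLinearHom Y.obj.X.hom :=
    fun Y => LambdaScheme.isLinear_iff Y.property.2.2
  have h := isPullback_frobProj p s
  have hq := isFlatQuotient_frobProj p s
  refine restrictsTo_of_iff _ (fun P => (isLinear_iff_isLinearHom (isPullback_descentMap p s P)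
    (isFlatQuotient_descentMap p s P) P.property.2.2).trans (e _).symm) fun Y Y' i hY => ?_
  -- Invariance under isomorphism: the Frobenius pullback of `Y`, projected further to `Y'`, is also
  -- a Frobenius pullback and flat quotient over `Y'`.
  refine (e Y').mpr ((isLinear_iff_isLinearHom (P := ((frobPullback p s).obj Y).obj)
    (q := frobProj p s Y ≫ (NHIG₀.overIso i).hom.left) ?_ ?_
    ((frobPullback p s).obj Y).property.2.2).mp (isLinear_of_isLinearHom (h Y) (hq Y) ((e Y).mp hY)))
  · exact (h Y).of_iso (Iso.refl _) (Iso.refl _) ((Over.forget _).mapIso (NHIG₀.overIso i))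
      (Iso.refl _) (by simp) (by simp) (by simp) (by simp)
  · refine LambdaConnection.isFlatQuotient_of_isFlat (g := Y'.obj.X.hom) ?_ _ fun W b =>
      (hq Y).isFlat _ ((NHIG₀.overIso i).hom.left.app W b)
    exact (h Y).of_iso (Iso.refl _) (Iso.refl _) ((Over.forget _).mapIso (NHIG₀.overIso i))
      (Iso.refl _) (by simp) (by simp) (by simp) (by simp)

theorem exists_linearModel_cartier (N : MIC₀ p s) (P : NMIC₀ p s) (m : LinearModel N.obj P.obj) :
    ∃ m' : LinearModel ((flatFunctor p s).obj N).obj ((cartier p s).functor.obj P).obj,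
      ∀ (U : (frobTwist p s).Opens) (v : Γ(((flatFunctor p s).obj N).obj.M, U)),
        (descentMap (cartierInverseIso p s) P).appLE
          (((cartier p s).functor.obj P).obj.X.hom ⁻¹ᵁ U)
          (P.obj.X.hom ⁻¹ᵁ relFrob p s ⁻¹ᵁ U) (descentMap_le (cartierInverseIso p s) P U)
            (m'.ι U v) =
          m.ι (relFrob p s ⁻¹ᵁ U) (((flatFunctorι p s).app N).app U v) := by
  obtain ⟨hg, L, hL, hL'⟩ := m.exists_descent (isPullback_descentMap p s P)
    (isFlatQuotient_descentMap p s P) N.property.1 N.property.2.1 N.property.2.2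
  exact ⟨.ofIsZero (N := ((flatFunctor p s).obj N).obj)
    ((cartier p s).functor.obj P).property.2.2 ((flatFunctor p s).obj N).property.2.2 hg L hL', hL⟩

end Cartier

end
end NonlinearCartier

theorem theorem1p4 {k : Type u} [CommRing k] (p : ℕ) [Fact p.Prime] [CharP k p]
    {S : Scheme.{u}} (s : S ⟶ Spec (.of k)) [Smooth s] :
    ∃ (e : NMIC₀ p s ≌ NHIG₀ (frobTwistStr p s))
      (α : e.inverse ⋙ NMIC₀.toOver p s ≅
        NHIG₀.toOver (frobTwistStr p s) ⋙ Over.pullback (relFrob p s)),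
      -- `e.inverse` is Frobenius pullback, with the connection killing the functions of `Y`
      (∀ (Y : NHIG₀ (frobTwistStr p s)) (W : Y.obj.X.left.Opens) (a : Γ(Y.obj.X.left, W)),
        (e.inverse.obj Y).obj.conn.IsFlat (proj α Y ⁻¹ᵁ W) ((proj α Y).app W a)) ∧
      -- `e.functor` sends `(X, ∇)` to the space of `X` with the sheaf of flat functions
      (∀ P : NMIC₀ p s, IsHomeomorph (descentMap α P) ∧
        ∀ W : (e.functor.obj P).obj.X.left.Opens,
          Function.Injective ((descentMap α P).app W) ∧
          Set.range ((descentMap α P).app W) =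
            {a : Γ(P.obj.X.left, descentMap α P ⁻¹ᵁ W) |
              P.obj.conn.IsFlat (descentMap α P ⁻¹ᵁ W) a}) ∧
      -- objects which are separated and of finite type over `k`
      RestrictsTo e
        (fun P => IsSeparated (P.obj.X.hom ≫ s) ∧ LocallyOfFiniteType (P.obj.X.hom ≫ s) ∧
          QuasiCompact (P.obj.X.hom ≫ s))
        (fun Y => IsSeparated (Y.obj.X.hom ≫ frobTwistStr p s) ∧
          LocallyOfFiniteType (Y.obj.X.hom ≫ frobTwistStr p s) ∧
          QuasiCompact (Y.obj.X.hom ≫ frobTwistStr p s)) ∧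
      -- `k`-varieties
      RestrictsTo e
        (fun P => IsVariety (P.obj.X.hom ≫ s))
        (fun Y => IsVariety (Y.obj.X.hom ≫ frobTwistStr p s) ∧
          IsIntegral (pullback Y.obj.X.hom (relFrob p s))) ∧
      -- smooth objects, and smooth objects which are `k`-varieties
      RestrictsTo e (fun P => Smooth P.obj.X.hom) (fun Y => Smooth Y.obj.X.hom) ∧
      (IsField k → RestrictsTo e
        (fun P => Smooth P.obj.X.hom ∧ IsVariety (P.obj.X.hom ≫ s))
        (fun Y => Smooth Y.obj.X.hom ∧ IsVariety (Y.obj.X.hom ≫ frobTwistStr p s))) ∧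
      -- linear objects
      RestrictsTo e (fun P => P.obj.IsLinear) (fun Y => Y.obj.IsLinear) ∧
      -- on linear objects, `e` is the classical Cartier correspondence `c : (M, ∇) ↦ M^{∇ = 0}`
      ∃ (c : MIC₀ p s ≌ HIG₀ (frobTwistStr p s))
        (j : c.functor ⋙ HIG₀.toModules (frobTwistStr p s) ⟶
          MIC₀.toModules p s ⋙ Scheme.Modules.pushforward (relFrob p s)),
        (∀ (N : MIC₀ p s) (U : (frobTwist p s).Opens),
          Function.Injective ((j.app N).app U) ∧
          Set.range ((j.app N).app U) =
            {v : Γ(N.obj.M, relFrob p s ⁻¹ᵁ U) | N.obj.IsFlat (relFrob p s ⁻¹ᵁ U) v}) ∧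
        ∀ (N : MIC₀ p s) (P : NMIC₀ p s) (m : LinearModel N.obj P.obj),
          ∃ m' : LinearModel (c.functor.obj N).obj (e.functor.obj P).obj,
            ∀ (U : (frobTwist p s).Opens) (v : Γ((c.functor.obj N).obj.M, U)),
              (descentMap α P).appLE ((e.functor.obj P).obj.X.hom ⁻¹ᵁ U)
                  (P.obj.X.hom ⁻¹ᵁ relFrob p s ⁻¹ᵁ U) (descentMap_le α P U) (m'.ι U v) =
                m.ι (relFrob p s ⁻¹ᵁ U) ((j.app N).app U v) := by
  refine ⟨cartier p s, cartierInverseIso p s, fun Y W a => ?_, fun P => ?_,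
    restrictsTo_finiteType p s, restrictsTo_isVariety p s, restrictsTo_smooth p s,
    restrictsTo_smooth_isVariety p s, restrictsTo_isLinear p s,
    (flatFunctor p s).asEquivalence, flatFunctorι p s, fun N U => ?_, ?_⟩
  · have key : ∀ r, r = frobProj p s Y →
        ((frobPullback p s).obj Y).obj.conn.IsFlat (r ⁻¹ᵁ W) (r.app W a) := by
      rintro _ rfl
      exact (isFlatQuotient_frobProj p s Y).isFlat W a
    exact key _ (proj_cartier p s Y)
  · have h := isFlatQuotient_descentMap p s P
    refine ⟨h.isHomeomorph, fun W => ⟨h.injective W, Set.Subset.antisymm ?_ (h.exists_eq W)⟩⟩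
    rintro _ ⟨b, rfl⟩
    exact h.isFlat W b
  · exact ⟨N.obj.isFlatModel_flatι.injective U, N.obj.isFlatModel_flatι.range_eq U⟩
  · exact exists_linearModel_cartier p s
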